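/- **Theorem 2.1 (reducibility).** Conventions. Let $n\ge 1$, $\Pi=[0,2\pi)^n$, $\sigma>0$, and $\mathbb T^n_\rho=\{\theta\in\mathbb C^n/(2\pi\mathbb Z)^n:\ |\mathrm{Im}\,\theta_j|<\rho\ \text{for all } j\}$. Matrices and sequences are indexed by $i,j\in\mathbb N=\{1,2,3,\dots\}$, $\ell^2=\ell^2(\mathbb N,\mathbb C)$, and for $p\ge 0$, $\ell^2_p=\{u\in\ell^2:\ \|u\|_p^2=\sum_{i\ge1} i^p|u_i|^2<\infty\}$. For $\alpha\in(0,1]$ let $\mathcal M_{\hat\alpha}$ be the space of bounded operators $A=(A_i^j)$ on $\ell^2$ with finite norm $$\|A\|_{\hat\alpha}=\max\Big\{\|A\|_{\mathcal B(\ell^2)},\ \sup_{i,j\ge1}(i\wedge j)^{\alpha}\,|A_{i+1}^{j+1}-A_i^j|\Big\},\qquad i\wedge j=\min\{i,j\}.$$ Let $\mathcal M_{\hat\alpha}(\Pi,\sigma)$ be the set of $C^1$ maps $\mathbb P:\Pi\times\mathbb T^n_\sigma\to\mathcal M_{\hat\alpha}$, $(\omega,\theta)\mapsto \mathbb P(\omega,\theta)$,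 that are analytic in $\theta\in\mathbb T^n_\sigma$ and for which $\|\mathbb P(\omega,\theta)\|_{\hat\alpha}$ and $\|\partial_{\omega_j}\mathbb P(\omega,\theta)\|_{\hat\alpha}$ $(1\le j\le n)$ are bounded on $\Pi\times\mathbb T^n_\sigma$. Statement. Let $\mathbb A=\mathrm{diag}\{\lambda_i\}$ with $\lambda_i=2i-1$, and let $\mathbb P\in\mathcal M_{\hat\alpha}(\Pi,\sigma)$ for some $\alpha\in(0,1]$ be such that $\mathbb P(\omega,\theta)$ is self-adjoint on $\ell^2$ for all $\omega\in\Pi$ and all real $\theta$. Consider the system $$\mathrm i\,\dot u=(\mathbb A+\epsilon\,\mathbb P(\omega,\omega t))\,u,\qquad u\in\ell^2. \tag{1}$$ Then there are $\epsilon_*>0$ and $C>0$ such that for every $\epsilon\in(0,\epsilon_*)$ there is a Cantor set $\Pi_\epsilon\subset\Pi$ (non-empty, compact, perfect and totally disconnected) with $$\mathrm{Meas}(\Pi\setminus\Pi_\epsilon)\le C\,\epsilon^{\frac{\alpha}{17(\alpha+2)}},$$ and there are functions $\lambda_i^\infty:\Pi_\epsilon\to\mathbb R$ $(i\in\mathbb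 N)$, $C^1$ in the sense of Whitney, and, for every $\omega\in\Pi_\epsilon$, bounded invertible operators $\mathcal U_{\omega,\epsilon}(\theta)$ on $\ell^2$, analytic in $\theta\in\mathbb T^n_{\sigma/2}$ and unitary for real $\theta$, such that for every $\omega\in\Pi_\epsilon$: 1. the change of variables $u(t)=\mathcal U_{\omega,\epsilon}(\omega t)v(t)$ reduces (1) to an autonomous diagonal system: $u$ solves (1) if and only if $v$ solves $\mathrm i\,\dot v=A^\infty v$, $A^\infty=\mathrm{diag}\{\lambda_i^\infty(\omega)\}$ (solutions being functions in $C(\mathbb R,\ell^2)$ that satisfy the equation in each coordinate); 2. $|\lambda_i^\infty(\omega)-\lambda_i|\le C\epsilon$ for all $i\in\mathbb N$; 3. $\|\mathcal U_{\omega,\epsilon}(\theta)^{\pm1}-\mathrm{id}\|_{\mathcal B(\ell^2_p)}\le C\epsilon^{2/3}$ for all $\theta\in\mathbb T^n_{\sigma/2}$ and all $p\in[0,2]$. -/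

import Mathlib

open scoped ENNReal

noncomputable section

namespace Reducibility

/-! Sequences and matrices are indexed from `0`: the index `i : ℕ` here stands for the
index `i + 1 ∈ {1, 2, 3, …}` of the usual convention. -/

/-- The complex sequence space `ℓ²`. -/
abbrev Ell2 : Type := lp (fun _ : ℕ => ℂ) 2

/-- Bounded operators on `ℓ²`, with the operator norm. -/
abbrev Op : Type := Ell2 →L[ℂ] Ell2

/-- The matrix entry `A_i^j` of a bounded operator, so that `(A u)_i = ∑_j A_i^j u_j`. -/
def entry (A : Op) (i j : ℕ) : ℂ := (A (lp.single 2 j (1 : ℂ)) : ℕ → ℂ) i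

/-- The difference matrix `(ΔA)_i^j = A_{i+1}^{j+1} - A_i^j`. -/
def diffEntry (A : Op) (i j : ℕ) : ℂ := entry A (i + 1) (j + 1) - entry A i j

/-- The quantity `(i ∧ j)^α |(ΔA)_i^j|`. -/
def wDiff (α : ℝ) (A : Op) (q : ℕ × ℕ) : ℝ :=
  (((min q.1 q.2 : ℕ) : ℝ) + 1) ^ α * ‖diffEntry A q.1 q.2‖

theorem entry_add (A B : Op) (i j : ℕ) : entry (A + B) i j = entry A i j + entry B i j := by
  simp [entry]

theorem entry_smul (c : ℂ) (A : Op) (i j : ℕ) : entry (c • A) i j = c * entry A i j := by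
  simp [entry]

theorem wDiff_nonneg (α : ℝ) (A : Op) (q : ℕ × ℕ) : 0 ≤ wDiff α A q := by
  unfold wDiff; positivity

theorem wDiff_add_le (α : ℝ) (A B : Op) (q : ℕ × ℕ) :
    wDiff α (A + B) q ≤ wDiff α A q + wDiff α B q := by
  unfold wDiff
  rw [← mul_add]
  have h : diffEntry (A + B) q.1 q.2 = diffEntry A q.1 q.2 + diffEntry B q.1 q.2 := by
    simp only [diffEntry, entry_add]; ring
  rw [h]
  exact mul_le_mul_of_nonneg_left (norm_add_le _ _) (by positivity)

theorem wDiff_smul (α : ℝ) (c : ℂ) (A : Op) (q : ℕ × ℕ) :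
    wDiff α (c • A) q = ‖c‖ * wDiff α A q := by
  unfold wDiff
  have h : diffEntry (c • A) q.1 q.2 = c * diffEntry A q.1 q.2 := by
    simp only [diffEntry, entry_smul]; ring
  rw [h, norm_mul]; ring

/-- The bounded operators `A` on `ℓ²` with `sup_{i,j} (i ∧ j)^α |(ΔA)_i^j| < ∞`. -/
def hatSubmodule (α : ℝ) : Submodule ℂ Op where
  carrier := {A | BddAbove (Set.range (wDiff α A))}
  zero_mem' := by
    refine ⟨0, ?_⟩
    rintro _ ⟨q, rfl⟩
    simp [wDiff, diffEntry, entry]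
  add_mem' := by
    rintro A B ⟨a, ha⟩ ⟨b, hb⟩
    refine ⟨a + b, ?_⟩
    rintro _ ⟨q, rfl⟩
    exact (wDiff_add_le α A B q).trans (add_le_add (ha ⟨q, rfl⟩) (hb ⟨q, rfl⟩))
  smul_mem' := by
    rintro c A ⟨a, ha⟩
    refine ⟨‖c‖ * a, ?_⟩
    rintro _ ⟨q, rfl⟩
    rw [wDiff_smul]
    exact mul_le_mul_of_nonneg_left (ha ⟨q, rfl⟩) (norm_nonneg c)

/-- The matrix space `M_α̂`. It is a type of its own because its norm is not the operator norm. -/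
def Mhat (α : ℝ) : Type := hatSubmodule α

instance (α : ℝ) : AddCommGroup (Mhat α) := inferInstanceAs (AddCommGroup (hatSubmodule α))

instance (α : ℝ) : Module ℂ (Mhat α) := inferInstanceAs (Module ℂ (hatSubmodule α))

/-- The underlying operator on `ℓ²` of an element of `M_α̂`. -/
def Mhat.op {α : ℝ} : Mhat α →ₗ[ℂ] Op := (hatSubmodule α).subtype

/-- The norm `‖A‖_α̂ = max (‖A‖, sup_{i,j} (i ∧ j)^α |(ΔA)_i^j|)`. -/
instance (α : ℝ) : Norm (Mhat α) := ⟨fun A => max ‖A.op‖ (⨆ q, wDiff α A.op q)⟩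

theorem Mhat.norm_def {α : ℝ} (A : Mhat α) : ‖A‖ = max ‖A.op‖ (⨆ q, wDiff α A.op q) := rfl

theorem Mhat.bddAbove {α : ℝ} (A : Mhat α) : BddAbove (Set.range (wDiff α A.op)) := A.2

theorem Mhat.core (α : ℝ) : NormedSpace.Core ℂ (Mhat α) where
  norm_nonneg A := (norm_nonneg _).trans (le_max_left _ _)
  norm_smul c A := by
    rw [Mhat.norm_def, Mhat.norm_def, map_smul, norm_smul,
      mul_max_of_nonneg _ _ (norm_nonneg c), Real.mul_iSup_of_nonneg (norm_nonneg c)]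
    simp only [wDiff_smul]
  norm_triangle A B := by
    rw [Mhat.norm_def, map_add]
    refine max_le ((norm_add_le _ _).trans
      (add_le_add (le_max_left _ _) (le_max_left _ _))) ?_
    refine ciSup_le fun q => (wDiff_add_le α _ _ q).trans (add_le_add ?_ ?_)
    · exact (le_ciSup A.bddAbove q).trans (le_max_right _ _)
    · exact (le_ciSup B.bddAbove q).trans (le_max_right _ _)
  norm_eq_zero_iff A := by
    constructor
    · intro h
      have h1 : ‖A.op‖ ≤ 0 := h ▸ le_max_left _ _
      exact Subtype.ext (norm_le_zero_iff.mp h1)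
    · rintro rfl
      rw [Mhat.norm_def, map_zero]
      simp [wDiff, diffEntry, entry]

instance (α : ℝ) : NormedAddCommGroup (Mhat α) := NormedAddCommGroup.ofCore (Mhat.core α)

instance (α : ℝ) : NormedSpace ℂ (Mhat α) := NormedSpace.ofCore (Mhat.core α)

/-- The frequency box `Π = [0, 2π)^n`. -/
def freqBox (n : ℕ) : Set (Fin n → ℝ) := Set.univ.pi fun _ => Set.Ico 0 (2 * Real.pi)

/-- The complex strip `{θ ∈ ℂ^n : |Im θ_j| < ρ for all j}`, which covers `T^n_ρ`. -/
def strip (n : ℕ) (ρ : ℝ) : Set (Fin n → ℂ) := {θ | ∀ j, |(θ j).im| < ρ}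

/-- A point of `ℝ^n` as a point of `ℂ^n`. -/
def toC {n : ℕ} (x : Fin n → ℝ) : Fin n → ℂ := fun j => (x j : ℂ)

/-- A function on the strip that is `2π`-periodic in each variable, i.e. a function on `T^n_ρ`. -/
def IsPeriodicOn {n : ℕ} {F : Type*} (ρ : ℝ) (f : (Fin n → ℂ) → F) : Prop :=
  ∀ θ ∈ strip n ρ, ∀ j, f (θ + Pi.single j ((2 * Real.pi : ℝ) : ℂ)) = f θ

/-- Membership in `M_α̂(Π, ρ)`: maps `Π × T^n_ρ → M_α̂` of class `C¹`, analytic in `θ`, with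
`sup (‖P(ω,θ)‖_α̂, ‖∂_{ω_j} P(ω,θ)‖_α̂) < ∞`. -/
structure MemMhat {n : ℕ} (α ρ : ℝ) (P : (Fin n → ℝ) → (Fin n → ℂ) → Mhat α) : Prop where
  contDiff : ContDiffOn ℝ 1 (fun z : (Fin n → ℝ) × (Fin n → ℂ) => P z.1 z.2)
    (freqBox n ×ˢ strip n ρ)
  analytic : ∀ ω ∈ freqBox n, AnalyticOnNhd ℂ (P ω) (strip n ρ)
  periodic : ∀ ω ∈ freqBox n, IsPeriodicOn ρ (P ω)
  bounded : ∃ M : ℝ, ∀ ω ∈ freqBox n, ∀ θ ∈ strip n ρ, ‖P ω θ‖ ≤ M ∧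
    ∀ j, ‖fderivWithin ℝ (fun w => P w θ) (freqBox n) ω (Pi.single j 1)‖ ≤ M

/-- The weighted space `ℓ²_p = {u ∈ ℓ² : ∑_i i^p |u_i|² < ∞}`. -/
def weighted (p : ℝ) : Set Ell2 := {u | Summable fun i : ℕ => ((i : ℝ) + 1) ^ p * ‖u i‖ ^ 2}

/-- The norm `‖u‖_p = (∑_i i^p |u_i|²)^{1/2}` of `ℓ²_p`. -/
def wNorm (p : ℝ) (u : Ell2) : ℝ := Real.sqrt (∑' i : ℕ, ((i : ℝ) + 1) ^ p * ‖u i‖ ^ 2)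

/-- `B` maps `ℓ²_p` to itself with `‖B‖_{B(ℓ²_p)} ≤ K`. -/
def OpNormLe (p : ℝ) (B : Op) (K : ℝ) : Prop :=
  ∀ u ∈ weighted p, B u ∈ weighted p ∧ wNorm p (B u) ≤ K * wNorm p u

/-- `u ∈ C(ℝ, ℓ²)` solves `i u' = (diag(d) + B(t)) u`, the equation being read in each
coordinate (`diag(d)` may be unbounded on `ℓ²`). -/
def IsSolution (d : ℕ → ℝ) (B : ℝ → Op) (u : ℝ → Ell2) : Prop :=
  Continuous u ∧ ∀ (t : ℝ) (i : ℕ), ∃ u' : ℂ, HasDerivAt (fun s => u s i) u' t ∧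
    Complex.I * u' = (d i : ℂ) * u t i + (B t (u t)) i

/-- A Cantor set: non-empty, compact, without isolated points, totally disconnected. -/
def IsCantorSet {X : Type*} [TopologicalSpace X] (S : Set X) : Prop :=
  S.Nonempty ∧ IsCompact S ∧ Preperfect S ∧ IsTotallyDisconnected S

/-- `f` is `C¹` on `S` in the sense of Whitney: there is a continuous `f'` on `S` with
`f(y) - f(x) - f'(x)(y - x) = o(|y - x|)` as `x, y → a` in `S`, for every `a ∈ S`. -/
def WhitneyC1On {n : ℕ} (f : (Fin n → ℝ) → ℝ) (S : Set (Fin n → ℝ)) : Prop :=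
  ∃ f' : (Fin n → ℝ) → (Fin n → ℝ) →L[ℝ] ℝ, ContinuousOn f' S ∧
    ∀ a ∈ S, (fun z : (Fin n → ℝ) × (Fin n → ℝ) => f z.2 - f z.1 - f' z.1 (z.2 - z.1))
      =o[nhdsWithin (a, a) (S ×ˢ S)] fun z => z.2 - z.1

/-- The unperturbed eigenvalues `1, 3, 5, …`. -/
def lam (i : ℕ) : ℝ := 2 * ((i : ℝ) + 1) - 1

end Reducibility

end

open scoped ENNReal

set_option linter.unusedSectionVars false

noncomputable section

namespace Reducibility

/-! ### Operators on `ℓ²` and their matrix entries -/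

/-! The proof is a KAM iteration at a fixed frequency ω. Let p(ωt) be the current perturbation, λ
the current diagonal and D the diagonal part of the mean of p. One step conjugates by the Cayley
transform W = (1 + G)(1 - G)⁻¹, where G solves the homological equation [diag λ, G] = i Ġ - (p -
D)/2. The diagonal becomes λ + D, and the new perturbation p' satisfies the closed identity (1 + G)
p' (1 - G) = (p + D)G - G(p + D) - G(p - D)G (`newP_identity`, `comm_newU`). This is quadratic in
size with no remainder series, and since G is anti-self-adjoint at real angles, W is unitary there.

The k-th Fourier coefficient of G is that of p times the Schur multiplier -1/(2(k·ω + λ_i - λ_j)).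
If the divisors are at least γ e^{-δ|k|}(1 + |i - j|), this multiplier decays like 1/(1 + |i - j|).
Such decay turns the square-summable rows and columns of a bounded operator into summable ones, so
the Schur product is bounded on ℓ². It also makes left and right multiplication by G bounded on
`Mhat α` (`left_mul_bound`, `right_mul_bound`), and makes G bounded on ℓ²_p for p ≤ 2
(`WBd.hadamard`). Because the unperturbed eigenvalues are equally spaced, moving from (i, j) to
(i+1, j+1) changes a divisor only through the correction of the diagonal (`dvs_succ_sub`); this is
why the multiplier respects the weighted difference norm.

Analyticity is encoded by Fourier series summable with weight e^{ρ|k|}. The divisors cost e^{4δ|k|},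
paid for by narrowing the strip by at least 4δ. The new perturbation is found by inverting 1 + L and
1 - R, where L and R are the multiplications by G acting on series with values in `Mhat α`
(`kamStep`), so no product of two general elements of `Mhat α` is ever needed. Nothing faster than
geometric decay is used: `sched_of_small` gives a schedule in which γ, δ and the perturbation all
shrink geometrically and G has size O(2^{-m}) at step m.

The dependence on ω is followed only as a Lipschitz bound on the set of frequencies that have
survived so far (`kam_lip`). This suffices for the measure estimate `volume_resonant_le`. For k ≠ 0,
resonance forces |i - j| ≤ 8|k|. For small min(i, j) each resonance zone is a thin slab; for large
min(i, j) the corrections of λ_i and λ_j nearly cancel, with the rate given by α, and one slab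
covers all these pairs. The excluded measure in one step is O(γ^{α/2} δ^{-(n+2)}). Writing ε = x^12
and starting with γ = x, the total is O(x^{α/2}) = O(ε^{α/24}), while the transformation is O(x^9) =
O(ε^{3/4}) close to the identity.

Whitney differentiability and the Cantor structure are obtained at the end. The limit eigenvalues
are Lipschitz, hence extend to ℝⁿ and are differentiable almost everywhere. An Egorov argument makes
their Taylor expansions uniform off a set of small measure, and a compact subset, its perfect
kernel, and irrational coordinates give the Cantor set (`exists_cantor_whitney`). -/

theorem hasSum_norm_sq (u : Ell2) : HasSum (fun i => ‖u i‖ ^ 2) (‖u‖ ^ 2) := by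
  have h := lp.hasSum_norm (p := 2) (by norm_num) u
  simpa using h

theorem tsum_enorm_sq (u : Ell2) : ∑' i, ‖u i‖ₑ ^ 2 = ‖u‖ₑ ^ 2 := by
  have h := hasSum_norm_sq u
  have h2 := ENNReal.ofReal_tsum_of_nonneg (fun i => sq_nonneg ‖u i‖) h.summable
  rw [h.tsum_eq] at h2
  simp only [← ofReal_norm, ← ENNReal.ofReal_pow (norm_nonneg _)]
  exact h2.symm

theorem norm_coord_le (u : Ell2) (i : ℕ) : ‖u i‖ ≤ ‖u‖ :=
  lp.norm_apply_le_norm (by norm_num) u i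

/-- The `i`-th coordinate functional. -/
def coord (i : ℕ) : Ell2 →L[ℂ] ℂ := lp.evalCLM ℂ (fun _ : ℕ => ℂ) 2 i

@[simp] theorem coord_apply (i : ℕ) (u : Ell2) : coord i u = u i := rfl

/-- The `j`-th unit vector. -/
def unitVec (j : ℕ) : Ell2 := lp.single 2 j (1 : ℂ)

theorem unitVec_apply (j i : ℕ) : unitVec j i = if i = j then 1 else 0 := by
  simp [unitVec, lp.single_apply, Pi.single_apply]

theorem norm_unitVec (j : ℕ) : ‖unitVec j‖ = 1 := by
  simp [unitVec, lp.norm_single]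

theorem entry_eq (A : Op) (i j : ℕ) : entry A i j = A (unitVec j) i := rfl

theorem single_eq_smul (j : ℕ) (c : ℂ) :
    (lp.single 2 j c : Ell2) = c • unitVec j := by
  rw [unitVec, ← lp.single_smul]; simp

theorem hasSum_unitVec (u : Ell2) : HasSum (fun j => u j • unitVec j) u := by
  simpa only [single_eq_smul] using lp.hasSum_single (by norm_num) u

theorem hasSum_entry_mul (A : Op) (u : Ell2) (i : ℕ) :
    HasSum (fun j => entry A i j * u j) (A u i) := by
  have h := (hasSum_unitVec u).map ((coord i).comp A) ((coord i).comp A).continuous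
  refine h.congr_fun fun j => ?_
  simp [entry_eq, mul_comm]

theorem hasSum_entry_comp (A B : Op) (i j : ℕ) :
    HasSum (fun l => entry A i l * entry B l j) (entry (A * B) i j) :=
  hasSum_entry_mul A (B (unitVec j)) i

theorem op_ext {A B : Op} (h : ∀ i j, entry A i j = entry B i j) : A = B := by
  ext u i
  rw [← (hasSum_entry_mul A u i).tsum_eq, ← (hasSum_entry_mul B u i).tsum_eq]
  simp only [h]

theorem norm_entry_le (A : Op) (i j : ℕ) : ‖entry A i j‖ ≤ ‖A‖ :=
  (norm_coord_le _ i).trans ((A.le_opNorm _).trans (by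
    rw [show ‖(lp.single 2 j 1 : Ell2)‖ = 1 from norm_unitVec j, mul_one]))

/-- The entry `A ↦ A_i^j` as a continuous linear functional. -/
def entryCLM (i j : ℕ) : Op →L[ℂ] ℂ :=
  (coord i).comp (ContinuousLinearMap.apply ℂ Ell2 (unitVec j))

@[simp] theorem entryCLM_apply (i j : ℕ) (A : Op) : entryCLM i j A = entry A i j := rfl

theorem entry_sub (A B : Op) (i j : ℕ) : entry (A - B) i j = entry A i j - entry B i j :=
  map_sub (entryCLM i j) A B

theorem entry_neg (A : Op) (i j : ℕ) : entry (-A) i j = -entry A i j :=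
  map_neg (entryCLM i j) A

theorem entry_star (A : Op) (i j : ℕ) :
    entry (star A) i j = (starRingEnd ℂ) (entry A j i) := by
  rw [ContinuousLinearMap.star_eq_adjoint]
  have h := ContinuousLinearMap.adjoint_inner_right A (unitVec i) (unitVec j)
  have h1 : ∀ v : Ell2, inner ℂ (unitVec i) v = v i := fun v => by
    simpa [unitVec] using lp.inner_single_left (𝕜 := ℂ) (G := fun _ : ℕ => ℂ) i (1 : ℂ) v
  have h2 : ∀ v : Ell2, inner ℂ v (unitVec j) = (starRingEnd ℂ) (v j) := fun v => by
    simpa [unitVec] using lp.inner_single_right (𝕜 := ℂ) (G := fun _ : ℕ => ℂ) j (1 : ℂ) v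
  rw [h1, h2] at h
  exact h

theorem tsum_col_le (A : Op) (j : ℕ) : ∑' i, ‖entry A i j‖ₑ ^ 2 ≤ ‖A‖ₑ ^ 2 := by
  have h := tsum_enorm_sq (A (unitVec j))
  simp only [entry_eq, h]
  gcongr
  refine (A.le_opENorm _).trans ?_
  rw [← ofReal_norm (unitVec j), norm_unitVec]; simp

theorem tsum_row_le (A : Op) (i : ℕ) : ∑' j, ‖entry A i j‖ₑ ^ 2 ≤ ‖A‖ₑ ^ 2 := by
  have h := tsum_col_le (star A) i
  have hn : ‖star A‖ₑ = ‖A‖ₑ := by 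
    rw [← ofReal_norm, ContinuousLinearMap.star_eq_adjoint,
      show ‖ContinuousLinearMap.adjoint A‖ = ‖A‖ from ContinuousLinearMap.adjoint.norm_map A,
      ofReal_norm]
  rw [hn] at h
  simpa only [entry_star, enorm_eq_nnnorm, RCLike.nnnorm_conj] using h

/-! ### Matrices of nonnegative numbers -/

theorem tsum_mul_sq_le (f g : ℕ → ℝ≥0∞) :
    (∑' i, f i * g i) ^ 2 ≤ (∑' i, f i ^ 2) * ∑' i, g i ^ 2 := by
  have h := ENNReal.lintegral_mul_le_Lp_mul_Lq (MeasureTheory.Measure.count : MeasureTheory.Measure ℕ)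
    (Real.HolderConjugate.two_two) (f := f) (g := g) (measurable_of_countable _).aemeasurable
    (measurable_of_countable _).aemeasurable
  simp only [MeasureTheory.lintegral_count, Pi.mul_apply] at h
  calc _ ≤ _ := pow_le_pow_left₀ (by positivity) h 2
    _ = _ := by
      rw [mul_pow]
      simp only [← ENNReal.rpow_natCast, ← ENNReal.rpow_mul]
      norm_num

theorem tsum_mul_le_of_sq {f g : ℕ → ℝ≥0∞} {a b : ℝ≥0∞} (hf : ∑' i, f i ^ 2 ≤ a ^ 2)
    (hg : ∑' i, g i ^ 2 ≤ b ^ 2) : ∑' i, f i * g i ≤ a * b := by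
  have h : (∑' i, f i * g i) ^ 2 ≤ (a * b) ^ 2 := by
    rw [mul_pow]
    exact (tsum_mul_sq_le f g).trans (by gcongr)
  exact (ENNReal.pow_le_pow_left_iff two_ne_zero).1 h

/-- The nonnegative matrix `t` defines an operator of norm at most `K` on `ℓ²`. -/
def MatBd (t : ℕ → ℕ → ℝ≥0∞) (K : ℝ≥0∞) : Prop :=
  ∀ w : ℕ → ℝ≥0∞, ∑' i, (∑' j, t i j * w j) ^ 2 ≤ K ^ 2 * ∑' j, w j ^ 2

theorem MatBd.mono {s t : ℕ → ℕ → ℝ≥0∞} {K : ℝ≥0∞} (h : MatBd t K) (hst : ∀ i j, s i j ≤ t i j) :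
    MatBd s K := fun w =>
  (ENNReal.tsum_le_tsum fun i => by
    gcongr with j
    exact hst i j).trans (h w)

/-- Schur's test: write t = t^{1/2} · t^{1/2}, apply Cauchy–Schwarz in j, and spend the row bound on
one factor and the column bound on the other. -/
theorem MatBd.of_schur {t : ℕ → ℕ → ℝ≥0∞} {K : ℝ≥0∞} (hr : ∀ i, ∑' j, t i j ≤ K)
    (hc : ∀ j, ∑' i, t i j ≤ K) : MatBd t K := by
  intro w
  have hs : ∀ x : ℝ≥0∞, (x ^ (1 / 2 : ℝ)) ^ 2 = x := fun x => by
    rw [← ENNReal.rpow_natCast, ← ENNReal.rpow_mul]; norm_num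
  have h1 : ∀ i, (∑' j, t i j * w j) ^ 2 ≤ K * ∑' j, t i j * w j ^ 2 := fun i => by
    have h := tsum_mul_sq_le (fun j => (t i j) ^ (1 / 2 : ℝ))
      (fun j => (t i j) ^ (1 / 2 : ℝ) * w j)
    simp only [← mul_assoc, ← sq, mul_pow, hs] at h
    exact h.trans (by gcongr; exact hr i)
  calc _ ≤ ∑' i, K * ∑' j, t i j * w j ^ 2 := ENNReal.tsum_le_tsum h1
    _ = K * ∑' j, (∑' i, t i j) * w j ^ 2 := by
      rw [ENNReal.tsum_mul_left, ENNReal.tsum_comm]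
      simp only [ENNReal.tsum_mul_right]
    _ ≤ K * ∑' j, K * w j ^ 2 := by
      gcongr with j
      exact hc j
    _ = _ := by rw [ENNReal.tsum_mul_left]; ring

theorem MatBd.of_hilbertSchmidt {t : ℕ → ℕ → ℝ≥0∞} {K : ℝ≥0∞}
    (h : ∑' i, ∑' j, t i j ^ 2 ≤ K ^ 2) : MatBd t K := by
  intro w
  calc _ ≤ ∑' i, (∑' j, t i j ^ 2) * ∑' j, w j ^ 2 :=
        ENNReal.tsum_le_tsum fun i => tsum_mul_sq_le _ _
    _ ≤ _ := by rw [ENNReal.tsum_mul_right]; gcongr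

theorem MatBd.add {s t : ℕ → ℕ → ℝ≥0∞} {K : ℝ≥0∞} (hs : MatBd s K) (ht : MatBd t K) :
    MatBd (fun i j => s i j + t i j) (2 * K) := by
  intro w
  have hsq : ∀ a b : ℝ≥0∞, (a + b) ^ 2 ≤ 2 * a ^ 2 + 2 * b ^ 2 := fun a b => by
    have h := ENNReal.rpow_add_le_mul_rpow_add_rpow a b (p := 2) (by norm_num)
    norm_num at h
    rwa [mul_add] at h
  calc ∑' i, (∑' j, (s i j + t i j) * w j) ^ 2
      ≤ ∑' i, (2 * (∑' j, s i j * w j) ^ 2 + 2 * (∑' j, t i j * w j) ^ 2) :=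
        ENNReal.tsum_le_tsum fun i => by
          simp only [add_mul, ENNReal.tsum_add]
          exact hsq _ _
    _ = 2 * (∑' i, (∑' j, s i j * w j) ^ 2) + 2 * (∑' i, (∑' j, t i j * w j) ^ 2) := by
        rw [ENNReal.tsum_add, ENNReal.tsum_mul_left, ENNReal.tsum_mul_left]
    _ ≤ 2 * (K ^ 2 * ∑' j, w j ^ 2) + 2 * (K ^ 2 * ∑' j, w j ^ 2) := by
        gcongr
        · exact hs w
        · exact ht w
    _ = _ := by ring

theorem summable_of_tsum_enorm_ne_top {f : ℕ → ℂ} (h : ∑' i, ‖f i‖ₑ ≠ ∞) : Summable f := by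
  have := ENNReal.summable_toReal h
  simp only [toReal_enorm] at this
  exact this.of_norm

theorem memℓp_of_tsum_enorm_sq_ne_top {f : ℕ → ℂ} (h : ∑' i, ‖f i‖ₑ ^ 2 ≠ ∞) :
    Memℓp f 2 := by
  rw [memℓp_gen_iff (by norm_num)]
  have := ENNReal.summable_toReal h
  simpa using this

theorem norm_le_of_tsum_enorm_sq_le {u : Ell2} {a : ℝ} (ha : 0 ≤ a)
    (h : ∑' i, ‖u i‖ₑ ^ 2 ≤ ENNReal.ofReal a ^ 2) : ‖u‖ ≤ a := by
  rw [tsum_enorm_sq] at h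
  have h2 := (ENNReal.pow_le_pow_left_iff two_ne_zero).1 h
  rw [← ofReal_norm] at h2
  exact (ENNReal.ofReal_le_ofReal_iff ha).1 h2

/-- A bounded nonnegative matrix that dominates the entries of `f` makes `f` a bounded operator. -/
theorem exists_op_of_matBd {f : ℕ → ℕ → ℂ} {K : ℝ} (hK : 0 ≤ K)
    (h : MatBd (fun i j => ‖f i j‖ₑ) (ENNReal.ofReal K)) :
    ∃ A : Op, (∀ i j, entry A i j = f i j) ∧ ‖A‖ ≤ K := by
  have hb : ∀ u : Ell2, ∑' i, (∑' j, ‖f i j‖ₑ * ‖u j‖ₑ) ^ 2 ≤ ENNReal.ofReal (K * ‖u‖) ^ 2 := by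
    intro u
    have := h fun j => ‖u j‖ₑ
    rwa [tsum_enorm_sq, ← mul_pow, ← ofReal_norm, ← ENNReal.ofReal_mul hK] at this
  have hs : ∀ (u : Ell2) i, Summable fun j => f i j * u j := by
    intro u i
    refine summable_of_tsum_enorm_ne_top ?_
    simp only [enorm_mul]
    intro htop
    have h1 := (ENNReal.le_tsum i).trans (hb u)
    rw [htop, ENNReal.top_pow two_ne_zero] at h1
    exact absurd h1 (by simp [← ENNReal.ofReal_pow (mul_nonneg hK (norm_nonneg u))])
  have hb2 : ∀ u : Ell2, ∑' i, ‖∑' j, f i j * u j‖ₑ ^ 2 ≤ ENNReal.ofReal (K * ‖u‖) ^ 2 :=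
    fun u => (ENNReal.tsum_le_tsum fun i => by
      gcongr
      refine enorm_tsum_le_tsum_enorm.trans ?_
      simp only [enorm_mul]; exact le_rfl).trans (hb u)
  have hmem : ∀ u : Ell2, Memℓp (fun i => ∑' j, f i j * u j) 2 := fun u =>
    memℓp_of_tsum_enorm_sq_ne_top (ne_top_of_le_ne_top (by simp) (hb2 u))
  let L : Ell2 →ₗ[ℂ] Ell2 :=
    { toFun := fun u => ⟨fun i => ∑' j, f i j * u j, hmem u⟩
      map_add' := fun u v => by
        ext i
        simp only [lp.coeFn_add, Pi.add_apply, mul_add]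
        exact (hs u i).tsum_add (hs v i)
      map_smul' := fun c u => by
        ext i
        simp only [lp.coeFn_smul, Pi.smul_apply, smul_eq_mul, RingHom.id_apply]
        rw [← tsum_mul_left]
        exact tsum_congr fun j => by ring }
  refine ⟨L.mkContinuous K fun u => norm_le_of_tsum_enorm_sq_le (by positivity) (hb2 u),
    fun i j => ?_, L.mkContinuous_norm_le hK _⟩
  change ∑' l, f i l * unitVec j l = f i j
  rw [tsum_eq_single j]
  · simp [unitVec_apply]
  · intro l hl; simp [unitVec_apply, hl]

/-! ### The weights `1 + |i - j|` -/

/-- The weight `1 + |i - j|`. -/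
def dw (i j : ℕ) : ℝ := 1 + |(i : ℝ) - j|

theorem one_le_dw (i j : ℕ) : 1 ≤ dw i j := by unfold dw; linarith [abs_nonneg ((i : ℝ) - j)]

theorem dw_pos (i j : ℕ) : 0 < dw i j := one_pos.trans_le (one_le_dw i j)

theorem dw_comm (i j : ℕ) : dw i j = dw j i := by unfold dw; rw [abs_sub_comm]

theorem tsum_inv_sq_le : ∑' m : ℕ, ENNReal.ofReal (1 / ((m : ℝ) + 1)) ^ 2 ≤ 2 := by
  refine ENNReal.tsum_le_of_sum_range_le fun N => ?_
  simp only [← ENNReal.ofReal_pow (show ∀ {m : ℕ}, 0 ≤ 1 / ((m : ℝ) + 1) by intro m; positivity)]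
  rw [← ENNReal.ofReal_sum_of_nonneg fun i _ => by positivity, ← ENNReal.ofReal_ofNat 2]
  refine ENNReal.ofReal_le_ofReal ?_
  have : ∀ N : ℕ, ∑ i ∈ Finset.range (N + 1), (1 / ((i : ℝ) + 1)) ^ 2 ≤ 2 - 1 / ((N : ℝ) + 1) := by
    intro N
    induction N with
    | zero => norm_num
    | succ N ih =>
      rw [Finset.sum_range_succ]
      have : (1 / ((N : ℝ) + 1 + 1)) ^ 2 ≤ 1 / ((N : ℝ) + 1) - 1 / ((N : ℝ) + 1 + 1) := by
        rw [div_sub_div _ _ (by positivity) (by positivity), div_pow,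
          div_le_div_iff₀ (by positivity) (by positivity)]
        nlinarith [(Nat.cast_nonneg N : (0 : ℝ) ≤ N)]
      push_cast
      linarith
  refine (Finset.sum_le_sum_of_subset_of_nonneg (Finset.range_mono (Nat.le_succ N))
    fun i _ _ => by positivity).trans ((this N).trans ?_)
  have : 0 ≤ 1 / ((N : ℝ) + 1) := by positivity
  linarith

theorem tsum_inv_dw_sq_le (i : ℕ) : ∑' j, ENNReal.ofReal (1 / dw i j) ^ 2 ≤ 2 ^ 2 := by
  set g : ℕ → ℝ≥0∞ := fun m => ENNReal.ofReal (1 / ((m : ℝ) + 1)) ^ 2 with hg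
  have h1 := Summable.sum_add_tsum_nat_add' (f := fun j => ENNReal.ofReal (1 / dw i j) ^ 2) (k := i)
    ENNReal.summable
  rw [← h1]
  have h2 : ∑ j ∈ Finset.range i, ENNReal.ofReal (1 / dw i j) ^ 2 ≤ 2 := by
    rw [← Finset.sum_range_reflect]
    refine (Finset.sum_le_sum (g := g) fun j hj => ?_).trans
      ((ENNReal.sum_le_tsum _).trans tsum_inv_sq_le)
    have hj' := Finset.mem_range.1 hj
    have hle : (j : ℝ) + 1 ≤ dw i (i - 1 - j) := by
      rw [dw, Nat.sub_sub, Nat.cast_sub (by omega)]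
      push_cast
      rw [abs_of_nonneg (by ring_nf; positivity)]
      linarith
    simp only [hg]
    gcongr
  have h3 : ∑' j, ENNReal.ofReal (1 / dw i (j + i)) ^ 2 ≤ 2 := by
    refine (ENNReal.tsum_le_tsum fun j => ?_).trans tsum_inv_sq_le
    have hle : (j : ℝ) + 1 ≤ dw i (j + i) := by
      rw [dw]
      push_cast
      rw [abs_sub_comm, abs_of_nonneg (by simp)]
      linarith
    gcongr
  calc _ ≤ (2 : ℝ≥0∞) + 2 := add_le_add h2 h3
    _ = _ := by norm_num

/-- The kernel `1 / (1 + |i - l|) + 1 / (l + 1)`. -/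
def kap (i l : ℕ) : ℝ := 1 / dw i l + 1 / ((l : ℝ) + 1)

theorem kap_nonneg (i l : ℕ) : 0 ≤ kap i l := by
  have := dw_pos i l
  unfold kap; positivity

theorem inv_dw_le_kap (i l : ℕ) : 1 / dw i l ≤ kap i l := by
  unfold kap
  have : 0 ≤ 1 / ((l : ℝ) + 1) := by positivity
  linarith

theorem tsum_kap_sq_le (i : ℕ) : ∑' l, ENNReal.ofReal (kap i l) ^ 2 ≤ 4 ^ 2 := by
  have hsq : ∀ a b : ℝ≥0∞, (a + b) ^ 2 ≤ 2 * a ^ 2 + 2 * b ^ 2 := fun a b => by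
    have h := ENNReal.rpow_add_le_mul_rpow_add_rpow a b (p := 2) (by norm_num)
    norm_num at h
    rwa [mul_add] at h
  calc _ ≤ ∑' l, (2 * ENNReal.ofReal (1 / dw i l) ^ 2
          + 2 * ENNReal.ofReal (1 / ((l : ℝ) + 1)) ^ 2) := by
        refine ENNReal.tsum_le_tsum fun l => ?_
        have := dw_pos i l
        rw [kap, ENNReal.ofReal_add (by positivity) (by positivity)]
        exact hsq _ _
    _ ≤ 2 * 2 ^ 2 + 2 * 2 := by
        rw [ENNReal.tsum_add, ENNReal.tsum_mul_left, ENNReal.tsum_mul_left]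
        gcongr
        · exact tsum_inv_dw_sq_le i
        · exact tsum_inv_sq_le
    _ ≤ _ := by norm_num

/-- The weight `(i ∧ j)^α`. -/
def minW (α : ℝ) (i j : ℕ) : ℝ := (((min i j : ℕ) : ℝ) + 1) ^ α

theorem minW_pos (α : ℝ) (i j : ℕ) : 0 < minW α i j := by unfold minW; positivity

theorem minW_comm (α : ℝ) (i j : ℕ) : minW α i j = minW α j i := by unfold minW; rw [min_comm]

theorem minW_mono {α : ℝ} (hα : 0 ≤ α) {i j k l : ℕ} (h : min i j ≤ min k l) :
    minW α i j ≤ minW α k l := by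
  unfold minW
  gcongr

/-- Replacing i by l in the weight loses at most (i+1)/(l+1), since α ≤ 1. Against 1 + |i - l| this
loss splits as 1/(1 + i - l) + 1/(l + 1), which is square-summable in l uniformly in i. -/
theorem minW_div_le {α : ℝ} (hα : α ∈ Set.Ioc (0 : ℝ) 1) (i j l : ℕ) :
    minW α i j / (minW α l j * dw i l) ≤ kap i l := by
  have hd := dw_pos i l
  rcases le_or_gt (min i j) (min l j) with h | h
  · refine le_trans ?_ (inv_dw_le_kap i l)
    rw [div_le_div_iff₀ (mul_pos (minW_pos _ _ _) hd) hd]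
    nlinarith [minW_mono hα.1.le h]
  · have hlj : min l j = l := by omega
    have hli : l < i := by omega
    have h1 : minW α i j / minW α l j ≤ ((i : ℝ) + 1) / ((l : ℝ) + 1) := by
      unfold minW
      rw [hlj, ← Real.div_rpow (by positivity) (by positivity)]
      have hx : (1 : ℝ) ≤ ((i : ℝ) + 1) / ((l : ℝ) + 1) := by
        rw [one_le_div (by positivity)]
        have : (l : ℝ) ≤ i := by exact_mod_cast hli.le
        linarith
      calc ((((min i j : ℕ) : ℝ) + 1) / ((l : ℝ) + 1)) ^ α
          ≤ (((i : ℝ) + 1) / ((l : ℝ) + 1)) ^ α := by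
            gcongr
            · exact hα.1.le
            · exact min_le_left _ _
        _ ≤ (((i : ℝ) + 1) / ((l : ℝ) + 1)) ^ (1 : ℝ) :=
            Real.rpow_le_rpow_of_exponent_le hx hα.2
        _ = _ := Real.rpow_one _
    rw [← div_div]
    refine (div_le_div_of_nonneg_right h1 hd.le).trans ?_
    unfold kap
    have hdw : dw i l = 1 + ((i : ℝ) - l) := by
      unfold dw
      rw [abs_of_nonneg]
      have : (l : ℝ) ≤ i := by exact_mod_cast hli.le
      linarith
    rw [hdw] at hd ⊢
    rw [div_div, div_add_div _ _ hd.ne' (by positivity), div_le_div_iff₀ (by positivity)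
      (by positivity)]
    have : (0 : ℝ) ≤ l := Nat.cast_nonneg l
    nlinarith [mul_pos hd (show (0 : ℝ) < l + 1 by positivity)]

/-! ### The space `M_α̂` -/

theorem Mhat.norm_op_le {α : ℝ} (Z : Mhat α) : ‖Z.op‖ ≤ ‖Z‖ := le_max_left _ _

theorem Mhat.wDiff_le {α : ℝ} (Z : Mhat α) (q : ℕ × ℕ) : wDiff α Z.op q ≤ ‖Z‖ :=
  (le_ciSup Z.bddAbove q).trans (le_max_right _ _)

theorem Mhat.op_injective {α : ℝ} : Function.Injective (Mhat.op (α := α)) :=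
  Subtype.val_injective

theorem Mhat.exists_of_bounds {α C : ℝ} {A : Op} (h : ‖A‖ ≤ C) (hd : ∀ q, wDiff α A q ≤ C) :
    ∃ Z : Mhat α, Z.op = A ∧ ‖Z‖ ≤ C :=
  ⟨(⟨A, ⟨C, by rintro _ ⟨q, rfl⟩; exact hd q⟩⟩ : hatSubmodule α), rfl,
    max_le h (ciSup_le hd)⟩

/-- The inclusion of `M_α̂` into the bounded operators. -/
def Mhat.opCLM {α : ℝ} : Mhat α →L[ℂ] Op :=
  Mhat.op.mkContinuous 1 fun Z => by rw [one_mul]; exact Z.norm_op_le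

@[simp] theorem Mhat.opCLM_apply {α : ℝ} (Z : Mhat α) : Mhat.opCLM Z = Z.op := rfl

theorem continuous_wDiff (α : ℝ) (q : ℕ × ℕ) : Continuous fun A => wDiff α A q := by
  have : ∀ A : Op, wDiff α A q = (((min q.1 q.2 : ℕ) : ℝ) + 1) ^ α *
      ‖entryCLM (q.1 + 1) (q.2 + 1) A - entryCLM q.1 q.2 A‖ := fun A => rfl
  simp only [this]
  fun_prop

/-- A Cauchy sequence converges in operator norm, and each `wDiff α · q` is continuous for that
norm, so the bounds on `u n - u m` survive the limit in m uniformly in q. Completeness is what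
allows Neumann series and infinite Fourier sums with values in `Mhat α`. -/
instance (α : ℝ) : CompleteSpace (Mhat α) := by
  refine Metric.complete_of_cauchySeq_tendsto fun u hu => ?_
  have hc : CauchySeq fun n => (u n).op :=
    hu.map (Mhat.opCLM (α := α)).uniformContinuous
  obtain ⟨A, hA⟩ := cauchySeq_tendsto_of_complete hc
  rw [Metric.cauchySeq_iff] at hu
  have key : ∀ ε > 0, ∃ N, ∀ n ≥ N, ∃ Z : Mhat α, Z.op = (u n).op - A ∧ ‖Z‖ ≤ ε := by
    intro ε hε
    obtain ⟨N, hN⟩ := hu ε hε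
    refine ⟨N, fun n hn => ?_⟩
    have hb : ∀ m ≥ N, ‖u n - u m‖ ≤ ε := fun m hm => by
      rw [← dist_eq_norm]; exact (hN n hn m hm).le
    have ht : Filter.Tendsto (fun m => (u n - u m).op) Filter.atTop (nhds ((u n).op - A)) := by
      simp only [map_sub]
      exact tendsto_const_nhds.sub hA
    refine Mhat.exists_of_bounds (le_of_tendsto ht.norm ?_) fun q =>
      le_of_tendsto (((continuous_wDiff α q).tendsto _).comp ht) ?_
    · filter_upwards [Filter.eventually_ge_atTop N] with m hm
      exact (Mhat.norm_op_le _).trans (hb m hm)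
    · filter_upwards [Filter.eventually_ge_atTop N] with m hm
      exact (Mhat.wDiff_le _ q).trans (hb m hm)
  obtain ⟨N, hN⟩ := key 1 one_pos
  obtain ⟨Z, hZ, -⟩ := hN N le_rfl
  refine ⟨u N - Z, ?_⟩
  rw [Metric.tendsto_atTop]
  intro ε hε
  obtain ⟨M, hM⟩ := key (ε / 2) (half_pos hε)
  refine ⟨M, fun n hn => ?_⟩
  obtain ⟨Y, hY, hYn⟩ := hM n hn
  have : u n - (u N - Z) = Y := Mhat.op_injective (by rw [map_sub, map_sub, hZ, hY]; abel)
  rw [dist_eq_norm, this]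
  linarith

/-- A linear map whose values lift, with a norm bound, through an injective linear map. -/
theorem exists_clm_lift {E F G : Type*} [NormedAddCommGroup E] [NormedSpace ℂ E]
    [NormedAddCommGroup F] [NormedSpace ℂ F] [AddCommGroup G] [Module ℂ G] {C : ℝ} (hC : 0 ≤ C)
    (J : F →ₗ[ℂ] G) (hJ : Function.Injective J) (T : E →ₗ[ℂ] G)
    (h : ∀ x, ∃ y, J y = T x ∧ ‖y‖ ≤ C * ‖x‖) :
    ∃ S : E →L[ℂ] F, (∀ x, J (S x) = T x) ∧ ‖S‖ ≤ C := by
  choose f hf hn using h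
  let L : E →ₗ[ℂ] F :=
    { toFun := f
      map_add' := fun x y => hJ (by rw [map_add, hf, hf, hf, map_add])
      map_smul' := fun c x => hJ (by rw [map_smul, hf, hf, map_smul]; rfl) }
  exact ⟨L.mkContinuous C hn, hf, L.mkContinuous_norm_le hC hn⟩

theorem diffEntry_star (A : Op) (i j : ℕ) :
    diffEntry (star A) i j = (starRingEnd ℂ) (diffEntry A j i) := by
  simp [diffEntry, entry_star]

theorem norm_star_op (A : Op) : ‖star A‖ = ‖A‖ := by
  rw [ContinuousLinearMap.star_eq_adjoint]
  exact ContinuousLinearMap.adjoint.norm_map A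

theorem Mhat.exists_star {α : ℝ} (Z : Mhat α) : ∃ Y : Mhat α, Y.op = star Z.op ∧ ‖Y‖ ≤ ‖Z‖ := by
  refine Mhat.exists_of_bounds ((norm_star_op _).trans_le Z.norm_op_le) fun q => ?_
  have h := Z.wDiff_le (q.2, q.1)
  simpa [wDiff, diffEntry_star, min_comm] using h

theorem norm_diffEntry_le {α : ℝ} (Z : Mhat α) (i j : ℕ) :
    minW α i j * ‖diffEntry Z.op i j‖ ≤ ‖Z‖ := Z.wDiff_le (i, j)

theorem Mhat.norm_entry_le {α : ℝ} (Z : Mhat α) (i j : ℕ) : ‖entry Z.op i j‖ ≤ ‖Z‖ :=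
  (Reducibility.norm_entry_le _ i j).trans Z.norm_op_le

/-- The matrix of entries, as a linear map. -/
def entryMat : Op →ₗ[ℂ] ℕ → ℕ → ℂ where
  toFun A i j := entry A i j
  map_add' _ _ := by ext i j; exact entry_add _ _ i j
  map_smul' _ _ := by ext i j; exact entry_smul _ _ i j

theorem entryMat_injective : Function.Injective entryMat := fun _ _ h =>
  op_ext fun i j => congrFun (congrFun h i) j

theorem exists_diag {α : ℝ} (Z : Mhat α) :
    ∃ Y : Mhat α, (∀ i j, entry Y.op i j = if i = j then entry Z.op i i else 0) ∧ ‖Y‖ ≤ ‖Z‖ := by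
  set f : ℕ → ℕ → ℂ := fun i j => if i = j then entry Z.op i i else 0 with hf
  have hbd : ∀ i, ‖entry Z.op i i‖ₑ ≤ ENNReal.ofReal ‖Z‖ := fun i => by
    rw [← ofReal_norm]; exact ENNReal.ofReal_le_ofReal (Z.norm_entry_le i i)
  have hM : MatBd (fun i j => ‖f i j‖ₑ) (ENNReal.ofReal ‖Z‖) := by
    refine MatBd.of_schur (fun i => ?_) fun j => ?_
    · rw [tsum_eq_single i fun j hj => by simp [hf, hj.symm]]
      simpa [hf] using hbd i
    · rw [tsum_eq_single j fun i hi => by simp [hf, hi]]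
      simpa [hf] using hbd j
  obtain ⟨A, hA, hn⟩ := exists_op_of_matBd (norm_nonneg Z) hM
  have hq : ∀ q, wDiff α A q ≤ ‖Z‖ := by
    rintro ⟨i, j⟩
    have h : diffEntry A i j = if i = j then diffEntry Z.op i i else 0 := by
      simp only [diffEntry, hA, hf, add_left_inj]
      split_ifs <;> simp
    unfold wDiff
    simp only [h]
    split_ifs with hij
    · subst hij; exact Z.wDiff_le (i, i)
    · simp
  obtain ⟨Y, hY, hYn⟩ := Mhat.exists_of_bounds hn hq
  exact ⟨Y, fun i j => by rw [hY, hA], hYn⟩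

theorem exists_diagCLM (α : ℝ) : ∃ D : Mhat α →L[ℂ] Mhat α,
    (∀ Z i j, entry (D Z).op i j = if i = j then entry Z.op i i else 0) ∧ ‖D‖ ≤ 1 := by
  let T : Mhat α →ₗ[ℂ] ℕ → ℕ → ℂ :=
    { toFun := fun Z i j => if i = j then entry Z.op i i else 0
      map_add' := fun Z W => by
        ext i j
        simp only [map_add, entry_add, Pi.add_apply]
        split_ifs <;> simp
      map_smul' := fun c Z => by
        ext i j
        simp only [map_smul, entry_smul, Pi.smul_apply, RingHom.id_apply, smul_eq_mul]
        split_ifs <;> simp }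
  obtain ⟨D, hD, hn⟩ := exists_clm_lift zero_le_one (entryMat ∘ₗ Mhat.op)
    (entryMat_injective.comp Mhat.op_injective) T fun Z => by
      obtain ⟨Y, hY, hn⟩ := exists_diag Z
      exact ⟨Y, by ext i j; exact hY i j, by rw [one_mul]; exact hn⟩
  exact ⟨D, fun Z i j => congrFun (congrFun (hD Z) i) j, hn⟩

/-- The diagonal part of an element of `M_α̂`. -/
def diagPart (α : ℝ) : Mhat α →L[ℂ] Mhat α := (exists_diagCLM α).choose

theorem entry_diagPart {α : ℝ} (Z : Mhat α) (i j : ℕ) :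
    entry (diagPart α Z).op i j = if i = j then entry Z.op i i else 0 :=
  (exists_diagCLM α).choose_spec.1 Z i j

theorem norm_diagPart_le (α : ℝ) : ‖diagPart α‖ ≤ 1 := (exists_diagCLM α).choose_spec.2

/-! ### Schur multipliers with off-diagonal decay -/

/-- A Schur multiplier `m` with `|m_ij| ≤ μ / (1 + |i - j|)` and
`|Δm_ij| ≤ μ (i ∧ j)^{-α} / (1 + |i - j|)`. -/
structure IsMult (α μ : ℝ) (m : ℕ → ℕ → ℂ) : Prop where
  bd : ∀ i j, dw i j * ‖m i j‖ ≤ μ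
  diff : ∀ i j, minW α i j * dw i j * ‖m (i + 1) (j + 1) - m i j‖ ≤ μ

theorem IsMult.nonneg {α μ : ℝ} {m : ℕ → ℕ → ℂ} (h : IsMult α μ m) : 0 ≤ μ :=
  (mul_nonneg (dw_pos 0 0).le (norm_nonneg _)).trans (h.bd 0 0)

open Classical in
/-- The Schur product of a multiplier and an operator (`0` if it is not a bounded operator). -/
def hadamard (m : ℕ → ℕ → ℂ) (A : Op) : Op :=
  if h : ∃ F : Op, ∀ i j, entry F i j = m i j * entry A i j then h.choose else 0

section hadamard

variable {α μ : ℝ} {m : ℕ → ℕ → ℂ}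

theorem IsMult.star (hm : IsMult α μ m) : IsMult α μ fun i j => (starRingEnd ℂ) (m j i) where
  bd i j := by
    rw [RCLike.norm_conj, dw_comm]; exact hm.bd j i
  diff i j := by
    rw [← map_sub, RCLike.norm_conj, dw_comm, minW_comm]; exact hm.diff j i

theorem IsMult.norm_le (hm : IsMult α μ m) (i j : ℕ) : ‖m i j‖ ≤ μ * (1 / dw i j) := by
  rw [mul_one_div, le_div_iff₀' (dw_pos i j)]; exact hm.bd i j

/-- The smoothing effect: a row of a bounded operator is only square-summable, but Cauchy–Schwarz
against 1/(1 + |i - j|), of ℓ² norm at most 2, makes it summable. -/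
theorem tsum_mult_row_le (hm : IsMult α μ m) (Z : Mhat α) (i : ℕ) :
    ∑' j, ‖m i j * entry Z.op i j‖ₑ ≤ ENNReal.ofReal (2 * (μ * ‖Z‖)) := by
  have h0 := hm.nonneg
  calc ∑' j, ‖m i j * entry Z.op i j‖ₑ
      ≤ ∑' j, ENNReal.ofReal μ * (ENNReal.ofReal (1 / dw i j) * ‖entry Z.op i j‖ₑ) := by
        refine ENNReal.tsum_le_tsum fun j => ?_
        rw [enorm_mul, ← mul_assoc, ← ENNReal.ofReal_mul h0]
        gcongr
        rw [← ofReal_norm]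
        exact ENNReal.ofReal_le_ofReal (hm.norm_le i j)
    _ ≤ ENNReal.ofReal μ * (2 * ‖Z.op‖ₑ) := by
        rw [ENNReal.tsum_mul_left]
        gcongr
        exact tsum_mul_le_of_sq (tsum_inv_dw_sq_le i) (tsum_row_le _ i)
    _ ≤ ENNReal.ofReal μ * (2 * ENNReal.ofReal ‖Z‖) := by
        gcongr
        rw [← ofReal_norm]
        exact ENNReal.ofReal_le_ofReal Z.norm_op_le
    _ = _ := by
        rw [ENNReal.ofReal_mul zero_le_two, ENNReal.ofReal_mul h0, ENNReal.ofReal_ofNat]; ring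

theorem tsum_mult_col_le (hm : IsMult α μ m) (Z : Mhat α) (j : ℕ) :
    ∑' i, ‖m i j * entry Z.op i j‖ₑ ≤ ENNReal.ofReal (2 * (μ * ‖Z‖)) := by
  obtain ⟨Y, hY, hn⟩ := Z.exists_star
  refine le_trans (le_of_eq ?_) ((tsum_mult_row_le hm.star Y j).trans
    (ENNReal.ofReal_le_ofReal (by gcongr; exact hm.nonneg)))
  refine tsum_congr fun i => ?_
  rw [hY, entry_star, ← map_mul, enorm_eq_nnnorm, enorm_eq_nnnorm, RCLike.nnnorm_conj]

/-- Domination of the Schur product with the weight `1 + |i - j| / (j + 1)`. -/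
theorem matBd_mult (hm : IsMult α μ m) (Z : Mhat α) :
    MatBd (fun i j => ‖m i j * entry Z.op i j‖ₑ *
      ENNReal.ofReal (1 + |(i : ℝ) - j| / ((j : ℝ) + 1))) (ENNReal.ofReal (4 * (μ * ‖Z‖))) := by
  have h0 := hm.nonneg
  have h1 : MatBd (fun i j => ‖m i j * entry Z.op i j‖ₑ) (ENNReal.ofReal (2 * (μ * ‖Z‖))) :=
    MatBd.of_schur (tsum_mult_row_le hm Z) (tsum_mult_col_le hm Z)
  have h2 : MatBd (fun i j => ‖m i j * entry Z.op i j‖ₑ *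
      ENNReal.ofReal (|(i : ℝ) - j| / ((j : ℝ) + 1))) (ENNReal.ofReal (2 * (μ * ‖Z‖))) := by
    -- The decay of m absorbs |i - j|; what remains is 1/(j+1), square-summable in j, times columns
    -- of Z that are bounded in ℓ².
    refine MatBd.of_hilbertSchmidt ?_
    rw [ENNReal.tsum_comm]
    calc _ ≤ ∑' j : ℕ, ENNReal.ofReal (1 / ((j : ℝ) + 1)) ^ 2 *
          (ENNReal.ofReal μ ^ 2 * ∑' i, ‖entry Z.op i j‖ₑ ^ 2) := by
          refine ENNReal.tsum_le_tsum fun j => ?_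
          rw [← ENNReal.tsum_mul_left, ← ENNReal.tsum_mul_left]
          refine ENNReal.tsum_le_tsum fun i => ?_
          rw [← mul_pow, ← mul_pow]
          refine pow_le_pow_left₀ zero_le ?_ 2
          rw [enorm_mul, ← mul_assoc, mul_right_comm]
          refine mul_le_mul_left ?_ _
          rw [← ofReal_norm, ← ENNReal.ofReal_mul (norm_nonneg _),
            ← ENNReal.ofReal_mul (by positivity)]
          refine ENNReal.ofReal_le_ofReal ?_
          rw [← mul_div_assoc, one_div_mul_eq_div]
          gcongr
          refine le_trans ?_ (hm.bd i j)
          rw [mul_comm]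
          gcongr
          unfold dw; linarith
      _ ≤ ∑' j : ℕ, ENNReal.ofReal (1 / ((j : ℝ) + 1)) ^ 2 *
          (ENNReal.ofReal μ ^ 2 * ‖Z.op‖ₑ ^ 2) := by
          gcongr with j
          exact tsum_col_le _ j
      _ ≤ 2 * (ENNReal.ofReal μ ^ 2 * (ENNReal.ofReal ‖Z‖) ^ 2) := by
          rw [ENNReal.tsum_mul_right]
          gcongr
          · exact tsum_inv_sq_le
          · rw [← ofReal_norm]
            exact ENNReal.ofReal_le_ofReal Z.norm_op_le
      _ ≤ (2 : ℝ≥0∞) ^ 2 * (ENNReal.ofReal μ ^ 2 * (ENNReal.ofReal ‖Z‖) ^ 2) := by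
          gcongr; norm_num
      _ = _ := by
          rw [ENNReal.ofReal_mul zero_le_two, ENNReal.ofReal_mul h0, ENNReal.ofReal_ofNat]; ring
  have h3 := h1.add h2
  have hK : 2 * ENNReal.ofReal (2 * (μ * ‖Z‖)) = ENNReal.ofReal (4 * (μ * ‖Z‖)) := by
    rw [← ENNReal.ofReal_ofNat 2, ← ENNReal.ofReal_mul (by norm_num)]
    congr 1
    ring
  rw [hK] at h3
  refine h3.mono fun i j => ?_
  rw [ENNReal.ofReal_add zero_le_one (by positivity), mul_add]
  simp

theorem matBd_mult' (hm : IsMult α μ m) (Z : Mhat α) :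
    MatBd (fun i j => ‖m i j * entry Z.op i j‖ₑ) (ENNReal.ofReal (4 * (μ * ‖Z‖))) :=
  (matBd_mult hm Z).mono fun i j => by
    refine le_mul_of_one_le_right zero_le ?_
    rw [ENNReal.one_le_ofReal]
    have : 0 ≤ |(i : ℝ) - j| / ((j : ℝ) + 1) := by positivity
    linarith

theorem hadamard_spec (hm : IsMult α μ m) (Z : Mhat α) :
    (∀ i j, entry (hadamard m Z.op) i j = m i j * entry Z.op i j) ∧
      ‖hadamard m Z.op‖ ≤ 4 * (μ * ‖Z‖) := by
  obtain ⟨A, hA, hn⟩ := exists_op_of_matBd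
    (mul_nonneg zero_le_four (mul_nonneg hm.nonneg (norm_nonneg Z))) (matBd_mult' hm Z)
  have h : ∃ F : Op, ∀ i j, entry F i j = m i j * entry Z.op i j := ⟨A, hA⟩
  have h1 : ∀ i j, entry (hadamard m Z.op) i j = m i j * entry Z.op i j := by
    unfold hadamard
    rw [dif_pos h]
    exact h.choose_spec
  refine ⟨h1, ?_⟩
  rw [op_ext (A := hadamard m Z.op) (B := A) fun i j => by rw [h1, hA]]
  exact hn

theorem entry_hadamard (hm : IsMult α μ m) (Z : Mhat α) (i j : ℕ) :
    entry (hadamard m Z.op) i j = m i j * entry Z.op i j := (hadamard_spec hm Z).1 i j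

theorem norm_hadamard_le (hm : IsMult α μ m) (Z : Mhat α) :
    ‖hadamard m Z.op‖ ≤ 4 * (μ * ‖Z‖) := (hadamard_spec hm Z).2

/-- Discrete Leibniz rule. The sum for the entry (i+1, j+1) is shifted by one in l to match that for
(i, j); its l = 0 term has no partner and stays as a boundary term. -/
theorem diffEntry_mul (A B : Op) (i j : ℕ) :
    diffEntry (A * B) i j = entry A (i + 1) 0 * entry B 0 (j + 1)
      + ∑' l, (diffEntry A i l * entry B (l + 1) (j + 1) + entry A i l * diffEntry B l j) := by
  have h1 := hasSum_entry_comp A B (i + 1) (j + 1)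
  have h2 := hasSum_entry_comp A B i j
  have h3 := (hasSum_nat_add_iff' 1).2 h1
  simp only [Finset.range_one, Finset.sum_singleton] at h3
  have h4 := (h3.sub h2).tsum_eq
  rw [diffEntry, ← sub_eq_iff_eq_add', sub_right_comm, ← h4]
  refine tsum_congr fun l => ?_
  simp only [diffEntry]; ring

/-- Only the left factor is smoothed. Its decay compensates the loss of weight at inner indices l
smaller than i, which a product of two general elements could not. The boundary term contributes 1,
the difference of the left factor 2·4 and that of the right factor 4, where 4 bounds the ℓ² norm of
`kap i`; together 13. -/
theorem left_mul_bound (hα : α ∈ Set.Ioc (0 : ℝ) 1) (hm : IsMult α μ m) (Z W : Mhat α) :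
    ∃ Y : Mhat α, Y.op = hadamard m Z.op * W.op ∧ ‖Y‖ ≤ 13 * (μ * ‖Z‖) * ‖W‖ := by
  have h0 := hm.nonneg
  have hn := norm_hadamard_le hm Z
  have he := entry_hadamard hm Z
  set F := hadamard m Z.op with hF
  have hμZ : 0 ≤ μ * ‖Z‖ := mul_nonneg h0 (norm_nonneg Z)
  refine Mhat.exists_of_bounds ((norm_mul_le _ _).trans ?_) ?_
  · gcongr
    · linarith
    · exact W.norm_op_le
  rintro ⟨i, j⟩
  have hr := minW_pos α i j
  have hWle : ‖W.op‖ₑ ≤ ENNReal.ofReal ‖W‖ := by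
    rw [← ofReal_norm]; exact ENNReal.ofReal_le_ofReal W.norm_op_le
  have hZle : ‖Z.op‖ₑ ≤ ENNReal.ofReal ‖Z‖ := by
    rw [← ofReal_norm]; exact ENNReal.ofReal_le_ofReal Z.norm_op_le
  -- the difference of the left factor
  have e1 : ∀ l, minW α i j * ‖diffEntry F i l‖ ≤ 2 * (μ * ‖Z‖) * kap i l := by
    intro l
    have hd := dw_pos i l
    have hrl := minW_pos α i l
    have hd2 : diffEntry F i l = m (i + 1) (l + 1) * diffEntry Z.op i l
        + (m (i + 1) (l + 1) - m i l) * entry Z.op i l := by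
      simp only [diffEntry, he]; ring
    have hdw : dw (i + 1) (l + 1) = dw i l := by
      unfold dw; push_cast; congr 2; ring
    have hb : minW α i l * dw i l * ‖diffEntry F i l‖ ≤ 2 * (μ * ‖Z‖) := by
      rw [hd2]
      have b1 : minW α i l * dw i l * ‖m (i + 1) (l + 1) * diffEntry Z.op i l‖ ≤ μ * ‖Z‖ := by
        rw [norm_mul]
        calc _ = (dw (i + 1) (l + 1) * ‖m (i + 1) (l + 1)‖) *
              (minW α i l * ‖diffEntry Z.op i l‖) := by rw [hdw]; ring
          _ ≤ _ := mul_le_mul (hm.bd _ _) (norm_diffEntry_le Z i l) (by positivity) h0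
      have b2 : minW α i l * dw i l * ‖(m (i + 1) (l + 1) - m i l) * entry Z.op i l‖
          ≤ μ * ‖Z‖ := by
        rw [norm_mul, ← mul_assoc]
        exact mul_le_mul (hm.diff _ _) (Z.norm_entry_le i l) (by positivity) h0
      calc _ ≤ minW α i l * dw i l * (‖m (i + 1) (l + 1) * diffEntry Z.op i l‖
              + ‖(m (i + 1) (l + 1) - m i l) * entry Z.op i l‖) := by
            gcongr; exact norm_add_le _ _
        _ ≤ _ := by rw [mul_add]; linarith
    have hk : minW α i j / (minW α i l * dw i l) ≤ kap i l := by
      refine le_trans ?_ (minW_div_le hα i i l)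
      rw [minW_comm α l i]
      gcongr
      refine minW_mono hα.1.le ?_
      simp
    calc minW α i j * ‖diffEntry F i l‖
        = (minW α i j / (minW α i l * dw i l)) * (minW α i l * dw i l * ‖diffEntry F i l‖) := by
          field_simp
      _ ≤ kap i l * (2 * (μ * ‖Z‖)) := by gcongr; exact kap_nonneg i l
      _ = _ := by ring
  -- The weight needed by W sits at l ∧ j instead of i ∧ j; the decay of F in |i - l| pays for the
  -- move.
  have e2 : ∀ l, minW α i j * (‖entry F i l‖ * ‖diffEntry W.op l j‖) ≤
      μ * ‖W‖ * (kap i l * ‖entry Z.op i l‖) := by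
    intro l
    have hd := dw_pos i l
    have hrl := minW_pos α l j
    rw [he, norm_mul]
    calc _ = (minW α i j / (minW α l j * dw i l)) * ((dw i l * ‖m i l‖) *
          (minW α l j * ‖diffEntry W.op l j‖) * ‖entry Z.op i l‖) := by field_simp
      _ ≤ kap i l * (μ * ‖W‖ * ‖entry Z.op i l‖) := by
          gcongr
          · exact kap_nonneg i l
          · exact minW_div_le hα i j l
          · exact hm.bd i l
          · exact norm_diffEntry_le W l j
      _ = _ := by ring
  -- The boundary entry lies i + 1 away from the diagonal, and α ≤ 1 makes its decay stronger than
  -- the weight.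
  have e3 : minW α i j * (‖entry F (i + 1) 0‖ * ‖entry W.op 0 (j + 1)‖) ≤ μ * ‖Z‖ * ‖W‖ := by
    have h1 : minW α i j ≤ dw (i + 1) 0 := by
      calc minW α i j ≤ ((i : ℝ) + 1) ^ α := by
            unfold minW
            gcongr
            · exact hα.1.le
            · exact min_le_left _ _
        _ ≤ ((i : ℝ) + 1) ^ (1 : ℝ) := Real.rpow_le_rpow_of_exponent_le (by simp) hα.2
        _ ≤ _ := by
            rw [Real.rpow_one, dw]
            rw [Nat.cast_zero, sub_zero, abs_of_nonneg (by positivity)]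
            push_cast
            linarith
    rw [he, norm_mul]
    calc _ ≤ dw (i + 1) 0 * (‖m (i + 1) 0‖ * ‖entry Z.op (i + 1) 0‖ * ‖entry W.op 0 (j + 1)‖) := by
          gcongr
      _ = (dw (i + 1) 0 * ‖m (i + 1) 0‖) * ‖entry Z.op (i + 1) 0‖ * ‖entry W.op 0 (j + 1)‖ := by
          ring
      _ ≤ _ := by
          gcongr
          · exact hm.bd _ _
          · exact Z.norm_entry_le _ _
          · exact W.norm_entry_le _ _
  have hkey : ENNReal.ofReal (minW α i j) * ‖diffEntry (F * W.op) i j‖ₑ ≤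
      ENNReal.ofReal (13 * (μ * ‖Z‖) * ‖W‖) := by
    have hconv : ∀ {a b : ℝ} {x : ℂ}, 0 ≤ a → a * ‖x‖ ≤ b →
        ENNReal.ofReal a * ‖x‖ₑ ≤ ENNReal.ofReal b := fun {a b x} ha hx => by
      rw [← ofReal_norm, ← ENNReal.ofReal_mul ha]
      exact ENNReal.ofReal_le_ofReal hx
    rw [diffEntry_mul]
    calc _ ≤ ENNReal.ofReal (minW α i j) * (‖entry F (i + 1) 0 * entry W.op 0 (j + 1)‖ₑ +
          ∑' l, (‖diffEntry F i l‖ₑ * ‖entry W.op (l + 1) (j + 1)‖ₑ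
            + ‖entry F i l * diffEntry W.op l j‖ₑ)) := by
          gcongr
          refine (enorm_add_le _ _).trans ?_
          gcongr
          refine enorm_tsum_le_tsum_enorm.trans (ENNReal.tsum_le_tsum fun l => ?_)
          refine (enorm_add_le _ _).trans ?_
          rw [enorm_mul]
      _ = ENNReal.ofReal (minW α i j) * ‖entry F (i + 1) 0 * entry W.op 0 (j + 1)‖ₑ +
          (∑' l, (ENNReal.ofReal (minW α i j) * ‖diffEntry F i l‖ₑ)
              * ‖entry W.op (l + 1) (j + 1)‖ₑ
            + ∑' l, ENNReal.ofReal (minW α i j) * ‖entry F i l * diffEntry W.op l j‖ₑ) := by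
          rw [mul_add, ENNReal.tsum_add, mul_add, ← ENNReal.tsum_mul_left,
            ← ENNReal.tsum_mul_left]
          simp only [mul_assoc]
      _ ≤ ENNReal.ofReal (μ * ‖Z‖ * ‖W‖) +
          (∑' l, ENNReal.ofReal (2 * (μ * ‖Z‖)) * (ENNReal.ofReal (kap i l)
              * ‖entry W.op (l + 1) (j + 1)‖ₑ)
            + ∑' l, ENNReal.ofReal (μ * ‖W‖) * (ENNReal.ofReal (kap i l) *
              ‖entry Z.op i l‖ₑ)) := by
          refine add_le_add (hconv hr.le (by rw [norm_mul]; exact e3)) (add_le_add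
            (ENNReal.tsum_le_tsum fun l => ?_) (ENNReal.tsum_le_tsum fun l => ?_))
          · rw [← mul_assoc, ← ENNReal.ofReal_mul (by positivity)]
            exact mul_le_mul_left (hconv hr.le (e1 l)) _
          · rw [← ofReal_norm (entry Z.op i l), ← ENNReal.ofReal_mul (kap_nonneg i l),
              ← ENNReal.ofReal_mul (mul_nonneg h0 (norm_nonneg _))]
            exact hconv hr.le (by rw [norm_mul]; exact e2 l)
      _ ≤ ENNReal.ofReal (μ * ‖Z‖ * ‖W‖) +
          (ENNReal.ofReal (2 * (μ * ‖Z‖)) * (4 * ENNReal.ofReal ‖W‖)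
            + ENNReal.ofReal (μ * ‖W‖) * (4 * ENNReal.ofReal ‖Z‖)) := by
          rw [ENNReal.tsum_mul_left, ENNReal.tsum_mul_left]
          gcongr
          · refine (tsum_mul_le_of_sq (tsum_kap_sq_le i) (b := ‖W.op‖ₑ) ?_).trans
              (by gcongr)
            exact (ENNReal.tsum_comp_le_tsum_of_injective (add_left_injective 1)
              fun l => ‖entry W.op l (j + 1)‖ₑ ^ 2).trans (tsum_col_le _ _)
          · exact (tsum_mul_le_of_sq (tsum_kap_sq_le i) (tsum_row_le _ i)).trans (by gcongr)
      _ = _ := by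
          rw [show (4 : ℝ≥0∞) = ENNReal.ofReal 4 by simp, ← ENNReal.ofReal_mul zero_le_four,
            ← ENNReal.ofReal_mul zero_le_four, ← ENNReal.ofReal_mul (by positivity),
            ← ENNReal.ofReal_mul (by positivity), ← ENNReal.ofReal_add (by positivity)
            (by positivity), ← ENNReal.ofReal_add (by positivity) (by positivity)]
          congr 1; ring
  rw [← ofReal_norm, ← ENNReal.ofReal_mul hr.le] at hkey
  exact (ENNReal.ofReal_le_ofReal_iff (by positivity)).1 hkey

theorem hadamard_star (hm : IsMult α μ m) (Z Y : Mhat α) (hY : Y.op = star Z.op) :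
    hadamard (fun i j => (starRingEnd ℂ) (m j i)) Y.op = star (hadamard m Z.op) :=
  op_ext fun i j => by
    rw [entry_hadamard hm.star, entry_star, entry_hadamard hm, hY, entry_star, map_mul]

theorem right_mul_bound (hα : α ∈ Set.Ioc (0 : ℝ) 1) (hm : IsMult α μ m) (Z W : Mhat α) :
    ∃ Y : Mhat α, Y.op = W.op * hadamard m Z.op ∧ ‖Y‖ ≤ 13 * (μ * ‖Z‖) * ‖W‖ := by
  obtain ⟨Z', hZ', hZn⟩ := Z.exists_star
  obtain ⟨W', hW', hWn⟩ := W.exists_star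
  obtain ⟨Y, hY, hYn⟩ := left_mul_bound hα hm.star Z' W'
  obtain ⟨Y', hY', hYn'⟩ := Y.exists_star
  refine ⟨Y', ?_, ?_⟩
  · rw [hY', hY, hadamard_star hm Z Z' hZ', hW', star_mul, star_star, star_star]
  · have h0 := hm.nonneg
    exact hYn'.trans (hYn.trans (by gcongr))

end hadamard

/-! ### Boundedness on the weighted spaces `ℓ²_p` -/

/-- The weight `i^{p/2}`. -/
def pw (p : ℝ) (i : ℕ) : ℝ := ((i : ℝ) + 1) ^ (p / 2)

theorem pw_pos (p : ℝ) (i : ℕ) : 0 < pw p i := by unfold pw; positivity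

theorem pw_sq (p : ℝ) (i : ℕ) : pw p i ^ 2 = ((i : ℝ) + 1) ^ p := by
  unfold pw
  rw [← Real.rpow_natCast, ← Real.rpow_mul (by positivity)]
  congr 1; push_cast; ring

/-- `w = D^{p/2} u`, where `D` is the diagonal operator with entries `1, 2, 3, …`. -/
def IsWeighted (p : ℝ) (u w : Ell2) : Prop := ∀ i, w i = (pw p i : ℂ) * u i

theorem IsWeighted.norm_sq {p : ℝ} {u w : Ell2} (h : IsWeighted p u w) (i : ℕ) :
    ‖w i‖ ^ 2 = ((i : ℝ) + 1) ^ p * ‖u i‖ ^ 2 := by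
  rw [h i, norm_mul, mul_pow, ← pw_sq]
  simp

theorem IsWeighted.mem {p : ℝ} {u w : Ell2} (h : IsWeighted p u w) : u ∈ weighted p := by
  have := (hasSum_norm_sq w).summable
  simp only [h.norm_sq] at this
  exact this

theorem IsWeighted.wNorm_eq {p : ℝ} {u w : Ell2} (h : IsWeighted p u w) : wNorm p u = ‖w‖ := by
  have := (hasSum_norm_sq w).tsum_eq
  simp only [h.norm_sq] at this
  rw [wNorm, this, Real.sqrt_sq (norm_nonneg w)]

theorem exists_isWeighted {p : ℝ} {u : Ell2} (h : u ∈ weighted p) : ∃ w, IsWeighted p u w := by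
  have hm : Memℓp (fun i => (pw p i : ℂ) * u i) 2 := by
    rw [memℓp_gen_iff (by norm_num)]
    refine Summable.congr h fun i => ?_
    rw [norm_mul]
    simp [mul_pow, pw_sq]
  exact ⟨⟨_, hm⟩, fun i => rfl⟩

/-- `D^{p/2} B D^{-p/2}` is bounded by `K` on `ℓ²`. -/
def WBd (p : ℝ) (B : Op) (K : ℝ) : Prop :=
  ∀ u w, IsWeighted p u w → ∃ z, IsWeighted p (B u) z ∧ ‖z‖ ≤ K * ‖w‖

theorem WBd.opNormLe {p K : ℝ} {B : Op} (h : WBd p B K) : OpNormLe p B K := by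
  intro u hu
  obtain ⟨w, hw⟩ := exists_isWeighted hu
  obtain ⟨z, hz, hn⟩ := h u w hw
  exact ⟨hz.mem, by rw [hz.wNorm_eq, hw.wNorm_eq]; exact hn⟩

theorem WBd.mono {p K L : ℝ} {B : Op} (h : WBd p B K) (hKL : K ≤ L) : WBd p B L := by
  intro u w hw
  obtain ⟨z, hz, hn⟩ := h u w hw
  exact ⟨z, hz, hn.trans (by gcongr)⟩

theorem WBd.zero (p : ℝ) : WBd p 0 0 := fun u w _ => ⟨0, fun i => by simp, by simp⟩

theorem WBd.one (p : ℝ) : WBd p 1 1 := fun u w h => ⟨w, h, by simp⟩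

theorem WBd.add {p K L : ℝ} {A B : Op} (hA : WBd p A K) (hB : WBd p B L) :
    WBd p (A + B) (K + L) := by
  intro u w hw
  obtain ⟨y, hy, hyn⟩ := hA u w hw
  obtain ⟨z, hz, hzn⟩ := hB u w hw
  refine ⟨y + z, fun i => ?_, (norm_add_le _ _).trans (by rw [add_mul]; gcongr)⟩
  simp only [lp.coeFn_add, Pi.add_apply, hy i, hz i, _root_.add_apply]
  ring

theorem WBd.smul {p K : ℝ} {A : Op} (hA : WBd p A K) (c : ℂ) : WBd p (c • A) (‖c‖ * K) := by
  intro u w hw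
  obtain ⟨y, hy, hyn⟩ := hA u w hw
  refine ⟨c • y, fun i => ?_, by rw [norm_smul, mul_assoc]; gcongr⟩
  simp only [lp.coeFn_smul, Pi.smul_apply, hy i, smul_eq_mul, _root_.smul_apply]
  ring

theorem WBd.mul {p K L : ℝ} {A B : Op} (hK : 0 ≤ K) (hA : WBd p A K) (hB : WBd p B L) :
    WBd p (A * B) (K * L) := by
  intro u w hw
  obtain ⟨y, hy, hyn⟩ := hB u w hw
  obtain ⟨z, hz, hzn⟩ := hA (B u) y hy
  exact ⟨z, hz, hzn.trans (by rw [mul_assoc]; gcongr)⟩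

theorem WBd.pow {p K : ℝ} {A : Op} (hK : 0 ≤ K) (hA : WBd p A K) (n : ℕ) :
    WBd p (A ^ n) (K ^ n) := by
  induction n with
  | zero => simpa using WBd.one p
  | succ n ih =>
    rw [pow_succ, pow_succ]
    exact ih.mul (pow_nonneg hK n) hA

theorem WBd.sum {ι : Type*} {p : ℝ} {A : ι → Op} {K : ι → ℝ} (h : ∀ k, WBd p (A k) (K k))
    (s : Finset ι) : WBd p (∑ k ∈ s, A k) (∑ k ∈ s, K k) := by
  classical
  induction s using Finset.induction_on with
  | empty => simpa using WBd.zero p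
  | insert a s ha ih =>
    rw [Finset.sum_insert ha, Finset.sum_insert ha]
    exact (h a).add ih

/-- A Fatou argument: convergence in the ℓ² operator norm gives convergence of every coordinate, and
the uniform weighted bound passes to finite partial sums. Convergence in the weighted norm is not
needed. -/
theorem WBd.of_tendsto {ι : Type*} {l : Filter ι} [l.NeBot] {p K : ℝ} {A : ι → Op} {B : Op}
    (h : ∀ k, WBd p (A k) K) (hB : Filter.Tendsto A l (nhds B)) : WBd p B K := by
  intro u w hw
  choose z hz hn using fun k => h k u w hw
  have ht : ∀ i, Filter.Tendsto (fun k => z k i) l (nhds ((pw p i : ℂ) * (B u) i)) := fun i => by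
    simp only [hz _ i]
    exact ((((coord i).comp (ContinuousLinearMap.apply ℂ Ell2 u)).continuous.tendsto B).comp
      hB).const_mul _
  have hb : ∀ s : Finset ℕ, ∑ i ∈ s, ‖(pw p i : ℂ) * (B u) i‖ ^ (2 : ℝ≥0∞).toReal ≤
      (K * ‖w‖) ^ (2 : ℝ≥0∞).toReal := fun s => by
    refine le_of_tendsto (f := fun k => ∑ i ∈ s, ‖z k i‖ ^ (2 : ℝ≥0∞).toReal) (x := l)
      (tendsto_finsetSum _ fun i _ => ((ht i).norm.rpow_const (Or.inr (by norm_num))))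
      (Filter.Eventually.of_forall fun k => ?_)
    refine (lp.sum_rpow_le_norm_rpow (by norm_num) (z k) s).trans ?_
    gcongr
    exact hn k
  have hKw : 0 ≤ K * ‖w‖ := by
    obtain ⟨k⟩ := l.nonempty_of_neBot
    exact (norm_nonneg _).trans (hn k)
  have hm : Memℓp (fun i => (pw p i : ℂ) * (B u) i) 2 := memℓp_gen' hb
  exact ⟨⟨_, hm⟩, fun i => rfl, lp.norm_le_of_forall_sum_le (by norm_num) hKw hb⟩

theorem WBd.of_hasSum {ι : Type*} {p K : ℝ} {A : ι → Op} {k : ι → ℝ} {B : Op}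
    (h : ∀ i, WBd p (A i) (k i)) (hk : ∀ i, 0 ≤ k i) (hK : Summable k) (hle : ∑' i, k i ≤ K)
    (hB : HasSum A B) : WBd p B K :=
  WBd.of_tendsto (fun s => (WBd.sum h s).mono ((hK.sum_le_tsum s fun i _ => hk i).trans hle)) hB

/-- The Cayley transform `(1 + G) (1 - G)⁻¹ = 2 (1 - G)⁻¹ - 1`. -/
def cayley {R : Type*} [Ring R] (G : R) : R := 2 * Ring.inverse (1 - G) - 1

/-! ### The Cayley transform in a Banach algebra. -/

section cayley

variable {R : Type*} [NormedRing R] [CompleteSpace R] {G : R}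

theorem cayley_mul (hG : ‖G‖ < 1) : cayley G * (1 - G) = 1 + G := by
  rw [cayley, sub_mul, mul_assoc, Ring.inverse_mul_cancel _ (isUnit_one_sub_of_norm_lt_one hG)]
  noncomm_ring

theorem mul_cayley (hG : ‖G‖ < 1) : (1 - G) * cayley G = 1 + G := by
  rw [cayley, mul_sub, two_mul, mul_add, Ring.mul_inverse_cancel _
    (isUnit_one_sub_of_norm_lt_one hG)]
  noncomm_ring

theorem norm_inverse_one_sub_sub_one_le (hG : ‖G‖ ≤ 1 / 2) :
    ‖Ring.inverse (1 - G) - 1‖ ≤ 2 * ‖G‖ := by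
  have hG1 : ‖G‖ < 1 := by linarith
  have hs1 : HasSum (fun n => G ^ (n + 1)) (Ring.inverse (1 - G) - 1) := by
    simpa using (hasSum_nat_add_iff' 1).2 (hasSum_geom_series_inverse G hG1)
  have hgeo : HasSum (fun n => ‖G‖ ^ (n + 1)) (‖G‖ * (1 - ‖G‖)⁻¹) := by
    simpa only [pow_succ'] using (hasSum_geometric_of_lt_one (norm_nonneg G) hG1).mul_left ‖G‖
  have := hs1.norm_le_of_bounded hgeo fun n => norm_pow_le' G n.succ_pos
  refine this.trans ?_
  rw [mul_comm]
  gcongr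
  rw [inv_le_comm₀ (by linarith) two_pos]; linarith

theorem norm_cayley_sub_one_le (hG : ‖G‖ ≤ 1 / 2) : ‖cayley G - 1‖ ≤ 4 * ‖G‖ := by
  have h : cayley G - 1 = (Ring.inverse (1 - G) - 1) + (Ring.inverse (1 - G) - 1) := by
    rw [cayley, two_mul]; abel
  rw [h]
  refine (norm_add_le _ _).trans ?_
  linarith [norm_inverse_one_sub_sub_one_le hG]

theorem cayley_mul_cayley_neg (hG : ‖G‖ < 1) : cayley G * cayley (-G) = 1 := by
  have hG' : ‖-G‖ < 1 := by rwa [norm_neg]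
  have hu := isUnit_one_sub_of_norm_lt_one hG'
  rw [sub_neg_eq_add] at hu
  have h2 : cayley G * cayley (-G) * (1 + G) = (1 + G) := by
    have h3 := cayley_mul hG'
    rw [sub_neg_eq_add, ← sub_eq_add_neg] at h3
    rw [mul_assoc, h3, cayley_mul hG]
  exact hu.mul_right_cancel (by rw [h2, one_mul])

end cayley

/-- The series W - 1 = 2 ∑_{n ≥ 1} Gⁿ converges in ℓ² because ‖G‖ < 1, while its weighted bound is
summed from the powers of g. -/
theorem WBd.cayley_sub_one {p g : ℝ} {G : Op} (hG : ‖G‖ < 1) (hg0 : 0 ≤ g) (hg : g ≤ 1 / 2)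
    (h : WBd p G g) : WBd p (cayley G - 1) (4 * g) := by
  have hs1 : HasSum (fun n => G ^ (n + 1)) (Ring.inverse (1 - G) - 1) := by
    simpa using (hasSum_nat_add_iff' 1).2 (hasSum_geom_series_inverse G hG)
  have hgeo : HasSum (fun n => g ^ (n + 1)) (g * (1 - g)⁻¹) := by
    simpa only [pow_succ'] using (hasSum_geometric_of_lt_one hg0 (by linarith)).mul_left g
  have h1 := WBd.of_hasSum (fun n => h.pow hg0 (n + 1)) (fun n => pow_nonneg hg0 _)
    hgeo.summable le_rfl hs1
  rw [hgeo.tsum_eq] at h1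
  have h2 := h1.smul 2
  have heq : (2 : ℂ) • (Ring.inverse (1 - G) - 1) = cayley G - 1 := by
    rw [cayley, two_mul, two_smul]; abel
  rw [heq] at h2
  refine h2.mono ?_
  have : (1 - g)⁻¹ ≤ 2 := by
    rw [inv_le_comm₀ (by linarith) two_pos]; linarith
  simp only [Complex.norm_ofNat]
  nlinarith

theorem WBd.mul_sub_one {p a b : ℝ} {A B : Op} (ha : 0 ≤ a) (hA : WBd p (A - 1) a)
    (hB : WBd p (B - 1) b) : WBd p (A * B - 1) (a * b + a + b) := by
  have h := ((hA.mul ha hB).add hA).add hB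
  have : (A - 1) * (B - 1) + (A - 1) + (B - 1) = A * B - 1 := by noncomm_ring
  rwa [this] at h

/-- The restriction p ≤ 2 enters here: the exponent p/2 is at most 1, so the ratio of weights grows
at most linearly in |i - j|/(j+1). -/
theorem pw_div_le {p : ℝ} (hp : p ∈ Set.Icc (0 : ℝ) 2) (i j : ℕ) :
    pw p i / pw p j ≤ 1 + |(i : ℝ) - j| / ((j : ℝ) + 1) := by
  unfold pw
  rw [← Real.div_rpow (by positivity) (by positivity)]
  have hp2 : p / 2 ≤ 1 := by linarith [hp.2]
  rcases le_total ((i : ℝ) + 1) ((j : ℝ) + 1) with h | h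
  · refine (Real.rpow_le_one (by positivity) ((div_le_one (by positivity)).2 h)
      (by linarith [hp.1])).trans ?_
    have : 0 ≤ |(i : ℝ) - j| / ((j : ℝ) + 1) := by positivity
    linarith
  · have h1 : 1 ≤ ((i : ℝ) + 1) / ((j : ℝ) + 1) := (one_le_div (by positivity)).2 h
    refine (Real.rpow_le_rpow_of_exponent_le h1 hp2).trans ?_
    rw [Real.rpow_one, abs_of_nonneg (by linarith), div_le_iff₀ (by positivity), add_mul,
      div_mul_cancel₀ _ (by positivity)]
    linarith

/-- Conjugation by D^{p/2} multiplies the entries by ratios of weights, and `pw_div_le` bounds these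
by exactly the factor already admitted in `matBd_mult`. -/
theorem WBd.hadamard {α μ p : ℝ} {m : ℕ → ℕ → ℂ} (hm : IsMult α μ m) (Z : Mhat α)
    (hp : p ∈ Set.Icc (0 : ℝ) 2) : WBd p (hadamard m Z.op) (4 * (μ * ‖Z‖)) := by
  intro u w hw
  have hK : 0 ≤ 4 * (μ * ‖Z‖) := mul_nonneg zero_le_four (mul_nonneg hm.nonneg (norm_nonneg Z))
  have hb : ∑' i, ‖(pw p i : ℂ) * (Reducibility.hadamard m Z.op u) i‖ₑ ^ 2 ≤
      ENNReal.ofReal (4 * (μ * ‖Z‖) * ‖w‖) ^ 2 := by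
    rw [ENNReal.ofReal_mul hK, mul_pow, ofReal_norm, ← tsum_enorm_sq]
    refine le_trans (ENNReal.tsum_le_tsum fun i => ?_) (matBd_mult hm Z fun j => ‖w j‖ₑ)
    gcongr
    rw [← (hasSum_entry_mul _ u i).tsum_eq, ← tsum_mul_left]
    refine enorm_tsum_le_tsum_enorm.trans (ENNReal.tsum_le_tsum fun j => ?_)
    rw [entry_hadamard hm, hw j, enorm_mul, enorm_mul, enorm_mul (pw p j : ℂ)]
    have : ‖(pw p i : ℂ)‖ₑ ≤ ENNReal.ofReal (1 + |(i : ℝ) - j| / ((j : ℝ) + 1)) *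
        ‖(pw p j : ℂ)‖ₑ := by
      rw [← ofReal_norm, ← ofReal_norm, ← ENNReal.ofReal_mul (by positivity)]
      refine ENNReal.ofReal_le_ofReal ?_
      simp only [Complex.norm_real, Real.norm_eq_abs, abs_of_pos (pw_pos _ _)]
      rw [← div_le_iff₀ (pw_pos p j)]
      exact pw_div_le hp i j
    calc _ ≤ (ENNReal.ofReal (1 + |(i : ℝ) - j| / ((j : ℝ) + 1)) *
          ‖(pw p j : ℂ)‖ₑ) * (‖m i j * entry Z.op i j‖ₑ * ‖u j‖ₑ) := by gcongr
      _ = _ := by ring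
  exact ⟨⟨_, memℓp_of_tsum_enorm_sq_ne_top (ne_top_of_le_ne_top (by simp) hb)⟩, fun i => rfl,
    norm_le_of_tsum_enorm_sq_le (by positivity) hb⟩

/-! ### Absolutely convergent Fourier series -/

/-- Fourier indices. -/
abbrev Idx (n : ℕ) : Type := Fin n → ℤ

/-- The length `|k| = ∑ |k_j|`. -/
def kn {n : ℕ} (k : Idx n) : ℝ := ∑ j, |(k j : ℝ)|

theorem kn_nonneg {n : ℕ} (k : Idx n) : 0 ≤ kn k := Finset.sum_nonneg fun _ _ => abs_nonneg _

theorem kn_add_le {n : ℕ} (k l : Idx n) : kn (k + l) ≤ kn k + kn l := by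
  unfold kn
  rw [← Finset.sum_add_distrib]
  refine Finset.sum_le_sum fun j _ => ?_
  simp only [Pi.add_apply, Int.cast_add]
  exact abs_add_le _ _

@[simp] theorem kn_zero {n : ℕ} : kn (0 : Idx n) = 0 := by simp [kn]

/-- Weighted Fourier coefficients: the coefficient at `k` is stored multiplied by `e^{ρ|k|}`. -/
abbrev X (n : ℕ) (E : Type*) [NormedAddCommGroup E] : Type _ := lp (fun _ : Idx n => E) 1

section X

variable {n : ℕ} {E F : Type*} [NormedAddCommGroup E] [NormedSpace ℂ E]
  [NormedAddCommGroup F] [NormedSpace ℂ F]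

/-- The inclusion of the `k`-th coefficient. -/
def incl (k : Idx n) : E →L[ℂ] X n E := lp.singleContinuousLinearMap ℂ (fun _ : Idx n => E) 1 k

theorem norm_incl_apply (k : Idx n) (x : E) : ‖(incl k x : X n E)‖ = ‖x‖ :=
  lp.norm_single (E := fun _ : Idx n => E) (p := 1) one_pos k x

theorem norm_incl_le (k : Idx n) : ‖(incl k : E →L[ℂ] X n E)‖ ≤ 1 :=
  ContinuousLinearMap.opNorm_le_bound _ zero_le_one fun x => by rw [norm_incl_apply, one_mul]

theorem incl_apply (k l : Idx n) (x : E) : (incl k x : X n E) l = if l = k then x else 0 := by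
  simp [incl, lp.single_apply, Pi.single_apply]

theorem hasSum_norm_X (a : X n E) : HasSum (fun k => ‖a k‖) ‖a‖ := by
  simpa using lp.hasSum_norm (p := 1) (by norm_num) a

theorem X_hom_ext {S T : X n E →L[ℂ] F} (h : ∀ k x, S (incl k x) = T (incl k x)) : S = T :=
  lp.ext_continuousLinearMap (by norm_num) fun k => by ext x; exact h k x

variable [CompleteSpace F]

theorem summable_lift {φ : Idx n → E →L[ℂ] F} {C : ℝ} (h : ∀ k, ‖φ k‖ ≤ C) (a : X n E) :
    Summable fun k => φ k (a k) :=
  Summable.of_norm_bounded ((hasSum_norm_X a).summable.mul_left C)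
    fun k => (φ k).le_of_opNorm_le (h k) _

/-- The continuous linear map given by a bounded family of continuous linear maps. -/
def liftX (φ : Idx n → E →L[ℂ] F) (C : ℝ) (h : ∀ k, ‖φ k‖ ≤ C) : X n E →L[ℂ] F :=
  LinearMap.mkContinuous
    { toFun := fun a => ∑' k, φ k (a k)
      map_add' := fun a b => by
        rw [← (summable_lift h a).tsum_add (summable_lift h b)]
        simp
      map_smul' := fun c a => by
        simp only [lp.coeFn_smul, Pi.smul_apply, map_smul, RingHom.id_apply]
        exact (summable_lift h a).tsum_const_smul c } C
    fun a => by
      refine tsum_of_norm_bounded ((hasSum_norm_X a).mul_left C) fun k => ?_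
      exact (φ k).le_of_opNorm_le (h k) _

theorem hasSum_liftX {φ : Idx n → E →L[ℂ] F} {C : ℝ} (h : ∀ k, ‖φ k‖ ≤ C) (a : X n E) :
    HasSum (fun k => φ k (a k)) (liftX φ C h a) := (summable_lift h a).hasSum

theorem liftX_incl {φ : Idx n → E →L[ℂ] F} {C : ℝ} (h : ∀ k, ‖φ k‖ ≤ C) (k : Idx n) (x : E) :
    liftX φ C h (incl k x) = φ k x := by
  refine (hasSum_liftX h (incl k x)).unique ?_
  convert hasSum_single k (fun l hl => ?_) using 1
  · simp [incl_apply]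
  · simp [incl_apply, hl]

theorem norm_liftX_le {φ : Idx n → E →L[ℂ] F} {C : ℝ} (h : ∀ k, ‖φ k‖ ≤ C) :
    ‖liftX φ C h‖ ≤ C :=
  LinearMap.mkContinuous_norm_le _ ((norm_nonneg _).trans (h 0)) _

end X

/-! ### Evaluation -/

/-- The character `e^{i k·θ}`. -/
def expf {n : ℕ} (k : Idx n) (θ : Fin n → ℂ) : ℂ := Complex.exp (Complex.I * ∑ j, (k j : ℂ) * θ j)

theorem expf_add {n : ℕ} (k l : Idx n) (θ : Fin n → ℂ) :
    expf (k + l) θ = expf k θ * expf l θ := by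
  rw [expf, expf, expf, ← Complex.exp_add, ← mul_add, ← Finset.sum_add_distrib]
  congr 2
  refine Finset.sum_congr rfl fun j _ => ?_
  simp only [Pi.add_apply, Int.cast_add]; ring

@[simp] theorem expf_zero {n : ℕ} (θ : Fin n → ℂ) : expf (0 : Idx n) θ = 1 := by simp [expf]

/-- The closed strip `|Im θ_j| ≤ ρ`. -/
def cstrip (n : ℕ) (ρ : ℝ) : Set (Fin n → ℂ) := {θ | ∀ j, |(θ j).im| ≤ ρ}

theorem toC_mem_cstrip {n : ℕ} {ρ : ℝ} (hρ : 0 ≤ ρ) (x : Fin n → ℝ) : toC x ∈ cstrip n ρ :=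
  fun j => by simpa [toC] using hρ

theorem norm_expf_le {n : ℕ} {ρ : ℝ} {θ : Fin n → ℂ} (h : θ ∈ cstrip n ρ) (k : Idx n) :
    ‖expf k θ‖ ≤ Real.exp (ρ * kn k) := by
  rw [expf, Complex.norm_exp]
  refine Real.exp_le_exp.2 ?_
  have : (Complex.I * ∑ j, (k j : ℂ) * θ j).re = ∑ j, -((k j : ℝ) * (θ j).im) := by
    simp [Complex.im_sum, Complex.mul_im]
  rw [this, kn, Finset.mul_sum]
  refine Finset.sum_le_sum fun j _ => ?_
  calc -((k j : ℝ) * (θ j).im) ≤ |(k j : ℝ) * (θ j).im| := neg_le_abs _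
    _ = |(θ j).im| * |(k j : ℝ)| := by rw [abs_mul, mul_comm]
    _ ≤ _ := by gcongr; exact h j

theorem expf_toC {n : ℕ} (k : Idx n) (x : Fin n → ℝ) :
    expf k (toC x) = Complex.exp (Complex.I * ((∑ j, (k j : ℝ) * x j : ℝ) : ℂ)) := by
  simp [expf, toC]

theorem norm_expf_toC {n : ℕ} (k : Idx n) (x : Fin n → ℝ) : ‖expf k (toC x)‖ = 1 := by
  rw [expf_toC, mul_comm, Complex.norm_exp_ofReal_mul_I]

theorem conj_expf_toC {n : ℕ} (k : Idx n) (x : Fin n → ℝ) :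
    (starRingEnd ℂ) (expf k (toC x)) = expf (-k) (toC x) := by
  rw [expf_toC, expf_toC, ← Complex.exp_conj]
  congr 1
  simp

/-- The factor `e^{i k·θ} e^{-ρ|k|}`, cut off where it exceeds `1` in absolute value. -/
def evc {n : ℕ} (ρ : ℝ) (θ : Fin n → ℂ) (k : Idx n) : ℂ :=
  if ‖expf k θ * (Real.exp (-(ρ * kn k)) : ℂ)‖ ≤ 1 then expf k θ * (Real.exp (-(ρ * kn k)) : ℂ)
  else 0

theorem norm_evc_le {n : ℕ} (ρ : ℝ) (θ : Fin n → ℂ) (k : Idx n) : ‖evc ρ θ k‖ ≤ 1 := by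
  unfold evc
  split_ifs with h
  · exact h
  · simp

/-- The cut-off never acts on the closed strip of width ρ. It is there so that `evX ρ θ` is a
contraction for every θ, without side conditions. -/
theorem evc_eq {n : ℕ} {ρ : ℝ} {θ : Fin n → ℂ} (h : θ ∈ cstrip n ρ) (k : Idx n) :
    evc ρ θ k = expf k θ * (Real.exp (-(ρ * kn k)) : ℂ) := by
  unfold evc
  rw [if_pos]
  rw [norm_mul, Complex.norm_real, Real.norm_eq_abs, Real.abs_exp, Real.exp_neg,
    mul_inv_le_iff₀ (Real.exp_pos _), one_mul]
  exact norm_expf_le h k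

section eval

variable {n : ℕ} {E F : Type*} [NormedAddCommGroup E] [NormedSpace ℂ E] [CompleteSpace E]
  [NormedAddCommGroup F] [NormedSpace ℂ F] [CompleteSpace F]

theorem norm_smul_id_le {c : ℂ} {C : ℝ} (h : ‖c‖ ≤ C) : ‖c • ContinuousLinearMap.id ℂ E‖ ≤ C := by
  rw [norm_smul]
  calc _ ≤ C * 1 := by
        gcongr
        · exact (norm_nonneg _).trans h
        · exact ContinuousLinearMap.norm_id_le
    _ = C := mul_one C

/-- The value at `θ` of the Fourier series with weighted coefficients `a`. -/
def evX (ρ : ℝ) (θ : Fin n → ℂ) : X n E →L[ℂ] E :=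
  liftX (fun k => evc ρ θ k • ContinuousLinearMap.id ℂ E) 1
    fun k => norm_smul_id_le (norm_evc_le ρ θ k)

theorem norm_evX_le (ρ : ℝ) (θ : Fin n → ℂ) : ‖(evX ρ θ : X n E →L[ℂ] E)‖ ≤ 1 := norm_liftX_le _

theorem evX_incl (ρ : ℝ) (θ : Fin n → ℂ) (k : Idx n) (x : E) :
    evX ρ θ (incl k x) = evc ρ θ k • x := by
  rw [evX, liftX_incl]; rfl

/-- The `k`-th Fourier coefficient. -/
def coefX (ρ : ℝ) (k : Idx n) (a : X n E) : E := (Real.exp (-(ρ * kn k)) : ℂ) • a k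

theorem coefX_sub (ρ : ℝ) (k : Idx n) (a b : X n E) :
    coefX ρ k (a - b) = coefX ρ k a - coefX ρ k b := by
  simp [coefX, smul_sub]

theorem norm_coefX (ρ : ℝ) (k : Idx n) (a : X n E) :
    ‖coefX ρ k a‖ = Real.exp (-(ρ * kn k)) * ‖a k‖ := by
  rw [coefX, norm_smul, Complex.norm_real, Real.norm_eq_abs, Real.abs_exp]

theorem hasSum_evX {ρ : ℝ} {θ : Fin n → ℂ} (h : θ ∈ cstrip n ρ) (a : X n E) :
    HasSum (fun k => expf k θ • coefX ρ k a) (evX ρ θ a) := by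
  refine (hasSum_liftX _ a).congr_fun fun k => ?_
  simp [evc_eq h, coefX, mul_smul]

/-- The summands of the multiplication by a Fourier series of operators. -/
def convTerm (ρ : ℝ) (T : Idx n → E →L[ℂ] F) (l k : Idx n) : E →L[ℂ] X n F :=
  (Real.exp (ρ * (kn (k + l) - kn l)) : ℂ) • (incl (k + l)).comp (T k)

/-- Coefficients are stored with their weights, so a product must convert the weight at l into that
at k + l; subadditivity of |·| bounds the conversion factor by e^{ρ|k|}. -/
theorem norm_convTerm_le {ρ : ℝ} (hρ : 0 ≤ ρ) (T : Idx n → E →L[ℂ] F) (l k : Idx n) :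
    ‖convTerm ρ T l k‖ ≤ Real.exp (ρ * kn k) * ‖T k‖ := by
  refine ContinuousLinearMap.opNorm_le_bound _ (by positivity) fun x => ?_
  have h : convTerm ρ T l k x = (Real.exp (ρ * (kn (k + l) - kn l)) : ℂ) • incl (k + l) (T k x) :=
    rfl
  rw [h, norm_smul, Complex.norm_real, Real.norm_eq_abs, Real.abs_exp, norm_incl_apply, mul_assoc]
  gcongr
  · linarith [kn_add_le k l]
  · exact (T k).le_opNorm x

theorem summable_convTerm {ρ : ℝ} (hρ : 0 ≤ ρ) {T : Idx n → E →L[ℂ] F}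
    (hT : Summable fun k => Real.exp (ρ * kn k) * ‖T k‖) (l : Idx n) :
    Summable (convTerm ρ T l) :=
  Summable.of_norm_bounded hT (norm_convTerm_le hρ T l)

theorem norm_tsum_convTerm_le {ρ : ℝ} (hρ : 0 ≤ ρ) {T : Idx n → E →L[ℂ] F}
    (hT : Summable fun k => Real.exp (ρ * kn k) * ‖T k‖) (l : Idx n) :
    ‖∑' k, convTerm ρ T l k‖ ≤ ∑' k, Real.exp (ρ * kn k) * ‖T k‖ :=
  tsum_of_norm_bounded hT.hasSum (norm_convTerm_le hρ T l)

open Classical in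
/-- Multiplication by a Fourier series `∑ T_k e^{i k·θ}` of operators (`0` if the coefficients
are not summable with weight `e^{ρ|k|}`). -/
def convX (ρ : ℝ) (T : Idx n → E →L[ℂ] F) : X n E →L[ℂ] X n F :=
  if h : 0 ≤ ρ ∧ Summable fun k => Real.exp (ρ * kn k) * ‖T k‖ then
    liftX (fun l => ∑' k, convTerm ρ T l k) _ (norm_tsum_convTerm_le h.1 h.2) else 0

section conv

variable {ρ : ℝ} {T : Idx n → E →L[ℂ] F}

theorem norm_convX_le (hρ : 0 ≤ ρ) (hT : Summable fun k => Real.exp (ρ * kn k) * ‖T k‖) :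
    ‖convX ρ T‖ ≤ ∑' k, Real.exp (ρ * kn k) * ‖T k‖ := by
  rw [convX, dif_pos ⟨hρ, hT⟩]
  exact norm_liftX_le _

theorem hasSum_convX_incl (hρ : 0 ≤ ρ) (hT : Summable fun k => Real.exp (ρ * kn k) * ‖T k‖)
    (l : Idx n) (x : E) :
    HasSum (fun k => (Real.exp (ρ * (kn (k + l) - kn l)) : ℂ) • incl (k + l) (T k x))
      (convX ρ T (incl l x)) := by
  rw [convX, dif_pos ⟨hρ, hT⟩]
  rw [liftX_incl]
  have h := (ContinuousLinearMap.apply ℂ (X n F) x).hasSum (summable_convTerm hρ hT l).hasSum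
  rw [ContinuousLinearMap.apply_apply] at h
  refine h.congr_fun fun k => ?_
  rw [ContinuousLinearMap.apply_apply]
  rfl

theorem convX_sub (hρ : 0 ≤ ρ) {T' : Idx n → E →L[ℂ] F}
    (hT : Summable fun k => Real.exp (ρ * kn k) * ‖T k‖)
    (hT' : Summable fun k => Real.exp (ρ * kn k) * ‖T' k‖)
    (hd : Summable fun k => Real.exp (ρ * kn k) * ‖T k - T' k‖) :
    convX ρ T - convX ρ T' = convX ρ fun k => T k - T' k := by
  refine X_hom_ext fun l x => ?_
  refine ((hasSum_convX_incl hρ hT l x).sub (hasSum_convX_incl hρ hT' l x)).unique ?_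
  convert hasSum_convX_incl hρ hd l x using 2 with k
  simp [smul_sub]

theorem summable_expf_smul (hT : Summable fun k => Real.exp (ρ * kn k) * ‖T k‖)
    {θ : Fin n → ℂ} (h : θ ∈ cstrip n ρ) : Summable fun k => expf k θ • T k :=
  Summable.of_norm_bounded hT fun k => by
    rw [norm_smul]; gcongr; exact norm_expf_le h k

/-- By continuity it suffices to test on a single coefficient, where the claim is multiplicativity
of the characters. -/
theorem evX_convX (hρ : 0 ≤ ρ) (hT : Summable fun k => Real.exp (ρ * kn k) * ‖T k‖)
    {θ : Fin n → ℂ} (h : θ ∈ cstrip n ρ) (a : X n E) :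
    evX ρ θ (convX ρ T a) = (∑' k, expf k θ • T k) (evX ρ θ a) := by
  have : (evX ρ θ).comp (convX ρ T) = (∑' k, expf k θ • T k).comp (evX ρ θ) := by
    refine X_hom_ext fun l x => ?_
    have h1 := (evX ρ θ : X n F →L[ℂ] F).hasSum (hasSum_convX_incl hρ hT l x)
    have h2 := (ContinuousLinearMap.apply ℂ F (evX ρ θ (incl l x))).hasSum
      (summable_expf_smul hT h).hasSum
    refine h1.unique ?_
    refine h2.congr_fun fun k => ?_
    simp only [map_smul, evX_incl, evc_eq h, ContinuousLinearMap.apply_apply,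
      _root_.smul_apply, smul_smul, expf_add]
    congr 1
    have : Real.exp (ρ * (kn (k + l) - kn l)) * Real.exp (-(ρ * kn (k + l)))
        = Real.exp (-(ρ * kn l)) := by
      rw [← Real.exp_add]; congr 1; ring
    rw [← this]
    push_cast
    ring
  exact DFunLike.congr_fun this a

end conv

/-- Reinterpretation of weighted coefficients for the smaller strip width `ρ'`. -/
def resX (ρ ρ' : ℝ) : X n E →L[ℂ] X n E :=
  liftX (fun k => ((min 1 (Real.exp (-((ρ - ρ') * kn k))) : ℝ) : ℂ) • incl k) 1 fun k => by
    rw [norm_smul, Complex.norm_real, Real.norm_eq_abs,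
      abs_of_nonneg (by positivity)]
    exact mul_le_one₀ (min_le_left _ _) (norm_nonneg _) (norm_incl_le k)

end eval

section eval

variable {n : ℕ} {E : Type*} [NormedAddCommGroup E] [NormedSpace ℂ E] [CompleteSpace E]

theorem norm_resX_le (ρ ρ' : ℝ) : ‖(resX ρ ρ' : X n E →L[ℂ] X n E)‖ ≤ 1 := norm_liftX_le _

theorem cstrip_mono {ρ ρ' : ℝ} (h : ρ' ≤ ρ) : cstrip n ρ' ⊆ cstrip n ρ :=
  fun _ hθ j => (hθ j).trans h

/-- For ρ' ≤ ρ the minimum with 1 in `resX` is inactive and the factor is the exact ratio of the two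
weights. -/
theorem evX_resX {ρ ρ' : ℝ} (h : ρ' ≤ ρ) {θ : Fin n → ℂ} (hθ : θ ∈ cstrip n ρ') (a : X n E) :
    evX ρ' θ (resX ρ ρ' a) = evX ρ θ a := by
  have : (evX ρ' θ).comp (resX ρ ρ') = (evX ρ θ : X n E →L[ℂ] E) := by
    refine X_hom_ext fun k x => ?_
    rw [ContinuousLinearMap.comp_apply, resX, liftX_incl]
    have h1 : Real.exp (-((ρ - ρ') * kn k)) ≤ 1 :=
      Real.exp_le_one_iff.2 (by nlinarith [kn_nonneg k])
    have h2 : Real.exp (-((ρ - ρ') * kn k)) * Real.exp (-(ρ' * kn k)) = Real.exp (-(ρ * kn k)) := by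
      rw [← Real.exp_add]; congr 1; ring
    rw [min_eq_right h1, _root_.smul_apply, map_smul, evX_incl, evX_incl,
      evc_eq hθ, evc_eq (cstrip_mono h hθ), smul_smul, ← h2]
    congr 1
    push_cast; ring
  exact DFunLike.congr_fun this a

/-! ### Derivative along the flow `θ = ω t` -/

/-- The frequency `k·ω`. -/
def freq (k : Idx n) (ω : Fin n → ℝ) : ℝ := ∑ j, (k j : ℝ) * ω j

theorem abs_freq_le (k : Idx n) (ω : Fin n → ℝ) : |freq k ω| ≤ kn k * ‖ω‖ := by
  unfold freq kn
  rw [Finset.sum_mul]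
  refine (Finset.abs_sum_le_sum_abs _ _).trans (Finset.sum_le_sum fun j _ => ?_)
  rw [abs_mul]
  gcongr
  exact norm_le_pi_norm ω j

theorem freq_sub (k : Idx n) (ω ω' : Fin n → ℝ) : freq k ω - freq k ω' = freq k (ω - ω') := by
  unfold freq
  rw [← Finset.sum_sub_distrib]
  exact Finset.sum_congr rfl fun j _ => by rw [Pi.sub_apply]; ring

theorem expf_flow (k : Idx n) (ω : Fin n → ℝ) (t : ℝ) :
    expf k (toC (t • ω)) = Complex.exp (Complex.I * ((freq k ω : ℝ) : ℂ) * t) := by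
  rw [expf_toC, freq]
  congr 1
  rw [mul_assoc, ← Complex.ofReal_mul, Finset.sum_mul]
  congr 3
  ext j
  simp only [Pi.smul_apply, smul_eq_mul]; ring

theorem mul_exp_neg_le {ρ x : ℝ} (hρ : 0 < ρ) : x * Real.exp (-(ρ * x)) ≤ 1 / ρ := by
  rw [Real.exp_neg, ← div_eq_mul_inv, div_le_div_iff₀ (Real.exp_pos _) hρ]
  nlinarith [Real.add_one_le_exp (ρ * x)]

/-- The derivative along the flow of the Fourier series with weighted coefficients `a`. -/
def devX {ρ : ℝ} (hρ : 0 < ρ) (ω : Fin n → ℝ) (t : ℝ) : X n E →L[ℂ] E :=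
  liftX (fun k => (Complex.I * (freq k ω : ℝ) * evc ρ (toC (t • ω)) k) •
    ContinuousLinearMap.id ℂ E) (‖ω‖ / ρ) fun k => norm_smul_id_le (by
      rw [evc_eq (toC_mem_cstrip hρ.le _), norm_mul, norm_mul, norm_mul, norm_expf_toC,
        Complex.norm_I, Complex.norm_real, Complex.norm_real, Real.norm_eq_abs, Real.norm_eq_abs,
        Real.abs_exp, one_mul, one_mul]
      calc _ ≤ kn k * ‖ω‖ * Real.exp (-(ρ * kn k)) := by gcongr; exact abs_freq_le k ω
        _ = ‖ω‖ * (kn k * Real.exp (-(ρ * kn k))) := by ring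
        _ ≤ ‖ω‖ * (1 / ρ) := by gcongr; exact mul_exp_neg_le hρ
        _ = _ := by ring)

theorem hasSum_devX {ρ : ℝ} (hρ : 0 < ρ) (ω : Fin n → ℝ) (t : ℝ) (a : X n E) :
    HasSum (fun k => (Complex.I * (freq k ω : ℝ) * expf k (toC (t • ω))) • coefX ρ k a)
      (devX hρ ω t a) := by
  refine (hasSum_liftX _ a).congr_fun fun k => ?_
  simp [evc_eq (toC_mem_cstrip hρ.le _), coefX, smul_smul, mul_assoc]

/-- Any positive width allows termwise differentiation: the factor |k·ω| is absorbed by |k|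
e^{-ρ|k|} ≤ 1/ρ. -/
theorem hasDerivAt_evX {ρ : ℝ} (hρ : 0 < ρ) (ω : Fin n → ℝ) (a : X n E) (t : ℝ) :
    HasDerivAt (fun s : ℝ => evX ρ (toC (s • ω)) a) (devX hρ ω t a) t := by
  have h := hasDerivAt_tsum (g := fun k s => expf k (toC (s • ω)) • coefX ρ k a)
    (g' := fun k s => (Complex.I * (freq k ω : ℝ) * expf k (toC (s • ω))) • coefX ρ k a)
    (u := fun k => ‖ω‖ / ρ * ‖a k‖) (y₀ := t) ((hasSum_norm_X a).summable.mul_left _)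
    (fun k s => ?_) (fun k s => ?_) (hasSum_evX (toC_mem_cstrip hρ.le _) a).summable t
  · rw [(hasSum_devX hρ ω t a).tsum_eq] at h
    exact h.congr_of_eventuallyEq (Filter.Eventually.of_forall fun s =>
      (hasSum_evX (toC_mem_cstrip hρ.le _) a).tsum_eq.symm)
  · refine HasDerivAt.smul_const ?_ _
    simp only [expf_flow]
    have := ((Complex.ofRealCLM.hasDerivAt (x := s)).const_mul
      (Complex.I * ((freq k ω : ℝ) : ℂ))).cexp
    simpa [mul_comm, mul_left_comm] using this
  · rw [norm_smul, norm_coefX, norm_mul, norm_mul, norm_expf_toC, Complex.norm_I,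
      Complex.norm_real, Real.norm_eq_abs, one_mul, mul_one, ← mul_assoc]
    gcongr
    calc _ ≤ kn k * ‖ω‖ * Real.exp (-(ρ * kn k)) := by gcongr; exact abs_freq_le k ω
      _ = ‖ω‖ * (kn k * Real.exp (-(ρ * kn k))) := by ring
      _ ≤ ‖ω‖ * (1 / ρ) := by gcongr; exact mul_exp_neg_le hρ
      _ = _ := by ring

/-! ### Analyticity -/

/-- The linear form `v ↦ i k·v`. -/
def charForm (k : Idx n) : (Fin n → ℂ) →L[ℂ] ℂ :=
  Complex.I • ∑ j, (k j : ℂ) • ContinuousLinearMap.proj j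

theorem charForm_apply (k : Idx n) (v : Fin n → ℂ) :
    charForm k v = Complex.I * ∑ j, (k j : ℂ) * v j := by
  simp [charForm]

theorem norm_charForm_le (k : Idx n) : ‖charForm k‖ ≤ kn k := by
  refine ContinuousLinearMap.opNorm_le_bound _ (kn_nonneg k) fun v => ?_
  rw [charForm_apply, norm_mul, Complex.norm_I, one_mul, kn, Finset.sum_mul]
  refine norm_sum_le_of_le _ fun j _ => ?_
  rw [norm_mul, Complex.norm_intCast]
  gcongr
  exact norm_le_pi_norm v j

/-- The `m`-th Taylor term of `x ↦ e^{i k·x} c` at a point where the character has the value `1`. -/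
def charTerm (k : Idx n) (c : E) (m : ℕ) : (Fin n → ℂ) [×m]→L[ℂ] E :=
  ((m.factorial : ℂ)⁻¹ • (ContinuousMultilinearMap.mkPiAlgebraFin ℂ m ℂ).compContinuousLinearMap
    fun _ => charForm k).smulRight c

theorem charTerm_diag (k : Idx n) (c : E) (m : ℕ) (y : Fin n → ℂ) :
    charTerm k c m (fun _ => y) = ((m.factorial : ℂ)⁻¹ * charForm k y ^ m) • c := by
  simp [charTerm]

theorem norm_charTerm_le (k : Idx n) (c : E) (m : ℕ) :
    ‖charTerm k c m‖ ≤ (kn k) ^ m / m.factorial * ‖c‖ := by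
  refine ContinuousMultilinearMap.opNorm_le_bound (by have := kn_nonneg k; positivity) fun v => ?_
  have : charTerm k c m v = ((m.factorial : ℂ)⁻¹ * ∏ i, charForm k (v i)) • c := by
    simp [charTerm, List.prod_ofFn]
  rw [this, norm_smul, norm_mul, norm_inv, Complex.norm_natCast, norm_prod]
  have h1 : ∏ i, ‖charForm k (v i)‖ ≤ kn k ^ m * ∏ i, ‖v i‖ := by
    calc _ ≤ ∏ i, kn k * ‖v i‖ := Finset.prod_le_prod (fun i _ => norm_nonneg _)
          fun i _ => (charForm k).le_of_opNorm_le (norm_charForm_le k) _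
      _ = _ := by rw [Finset.prod_mul_distrib]; simp
  calc _ ≤ (m.factorial : ℝ)⁻¹ * (kn k ^ m * ∏ i, ‖v i‖) * ‖c‖ := by gcongr
    _ = _ := by ring

theorem hasSum_real_exp (x : ℝ) : HasSum (fun m : ℕ => x ^ m / m.factorial) (Real.exp x) := by
  rw [Real.exp_eq_exp_ℝ]
  exact NormedSpace.expSeries_div_hasSum_exp x

/-- Expand each character e^{ik·(θ₀ + y)} in powers of y. The bound (r|k|)^m/m! ≤ e^{r|k|} is paid
for by the distance r from θ₀ to the boundary of the strip, which gives Taylor coefficients with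
radius at least r. -/
theorem analyticOnNhd_evX {ρ : ℝ} (hρ : 0 < ρ) (a : X n E) :
    AnalyticOnNhd ℂ (fun θ => evX ρ θ a) (strip n ρ) := by
  intro θ₀ hθ₀
  set s : ℝ := ‖fun j => (θ₀ j).im‖ with hs
  have hsρ : s < ρ := (pi_norm_lt_iff hρ).2 fun j => hθ₀ j
  set r : ℝ := ρ - s with hr
  have hr0 : 0 < r := sub_pos.2 hsρ
  set c : Idx n → E := fun k => expf k θ₀ • coefX ρ k a with hc
  have hθs : θ₀ ∈ cstrip n s := fun j => norm_le_pi_norm (fun j => (θ₀ j).im) j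
  have hcn : ∀ k, ‖c k‖ ≤ Real.exp (-(r * kn k)) * ‖a k‖ := fun k => by
    rw [hc]
    simp only
    rw [norm_smul, norm_coefX, ← mul_assoc]
    gcongr
    calc _ ≤ Real.exp (s * kn k) * Real.exp (-(ρ * kn k)) := by
          gcongr; exact norm_expf_le hθs k
      _ = _ := by rw [← Real.exp_add]; congr 1; rw [hr]; ring
  have hterm : ∀ k m, ‖charTerm k (c k) m‖ * r ^ m ≤ ‖a k‖ := fun k m => by
    calc _ ≤ (kn k ^ m / m.factorial * (Real.exp (-(r * kn k)) * ‖a k‖)) * r ^ m := by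
          gcongr
          refine (norm_charTerm_le k (c k) m).trans ?_
          have := kn_nonneg k
          gcongr
          exact hcn k
      _ = ((r * kn k) ^ m / m.factorial) * Real.exp (-(r * kn k)) * ‖a k‖ := by
          rw [mul_pow]; ring
      _ ≤ Real.exp (r * kn k) * Real.exp (-(r * kn k)) * ‖a k‖ := by
          gcongr
          exact Real.pow_div_factorial_le_exp _ (mul_nonneg hr0.le (kn_nonneg k)) m
      _ = _ := by rw [← Real.exp_add, add_neg_cancel, Real.exp_zero, one_mul]
  have hsumA := hasSum_norm_X a
  have hsm : ∀ m, Summable fun k => charTerm k (c k) m := fun m =>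
    Summable.of_norm_bounded (hsumA.summable.mul_left (r ^ m)⁻¹) fun k => by
      rw [inv_mul_eq_div, le_div_iff₀ (by positivity)]; exact hterm k m
  refine ⟨fun m => ∑' k, charTerm k (c k) m, ENNReal.ofReal r, ?_, by simpa using hr0, ?_⟩
  · refine FormalMultilinearSeries.le_radius_of_bound _ ‖a‖ (r := r.toNNReal) fun m => ?_
    rw [Real.coe_toNNReal _ hr0.le, ← le_div_iff₀ (by positivity)]
    refine tsum_of_norm_bounded (hsumA.div_const (r ^ m)) fun k => ?_
    rw [le_div_iff₀ (by positivity)]; exact hterm k m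
  · intro y hy
    have hy' : ‖y‖ < r := by
      simpa [← ofReal_norm, ENNReal.ofReal_lt_ofReal_iff hr0] using hy
    -- The double series is absolutely summable: summed over m first it gives the value at θ₀ + y,
    -- summed over k first the Taylor series.
    set g : Idx n × ℕ → E := fun q => charTerm q.1 (c q.1) q.2 (fun _ => y) with hg
    have hgk : ∀ k, HasSum (fun m => g (k, m)) (Complex.exp (charForm k y) • c k) := fun k => by
      simp only [hg, charTerm_diag]
      refine HasSum.smul_const ?_ _
      rw [Complex.exp_eq_exp_ℂ]
      have h : HasSum (fun m : ℕ => charForm k y ^ m / (m.factorial : ℂ))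
          (NormedSpace.exp (charForm k y)) := NormedSpace.expSeries_div_hasSum_exp _
      exact h.congr_fun fun m => (div_eq_inv_mul _ _).symm
    have hgn : ∀ k m, ‖g (k, m)‖ ≤ (r * kn k) ^ m / m.factorial * ‖c k‖ := fun k m => by
      calc _ ≤ ‖charTerm k (c k) m‖ * ∏ _i : Fin m, ‖y‖ := (charTerm k (c k) m).le_opNorm _
        _ ≤ (kn k ^ m / m.factorial * ‖c k‖) * r ^ m := by
            rw [Finset.prod_const, Finset.card_univ, Fintype.card_fin]
            gcongr
            · have := kn_nonneg k
              positivity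
            · exact norm_charTerm_le k (c k) m
        _ = _ := by rw [mul_pow]; ring
    have hexp : ∀ k, HasSum (fun m : ℕ => (r * kn k) ^ m / m.factorial * ‖c k‖)
        (Real.exp (r * kn k) * ‖c k‖) := fun k => (hasSum_real_exp _).mul_right _
    have hgs : Summable g := by
      refine Summable.of_norm ?_
      rw [summable_prod_of_nonneg fun q => norm_nonneg _]
      refine ⟨fun k => Summable.of_nonneg_of_le (fun m => norm_nonneg _) (hgn k)
        (hexp k).summable, ?_⟩
      refine Summable.of_nonneg_of_le (fun k => tsum_nonneg fun m => norm_nonneg _)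
        (fun k => ?_) hsumA.summable
      refine ((Summable.of_nonneg_of_le (fun m => norm_nonneg _) (hgn k)
        (hexp k).summable).tsum_le_tsum (hgn k) (hexp k).summable).trans ?_
      rw [(hexp k).tsum_eq]
      calc _ ≤ Real.exp (r * kn k) * (Real.exp (-(r * kn k)) * ‖a k‖) := by gcongr; exact hcn k
        _ = _ := by rw [← mul_assoc, ← Real.exp_add, add_neg_cancel, Real.exp_zero, one_mul]
    have hyθ : θ₀ + y ∈ cstrip n ρ := fun j => by
      have h1 := hθs j
      have h2 : |(y j).im| ≤ ‖y‖ := (Complex.abs_im_le_norm _).trans (norm_le_pi_norm y j)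
      rw [Pi.add_apply, Complex.add_im]
      have := abs_add_le (θ₀ j).im (y j).im
      linarith
    have hval : ∑' q, g q = evX ρ (θ₀ + y) a := by
      rw [hgs.tsum_prod, ← (hasSum_evX hyθ a).tsum_eq]
      refine tsum_congr fun k => ?_
      rw [(hgk k).tsum_eq, hc]
      simp only
      rw [smul_smul]
      congr 1
      rw [charForm_apply, expf, expf, ← Complex.exp_add, ← mul_add, ← Finset.sum_add_distrib]
      congr 2
      refine Finset.sum_congr rfl fun j _ => ?_
      rw [Pi.add_apply]; ring
    have hh := ((Equiv.prodComm ℕ (Idx n)).hasSum_iff.2 hgs.hasSum).prod_fiberwise fun m =>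
      ((Equiv.prodComm ℕ (Idx n)).summable_iff.2 hgs).prod_factor m |>.hasSum
    rw [hval] at hh
    refine hh.congr_fun fun m => ?_
    have := (hsm m).hasSum.map (ContinuousMultilinearMap.apply ℂ (fun _ : Fin m => Fin n → ℂ) E
      fun _ => y) (ContinuousLinearMap.continuous _)
    exact this.tsum_eq.symm

/-! ### Uniqueness of Fourier coefficients -/

/-- The series converges uniformly, hence in L² of the torus, where the characters are orthonormal.
This turns self-adjointness at real angles into a symmetry of the coefficients. -/
theorem fourier_unique {a : Idx n → ℂ} (ha : Summable fun k => ‖a k‖)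
    (h : ∀ x : Fin n → ℝ, ∑' k, a k * expf k (toC x) = 0) : a = 0 := by
  have hs : Summable fun k => a k • (UnitAddTorus.mFourier k : C(UnitAddTorus (Fin n), ℂ)) :=
    Summable.of_norm (by
      simpa only [norm_smul, UnitAddTorus.mFourier_norm, mul_one] using ha)
  have h0 : ∑' k, a k • (UnitAddTorus.mFourier k : C(UnitAddTorus (Fin n), ℂ)) = 0 := by
    ext y
    obtain ⟨x, rfl⟩ : ∃ x : Fin n → ℝ, (fun j => (x j : UnitAddCircle)) = y := by
      choose x hx using fun j => QuotientAddGroup.mk_surjective (y j)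
      exact ⟨x, funext hx⟩
    have h1 := (ContinuousMap.evalCLM ℂ (fun j => (x j : UnitAddCircle))).hasSum hs.hasSum
    have h2 : (ContinuousMap.evalCLM ℂ (fun j => (x j : UnitAddCircle)))
        (∑' k, a k • (UnitAddTorus.mFourier k : C(UnitAddTorus (Fin n), ℂ)))
        = ∑' k, a k * expf k (toC fun j => 2 * Real.pi * x j) := by
      rw [← h1.tsum_eq]
      refine tsum_congr fun k => ?_
      simp only [map_smul, smul_eq_mul]
      congr 1
      change ∏ j, (fourier (k j) (x j : UnitAddCircle)) = _
      simp only [fourier_coe_apply, expf, toC, ← Complex.exp_sum, Finset.mul_sum]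
      congr 1
      refine Finset.sum_congr rfl fun j _ => ?_
      push_cast
      ring
    rw [h] at h2
    exact h2
  have h3 : HasSum (fun k => a k • UnitAddTorus.mFourierLp (d := Fin n) 2 k) 0 := by
    have := (ContinuousMap.toLp (E := ℂ) 2 (MeasureTheory.Measure.pi fun _ : Fin n =>
      (AddCircle.haarAddCircle : MeasureTheory.Measure UnitAddCircle)) ℂ).hasSum hs.hasSum
    rw [h0, map_zero] at this
    exact this.congr_fun fun k => (map_smul _ _ _).symm
  ext k₀
  have h4 := (innerSL ℂ (UnitAddTorus.mFourierLp (d := Fin n) 2 k₀)).hasSum h3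
  rw [map_zero] at h4
  refine (h4.unique ?_).symm
  convert hasSum_single k₀ (fun l hl => ?_) using 1
  · have := (UnitAddTorus.orthonormal_mFourier (d := Fin n)).1 k₀
    rw [map_smul]
    change a k₀ = a k₀ • inner ℂ (UnitAddTorus.mFourierLp 2 k₀) (UnitAddTorus.mFourierLp 2 k₀)
    rw [inner_self_eq_norm_sq_to_K, this]; simp
  · have := (UnitAddTorus.orthonormal_mFourier (d := Fin n)).2 (Ne.symm hl)
    rw [map_smul]
    change a l • inner ℂ (UnitAddTorus.mFourierLp 2 k₀) (UnitAddTorus.mFourierLp 2 l) = 0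
    rw [this]; simp

end eval

/-! ### Small divisors -/

section divisors

variable {n : ℕ} {α : ℝ}

/-- The eigenvalues `λ_i + Re Λ_ii`. -/
def lamOf (Λ : Mhat α) (i : ℕ) : ℝ := lam i + (entry Λ.op i i).re

/-- The divisors `k·ω + λ_i - λ_j`. -/
def dvs (ω : Fin n → ℝ) (Λ : Mhat α) (k : Idx n) (i j : ℕ) : ℝ :=
  freq k ω + lamOf Λ i - lamOf Λ j

/-- The non-resonance condition. -/
def NonRes (γ δ : ℝ) (ω : Fin n → ℝ) (Λ : Mhat α) : Prop :=
  ∀ (k : Idx n) (i j : ℕ), (k ≠ 0 ∨ i ≠ j) →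
    γ * Real.exp (-(δ * kn k)) * dw i j ≤ |dvs ω Λ k i j|

open Classical in
/-- The Schur multiplier `-1 / (2 (k·ω + λ_i - λ_j))` of the homological equation. -/
def mult (ω : Fin n → ℝ) (Λ : Mhat α) (k : Idx n) (i j : ℕ) : ℂ :=
  if k = 0 ∧ i = j then 0 else (((-1 / (2 * dvs ω Λ k i j) : ℝ)) : ℂ)

theorem dw_succ (i j : ℕ) : dw (i + 1) (j + 1) = dw i j := by
  unfold dw; push_cast; congr 2; ring

/-- Equal spacing of the unperturbed spectrum cancels `lam` and the frequency; only the correction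
of the diagonal is left, and its differences decay like the inverse weight. -/
theorem dvs_succ_sub (ω : Fin n → ℝ) (Λ : Mhat α) (k : Idx n) (i j : ℕ) :
    dvs ω Λ k (i + 1) (j + 1) - dvs ω Λ k i j =
      (diffEntry Λ.op i i).re - (diffEntry Λ.op j j).re := by
  simp only [dvs, lamOf, lam, diffEntry, Complex.sub_re]
  push_cast
  ring

theorem minW_mul_abs_diff_le (hα : 0 ≤ α) (Λ : Mhat α) (i j : ℕ) :
    minW α i j * |(diffEntry Λ.op i i).re - (diffEntry Λ.op j j).re| ≤ 2 * ‖Λ‖ := by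
  have h : ∀ l, min i j ≤ l → minW α i j * |(diffEntry Λ.op l l).re| ≤ ‖Λ‖ := fun l hl => by
    refine le_trans ?_ (norm_diffEntry_le Λ l l)
    refine mul_le_mul (minW_mono hα (by simpa using hl)) (Complex.abs_re_le_norm _)
      (abs_nonneg _) (minW_pos α l l).le
  calc _ ≤ minW α i j * (|(diffEntry Λ.op i i).re| + |(diffEntry Λ.op j j).re|) := by
        gcongr
        · exact (minW_pos _ _ _).le
        · exact abs_sub _ _
    _ ≤ _ := by rw [mul_add]; linarith [h i (min_le_left _ _), h j (min_le_right _ _)]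

theorem mult_of_ne {ω : Fin n → ℝ} {Λ : Mhat α} {k : Idx n} {i j : ℕ} (h : k ≠ 0 ∨ i ≠ j) :
    mult ω Λ k i j = ((-1 / (2 * dvs ω Λ k i j) : ℝ) : ℂ) := by
  unfold mult
  rw [if_neg]
  tauto

theorem mult_zero_diag (ω : Fin n → ℝ) (Λ : Mhat α) (i : ℕ) :
    mult ω Λ 0 i i = 0 := by simp [mult]

section bounds

variable {γ δ : ℝ} {ω ω' : Fin n → ℝ} {Λ Λ' : Mhat α}

theorem NonRes.pos (hγ : 0 < γ) (h : NonRes γ δ ω Λ) {k : Idx n} {i j : ℕ}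
    (hk : k ≠ 0 ∨ i ≠ j) : 0 < |dvs ω Λ k i j| :=
  (mul_pos (mul_pos hγ (Real.exp_pos _)) (dw_pos i j)).trans_le (h k i j hk)

theorem mult_bd (hγ : 0 < γ) (h : NonRes γ δ ω Λ) (k : Idx n) (i j : ℕ) :
    dw i j * ‖mult ω Λ k i j‖ ≤ 1 / 2 * (γ * Real.exp (-(δ * kn k)))⁻¹ := by
  by_cases hk : k ≠ 0 ∨ i ≠ j
  · have hd := h.pos hγ hk
    have := h k i j hk
    rw [mult_of_ne hk, Complex.norm_real, Real.norm_eq_abs, abs_div, abs_neg, abs_one, abs_mul,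
      abs_two, ← div_eq_mul_inv, mul_one_div, div_le_div_iff₀ (by positivity)
      (mul_pos hγ (Real.exp_pos _))]
    linarith
  · rw [not_or, not_not, not_not] at hk
    obtain ⟨rfl, rfl⟩ := hk
    rw [mult_zero_diag, norm_zero, mul_zero]
    positivity

/-- With divisors d and d' at (i, j) and (i+1, j+1), the difference is (d' - d)/(2dd'): the
numerator carries (i ∧ j)^{-α}, and each factor of the denominator carries 1 + |i - j|, of which one
is needed. -/
theorem mult_diff (hα : 0 ≤ α) (hγ : 0 < γ) (hΛ : ‖Λ‖ ≤ 1) (h : NonRes γ δ ω Λ) (k : Idx n)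
    (i j : ℕ) : minW α i j * dw i j * ‖mult ω Λ k (i + 1) (j + 1) - mult ω Λ k i j‖ ≤
      ((γ * Real.exp (-(δ * kn k))) ^ 2)⁻¹ := by
  have hc : 0 < γ * Real.exp (-(δ * kn k)) := mul_pos hγ (Real.exp_pos _)
  by_cases hk : k ≠ 0 ∨ i ≠ j
  · have hk' : k ≠ 0 ∨ i + 1 ≠ j + 1 := by simpa using hk
    have hd := h.pos hγ hk
    have hd' := h.pos hγ hk'
    have h1 := h k i j hk
    have h2 := h k (i + 1) (j + 1) hk'
    rw [dw_succ] at h2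
    have hw := dw_pos i j
    have hw1 := one_le_dw i j
    have hm := minW_mul_abs_diff_le hα Λ i j
    rw [← dvs_succ_sub ω Λ k] at hm
    have h0 : dvs ω Λ k i j ≠ 0 := abs_pos.1 hd
    have h0' : dvs ω Λ k (i + 1) (j + 1) ≠ 0 := abs_pos.1 hd'
    rw [mult_of_ne hk, mult_of_ne hk', ← Complex.ofReal_sub, Complex.norm_real, Real.norm_eq_abs]
    set d := dvs ω Λ k i j
    set d' := dvs ω Λ k (i + 1) (j + 1)
    set c := γ * Real.exp (-(δ * kn k))
    have heq : -1 / (2 * d') - -1 / (2 * d) = (d' - d) / (2 * (d * d')) := by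
      field_simp; ring
    rw [heq, abs_div, abs_mul, abs_two, abs_mul, mul_div_assoc', inv_eq_one_div,
      div_le_div_iff₀ (by positivity) (by positivity)]
    have hdd : (c * dw i j) * (c * dw i j) ≤ |d| * |d'| := mul_le_mul h1 h2 (by positivity) hd.le
    calc minW α i j * dw i j * |d' - d| * c ^ 2
        = (minW α i j * |d' - d|) * (c ^ 2 * dw i j) := by ring
      _ ≤ 2 * (c ^ 2 * dw i j) := by gcongr; linarith
      _ ≤ 2 * ((c * dw i j) * (c * dw i j)) := by
          have : c ^ 2 * dw i j * 1 ≤ c ^ 2 * dw i j * dw i j := by gcongr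
          nlinarith
      _ ≤ _ := by linarith
  · rw [not_or, not_not, not_not] at hk
    obtain ⟨rfl, rfl⟩ := hk
    rw [mult_zero_diag, mult_zero_diag, sub_zero, norm_zero, mul_zero]
    positivity

theorem exp_factor_le (hδ : 0 < δ) (hδ1 : δ ≤ 1) (hγ : 0 < γ) (hγ1 : γ ≤ 1) (k : Idx n) :
    ((γ * Real.exp (-(δ * kn k))) ^ 2)⁻¹ ≤ 1 / (δ * γ ^ 3) * Real.exp (4 * δ * kn k) := by
  have hk := kn_nonneg k
  rw [mul_pow, mul_inv, ← Real.exp_nat_mul, ← Real.exp_neg]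
  gcongr
  · rw [inv_eq_one_div]
    gcongr
    calc δ * γ ^ 3 = (δ * γ) * γ ^ 2 := by ring
      _ ≤ 1 * γ ^ 2 := by gcongr; exact mul_le_one₀ hδ1 hγ.le hγ1
      _ = _ := one_mul _
  · push_cast
    nlinarith

theorem mult_isMult (hα : 0 ≤ α) (hδ : 0 < δ) (hδ1 : δ ≤ 1) (hγ : 0 < γ) (hγ1 : γ ≤ 1)
    (hΛ : ‖Λ‖ ≤ 1) (h : NonRes γ δ ω Λ) (k : Idx n) :
    IsMult α (1 / (δ * γ ^ 3) * Real.exp (4 * δ * kn k)) (mult ω Λ k) where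
  bd i j := by
    refine (mult_bd hγ h k i j).trans (le_trans ?_ (exp_factor_le hδ hδ1 hγ hγ1 k))
    have hc : 0 < γ * Real.exp (-(δ * kn k)) := mul_pos hγ (Real.exp_pos _)
    have hc1 : γ * Real.exp (-(δ * kn k)) ≤ 1 := mul_le_one₀ hγ1 (Real.exp_pos _).le
      (Real.exp_le_one_iff.2 (by nlinarith [kn_nonneg k]))
    calc _ ≤ 1 * (γ * Real.exp (-(δ * kn k)))⁻¹ := by gcongr; norm_num
      _ ≤ _ := by
        rw [one_mul]
        gcongr
        nlinarith
  diff i j := (mult_diff hα hγ hΛ h k i j).trans (exp_factor_le hδ hδ1 hγ hγ1 k)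

/-- The resolvent-type identity m - m' = 2(d - d') m m' reduces everything to the bounds for m and
m'. The change d - d' is at most (|k| + 2)r, and its own shift difference is O(r (i ∧ j)^{-α}) by
`dvs_succ_sub`. -/
theorem mult_sub_isMult (hα : 0 ≤ α) (hδ : 0 < δ) (hδ1 : δ ≤ 1) (hγ : 0 < γ) (hγ1 : γ ≤ 1)
    (hΛ : ‖Λ‖ ≤ 1) (hΛ' : ‖Λ'‖ ≤ 1) (h : NonRes γ δ ω Λ) (h' : NonRes γ δ ω' Λ') {r : ℝ}
    (hr : ‖ω - ω'‖ ≤ r) (hΛr : ‖Λ - Λ'‖ ≤ r) (k : Idx n) :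
    IsMult α (1 / (δ * γ ^ 3) * Real.exp (4 * δ * kn k) * (5 * r))
      fun i j => mult ω Λ k i j - mult ω' Λ' k i j := by
  have hk0 := kn_nonneg k
  have hr0 : 0 ≤ r := (norm_nonneg _).trans hr
  set c := γ * Real.exp (-(δ * kn k)) with hcdef
  have hc : 0 < c := mul_pos hγ (Real.exp_pos _)
  have hc1 : c ≤ 1 := mul_le_one₀ hγ1 (Real.exp_pos _).le
    (Real.exp_le_one_iff.2 (by nlinarith [kn_nonneg k]))
  -- This worst case fixes the form of the constant: three inverse divisors give γ^{-3} e^{3δ|k|},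
  -- and the factor 1 + |k| coming from the change of frequency costs e^{δ|k|}/δ.
  have hfac : (1 + kn k) * (c ^ 3)⁻¹ ≤ 1 / (δ * γ ^ 3) * Real.exp (4 * δ * kn k) := by
    rw [hcdef, mul_pow, mul_inv, ← Real.exp_nat_mul, ← Real.exp_neg]
    have h1 : 1 + kn k ≤ 1 / δ * Real.exp (δ * kn k) := by
      rw [one_div_mul_eq_div, le_div_iff₀ hδ]
      nlinarith [Real.add_one_le_exp (δ * kn k)]
    calc _ ≤ (1 / δ * Real.exp (δ * kn k)) *
          ((γ ^ 3)⁻¹ * Real.exp (-((3 : ℕ) * -(δ * kn k)))) := by gcongr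
      _ = (1 / δ * (γ ^ 3)⁻¹) * (Real.exp (δ * kn k) *
          Real.exp (-((3 : ℕ) * -(δ * kn k)))) := by ring
      _ = _ := by
        rw [← Real.exp_add]
        congr 1
        · field_simp
        · congr 1; push_cast; ring
  set e : ℕ → ℕ → ℝ := fun i j => dvs ω Λ k i j - dvs ω' Λ' k i j with he
  have hent : ∀ i, |(entry Λ.op i i).re - (entry Λ'.op i i).re| ≤ r := fun i => by
    rw [← Complex.sub_re, ← entry_sub, ← map_sub]
    exact (Complex.abs_re_le_norm _).trans ((Mhat.norm_entry_le _ i i).trans hΛr)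
  have heb : ∀ i j, |e i j| ≤ (kn k + 2) * r := fun i j => by
    have h1 : e i j = freq k (ω - ω') + ((entry Λ.op i i).re - (entry Λ'.op i i).re)
        - ((entry Λ.op j j).re - (entry Λ'.op j j).re) := by
      rw [← freq_sub, he]; simp only [dvs, lamOf]; ring
    have h2 : |freq k (ω - ω')| ≤ kn k * r := (abs_freq_le _ _).trans (by gcongr)
    rw [h1]
    refine (abs_sub _ _).trans ?_
    have := abs_add_le (freq k (ω - ω')) ((entry Λ.op i i).re - (entry Λ'.op i i).re)
    linarith [hent i, hent j]
  have hed : ∀ i j, minW α i j * |e (i + 1) (j + 1) - e i j| ≤ 2 * r := fun i j => by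
    have h1 : e (i + 1) (j + 1) - e i j = (diffEntry (Λ - Λ').op i i).re
        - (diffEntry (Λ - Λ').op j j).re := by
      have a := dvs_succ_sub ω Λ k i j
      have b := dvs_succ_sub ω' Λ' k i j
      have hd : ∀ l, (diffEntry (Λ - Λ').op l l).re =
          (diffEntry Λ.op l l).re - (diffEntry Λ'.op l l).re := fun l => by
        simp only [diffEntry, map_sub, entry_sub, Complex.sub_re]; ring
      rw [hd, hd, he]; simp only; linarith
    rw [h1]
    exact (minW_mul_abs_diff_le hα _ i j).trans (by gcongr)
  have hprod : ∀ i j, mult ω Λ k i j - mult ω' Λ' k i j =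
      2 * (e i j : ℂ) * (mult ω Λ k i j * mult ω' Λ' k i j) := fun i j => by
    by_cases hk : k ≠ 0 ∨ i ≠ j
    · have h0 : dvs ω Λ k i j ≠ 0 := abs_pos.1 (h.pos hγ hk)
      have h0' : dvs ω' Λ' k i j ≠ 0 := abs_pos.1 (h'.pos hγ hk)
      rw [mult_of_ne hk, mult_of_ne hk, he]
      norm_cast
      field_simp
      push_cast
      ring
    · rw [not_or, not_not, not_not] at hk
      obtain ⟨rfl, rfl⟩ := hk
      simp [mult_zero_diag]
  have hm := mult_bd hγ h k
  have hm' := mult_bd hγ h' k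
  have hb1 : ∀ i j, ‖mult ω Λ k i j‖ ≤ 1 / 2 * c⁻¹ := fun i j =>
    (le_mul_of_one_le_left (norm_nonneg _) (one_le_dw i j)).trans (hm i j)
  have hb1' : ∀ i j, ‖mult ω' Λ' k i j‖ ≤ 1 / 2 * c⁻¹ := fun i j =>
    (le_mul_of_one_le_left (norm_nonneg _) (one_le_dw i j)).trans (hm' i j)
  have hci : c⁻¹ ^ 2 ≤ (c ^ 3)⁻¹ := by
    rw [← inv_pow]
    exact pow_le_pow_right₀ ((one_le_inv₀ hc).2 hc1) (by norm_num)
  have hci0 : 0 < c⁻¹ := inv_pos.2 hc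
  constructor
  · intro i j
    rw [hprod, norm_mul, norm_mul, norm_mul, Complex.norm_ofNat, Complex.norm_real,
      Real.norm_eq_abs]
    calc dw i j * (2 * |e i j| * (‖mult ω Λ k i j‖ * ‖mult ω' Λ' k i j‖))
        = 2 * |e i j| * ((dw i j * ‖mult ω Λ k i j‖) * ‖mult ω' Λ' k i j‖) := by ring
      _ ≤ 2 * ((kn k + 2) * r) * ((1 / 2 * c⁻¹) * (1 / 2 * c⁻¹)) := by
          exact mul_le_mul (mul_le_mul_of_nonneg_left (heb i j) zero_le_two)
            (mul_le_mul (hm i j) (hb1' i j) (norm_nonneg _) (by positivity))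
            (mul_nonneg (mul_nonneg (dw_pos i j).le (norm_nonneg _)) (norm_nonneg _))
            (by positivity)
      _ = (kn k + 2) * r / 2 * c⁻¹ ^ 2 := by ring
      _ ≤ ((1 + kn k) * (5 * r)) * (c ^ 3)⁻¹ := by
          gcongr
          nlinarith [mul_nonneg hk0 hr0]
      _ = ((1 + kn k) * (c ^ 3)⁻¹) * (5 * r) := by ring
      _ ≤ _ := by gcongr
  · intro i j
    have hd := mult_diff hα hγ hΛ h k i j
    have hd' := mult_diff hα hγ hΛ' h' k i j
    have hW := minW_pos α i j
    have hw := dw_pos i j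
    simp only [hprod]
    set m := mult ω Λ k i j
    set m' := mult ω' Λ' k i j
    set p := mult ω Λ k (i + 1) (j + 1)
    set p' := mult ω' Λ' k (i + 1) (j + 1)
    have hp : dw i j * ‖p‖ ≤ 1 / 2 * c⁻¹ := by
      have := hm (i + 1) (j + 1); rwa [dw_succ] at this
    have heq : 2 * (e (i + 1) (j + 1) : ℂ) * (p * p') - 2 * (e i j : ℂ) * (m * m') =
        2 * ((e (i + 1) (j + 1) - e i j : ℝ) : ℂ) * (p * p') +
          (2 * (e i j : ℂ) * ((p - m) * p') + 2 * (e i j : ℂ) * (m * (p' - m'))) := by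
      push_cast; ring
    rw [heq]
    have t1 : minW α i j * dw i j * ‖2 * ((e (i + 1) (j + 1) - e i j : ℝ) : ℂ) * (p * p')‖ ≤
        r * c⁻¹ ^ 2 := by
      rw [norm_mul, norm_mul, norm_mul, Complex.norm_ofNat, Complex.norm_real, Real.norm_eq_abs]
      calc _ = 2 * (minW α i j * |e (i + 1) (j + 1) - e i j|) * ((dw i j * ‖p‖) * ‖p'‖) := by ring
        _ ≤ 2 * (2 * r) * ((1 / 2 * c⁻¹) * (1 / 2 * c⁻¹)) := by
          exact mul_le_mul (mul_le_mul_of_nonneg_left (hed i j) zero_le_two)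
            (mul_le_mul hp (hb1' _ _) (norm_nonneg _) (by positivity))
            (mul_nonneg (mul_nonneg (dw_pos i j).le (norm_nonneg _)) (norm_nonneg _))
            (by positivity)
        _ = _ := by ring
    have t2 : minW α i j * dw i j * ‖2 * (e i j : ℂ) * ((p - m) * p')‖ ≤
        (kn k + 2) * r * (c ^ 3)⁻¹ := by
      rw [norm_mul, norm_mul, norm_mul, Complex.norm_ofNat, Complex.norm_real, Real.norm_eq_abs]
      calc _ = 2 * |e i j| * ((minW α i j * dw i j * ‖p - m‖) * ‖p'‖) := by ring
        _ ≤ 2 * ((kn k + 2) * r) * ((c ^ 2)⁻¹ * (1 / 2 * c⁻¹)) := by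
          gcongr
          · exact heb i j
          · exact hb1' _ _
        _ = _ := by rw [pow_succ c 2, mul_inv]; ring
    have t3 : minW α i j * dw i j * ‖2 * (e i j : ℂ) * (m * (p' - m'))‖ ≤
        (kn k + 2) * r * (c ^ 3)⁻¹ := by
      rw [norm_mul, norm_mul, norm_mul, Complex.norm_ofNat, Complex.norm_real, Real.norm_eq_abs]
      calc _ = 2 * |e i j| * ((minW α i j * dw i j * ‖p' - m'‖) * ‖m‖) := by ring
        _ ≤ 2 * ((kn k + 2) * r) * ((c ^ 2)⁻¹ * (1 / 2 * c⁻¹)) := by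
          gcongr
          · exact heb i j
          · exact hb1 _ _
        _ = _ := by rw [pow_succ c 2, mul_inv]; ring
    calc _ ≤ minW α i j * dw i j * (‖2 * ((e (i + 1) (j + 1) - e i j : ℝ) : ℂ) * (p * p')‖ +
          (‖2 * (e i j : ℂ) * ((p - m) * p')‖ + ‖2 * (e i j : ℂ) * (m * (p' - m'))‖)) := by
          gcongr
          exact (norm_add_le _ _).trans (by gcongr; exact norm_add_le _ _)
      _ ≤ r * c⁻¹ ^ 2 + ((kn k + 2) * r * (c ^ 3)⁻¹ + (kn k + 2) * r * (c ^ 3)⁻¹) := by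
          rw [mul_add, mul_add]; linarith
      _ ≤ r * (c ^ 3)⁻¹ + ((kn k + 2) * r * (c ^ 3)⁻¹ + (kn k + 2) * r * (c ^ 3)⁻¹) := by
          gcongr
      _ = ((5 + 2 * kn k) * r) * (c ^ 3)⁻¹ := by ring
      _ ≤ ((1 + kn k) * (5 * r)) * (c ^ 3)⁻¹ := by
          exact mul_le_mul_of_nonneg_right (by nlinarith [mul_nonneg hk0 hr0]) (by positivity)
      _ = ((1 + kn k) * (c ^ 3)⁻¹) * (5 * r) := by ring
      _ ≤ _ := by gcongr

end bounds

end divisors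

/-! ### Multiplication operators on `M_α̂` -/

/-- Left and right multiplication by `F` act on `M_α̂` with norm at most `c`. -/
def MulBd (α : ℝ) (F : Op) (c : ℝ) : Prop :=
  (∃ L : Mhat α →L[ℂ] Mhat α, (∀ W, (L W).op = F * W.op) ∧ ‖L‖ ≤ c) ∧
    ∃ R : Mhat α →L[ℂ] Mhat α, (∀ W, (R W).op = W.op * F) ∧ ‖R‖ ≤ c

open Classical in
/-- Left multiplication by `F` on `M_α̂` (`0` if it is not bounded). -/
def lmul (α : ℝ) (F : Op) : Mhat α →L[ℂ] Mhat α :=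
  if h : ∃ L : Mhat α →L[ℂ] Mhat α, ∀ W, (L W).op = F * W.op then h.choose else 0

open Classical in
/-- Right multiplication by `F` on `M_α̂` (`0` if it is not bounded). -/
def rmul (α : ℝ) (F : Op) : Mhat α →L[ℂ] Mhat α :=
  if h : ∃ R : Mhat α →L[ℂ] Mhat α, ∀ W, (R W).op = W.op * F then h.choose else 0

section MulBd

variable {α c d : ℝ} {F G : Op}

theorem op_clm_ext {L L' : Mhat α →L[ℂ] Mhat α} (h : ∀ W, (L W).op = (L' W).op) : L = L' :=
  ContinuousLinearMap.ext fun W => Mhat.op_injective (h W)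

theorem MulBd.op_lmul (h : MulBd α F c) (W : Mhat α) : (lmul α F W).op = F * W.op := by
  have h' : ∃ L : Mhat α →L[ℂ] Mhat α, ∀ W, (L W).op = F * W.op := ⟨_, h.1.choose_spec.1⟩
  rw [lmul, dif_pos h']
  exact h'.choose_spec W

theorem MulBd.op_rmul (h : MulBd α F c) (W : Mhat α) : (rmul α F W).op = W.op * F := by
  have h' : ∃ L : Mhat α →L[ℂ] Mhat α, ∀ W, (L W).op = W.op * F := ⟨_, h.2.choose_spec.1⟩
  rw [rmul, dif_pos h']
  exact h'.choose_spec W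

theorem MulBd.norm_lmul_le (h : MulBd α F c) : ‖lmul α F‖ ≤ c := by
  obtain ⟨L, hL, hn⟩ := h.1
  rwa [op_clm_ext fun W => (h.op_lmul W).trans (hL W).symm]

theorem MulBd.norm_rmul_le (h : MulBd α F c) : ‖rmul α F‖ ≤ c := by
  obtain ⟨L, hL, hn⟩ := h.2
  rwa [op_clm_ext fun W => (h.op_rmul W).trans (hL W).symm]

theorem MulBd.add (hF : MulBd α F c) (hG : MulBd α G d) : MulBd α (F + G) (c + d) := by
  obtain ⟨⟨L, hL, hLn⟩, R, hR, hRn⟩ := hF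
  obtain ⟨⟨L', hL', hLn'⟩, R', hR', hRn'⟩ := hG
  exact ⟨⟨L + L', fun W => by simp [hL, hL', add_mul], (norm_add_le _ _).trans (by gcongr)⟩,
    R + R', fun W => by simp [hR, hR', mul_add], (norm_add_le _ _).trans (by gcongr)⟩

theorem norm_lmul_sub_le {b : ℝ} (hF : MulBd α F c) (hG : MulBd α G d) (h : MulBd α (F - G) b) :
    ‖lmul α F - lmul α G‖ ≤ b := by
  obtain ⟨L, hL, hn⟩ := h.1
  rwa [show lmul α F - lmul α G = L from op_clm_ext fun W => by
    simp [hF.op_lmul, hG.op_lmul, hL, sub_mul]]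

theorem norm_rmul_sub_le {b : ℝ} (hF : MulBd α F c) (hG : MulBd α G d) (h : MulBd α (F - G) b) :
    ‖rmul α F - rmul α G‖ ≤ b := by
  obtain ⟨L, hL, hn⟩ := h.2
  rwa [show rmul α F - rmul α G = L from op_clm_ext fun W => by
    simp [hF.op_rmul, hG.op_rmul, hL, mul_sub]]

theorem MulBd.hadamard (hα : α ∈ Set.Ioc (0 : ℝ) 1) {μ : ℝ} {m : ℕ → ℕ → ℂ} (hm : IsMult α μ m)
    (Z : Mhat α) : MulBd α (hadamard m Z.op) (13 * (μ * ‖Z‖)) := by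
  have hK : 0 ≤ 13 * (μ * ‖Z‖) := mul_nonneg (by norm_num) (mul_nonneg hm.nonneg (norm_nonneg Z))
  constructor
  · exact exists_clm_lift hK Mhat.op Mhat.op_injective
      ((LinearMap.mulLeft ℂ (Reducibility.hadamard m Z.op)).comp Mhat.op)
      fun W => left_mul_bound hα hm Z W
  · exact exists_clm_lift hK Mhat.op Mhat.op_injective
      ((LinearMap.mulRight ℂ (Reducibility.hadamard m Z.op)).comp Mhat.op)
      fun W => right_mul_bound hα hm Z W

end MulBd

/-! ### The algebra of one step -/

section kamStep

variable {E : Type*} [NormedAddCommGroup E] [NormedSpace ℂ E] [CompleteSpace E]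

theorem inverse_one_sub_apply {R : E →L[ℂ] E} {g : ℝ} (hR : ‖R‖ ≤ g) (hg : g ≤ 1 / 2) (y : E) :
    Ring.inverse (1 - R) y - R (Ring.inverse (1 - R) y) = y := by
  have h := Ring.mul_inverse_cancel _ (isUnit_one_sub_of_norm_lt_one
    (show ‖R‖ < 1 by linarith))
  simpa using DFunLike.congr_fun h y

theorem norm_le_two_mul {R : E →L[ℂ] E} {g b : ℝ} (hR : ‖R‖ ≤ g) (hg : g ≤ 1 / 2) {x y : E}
    (h : x - R x = y) (hy : ‖y‖ ≤ b) : ‖x‖ ≤ 2 * b := by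
  have h1 : ‖R x‖ ≤ 1 / 2 * ‖x‖ := (R.le_of_opNorm_le (hR.trans hg) x)
  have h2 : ‖x‖ ≤ ‖y‖ + ‖R x‖ := by
    calc ‖x‖ = ‖y + R x‖ := by rw [← h]; congr 1; abel
      _ ≤ _ := norm_add_le _ _
  linarith

/-- The solution `X` of `(1 + L)(1 - R) X = (R - L)(Q + D) - L R (Q - D)`. -/
def kamStep (L R : E →L[ℂ] E) (Q D : E) : E :=
  Ring.inverse (1 - -L) (Ring.inverse (1 - R) ((R - L) (Q + D) - L (R (Q - D))))

variable {L R L' R' : E →L[ℂ] E} {Q D Q' D' : E} {g e h : ℝ}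

/-- The two inverses are taken among bounded operators on E, so E needs no multiplication of its
own. -/
theorem kamStep_spec (hL : ‖L‖ ≤ g) (hR : ‖R‖ ≤ g) (hg : g ≤ 1 / 2) :
    ∃ Z, Z - R Z = (R - L) (Q + D) - L (R (Q - D)) ∧ kamStep L R Q D + L (kamStep L R Q D) = Z := by
  refine ⟨_, inverse_one_sub_apply hR hg _, ?_⟩
  have := inverse_one_sub_apply (R := -L) (by rwa [norm_neg]) hg
    (Ring.inverse (1 - R) ((R - L) (Q + D) - L (R (Q - D))))
  rwa [_root_.neg_apply, sub_neg_eq_add] at this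

theorem norm_kamRhs_le (hL : ‖L‖ ≤ g) (hR : ‖R‖ ≤ g) (hg0 : 0 ≤ g) (hg : g ≤ 1 / 2)
    (hQ : ‖Q‖ ≤ e) (hD : ‖D‖ ≤ e) : ‖(R - L) (Q + D) - L (R (Q - D))‖ ≤ 5 * g * e := by
  have he : 0 ≤ e := (norm_nonneg _).trans hQ
  have h1 : ‖(R - L) (Q + D)‖ ≤ (g + g) * (e + e) :=
    (R - L).le_of_opNorm_le_of_le ((norm_sub_le _ _).trans (add_le_add hR hL))
      ((norm_add_le _ _).trans (add_le_add hQ hD))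
  have h2 : ‖L (R (Q - D))‖ ≤ g * (g * (e + e)) :=
    L.le_of_opNorm_le_of_le hL (R.le_of_opNorm_le_of_le hR
      ((norm_sub_le _ _).trans (add_le_add hQ hD)))
  have h3 : g * (g * (e + e)) ≤ 1 / 2 * (g * (e + e)) := by gcongr
  refine (norm_sub_le _ _).trans ?_
  nlinarith

/-- The right-hand side is at most 5ge, and each of the two inversions at most doubles it. -/
theorem norm_kamStep_le (hL : ‖L‖ ≤ g) (hR : ‖R‖ ≤ g) (hg0 : 0 ≤ g) (hg : g ≤ 1 / 2)
    (hQ : ‖Q‖ ≤ e) (hD : ‖D‖ ≤ e) : ‖kamStep L R Q D‖ ≤ 20 * g * e := by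
  obtain ⟨Z, h1, h2⟩ := kamStep_spec (Q := Q) (D := D) hL hR hg
  have hZ := norm_le_two_mul hR hg h1 (norm_kamRhs_le hL hR hg0 hg hQ hD)
  have := norm_le_two_mul (R := -L) (by rwa [norm_neg]) hg
    (by rw [_root_.neg_apply, sub_neg_eq_add]; exact h2) hZ
  linarith

/-- Subtract the defining equations of the two solutions and change one ingredient at a time. Using
g ≤ 1/2, the pieces `t1` to `t6` add up to 4 + 24 + 1 + 6 + 6 + 30 = 71 times geh; the rest is
rounding. -/
theorem norm_kamStep_sub_le (hL : ‖L‖ ≤ g) (hR : ‖R‖ ≤ g) (hL' : ‖L'‖ ≤ g) (hR' : ‖R'‖ ≤ g)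
    (hg0 : 0 ≤ g) (hg : g ≤ 1 / 2) (hQ : ‖Q‖ ≤ e) (hQ' : ‖Q'‖ ≤ e) (hD' : ‖D'‖ ≤ e)
    (hQd : ‖Q - Q'‖ ≤ e * h) (hDd : ‖D - D'‖ ≤ e * h) (hh : 0 ≤ h)
    (hLd : ‖L - L'‖ ≤ 6 * g * h) (hRd : ‖R - R'‖ ≤ 6 * g * h) :
    ‖kamStep L R Q D - kamStep L' R' Q' D'‖ ≤ 1000 * g * e * h := by
  have he : 0 ≤ e := (norm_nonneg _).trans hQ
  obtain ⟨Z, h1, h2⟩ := kamStep_spec (Q := Q) (D := D) hL hR hg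
  obtain ⟨Z', h1', h2'⟩ := kamStep_spec (Q := Q') (D := D') hL' hR' hg
  have hZ' := norm_le_two_mul hR' hg h1' (norm_kamRhs_le hL' hR' hg0 hg hQ' hD')
  have hX' := norm_kamStep_le hL' hR' hg0 hg hQ' hD'
  set x := kamStep L R Q D
  set x' := kamStep L' R' Q' D'
  have hA : ‖(Q + D) - (Q' + D')‖ ≤ e * h + e * h := by
    rw [add_sub_add_comm]; exact (norm_add_le _ _).trans (add_le_add hQd hDd)
  have hB : ‖(Q - D) - (Q' - D')‖ ≤ e * h + e * h := by
    rw [sub_sub_sub_comm]; exact (norm_sub_le _ _).trans (add_le_add hQd hDd)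
  have hA' : ‖Q' + D'‖ ≤ e + e := (norm_add_le _ _).trans (add_le_add hQ' hD')
  have hB' : ‖Q' - D'‖ ≤ e + e := (norm_sub_le _ _).trans (add_le_add hQ' hD')
  have geh : 0 ≤ g * e * h := by positivity
  have gg : g * (g * e * h) ≤ 1 / 2 * (g * e * h) := by gcongr
  have t1 : ‖(R - L) ((Q + D) - (Q' + D'))‖ ≤ (g + g) * (e * h + e * h) :=
    (R - L).le_of_opNorm_le_of_le ((norm_sub_le _ _).trans (add_le_add hR hL)) hA
  have t2 : ‖(R - R' - (L - L')) (Q' + D')‖ ≤ (6 * g * h + 6 * g * h) * (e + e) :=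
    (R - R' - (L - L')).le_of_opNorm_le_of_le ((norm_sub_le _ _).trans (add_le_add hRd hLd)) hA'
  have t3 : ‖L (R ((Q - D) - (Q' - D')))‖ ≤ g * (g * (e * h + e * h)) :=
    L.le_of_opNorm_le_of_le hL (R.le_of_opNorm_le_of_le hR hB)
  have t4 : ‖L ((R - R') (Q' - D'))‖ ≤ g * (6 * g * h * (e + e)) :=
    L.le_of_opNorm_le_of_le hL ((R - R').le_of_opNorm_le_of_le hRd hB')
  have t5 : ‖(L - L') (R' (Q' - D'))‖ ≤ 6 * g * h * (g * (e + e)) :=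
    (L - L').le_of_opNorm_le_of_le hLd (R'.le_of_opNorm_le_of_le hR' hB')
  have t6 : ‖(R - R') Z'‖ ≤ 6 * g * h * (2 * (5 * g * e)) :=
    (R - R').le_of_opNorm_le_of_le hRd hZ'
  have hZd : ‖Z - Z'‖ ≤ 2 * (71 * (g * e * h)) := by
    refine norm_le_two_mul hR hg (x := Z - Z')
      (y := (R - L) ((Q + D) - (Q' + D')) + (R - R' - (L - L')) (Q' + D')
        - (L (R ((Q - D) - (Q' - D'))) + L ((R - R') (Q' - D')) + (L - L') (R' (Q' - D')))
        + (R - R') Z') ?_ ?_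
    · have e1 : Z = R Z + ((R - L) (Q + D) - L (R (Q - D))) := by rw [← h1]; abel
      have e2 : Z' = R' Z' + ((R' - L') (Q' + D') - L' (R' (Q' - D'))) := by rw [← h1']; abel
      have e3 : Z - Z' - R (Z - Z') = (R - R') Z' + ((R - L) (Q + D) - L (R (Q - D)))
          - ((R' - L') (Q' + D') - L' (R' (Q' - D'))) := by
        rw [← h1, ← h1']
        simp only [map_sub, _root_.sub_apply]
        abel
      rw [e3]
      simp only [map_sub, map_add, _root_.sub_apply]
      abel
    · refine (norm_add_le _ _).trans ?_
      have := norm_sub_le ((R - L) ((Q + D) - (Q' + D')) + (R - R' - (L - L')) (Q' + D'))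
        (L (R ((Q - D) - (Q' - D'))) + L ((R - R') (Q' - D')) + (L - L') (R' (Q' - D')))
      have a1 := norm_add_le ((R - L) ((Q + D) - (Q' + D'))) ((R - R' - (L - L')) (Q' + D'))
      have a2 := norm_add_le (L (R ((Q - D) - (Q' - D'))) + L ((R - R') (Q' - D')))
        ((L - L') (R' (Q' - D')))
      have a3 := norm_add_le (L (R ((Q - D) - (Q' - D')))) (L ((R - R') (Q' - D')))
      nlinarith
  have t7 : ‖(L - L') x'‖ ≤ 6 * g * h * (20 * g * e) := (L - L').le_of_opNorm_le_of_le hLd hX'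
  have hfin := norm_le_two_mul (R := -L) (by rwa [norm_neg]) hg (x := x - x')
    (y := Z - Z' - (L - L') x') (b := 500 * (g * e * h)) (by
      rw [← h2, ← h2']
      simp only [map_sub, _root_.sub_apply, _root_.neg_apply]
      abel) (by
      refine (norm_sub_le _ _).trans ?_
      nlinarith)
  linarith

end kamStep

/-! ### One step of the iteration -/

section step

variable {n : ℕ} {α : ℝ}

/-- The Fourier coefficients of the solution of the homological equation. -/
def gen (ω : Fin n → ℝ) (Λ : Mhat α) (ρ : ℝ) (P : X n (Mhat α)) (k : Idx n) : Op :=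
  hadamard (mult ω Λ k) (coefX ρ k P).op

/-- The solution of the homological equation. -/
def genV (ω : Fin n → ℝ) (Λ : Mhat α) (ρ : ℝ) (P : X n (Mhat α)) (θ : Fin n → ℂ) : Op :=
  ∑' k, expf k θ • gen ω Λ ρ P k

/-- The diagonal part of the mean. -/
def meanDiag (P : X n (Mhat α)) : Mhat α := diagPart α (coefX 0 0 P)

/-- The perturbation after one step. -/
def newP (ω : Fin n → ℝ) (Λ : Mhat α) (ρ ρ' : ℝ) (P : X n (Mhat α)) : X n (Mhat α) :=
  kamStep (convX ρ' fun k => lmul α (gen ω Λ ρ P k)) (convX ρ' fun k => rmul α (gen ω Λ ρ P k))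
    (resX ρ ρ' P) (incl 0 (meanDiag P))

/-- The transformation after one step. -/
def newU (s : ℝ) (ω : Fin n → ℝ) (Λ : Mhat α) (ρ : ℝ) (P : X n (Mhat α)) (U : X n Op) : X n Op :=
  cayley (convX s fun k => (ContinuousLinearMap.mul ℂ Op).flip (gen ω Λ ρ P k)) U

/-- The inverse transformation after one step. -/
def newV (s : ℝ) (ω : Fin n → ℝ) (Λ : Mhat α) (ρ : ℝ) (P : X n (Mhat α)) (V : X n Op) : X n Op :=
  cayley (-convX s fun k => ContinuousLinearMap.mul ℂ Op (gen ω Λ ρ P k)) V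

/-- The smallness constant of one step. -/
def gcon (γ δ e : ℝ) : ℝ := 13 * (1 / (δ * γ ^ 3)) * e

/-- Admissible parameters of one step. -/
structure StepPar (γ δ ρ ρ' e : ℝ) : Prop where
  hγ : 0 < γ
  hγ1 : γ ≤ 1
  hδ : 0 < δ
  hδ1 : δ ≤ 1
  hρ' : 0 ≤ ρ'
  hρ : ρ' + 4 * δ ≤ ρ
  he : 0 ≤ e
  hg : gcon γ δ e ≤ 1 / 2

/-- Admissible data of one step. -/
structure StepAt (γ δ e : ℝ) (ω : Fin n → ℝ) (Λ : Mhat α) (P : X n (Mhat α)) : Prop where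
  hΛ : ‖Λ‖ ≤ 1
  nr : NonRes γ δ ω Λ
  hP : ‖P‖ ≤ e

variable {γ δ ρ ρ' e : ℝ} {ω ω' : Fin n → ℝ} {Λ Λ' : Mhat α} {P P' : X n (Mhat α)}

theorem StepPar.gcon_nonneg (h : StepPar γ δ ρ ρ' e) : 0 ≤ gcon γ δ e := by
  have := h.hγ; have := h.hδ; have := h.he
  unfold gcon; positivity

/-- The loss of width: the factor e^{4δ|k|} of the small divisors is swallowed because ρ' + 4δ ≤ ρ.
-/
theorem StepPar.exp_mul_le (h : StepPar γ δ ρ ρ' e) (k : Idx n) {c : ℝ} (hc : 0 ≤ c)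
    (Q : X n (Mhat α)) :
    Real.exp (ρ' * kn k) * (13 * (1 / (δ * γ ^ 3) * Real.exp (4 * δ * kn k) * c * ‖coefX ρ k Q‖)) ≤
      13 * (1 / (δ * γ ^ 3)) * c * ‖Q k‖ := by
  have := h.hγ; have := h.hδ
  rw [norm_coefX]
  have h1 : Real.exp (ρ' * kn k) * Real.exp (4 * δ * kn k) * Real.exp (-(ρ * kn k)) ≤ 1 := by
    rw [← Real.exp_add, ← Real.exp_add, Real.exp_le_one_iff]
    nlinarith [mul_nonneg (sub_nonneg.2 h.hρ) (kn_nonneg k)]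
  calc _ = (Real.exp (ρ' * kn k) * Real.exp (4 * δ * kn k) * Real.exp (-(ρ * kn k))) *
        (13 * (1 / (δ * γ ^ 3)) * c * ‖Q k‖) := by ring
    _ ≤ 1 * (13 * (1 / (δ * γ ^ 3)) * c * ‖Q k‖) := by gcongr
    _ = _ := one_mul _

theorem mulBd_gen (hα : α ∈ Set.Ioc (0 : ℝ) 1) (h : StepPar γ δ ρ ρ' e)
    (hs : StepAt γ δ e ω Λ P) (k : Idx n) : MulBd α (gen ω Λ ρ P k)
      (13 * (1 / (δ * γ ^ 3) * Real.exp (4 * δ * kn k) * 1 * ‖coefX ρ k P‖)) := by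
  rw [mul_one]
  exact MulBd.hadamard hα (mult_isMult hα.1.le h.hδ h.hδ1 h.hγ h.hγ1 hs.hΛ hs.nr k) _

theorem hasSum_gcon (a : X n (Mhat α)) :
    HasSum (fun k => 13 * (1 / (δ * γ ^ 3)) * 1 * ‖a k‖) (gcon γ δ ‖a‖) := by
  have := (hasSum_norm_X a).mul_left (13 * (1 / (δ * γ ^ 3)) * 1)
  rwa [mul_one] at this ⊢

theorem gcon_mono (h : StepPar γ δ ρ ρ' e) {a b : ℝ} (hab : a ≤ b) : gcon γ δ a ≤ gcon γ δ b := by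
  have := h.hγ; have := h.hδ
  unfold gcon; gcongr

theorem norm_lmul_gen_le (hα : α ∈ Set.Ioc (0 : ℝ) 1) (h : StepPar γ δ ρ ρ' e)
    (hs : StepAt γ δ e ω Λ P) (k : Idx n) :
    Real.exp (ρ' * kn k) * ‖lmul α (gen ω Λ ρ P k)‖ ≤ 13 * (1 / (δ * γ ^ 3)) * 1 * ‖P k‖ :=
  (mul_le_mul_of_nonneg_left (mulBd_gen hα h hs k).norm_lmul_le (Real.exp_pos _).le).trans
    (h.exp_mul_le k zero_le_one P)

theorem norm_rmul_gen_le (hα : α ∈ Set.Ioc (0 : ℝ) 1) (h : StepPar γ δ ρ ρ' e)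
    (hs : StepAt γ δ e ω Λ P) (k : Idx n) :
    Real.exp (ρ' * kn k) * ‖rmul α (gen ω Λ ρ P k)‖ ≤ 13 * (1 / (δ * γ ^ 3)) * 1 * ‖P k‖ :=
  (mul_le_mul_of_nonneg_left (mulBd_gen hα h hs k).norm_rmul_le (Real.exp_pos _).le).trans
    (h.exp_mul_le k zero_le_one P)

theorem norm_gen_le' (hα : α ∈ Set.Ioc (0 : ℝ) 1) (h : StepPar γ δ ρ ρ' e)
    (hs : StepAt γ δ e ω Λ P) (k : Idx n) :
    ‖gen ω Λ ρ P k‖ ≤ 13 * (1 / (δ * γ ^ 3) * Real.exp (4 * δ * kn k) * 1 * ‖coefX ρ k P‖) := by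
  have hm := mult_isMult hα.1.le h.hδ h.hδ1 h.hγ h.hγ1 hs.hΛ hs.nr k
  refine (norm_hadamard_le hm _).trans ?_
  rw [mul_one]
  have := mul_nonneg hm.nonneg (norm_nonneg (coefX ρ k P))
  linarith

theorem norm_gen_le (hα : α ∈ Set.Ioc (0 : ℝ) 1) (h : StepPar γ δ ρ ρ' e)
    (hs : StepAt γ δ e ω Λ P) (k : Idx n) :
    Real.exp (ρ' * kn k) * ‖gen ω Λ ρ P k‖ ≤ 13 * (1 / (δ * γ ^ 3)) * 1 * ‖P k‖ :=
  (mul_le_mul_of_nonneg_left (norm_gen_le' hα h hs k) (Real.exp_pos _).le).trans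
    (h.exp_mul_le k zero_le_one P)

theorem summable_gen (hα : α ∈ Set.Ioc (0 : ℝ) 1) (h : StepPar γ δ ρ ρ' e)
    (hs : StepAt γ δ e ω Λ P) : Summable fun k => Real.exp (ρ' * kn k) * ‖gen ω Λ ρ P k‖ :=
  Summable.of_nonneg_of_le (fun _ => by positivity) (norm_gen_le hα h hs) (hasSum_gcon P).summable

theorem summable_lmul_gen (hα : α ∈ Set.Ioc (0 : ℝ) 1) (h : StepPar γ δ ρ ρ' e)
    (hs : StepAt γ δ e ω Λ P) :
    Summable fun k => Real.exp (ρ' * kn k) * ‖lmul α (gen ω Λ ρ P k)‖ :=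
  Summable.of_nonneg_of_le (fun _ => by positivity) (norm_lmul_gen_le hα h hs)
    (hasSum_gcon P).summable

theorem summable_rmul_gen (hα : α ∈ Set.Ioc (0 : ℝ) 1) (h : StepPar γ δ ρ ρ' e)
    (hs : StepAt γ δ e ω Λ P) :
    Summable fun k => Real.exp (ρ' * kn k) * ‖rmul α (gen ω Λ ρ P k)‖ :=
  Summable.of_nonneg_of_le (fun _ => by positivity) (norm_rmul_gen_le hα h hs)
    (hasSum_gcon P).summable

theorem norm_convX_lmul_le (hα : α ∈ Set.Ioc (0 : ℝ) 1) (h : StepPar γ δ ρ ρ' e)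
    (hs : StepAt γ δ e ω Λ P) : ‖convX ρ' fun k => lmul α (gen ω Λ ρ P k)‖ ≤ gcon γ δ e :=
  (norm_convX_le h.hρ' (summable_lmul_gen hα h hs)).trans
    ((hasSum_le (norm_lmul_gen_le hα h hs) (summable_lmul_gen hα h hs).hasSum
      (hasSum_gcon P)).trans (gcon_mono h hs.hP))

theorem norm_convX_rmul_le (hα : α ∈ Set.Ioc (0 : ℝ) 1) (h : StepPar γ δ ρ ρ' e)
    (hs : StepAt γ δ e ω Λ P) : ‖convX ρ' fun k => rmul α (gen ω Λ ρ P k)‖ ≤ gcon γ δ e :=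
  (norm_convX_le h.hρ' (summable_rmul_gen hα h hs)).trans
    ((hasSum_le (norm_rmul_gen_le hα h hs) (summable_rmul_gen hα h hs).hasSum
      (hasSum_gcon P)).trans (gcon_mono h hs.hP))

theorem norm_meanDiag_le (P : X n (Mhat α)) : ‖meanDiag P‖ ≤ ‖P‖ := by
  have h1 : ‖diagPart α (coefX 0 0 P)‖ ≤ 1 * ‖coefX 0 0 P‖ :=
    (diagPart α).le_of_opNorm_le (norm_diagPart_le α) _
  rw [norm_coefX, one_mul, kn_zero, mul_zero, neg_zero, Real.exp_zero, one_mul] at h1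
  exact h1.trans (le_hasSum (hasSum_norm_X P) 0 fun _ _ => norm_nonneg _)

theorem meanDiag_sub (P P' : X n (Mhat α)) : meanDiag P - meanDiag P' = meanDiag (P - P') := by
  rw [meanDiag, meanDiag, meanDiag, coefX_sub, map_sub]

theorem norm_resX_apply_le (ρ ρ' : ℝ) (P : X n (Mhat α)) : ‖resX ρ ρ' P‖ ≤ ‖P‖ := by
  have h : ‖(resX ρ ρ' : X n (Mhat α) →L[ℂ] X n (Mhat α)) P‖ ≤ 1 * ‖P‖ :=
    ContinuousLinearMap.le_of_opNorm_le _ (norm_resX_le ρ ρ') P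
  rwa [one_mul] at h

theorem norm_newP_le (hα : α ∈ Set.Ioc (0 : ℝ) 1) (h : StepPar γ δ ρ ρ' e)
    (hs : StepAt γ δ e ω Λ P) : ‖newP ω Λ ρ ρ' P‖ ≤ 20 * gcon γ δ e * e :=
  norm_kamStep_le (norm_convX_lmul_le hα h hs) (norm_convX_rmul_le hα h hs) h.gcon_nonneg h.hg
    ((norm_resX_apply_le ρ ρ' P).trans hs.hP)
    (by rw [norm_incl_apply]; exact (norm_meanDiag_le P).trans hs.hP)

/-! ### Lipschitz dependence on the frequency -/

/-- Split as the old multiplier on P - P' plus the change of the multiplier on P'; both are Schur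
products with multipliers of the admissible kind. -/
theorem gen_sub (hα : α ∈ Set.Ioc (0 : ℝ) 1) (h : StepPar γ δ ρ ρ' e)
    (hs : StepAt γ δ e ω Λ P) (hs' : StepAt γ δ e ω' Λ' P') {r : ℝ} (hr : ‖ω - ω'‖ ≤ r)
    (hΛr : ‖Λ - Λ'‖ ≤ r) (k : Idx n) :
    MulBd α (gen ω Λ ρ P k - gen ω' Λ' ρ P' k)
      (13 * (1 / (δ * γ ^ 3) * Real.exp (4 * δ * kn k) * 1 * ‖coefX ρ k (P - P')‖) +
       13 * (1 / (δ * γ ^ 3) * Real.exp (4 * δ * kn k) * (5 * r) * ‖coefX ρ k P'‖)) := by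
  have hm := mult_isMult hα.1.le h.hδ h.hδ1 h.hγ h.hγ1 hs.hΛ hs.nr k
  have hm' := mult_isMult hα.1.le h.hδ h.hδ1 h.hγ h.hγ1 hs'.hΛ hs'.nr k
  have hd := mult_sub_isMult hα.1.le h.hδ h.hδ1 h.hγ h.hγ1 hs.hΛ hs'.hΛ hs.nr hs'.nr hr hΛr k
  have heq : gen ω Λ ρ P k - gen ω' Λ' ρ P' k = hadamard (mult ω Λ k) (coefX ρ k (P - P')).op +
      hadamard (fun i j => mult ω Λ k i j - mult ω' Λ' k i j) (coefX ρ k P').op := by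
    refine op_ext fun i j => ?_
    rw [entry_sub, entry_add, gen, gen, entry_hadamard hm, entry_hadamard hm', entry_hadamard hm,
      entry_hadamard hd, coefX_sub, map_sub, entry_sub]
    ring
  rw [heq, mul_one]
  exact (MulBd.hadamard hα hm _).add (MulBd.hadamard hα hd _)

theorem gen_sub_weight (h : StepPar γ δ ρ ρ' e) {r : ℝ} (hr0 : 0 ≤ r) (k : Idx n) :
    Real.exp (ρ' * kn k) *
      (13 * (1 / (δ * γ ^ 3) * Real.exp (4 * δ * kn k) * 1 * ‖coefX ρ k (P - P')‖) +
       13 * (1 / (δ * γ ^ 3) * Real.exp (4 * δ * kn k) * (5 * r) * ‖coefX ρ k P'‖)) ≤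
      13 * (1 / (δ * γ ^ 3)) * 1 * ‖(P - P') k‖ + 5 * r * (13 * (1 / (δ * γ ^ 3)) * 1 * ‖P' k‖) := by
  rw [mul_add]
  refine (add_le_add (h.exp_mul_le k zero_le_one _)
    (h.exp_mul_le k (mul_nonneg (by norm_num) hr0) _)).trans (le_of_eq ?_)
  ring

theorem hasSum_gen_sub_weight (r : ℝ) :
    HasSum (fun k => 13 * (1 / (δ * γ ^ 3)) * 1 * ‖(P - P') k‖ +
      5 * r * (13 * (1 / (δ * γ ^ 3)) * 1 * ‖P' k‖))
      (gcon γ δ ‖P - P'‖ + 5 * r * gcon γ δ ‖P'‖) :=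
  (hasSum_gcon (P - P')).add ((hasSum_gcon P').mul_left _)

theorem norm_convX_sub_le (hα : α ∈ Set.Ioc (0 : ℝ) 1) (h : StepPar γ δ ρ ρ' e)
    (hs : StepAt γ δ e ω Λ P) (hs' : StepAt γ δ e ω' Λ' P') {r : ℝ} (hr : ‖ω - ω'‖ ≤ r)
    (hΛr : ‖Λ - Λ'‖ ≤ r) (hPr : ‖P - P'‖ ≤ e * r) :
    ‖(convX ρ' fun k => lmul α (gen ω Λ ρ P k)) - convX ρ' fun k => lmul α (gen ω' Λ' ρ P' k)‖ ≤
        6 * gcon γ δ e * r ∧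
      ‖(convX ρ' fun k => rmul α (gen ω Λ ρ P k)) - convX ρ' fun k => rmul α (gen ω' Λ' ρ P' k)‖ ≤
        6 * gcon γ δ e * r := by
  have hr0 : 0 ≤ r := (norm_nonneg _).trans hr
  -- The factor 6 is 1 from the change of the perturbation and 5 from the change of the multiplier.
  have hfin : gcon γ δ ‖P - P'‖ + 5 * r * gcon γ δ ‖P'‖ ≤ 6 * gcon γ δ e * r := by
    calc _ ≤ gcon γ δ (e * r) + 5 * r * gcon γ δ e := by
          gcongr
          · exact gcon_mono h hPr
          · exact gcon_mono h hs'.hP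
      _ = _ := by unfold gcon; ring
  have hL : ∀ k, Real.exp (ρ' * kn k) * ‖lmul α (gen ω Λ ρ P k) - lmul α (gen ω' Λ' ρ P' k)‖ ≤ _ :=
    fun k => (mul_le_mul_of_nonneg_left (norm_lmul_sub_le (mulBd_gen hα h hs k)
      (mulBd_gen hα h hs' k) (gen_sub hα h hs hs' hr hΛr k)) (Real.exp_pos _).le).trans
      (gen_sub_weight h hr0 k)
  have hR : ∀ k, Real.exp (ρ' * kn k) * ‖rmul α (gen ω Λ ρ P k) - rmul α (gen ω' Λ' ρ P' k)‖ ≤ _ :=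
    fun k => (mul_le_mul_of_nonneg_left (norm_rmul_sub_le (mulBd_gen hα h hs k)
      (mulBd_gen hα h hs' k) (gen_sub hα h hs hs' hr hΛr k)) (Real.exp_pos _).le).trans
      (gen_sub_weight h hr0 k)
  have hW := hasSum_gen_sub_weight (γ := γ) (δ := δ) (P := P) (P' := P') r
  have hLs := Summable.of_nonneg_of_le (fun _ => by positivity) hL hW.summable
  have hRs := Summable.of_nonneg_of_le (fun _ => by positivity) hR hW.summable
  constructor
  · rw [convX_sub h.hρ' (summable_lmul_gen hα h hs) (summable_lmul_gen hα h hs') hLs]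
    exact (norm_convX_le h.hρ' hLs).trans ((hasSum_le hL hLs.hasSum hW).trans hfin)
  · rw [convX_sub h.hρ' (summable_rmul_gen hα h hs) (summable_rmul_gen hα h hs') hRs]
    exact (norm_convX_le h.hρ' hRs).trans ((hasSum_le hR hRs.hasSum hW).trans hfin)

theorem norm_newP_sub_le (hα : α ∈ Set.Ioc (0 : ℝ) 1) (h : StepPar γ δ ρ ρ' e)
    (hs : StepAt γ δ e ω Λ P) (hs' : StepAt γ δ e ω' Λ' P') {r : ℝ} (hr : ‖ω - ω'‖ ≤ r)
    (hΛr : ‖Λ - Λ'‖ ≤ r) (hPr : ‖P - P'‖ ≤ e * r) :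
    ‖newP ω Λ ρ ρ' P - newP ω' Λ' ρ ρ' P'‖ ≤ 1000 * gcon γ δ e * e * r := by
  obtain ⟨hLd, hRd⟩ := norm_convX_sub_le hα h hs hs' hr hΛr hPr
  refine norm_kamStep_sub_le (norm_convX_lmul_le hα h hs) (norm_convX_rmul_le hα h hs)
    (norm_convX_lmul_le hα h hs') (norm_convX_rmul_le hα h hs') h.gcon_nonneg h.hg
    ((norm_resX_apply_le ρ ρ' P).trans hs.hP)
    ((norm_resX_apply_le ρ ρ' P').trans hs'.hP)
    (by rw [norm_incl_apply]; exact (norm_meanDiag_le P').trans hs'.hP)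
    ?_ ?_ ((norm_nonneg _).trans hr) hLd hRd
  · rw [← map_sub]; exact (norm_resX_apply_le ρ ρ' _).trans hPr
  · rw [← map_sub, norm_incl_apply, meanDiag_sub]; exact (norm_meanDiag_le _).trans hPr

end step

/-! ### The step evaluated at an angle: generator, new perturbation and transformations as
operators. -/

section stepEval

variable {n : ℕ} {α : ℝ} {γ δ ρ ρ' e s : ℝ} {ω : Fin n → ℝ} {Λ : Mhat α} {P : X n (Mhat α)}
  {θ : Fin n → ℂ}

theorem hasSum_genV (hα : α ∈ Set.Ioc (0 : ℝ) 1) (h : StepPar γ δ ρ ρ' e)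
    (hs : StepAt γ δ e ω Λ P) (hθ : θ ∈ cstrip n ρ') :
    HasSum (fun k => expf k θ • gen ω Λ ρ P k) (genV ω Λ ρ P θ) :=
  (Summable.of_norm_bounded (summable_gen hα h hs) fun k => by
    rw [norm_smul]; gcongr; exact norm_expf_le hθ k).hasSum

theorem norm_genV_le (hα : α ∈ Set.Ioc (0 : ℝ) 1) (h : StepPar γ δ ρ ρ' e)
    (hs : StepAt γ δ e ω Λ P) (hθ : θ ∈ cstrip n ρ') : ‖genV ω Λ ρ P θ‖ ≤ gcon γ δ e := by
  refine ((hasSum_genV hα h hs hθ).norm_le_of_bounded (hasSum_gcon P) fun k => ?_).trans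
    (gcon_mono h hs.hP)
  rw [norm_smul]
  exact (mul_le_mul_of_nonneg_right (norm_expf_le hθ k) (norm_nonneg _)).trans
    (norm_gen_le hα h hs k)

theorem wBd_genV (hα : α ∈ Set.Ioc (0 : ℝ) 1) (h : StepPar γ δ ρ ρ' e)
    (hs : StepAt γ δ e ω Λ P) (hθ : θ ∈ cstrip n ρ') {p : ℝ} (hp : p ∈ Set.Icc (0 : ℝ) 2) :
    WBd p (genV ω Λ ρ P θ) (gcon γ δ e) := by
  have hle : ∀ k, Real.exp (ρ' * kn k) *
      (13 * (1 / (δ * γ ^ 3) * Real.exp (4 * δ * kn k) * 1 * ‖coefX ρ k P‖)) ≤ _ :=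
    fun k => h.exp_mul_le k zero_le_one P
  have h0 : ∀ k, 0 ≤ Real.exp (ρ' * kn k) *
      (13 * (1 / (δ * γ ^ 3) * Real.exp (4 * δ * kn k) * 1 * ‖coefX ρ k P‖)) := fun k => by
    have := h.hγ; have := h.hδ; positivity
  have hsum := Summable.of_nonneg_of_le h0 hle (hasSum_gcon P).summable
  refine WBd.of_hasSum (fun k => ?_) h0 hsum ((hasSum_le hle hsum.hasSum (hasSum_gcon P)).trans
    (gcon_mono h hs.hP)) (hasSum_genV hα h hs hθ)
  have hm := mult_isMult hα.1.le h.hδ h.hδ1 h.hγ h.hγ1 hs.hΛ hs.nr k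
  refine ((WBd.hadamard hm (coefX ρ k P) hp).smul (expf k θ)).mono ?_
  have := mul_nonneg hm.nonneg (norm_nonneg (coefX ρ k P))
  rw [mul_one]
  refine mul_le_mul (norm_expf_le hθ k) ?_ (by positivity) (Real.exp_pos _).le
  linarith

theorem op_evX_lmul (hα : α ∈ Set.Ioc (0 : ℝ) 1) (h : StepPar γ δ ρ ρ' e)
    (hs : StepAt γ δ e ω Λ P) (hθ : θ ∈ cstrip n ρ') (a : X n (Mhat α)) :
    (evX ρ' θ (convX ρ' (fun k => lmul α (gen ω Λ ρ P k)) a)).op =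
      genV ω Λ ρ P θ * (evX ρ' θ a).op := by
  have hS := summable_lmul_gen hα h hs
  rw [evX_convX h.hρ' hS hθ]
  have h1 := (Mhat.opCLM.comp (ContinuousLinearMap.apply ℂ (Mhat α) (evX ρ' θ a))).hasSum
    (summable_expf_smul hS hθ).hasSum
  have h2 := (hasSum_genV hα h hs hθ).mul_right (evX ρ' θ a).op
  refine h1.unique (h2.congr_fun fun k => ?_)
  simp only [ContinuousLinearMap.comp_apply, ContinuousLinearMap.apply_apply,
    Mhat.opCLM_apply, map_smul, (mulBd_gen hα h hs k).op_lmul, smul_mul_assoc]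

theorem op_evX_rmul (hα : α ∈ Set.Ioc (0 : ℝ) 1) (h : StepPar γ δ ρ ρ' e)
    (hs : StepAt γ δ e ω Λ P) (hθ : θ ∈ cstrip n ρ') (a : X n (Mhat α)) :
    (evX ρ' θ (convX ρ' (fun k => rmul α (gen ω Λ ρ P k)) a)).op =
      (evX ρ' θ a).op * genV ω Λ ρ P θ := by
  have hS := summable_rmul_gen hα h hs
  rw [evX_convX h.hρ' hS hθ]
  have h1 := (Mhat.opCLM.comp (ContinuousLinearMap.apply ℂ (Mhat α) (evX ρ' θ a))).hasSum
    (summable_expf_smul hS hθ).hasSum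
  have h2 := (hasSum_genV hα h hs hθ).mul_left (evX ρ' θ a).op
  refine h1.unique (h2.congr_fun fun k => ?_)
  simp only [ContinuousLinearMap.comp_apply, ContinuousLinearMap.apply_apply,
    Mhat.opCLM_apply, map_smul, (mulBd_gen hα h hs k).op_rmul, mul_smul_comm]

theorem evX_incl_zero (ρ : ℝ) {E : Type*} [NormedAddCommGroup E] [NormedSpace ℂ E]
    [CompleteSpace E] (hθ : θ ∈ cstrip n ρ) (x : E) :
    evX ρ θ (incl (0 : Idx n) x) = x := by
  rw [evX_incl, evc_eq hθ]; simp

/-- Evaluation turns the convolutions into multiplications by G. The outcome is precisely what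
conjugation by the Cayley transform forces on the new perturbation, and every term on the right
contains both G and the old perturbation or its mean diagonal. -/
theorem newP_identity (hα : α ∈ Set.Ioc (0 : ℝ) 1) (h : StepPar γ δ ρ ρ' e)
    (hs : StepAt γ δ e ω Λ P) (hθ : θ ∈ cstrip n ρ') :
    (1 + genV ω Λ ρ P θ) * (evX ρ' θ (newP ω Λ ρ ρ' P)).op * (1 - genV ω Λ ρ P θ) =
      ((evX ρ θ P).op + (meanDiag P).op) * genV ω Λ ρ P θ -
        genV ω Λ ρ P θ * ((evX ρ θ P).op + (meanDiag P).op) -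
        genV ω Λ ρ P θ * ((evX ρ θ P).op - (meanDiag P).op) * genV ω Λ ρ P θ := by
  have hρρ : ρ' ≤ ρ := by have := h.hρ; have := h.hδ; linarith
  obtain ⟨Z, h1, h2⟩ := kamStep_spec (Q := resX ρ ρ' P) (D := incl 0 (meanDiag P))
    (norm_convX_lmul_le hα h hs) (norm_convX_rmul_le hα h hs) h.hg
  rw [← newP] at h2
  have e1 := congrArg (fun a => (evX ρ' θ a).op) h1
  have e2 := congrArg (fun a => (evX ρ' θ a).op) h2
  simp only [map_add, map_sub, op_evX_rmul hα h hs hθ, op_evX_lmul hα h hs hθ,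
    _root_.sub_apply, evX_resX hρρ hθ, evX_incl_zero ρ' hθ] at e1 e2
  set G := genV ω Λ ρ P θ
  set p := (evX ρ' θ (newP ω Λ ρ ρ' P)).op
  set q := (evX ρ θ P).op
  set d := (meanDiag P).op
  rw [← e2] at e1
  calc (1 + G) * p * (1 - G) = (p + G * p) - (p + G * p) * G := by noncomm_ring
    _ = _ := by rw [e1]; noncomm_ring

/-! ### The transformations -/

theorem norm_convX_flip_le (hα : α ∈ Set.Ioc (0 : ℝ) 1) (h : StepPar γ δ ρ ρ' e)
    (hs : StepAt γ δ e ω Λ P) (hs0 : 0 ≤ s) (hsρ : s ≤ ρ') :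
    (Summable fun k => Real.exp (s * kn k) *
      ‖(ContinuousLinearMap.mul ℂ Op).flip (gen ω Λ ρ P k)‖) ∧
    ‖convX s fun k => (ContinuousLinearMap.mul ℂ Op).flip (gen ω Λ ρ P k)‖ ≤ gcon γ δ e := by
  have hle : ∀ k, Real.exp (s * kn k) *
      ‖(ContinuousLinearMap.mul ℂ Op).flip (gen ω Λ ρ P k)‖ ≤
      13 * (1 / (δ * γ ^ 3)) * 1 * ‖P k‖ := fun k => by
    refine le_trans ?_ (norm_gen_le hα h hs k)
    have := kn_nonneg k
    gcongr
    exact ContinuousLinearMap.opNorm_le_bound _ (norm_nonneg _) fun x => by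
      rw [ContinuousLinearMap.flip_apply, ContinuousLinearMap.mul_apply', mul_comm ‖_‖]
      exact norm_mul_le _ _
  have hS := Summable.of_nonneg_of_le (fun _ => by positivity) hle (hasSum_gcon P).summable
  exact ⟨hS, (norm_convX_le hs0 hS).trans ((hasSum_le hle hS.hasSum (hasSum_gcon P)).trans
    (gcon_mono h hs.hP))⟩

theorem norm_convX_mul_le (hα : α ∈ Set.Ioc (0 : ℝ) 1) (h : StepPar γ δ ρ ρ' e)
    (hs : StepAt γ δ e ω Λ P) (hs0 : 0 ≤ s) (hsρ : s ≤ ρ') :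
    (Summable fun k => Real.exp (s * kn k) *
      ‖ContinuousLinearMap.mul ℂ Op (gen ω Λ ρ P k)‖) ∧
    ‖convX s fun k => ContinuousLinearMap.mul ℂ Op (gen ω Λ ρ P k)‖ ≤ gcon γ δ e := by
  have hle : ∀ k, Real.exp (s * kn k) *
      ‖ContinuousLinearMap.mul ℂ Op (gen ω Λ ρ P k)‖ ≤
      13 * (1 / (δ * γ ^ 3)) * 1 * ‖P k‖ := fun k => by
    refine le_trans ?_ (norm_gen_le hα h hs k)
    have := kn_nonneg k
    gcongr
    exact ContinuousLinearMap.opNorm_mul_apply_le _ _ _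
  have hS := Summable.of_nonneg_of_le (fun _ => by positivity) hle (hasSum_gcon P).summable
  exact ⟨hS, (norm_convX_le hs0 hS).trans ((hasSum_le hle hS.hasSum (hasSum_gcon P)).trans
    (gcon_mono h hs.hP))⟩

theorem evX_convX_flip (hα : α ∈ Set.Ioc (0 : ℝ) 1) (h : StepPar γ δ ρ ρ' e)
    (hs : StepAt γ δ e ω Λ P) (hs0 : 0 ≤ s) (hsρ : s ≤ ρ') (hθ : θ ∈ cstrip n s) (a : X n Op) :
    evX s θ (convX s (fun k => (ContinuousLinearMap.mul ℂ Op).flip (gen ω Λ ρ P k)) a) =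
      evX s θ a * genV ω Λ ρ P θ := by
  have hS := (norm_convX_flip_le hα h hs hs0 hsρ).1
  rw [evX_convX hs0 hS hθ]
  have h1 := (ContinuousLinearMap.apply ℂ Op (evX s θ a)).hasSum
    (summable_expf_smul hS hθ).hasSum
  have h2 := (hasSum_genV hα h hs (cstrip_mono hsρ hθ)).mul_left (evX s θ a)
  refine h1.unique (h2.congr_fun fun k => ?_)
  simp only [ContinuousLinearMap.apply_apply, _root_.smul_apply, mul_smul_comm,
    ContinuousLinearMap.flip_apply, ContinuousLinearMap.mul_apply']

theorem evX_convX_mul (hα : α ∈ Set.Ioc (0 : ℝ) 1) (h : StepPar γ δ ρ ρ' e)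
    (hs : StepAt γ δ e ω Λ P) (hs0 : 0 ≤ s) (hsρ : s ≤ ρ') (hθ : θ ∈ cstrip n s) (a : X n Op) :
    evX s θ (convX s (fun k => ContinuousLinearMap.mul ℂ Op (gen ω Λ ρ P k)) a) =
      genV ω Λ ρ P θ * evX s θ a := by
  have hS := (norm_convX_mul_le hα h hs hs0 hsρ).1
  rw [evX_convX hs0 hS hθ]
  have h1 := (ContinuousLinearMap.apply ℂ Op (evX s θ a)).hasSum
    (summable_expf_smul hS hθ).hasSum
  have h2 := (hasSum_genV hα h hs (cstrip_mono hsρ hθ)).mul_right (evX s θ a)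
  refine h1.unique (h2.congr_fun fun k => ?_)
  simp only [ContinuousLinearMap.apply_apply, _root_.smul_apply, smul_mul_assoc,
    ContinuousLinearMap.mul_apply']

/-- An evaluation that intertwines T with multiplication by G also intertwines (1 - T)⁻¹ with (1 -
G)⁻¹, hence the Cayley transforms. -/
theorem evX_cayley {E : Type*} [NormedAddCommGroup E] [NormedSpace ℂ E] [CompleteSpace E]
    {T : E →L[ℂ] E} {g : ℝ} (hT : ‖T‖ ≤ g) (hg : g ≤ 1 / 2)
    {ev : E →L[ℂ] Op} {G : Op} (hG : ‖G‖ ≤ g) (U : E) :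
    ((∀ a, ev (T a) = ev a * G) → ev (cayley T U) = ev U * cayley G) ∧
    ((∀ a, ev (T a) = G * ev a) → ev (cayley T U) = cayley G * ev U) := by
  have hy := inverse_one_sub_apply hT hg U
  set y := Ring.inverse (1 - T) U with hyd
  have hc : cayley T U = y + y - U := by
    rw [cayley, two_mul]; rfl
  have hu := isUnit_one_sub_of_norm_lt_one (show ‖G‖ < 1 by linarith)
  rw [hc, map_sub, map_add]
  constructor
  · intro h
    have h1 : ev y * (1 - G) = ev U := by rw [← hy, map_sub, h, mul_sub, mul_one]
    have h2 : ev y = ev U * Ring.inverse (1 - G) := by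
      rw [← h1, mul_assoc, Ring.mul_inverse_cancel _ hu, mul_one]
    rw [h2, cayley, mul_sub, two_mul, mul_add, mul_one]
  · intro h
    have h1 : (1 - G) * ev y = ev U := by rw [← hy, map_sub, h, sub_mul, one_mul]
    have h2 : ev y = Ring.inverse (1 - G) * ev U := by
      rw [← h1, ← mul_assoc, Ring.inverse_mul_cancel _ hu, one_mul]
    rw [h2, cayley, sub_mul, two_mul, add_mul, one_mul]

theorem evX_newU (hα : α ∈ Set.Ioc (0 : ℝ) 1) (h : StepPar γ δ ρ ρ' e)
    (hs : StepAt γ δ e ω Λ P) (hs0 : 0 ≤ s) (hsρ : s ≤ ρ') (hθ : θ ∈ cstrip n s) (U : X n Op) :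
    evX s θ (newU s ω Λ ρ P U) = evX s θ U * cayley (genV ω Λ ρ P θ) :=
  (evX_cayley (norm_convX_flip_le hα h hs hs0 hsρ).2 h.hg
    (norm_genV_le hα h hs (cstrip_mono hsρ hθ)) U).1 (evX_convX_flip hα h hs hs0 hsρ hθ)

theorem evX_newV (hα : α ∈ Set.Ioc (0 : ℝ) 1) (h : StepPar γ δ ρ ρ' e)
    (hs : StepAt γ δ e ω Λ P) (hs0 : 0 ≤ s) (hsρ : s ≤ ρ') (hθ : θ ∈ cstrip n s) (V : X n Op) :
    evX s θ (newV s ω Λ ρ P V) = cayley (-genV ω Λ ρ P θ) * evX s θ V :=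
  (evX_cayley (by rw [norm_neg]; exact (norm_convX_mul_le hα h hs hs0 hsρ).2) h.hg
    (by rw [norm_neg]; exact norm_genV_le hα h hs (cstrip_mono hsρ hθ)) V).2 fun a => by
      rw [_root_.neg_apply, map_neg, evX_convX_mul hα h hs hs0 hsρ hθ, neg_mul]

theorem norm_cayley_apply_sub_le {E : Type*} [NormedAddCommGroup E] [NormedSpace ℂ E]
    [CompleteSpace E] {T : E →L[ℂ] E} {g : ℝ} (hT : ‖T‖ ≤ g) (hg : g ≤ 1 / 2) (U : E) :
    ‖cayley T U - U‖ ≤ 4 * g * ‖U‖ := by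
  have h1 : cayley T U - U = (cayley T - 1) U := rfl
  rw [h1]
  exact (cayley T - 1).le_of_opNorm_le ((norm_cayley_sub_one_le (hT.trans hg)).trans
    (by gcongr)) U

theorem norm_newU_sub_le (hα : α ∈ Set.Ioc (0 : ℝ) 1) (h : StepPar γ δ ρ ρ' e)
    (hs : StepAt γ δ e ω Λ P) (hs0 : 0 ≤ s) (hsρ : s ≤ ρ') (U : X n Op) :
    ‖newU s ω Λ ρ P U - U‖ ≤ 4 * gcon γ δ e * ‖U‖ :=
  norm_cayley_apply_sub_le (norm_convX_flip_le hα h hs hs0 hsρ).2 h.hg U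

theorem norm_newV_sub_le (hα : α ∈ Set.Ioc (0 : ℝ) 1) (h : StepPar γ δ ρ ρ' e)
    (hs : StepAt γ δ e ω Λ P) (hs0 : 0 ≤ s) (hsρ : s ≤ ρ') (V : X n Op) :
    ‖newV s ω Λ ρ P V - V‖ ≤ 4 * gcon γ δ e * ‖V‖ :=
  norm_cayley_apply_sub_le (by rw [norm_neg]; exact (norm_convX_mul_le hα h hs hs0 hsρ).2) h.hg V

/-! ### Self-adjointness at real angles -/

/-- The Fourier series with coefficients `a` is self-adjoint at real angles. -/
def IsHerm (ρ : ℝ) (a : X n (Mhat α)) : Prop :=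
  ∀ x : Fin n → ℝ, IsSelfAdjoint (evX ρ (toC x) a).op

/-- Conjugating the series of the (j, i) entry and reindexing k ↦ -k gives a second expansion of the
(i, j) entry; `fourier_unique` compares the two. -/
theorem star_coef_of_isSelfAdjoint {A : Idx n → Op} (hA : Summable fun k => ‖A k‖)
    (h : ∀ x : Fin n → ℝ, IsSelfAdjoint (∑' k, expf k (toC x) • A k)) (k : Idx n) :
    star (A k) = A (-k) := by
  refine op_ext fun i j => ?_
  rw [entry_star]
  set c : Idx n → ℂ := fun k => (starRingEnd ℂ) (entry (A (-k)) j i) - entry (A k) i j with hc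
  have hsum1 : Summable fun k : Idx n => ‖A (-k)‖ := (Equiv.neg (Idx n)).summable_iff.2 hA
  have hcs : Summable fun k => ‖c k‖ := by
    refine Summable.of_nonneg_of_le (fun _ => norm_nonneg _) (fun k => ?_) (hsum1.add hA)
    refine (norm_sub_le _ _).trans (add_le_add ?_ (norm_entry_le _ _ _))
    rw [RCLike.norm_conj]
    exact norm_entry_le _ _ _
  have hz := fourier_unique hcs fun x => by
    have hS : Summable fun k => expf k (toC x) • A k := Summable.of_norm_bounded hA fun k => by
      rw [norm_smul, norm_expf_toC, one_mul]
    have h1 : ∀ i j, HasSum (fun k => expf k (toC x) * entry (A k) i j)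
        (entry (∑' k, expf k (toC x) • A k) i j) := fun i j => by
      have := (entryCLM i j).hasSum hS.hasSum
      simp only [map_smul, smul_eq_mul] at this
      exact this
    have h2 := ((Equiv.neg (Idx n)).hasSum_iff.2 (h1 j i)).star
    have h4 := h2.sub (h1 i j)
    have h5 := congrArg (fun A => entry A i j) (h x).star_eq
    simp only [entry_star] at h5
    rw [← starRingEnd_apply, h5, sub_self] at h4
    rw [← h4.tsum_eq]
    refine tsum_congr fun k => ?_
    simp only [hc, Function.comp_apply, Equiv.neg_apply, star_mul']
    rw [sub_mul, ← starRingEnd_apply, ← starRingEnd_apply, conj_expf_toC, neg_neg]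
    ring
  have := congrFun hz (-k)
  simp only [hc, Pi.zero_apply, neg_neg] at this
  exact sub_eq_zero.1 this

theorem hasSum_op_evX (hρ : 0 ≤ ρ) (a : X n (Mhat α)) (x : Fin n → ℝ) :
    HasSum (fun k => expf k (toC x) • (coefX ρ k a).op) (evX ρ (toC x) a).op := by
  have := (Mhat.opCLM (α := α)).hasSum (hasSum_evX (toC_mem_cstrip hρ x) a)
  simp only [map_smul, Mhat.opCLM_apply] at this
  exact this

theorem norm_op_coefX_le (hρ : 0 ≤ ρ) (a : X n (Mhat α)) (k : Idx n) :
    ‖(coefX ρ k a).op‖ ≤ ‖a k‖ := by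
  refine (Mhat.norm_op_le _).trans ?_
  rw [norm_coefX]
  refine mul_le_of_le_one_left (norm_nonneg _) (Real.exp_le_one_iff.2 ?_)
  have := mul_nonneg hρ (kn_nonneg k)
  linarith

theorem IsHerm.star_coefX (hρ : 0 ≤ ρ) {a : X n (Mhat α)} (ha : IsHerm ρ a) (k : Idx n) :
    star (coefX ρ k a).op = (coefX ρ (-k) a).op :=
  star_coef_of_isSelfAdjoint (Summable.of_nonneg_of_le (fun _ => norm_nonneg _)
    (norm_op_coefX_le hρ a) (hasSum_norm_X a).summable)
    (fun x => by rw [(hasSum_op_evX hρ a x).tsum_eq]; exact ha x) k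

theorem freq_neg (k : Idx n) (ω : Fin n → ℝ) : freq (-k) ω = -freq k ω := by
  simp [freq, Finset.sum_neg_distrib]

/-- The divisors are real and odd under (k, i, j) ↦ (-k, j, i). Hence a self-adjoint perturbation
has an anti-self-adjoint generator. -/
theorem mult_neg (ω : Fin n → ℝ) (Λ : Mhat α) (k : Idx n) (i j : ℕ) :
    mult ω Λ (-k) j i = -(starRingEnd ℂ) (mult ω Λ k i j) := by
  have hd : dvs ω Λ (-k) j i = -dvs ω Λ k i j := by
    simp only [dvs, freq_neg]; ring
  unfold mult
  by_cases h : k = 0 ∧ i = j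
  · rw [if_pos h, if_pos (by simpa [eq_comm] using h)]; simp
  · rw [if_neg h, if_neg (by simpa [eq_comm] using h), Complex.conj_ofReal, hd]
    push_cast
    rw [mul_neg, div_neg]

theorem star_gen (hα : α ∈ Set.Ioc (0 : ℝ) 1) (h : StepPar γ δ ρ ρ' e)
    (hs : StepAt γ δ e ω Λ P) (hP : IsHerm ρ P) (k : Idx n) :
    star (gen ω Λ ρ P k) = -gen ω Λ ρ P (-k) := by
  have hρ0 : 0 ≤ ρ := by have := h.hρ; have := h.hρ'; have := h.hδ; linarith
  have hm := fun k => mult_isMult hα.1.le h.hδ h.hδ1 h.hγ h.hγ1 hs.hΛ hs.nr k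
  refine op_ext fun i j => ?_
  have hc := congrArg (fun A => entry A i j) (hP.star_coefX hρ0 k)
  simp only [entry_star] at hc
  rw [entry_star, entry_neg, gen, gen, entry_hadamard (hm _), entry_hadamard (hm _), map_mul, hc,
    mult_neg ω Λ k j i]
  ring

theorem star_genV (hα : α ∈ Set.Ioc (0 : ℝ) 1) (h : StepPar γ δ ρ ρ' e)
    (hs : StepAt γ δ e ω Λ P) (hP : IsHerm ρ P) (x : Fin n → ℝ) :
    star (genV ω Λ ρ P (toC x)) = -genV ω Λ ρ P (toC x) := by
  have h1 := hasSum_genV hα h hs (toC_mem_cstrip h.hρ' x)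
  have h2 := (Equiv.neg (Idx n)).hasSum_iff.2 h1.neg
  refine h1.star.unique (h2.congr_fun fun k => ?_)
  simp only [Function.comp_apply, Equiv.neg_apply, star_smul, star_gen hα h hs hP,
    ← starRingEnd_apply, conj_expf_toC, smul_neg]

theorem star_meanDiag (hρ : 0 ≤ ρ) (hP : IsHerm ρ P) :
    star (meanDiag P).op = (meanDiag P).op := by
  have h0 : coefX ρ 0 P = coefX 0 0 P := by simp [coefX]
  have h1 := hP.star_coefX hρ 0
  rw [neg_zero, h0] at h1
  refine op_ext fun i j => ?_
  have hc := congrArg (fun A => entry A i j) h1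
  simp only [entry_star] at hc
  rw [entry_star, meanDiag, entry_diagPart, entry_diagPart]
  by_cases hij : i = j
  · simp [hij] at hc ⊢; exact hc
  · simp [hij, Ne.symm hij]

/-- Taking adjoints in `newP_identity` with G* = -G reproduces the identity with p' replaced by its
adjoint; the outer factors 1 ± G are invertible and cancel. -/
theorem IsHerm.newP (hα : α ∈ Set.Ioc (0 : ℝ) 1) (h : StepPar γ δ ρ ρ' e)
    (hs : StepAt γ δ e ω Λ P) (hP : IsHerm ρ P) : IsHerm ρ' (newP ω Λ ρ ρ' P) := by
  have hρ0 : 0 ≤ ρ := by have := h.hρ; have := h.hρ'; have := h.hδ; linarith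
  intro x
  have hid := newP_identity hα h hs (toC_mem_cstrip h.hρ' x)
  have hG := norm_genV_le hα h hs (toC_mem_cstrip h.hρ' x)
  have hs1 := star_genV hα h hs hP x
  have hs2 := star_meanDiag hρ0 hP
  have hs3 := (hP x).star_eq
  have h1 : ‖genV ω Λ ρ P (toC x)‖ < 1 := by have := h.hg; linarith
  have hu := isUnit_one_sub_of_norm_lt_one h1
  have hu' := isUnit_one_sub_of_norm_lt_one (x := -genV ω Λ ρ P (toC x)) (by rwa [norm_neg])
  rw [sub_neg_eq_add] at hu'
  have hid' := congrArg star hid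
  simp only [star_mul, star_sub, star_add, star_one, hs1, hs2, hs3] at hid'
  refine hu'.mul_left_cancel (hu.mul_right_cancel ?_)
  rw [hid]
  refine Eq.trans (Eq.trans ?_ hid') ?_ <;> noncomm_ring

end stepEval

/-! ### Commutation with diagonal operators -/

/-- The identity `diag(a) X - X diag(b) = K`, read entrywise. -/
def Comm (a b : ℕ → ℝ) (X K : Op) : Prop :=
  ∀ i j, ((a i - b j : ℝ) : ℂ) * entry X i j = entry K i j

namespace Comm

variable {a b c : ℕ → ℝ} {X Y K L : Op}

/-- The diagonals may be unbounded, so the Leibniz rule is checked inside the sum over the middle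
index, where their contribution telescopes. -/
theorem mul (hX : Comm a b X K) (hY : Comm b c Y L) : Comm a c (X * Y) (K * Y + X * L) := by
  intro i j
  rw [entry_add]
  refine ((hasSum_entry_comp X Y i j).mul_left _).unique
    (((hasSum_entry_comp K Y i j).add (hasSum_entry_comp X L i j)).congr_fun fun l => ?_)
  rw [← hX i l, ← hY l j]
  push_cast
  ring

theorem add (hX : Comm a b X K) (hY : Comm a b Y L) : Comm a b (X + Y) (K + L) := fun i j => by
  rw [entry_add, entry_add, mul_add, hX, hY]

theorem sub (hX : Comm a b X K) (hY : Comm a b Y L) : Comm a b (X - Y) (K - L) := fun i j => by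
  rw [entry_sub, entry_sub, mul_sub, hX, hY]

theorem one (a : ℕ → ℝ) : Comm a a 1 0 := fun i j => by
  by_cases h : i = j
  · subst h; simp [entry]
  · simp [entry, h]

theorem of_tendsto {ι : Type*} {l : Filter ι} [l.NeBot] {x k : ι → Op} {b' : ι → ℕ → ℝ}
    (h : ∀ n, Comm a (b' n) (x n) (k n)) (hx : Filter.Tendsto x l (nhds X))
    (hk : Filter.Tendsto k l (nhds K))
    (hb : ∀ j, Filter.Tendsto (fun n => b' n j) l (nhds (b j))) : Comm a b X K := by
  intro i j
  have h1 := ((entryCLM i j).continuous.tendsto X).comp hx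
  have h2 := ((entryCLM i j).continuous.tendsto K).comp hk
  have h3 : Filter.Tendsto (fun n => ((a i - b' n j : ℝ) : ℂ)) l (nhds ((a i - b j : ℝ) : ℂ)) :=
    (Complex.continuous_ofReal.tendsto _).comp (tendsto_const_nhds.sub (hb j))
  refine tendsto_nhds_unique (h3.mul h1) (h2.congr fun n => ?_)
  exact (h n i j).symm

/-- The partial sums of the Neumann series together with their commutators. -/
def neumann (X K : Op) : ℕ → Op × Op
  | 0 => (0, 0)
  | n + 1 => (1 + X * (neumann X K n).1, K * (neumann X K n).1 + X * (neumann X K n).2)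

/-- Formally [a, (1 - X)⁻¹] = (1 - X)⁻¹ [a, X] (1 - X)⁻¹, but the unbounded diagonal forbids direct
manipulation. The rule is propagated along Neumann partial sums instead, and entrywise commutation
is closed under norm limits. -/
theorem inverse (hX : Comm a a X K) (hn : ‖X‖ ≤ 1 / 2) :
    Comm a a (Ring.inverse (1 - X)) (Ring.inverse (1 - X) * K * Ring.inverse (1 - X)) := by
  have hu := isUnit_one_sub_of_norm_lt_one (show ‖X‖ < 1 by linarith)
  set V := Ring.inverse (1 - X) with hV
  have hXV : 1 + X * V = V := by
    have := Ring.mul_inverse_cancel _ hu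
    rw [← hV, sub_mul, one_mul] at this
    rw [← this]; abel
  have hXK : K * V + X * (V * K * V) = V * K * V := by
    calc K * V + X * (V * K * V) = (1 + X * V) * K * V := by noncomm_ring
      _ = _ := by rw [hXV]
  have hc : ∀ n, Comm a a (neumann X K n).1 (neumann X K n).2 := fun n => by
    induction n with
    | zero => intro i j; simp [neumann, entry]
    | succ n ih => simpa [neumann] using (one a).add (hX.mul ih)
  have h1 : ∀ n, ‖(neumann X K n).1 - V‖ ≤ ‖V‖ * (1 / 2) ^ n := fun n => by
    induction n with
    | zero => simp [neumann]
    | succ n ih =>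
      have : (neumann X K (n + 1)).1 - V = X * ((neumann X K n).1 - V) := by
        conv_lhs => rw [← hXV]
        simp only [neumann]; noncomm_ring
      rw [this, pow_succ]
      refine (norm_mul_le _ _).trans ?_
      calc _ ≤ 1 / 2 * (‖V‖ * (1 / 2) ^ n) := by gcongr
        _ = _ := by ring
  -- Large enough for the initial error and for the forcing term, which is at most c/2 · 2^{-n}.
  -- Forcing and contraction have the same rate 1/2, hence the factor n + 1 below.
  set c := ‖V * K * V‖ + 2 * (‖K‖ * ‖V‖) with hcd
  have h2 : ∀ n : ℕ, ‖(neumann X K n).2 - V * K * V‖ ≤ ((n : ℝ) + 1) * (c * (1 / 2) ^ n) :=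
    fun n => by
    induction n with
    | zero =>
      simp only [neumann, zero_sub, norm_neg, Nat.cast_zero, zero_add, one_mul, pow_zero, mul_one,
        hcd]
      have : 0 ≤ ‖K‖ * ‖V‖ := by positivity
      linarith
    | succ n ih =>
      have : (neumann X K (n + 1)).2 - V * K * V =
          K * ((neumann X K n).1 - V) + X * ((neumann X K n).2 - V * K * V) := by
        conv_lhs => rw [← hXK]
        simp only [neumann]; noncomm_ring
      rw [this, pow_succ]
      calc _ ≤ ‖K‖ * (‖V‖ * (1 / 2) ^ n) + 1 / 2 * (((n : ℝ) + 1) * (c * (1 / 2) ^ n)) := by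
            refine (norm_add_le _ _).trans (add_le_add ?_ ?_)
            · exact (norm_mul_le _ _).trans (by gcongr; exact h1 n)
            · exact (norm_mul_le _ _).trans (by gcongr)
        _ ≤ 1 / 2 * (c * (1 / 2) ^ n) + 1 / 2 * (((n : ℝ) + 1) * (c * (1 / 2) ^ n)) := by
            have : ‖K‖ * ‖V‖ ≤ 1 / 2 * c := by
              rw [hcd]; have := norm_nonneg (V * K * V); linarith
            have h3 : (0 : ℝ) < (1 / 2) ^ n := by positivity
            nlinarith
        _ = _ := by push_cast; ring
  have hp : Filter.Tendsto (fun n : ℕ => ((1 : ℝ) / 2) ^ n) Filter.atTop (nhds 0) :=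
    tendsto_pow_atTop_nhds_zero_of_lt_one (by norm_num) (by norm_num)
  have hnp : Filter.Tendsto (fun n : ℕ => (n : ℝ) * ((1 : ℝ) / 2) ^ n) Filter.atTop (nhds 0) :=
    tendsto_self_mul_const_pow_of_lt_one (by norm_num) (by norm_num)
  refine of_tendsto (b' := fun _ => a) hc (l := Filter.atTop) ?_ ?_ fun j => tendsto_const_nhds
  · rw [tendsto_iff_norm_sub_tendsto_zero]
    refine squeeze_zero (fun _ => norm_nonneg _) h1 ?_
    simpa using hp.const_mul ‖V‖
  · rw [tendsto_iff_norm_sub_tendsto_zero]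
    refine squeeze_zero (fun _ => norm_nonneg _) h2 ?_
    have := (hnp.add hp).const_mul c
    rw [add_zero, mul_zero] at this
    exact this.congr fun n => by ring

end Comm

/-! ### Derivatives of products, inverses and Cayley transforms along a curve of operators. -/

section derivative

theorem hasDerivAt_mul_op {f g : ℝ → Op} {f' g' : Op} {t : ℝ} (hf : HasDerivAt f f' t)
    (hg : HasDerivAt g g' t) : HasDerivAt (fun r => f r * g r) (f' * g t + f t * g') t := by
  have h := ((ContinuousLinearMap.mul ℂ Op).isBoundedBilinearMap.hasFDerivAt
    (f t, g t)).restrictScalars ℝ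
  have h2 := h.comp_hasDerivAt t (hf.prodMk hg)
  have h3 : HasDerivAt (fun r => f r * g r) (f t * g' + f' * g t) t := h2
  rwa [add_comm] at h3

theorem hasDerivAt_inverse_one_sub {f : ℝ → Op} {f' : Op} {t : ℝ} (hf : HasDerivAt f f' t)
    (hn : ‖f t‖ < 1) : HasDerivAt (fun r => Ring.inverse (1 - f r))
      (Ring.inverse (1 - f t) * f' * Ring.inverse (1 - f t)) t := by
  obtain ⟨u, hu⟩ := isUnit_one_sub_of_norm_lt_one hn
  have h := (hasFDerivAt_ringInverse (𝕜 := ℂ) u).restrictScalars ℝ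
  rw [hu] at h
  have h2 := h.comp_hasDerivAt t (hf.const_sub 1)
  have h3 : HasDerivAt (fun r => Ring.inverse (1 - f r))
    (-((u⁻¹ : Opˣ) * -f' * (u⁻¹ : Opˣ) : Op)) t := h2
  rw [← hu, Ring.inverse_unit]
  simpa using h3

theorem hasDerivAt_cayley {f : ℝ → Op} {f' : Op} {t : ℝ} (hf : HasDerivAt f f' t)
    (hn : ‖f t‖ < 1) : HasDerivAt (fun r => cayley (f r))
      ((2 : ℂ) • (Ring.inverse (1 - f t) * f' * Ring.inverse (1 - f t))) t := by
  have h := hasDerivAt_inverse_one_sub hf hn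
  have h2 := (h.add h).sub_const 1
  rw [two_smul]
  refine h2.congr_of_eventuallyEq (Filter.Eventually.of_forall fun r => ?_)
  simp [cayley, two_mul]

end derivative

/-! ### The homological equation and the conjugation along the flow. -/

section stepDynamics

variable {n : ℕ} {α : ℝ} {γ δ ρ ρ' e s : ℝ} {ω : Fin n → ℝ} {Λ : Mhat α} {P : X n (Mhat α)}

theorem devX_incl (hs0 : 0 < s) (ω : Fin n → ℝ) (t : ℝ) (k : Idx n) (x : Op) :
    devX hs0 ω t (incl k x) = (Complex.I * (freq k ω : ℝ) * evc s (toC (t • ω)) k) • x := by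
  rw [devX, liftX_incl]; rfl

/-- The generator as a weighted Fourier series. -/
def genX (s : ℝ) (ω : Fin n → ℝ) (Λ : Mhat α) (ρ : ℝ) (P : X n (Mhat α)) : X n Op :=
  convX s (fun k => (ContinuousLinearMap.mul ℂ Op).flip (gen ω Λ ρ P k)) (incl 0 1)

theorem evX_genX (hα : α ∈ Set.Ioc (0 : ℝ) 1) (h : StepPar γ δ ρ ρ' e)
    (hs : StepAt γ δ e ω Λ P) (hs0 : 0 ≤ s) (hsρ : s ≤ ρ') {θ : Fin n → ℂ} (hθ : θ ∈ cstrip n s) :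
    evX s θ (genX s ω Λ ρ P) = genV ω Λ ρ P θ := by
  rw [genX, evX_convX_flip hα h hs hs0 hsρ hθ, evX_incl_zero s hθ, one_mul]

theorem hasSum_devX_genX (hα : α ∈ Set.Ioc (0 : ℝ) 1) (h : StepPar γ δ ρ ρ' e)
    (hs : StepAt γ δ e ω Λ P) (hs0 : 0 < s) (hsρ : s ≤ ρ') (t : ℝ) :
    HasSum (fun k => (Complex.I * (freq k ω : ℝ) * expf k (toC (t • ω))) • gen ω Λ ρ P k)
      (devX hs0 ω t (genX s ω Λ ρ P)) := by
  have h1 := (devX hs0 ω t : X n Op →L[ℂ] Op).hasSum (hasSum_convX_incl hs0.le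
    (norm_convX_flip_le hα h hs hs0.le hsρ).1 0 (1 : Op))
  refine h1.congr_fun fun k => ?_
  rw [map_smul, devX_incl, evc_eq (toC_mem_cstrip hs0.le _), smul_smul, kn_zero, add_zero,
    ContinuousLinearMap.flip_apply, ContinuousLinearMap.mul_apply', one_mul]
  congr 1
  have : Real.exp (s * (kn k - 0)) * Real.exp (-(s * kn k)) = 1 := by
    rw [← Real.exp_add, ← Real.exp_zero]; congr 1; ring
  calc _ = (Complex.I * (freq k ω : ℝ) * expf k (toC (t • ω))) *
        ((Real.exp (s * (kn k - 0)) * Real.exp (-(s * kn k)) : ℝ) : ℂ) := by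
        rw [this]; simp
    _ = _ := by push_cast; ring

theorem hasDerivAt_genV (hα : α ∈ Set.Ioc (0 : ℝ) 1) (h : StepPar γ δ ρ ρ' e)
    (hs : StepAt γ δ e ω Λ P) (hs0 : 0 < s) (hsρ : s ≤ ρ') (t : ℝ) :
    HasDerivAt (fun r : ℝ => genV ω Λ ρ P (toC (r • ω))) (devX hs0 ω t (genX s ω Λ ρ P)) t :=
  (hasDerivAt_evX hs0 ω (genX s ω Λ ρ P) t).congr_of_eventuallyEq
    (Filter.Eventually.of_forall fun _ =>
      (evX_genX hα h hs hs0.le hsρ (toC_mem_cstrip hs0.le _)).symm)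

theorem dvs_mul_mult (hγ : 0 < γ) (hs : NonRes γ δ ω Λ) (k : Idx n) (i j : ℕ) :
    (dvs ω Λ k i j : ℂ) * mult ω Λ k i j = if k = 0 ∧ i = j then 0 else -(1 / 2) := by
  split_ifs with hk
  · rw [hk.1, hk.2, mult_zero_diag, mul_zero]
  · have hk' : k ≠ 0 ∨ i ≠ j := by tauto
    have h0 : dvs ω Λ k i j ≠ 0 := abs_pos.1 (hs.pos hγ hk')
    rw [mult_of_ne hk', ← Complex.ofReal_mul]
    have : dvs ω Λ k i j * (-1 / (2 * dvs ω Λ k i j)) = -(1 / 2) := by field_simp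
    rw [this]; push_cast; rfl

/-- The homological equation. At the k-th coefficient the time derivative and the commutator combine
into the divisor, which the multiplier turns into -1/2. The one case left out, k = 0 with i = j, is
the mean diagonal that is moved into the normal form. -/
theorem comm_genV (hα : α ∈ Set.Ioc (0 : ℝ) 1) (h : StepPar γ δ ρ ρ' e)
    (hs : StepAt γ δ e ω Λ P) (hs0 : 0 < s) (hsρ : s ≤ ρ') (t : ℝ) :
    Comm (lamOf Λ) (lamOf Λ) (genV ω Λ ρ P (toC (t • ω)))
      (Complex.I • devX hs0 ω t (genX s ω Λ ρ P) -
        (1 / 2 : ℂ) • ((evX ρ (toC (t • ω)) P).op - (meanDiag P).op)) := by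
  have hρ0 : 0 ≤ ρ := by have := h.hρ; have := h.hρ'; have := h.hδ; linarith
  intro i j
  set θ := toC (t • ω)
  have e1 := (entryCLM i j).hasSum (hasSum_genV hα h hs (toC_mem_cstrip h.hρ' (t • ω)))
  have e2 := (entryCLM i j).hasSum (hasSum_devX_genX hα h hs hs0 hsρ t)
  have e3 := (entryCLM i j).hasSum (hasSum_op_evX hρ0 P (t • ω))
  simp only [map_smul, smul_eq_mul] at e1 e2 e3
  have e4 : HasSum (fun k : Idx n => if k = 0 then entry (meanDiag P).op i j else 0)
      (entry (meanDiag P).op i j) := by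
    simpa using hasSum_ite_eq (0 : Idx n) (entry (meanDiag P).op i j)
  rw [entry_sub, entry_smul, entry_smul, entry_sub]
  refine (e1.mul_left _).unique
    (((e2.mul_left Complex.I).sub ((e3.sub e4).mul_left (1 / 2))).congr_fun fun k => ?_)
  have hg : entryCLM i j (gen ω Λ ρ P k) = mult ω Λ k i j * entry (coefX ρ k P).op i j :=
    entry_hadamard (mult_isMult hα.1.le h.hδ h.hδ1 h.hγ h.hγ1 hs.hΛ hs.nr k) _ i j
  have hP : entryCLM i j (coefX ρ k P).op = entry (coefX ρ k P).op i j := rfl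
  have hd := dvs_mul_mult h.hγ hs.nr k i j
  have hfr : (freq k ω : ℂ) = dvs ω Λ k i j - ((lamOf Λ i - lamOf Λ j : ℝ) : ℂ) := by
    rw [dvs]; push_cast; ring
  have hI : Complex.I * (Complex.I * (freq k ω : ℂ) * expf k θ * entryCLM i j (gen ω Λ ρ P k)) =
      -((freq k ω : ℂ) * (expf k θ * entryCLM i j (gen ω Λ ρ P k))) := by
    linear_combination ((freq k ω : ℂ) * (expf k θ * entryCLM i j (gen ω Λ ρ P k))) *
      Complex.I_mul_I
  rw [hI, hg, hP, hfr]
  by_cases hk : k = 0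
  · subst hk
    have h0 : coefX ρ 0 P = coefX 0 0 P := by simp [coefX]
    rw [if_pos rfl, meanDiag, entry_diagPart, h0, expf_zero]
    by_cases hij : i = j
    · subst hij; simp [mult_zero_diag]
    · rw [if_neg (by simp [hij])] at hd
      rw [if_neg hij]
      linear_combination (entry (coefX 0 0 P).op i j) * hd
  · rw [if_neg hk]
    rw [if_neg (by simp [hk])] at hd
    linear_combination (expf k θ * entry (coefX ρ k P).op i j) * hd

theorem lamOf_add_meanDiag (Λ : Mhat α) (P : X n (Mhat α)) (i : ℕ) :
    lamOf (Λ + meanDiag P) i = lamOf Λ i + (entry (meanDiag P).op i i).re := by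
  simp only [lamOf, map_add, entry_add, Complex.add_re]; ring

/-- The invariant of the iteration: U conjugates the original system into the one with the current
diagonal and perturbation. It suffices that W does this for one step, since `Comm.mul` composes the
two relations. Self-adjointness makes the mean diagonal real, so it can be added to the eigenvalues.
-/
theorem comm_newU (hα : α ∈ Set.Ioc (0 : ℝ) 1) (h : StepPar γ δ ρ ρ' e)
    (hs : StepAt γ δ e ω Λ P) (hP : IsHerm ρ P) (hs0 : 0 < s) (hsρ : s ≤ ρ') {t : ℝ} {P₀ : Op}
    {U : X n Op} (hU : Comm lam (lamOf Λ) (evX s (toC (t • ω)) U)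
      (Complex.I • devX hs0 ω t U - P₀ * evX s (toC (t • ω)) U +
        evX s (toC (t • ω)) U * (evX ρ (toC (t • ω)) P).op)) :
    Comm lam (lamOf (Λ + meanDiag P)) (evX s (toC (t • ω)) (newU s ω Λ ρ P U))
      (Complex.I • devX hs0 ω t (newU s ω Λ ρ P U) -
        P₀ * evX s (toC (t • ω)) (newU s ω Λ ρ P U) +
        evX s (toC (t • ω)) (newU s ω Λ ρ P U) *
          (evX ρ' (toC (t • ω)) (newP ω Λ ρ ρ' P)).op) := by
  have hρ0 : 0 ≤ ρ := by have := h.hρ; have := h.hρ'; have := h.hδ; linarith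
  have hθs : ∀ r : ℝ, toC (r • ω) ∈ cstrip n s := fun _ => toC_mem_cstrip hs0.le _
  have hG := norm_genV_le hα h hs (toC_mem_cstrip h.hρ' (t • ω))
  have hG' : ‖genV ω Λ ρ P (toC (t • ω))‖ ≤ 1 / 2 := hG.trans h.hg
  have hG1 : ‖genV ω Λ ρ P (toC (t • ω))‖ < 1 := by linarith
  have hcomm := (comm_genV hα h hs hs0 hsρ t).inverse hG'
  have hdG := hasDerivAt_genV hα h hs hs0 hsρ t
  have hdW := hasDerivAt_cayley hdG hG1
  have hdU := hasDerivAt_mul_op (hasDerivAt_evX hs0 ω U t) hdW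
  have hdU' := (hasDerivAt_evX hs0 ω (newU s ω Λ ρ P U) t).unique
    (hdU.congr_of_eventuallyEq (Filter.Eventually.of_forall fun r =>
      evX_newU hα h hs hs0.le hsρ (hθs r) U))
  have hid := newP_identity hα h hs (toC_mem_cstrip h.hρ' (t • ω))
  have hc1 := cayley_mul hG1
  have hc2 := mul_cayley hG1
  have hu := isUnit_one_sub_of_norm_lt_one hG1
  have hv1 := Ring.inverse_mul_cancel _ hu
  have hv2 := Ring.mul_inverse_cancel _ hu
  rw [hdU', evX_newU hα h hs hs0.le hsρ (hθs t)]
  have hWeq : cayley (genV ω Λ ρ P (toC (t • ω))) = Ring.inverse (1 - genV ω Λ ρ P (toC (t • ω)))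
      + Ring.inverse (1 - genV ω Λ ρ P (toC (t • ω))) - 1 := by rw [cayley, two_mul]
  set θ := toC (t • ω)
  set G := genV ω Λ ρ P θ
  set V := Ring.inverse (1 - G)
  set W := cayley G
  set p := (evX ρ θ P).op
  set p' := (evX ρ' θ (newP ω Λ ρ ρ' P)).op
  set D := (meanDiag P).op with hD
  set G' := devX hs0 ω t (genX s ω Λ ρ P)
  set K := Complex.I • G' - (1 / 2 : ℂ) • (p - D)
  have hW1 : Comm (lamOf Λ) (lamOf Λ) W (V * K * V + V * K * V - 0) := by
    rw [hWeq]; exact (hcomm.add hcomm).sub (Comm.one _)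
  have hDre : ∀ j, ((entry D j j).re : ℂ) = entry D j j := fun j => by
    have h1 := congrArg (fun A => entry A j j) (star_meanDiag hρ0 hP)
    simp only [entry_star] at h1
    exact Complex.conj_eq_iff_re.1 h1
  have hWD : ∀ i j, entry (W * D) i j = entry W i j * entry D j j := fun i j => by
    refine (hasSum_entry_comp W D i j).unique ?_
    refine hasSum_single (f := fun l => entry W i l * entry D l j) j fun l hl => ?_
    rw [hD, meanDiag, entry_diagPart, if_neg hl, mul_zero]
  have hW2 : Comm (lamOf Λ) (lamOf (Λ + meanDiag P)) W (V * K * V + V * K * V - W * D) := by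
    intro i j
    have h1 := hW1 i j
    rw [sub_zero] at h1
    rw [entry_sub, hWD, ← h1, lamOf_add_meanDiag, ← hD]
    push_cast
    linear_combination (-entry W i j) * hDre j
  -- Multiplied by 1 - G on both sides, with (1 - G)W = W(1 - G) = 1 + G, this is the identity
  -- defining p'.
  have hkey : V * (p - D) * V = p * W - W * D - W * p' := by
    refine hu.mul_left_cancel (hu.mul_right_cancel ?_)
    calc (1 - G) * (V * (p - D) * V) * (1 - G)
        = ((1 - G) * V) * (p - D) * (V * (1 - G)) := by noncomm_ring
      _ = p - D := by rw [hv1, hv2, one_mul, mul_one]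
      _ = (1 - G) * p * (1 + G) - (1 + G) * D * (1 - G) - (1 + G) * p' * (1 - G) := by
          rw [hid]; noncomm_ring
      _ = (1 - G) * p * (W * (1 - G)) - ((1 - G) * W) * D * (1 - G) -
          ((1 - G) * W) * p' * (1 - G) := by rw [hc1, hc2]
      _ = _ := by noncomm_ring
  have hK : V * K * V + V * K * V - W * D =
      Complex.I • ((2 : ℂ) • (V * G' * V)) - p * W + W * p' := by
    have h1 : V * K * V = Complex.I • (V * G' * V) - (1 / 2 : ℂ) • (V * (p - D) * V) := by
      simp only [K, mul_sub, sub_mul, mul_smul_comm, smul_mul_assoc]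
    have h2 : (1 / 2 : ℂ) • (V * (p - D) * V) + (1 / 2 : ℂ) • (V * (p - D) * V) =
        p * W - W * D - W * p' := by
      rw [← add_smul, hkey]; norm_num
    rw [h1, two_smul, smul_add]
    calc _ = Complex.I • (V * G' * V) + Complex.I • (V * G' * V) -
          ((1 / 2 : ℂ) • (V * (p - D) * V) + (1 / 2 : ℂ) • (V * (p - D) * V)) - W * D := by abel
      _ = _ := by rw [h2]; abel
  rw [hK] at hW2
  have hfin := hU.mul hW2
  refine (congrArg (Comm _ _ _) ?_).mp hfin
  simp only [add_mul, sub_mul, mul_add, mul_sub, smul_mul_assoc, mul_smul_comm, smul_add, mul_assoc]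
  abel

end stepDynamics

/-! ### The iteration -/

/-- A schedule of parameters for the iteration. -/
structure Sched (γ δ ρ e : ℕ → ℝ) (s g E : ℝ) : Prop where
  par : ∀ m, StepPar (γ m) (δ m) (ρ m) (ρ (m + 1)) (e m)
  next : ∀ m, 1000 * gcon (γ m) (δ m) (e m) * e m ≤ e (m + 1)
  hs : 0 < s
  hsρ : ∀ m, s ≤ ρ m
  geo : ∀ m, gcon (γ m) (δ m) (e m) ≤ g * (1 / 2) ^ m
  hg0 : 0 ≤ g
  hg : 16 * g ≤ 1
  summ : HasSum e E
  hE : E ≤ 1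

/-- The state of the iteration: perturbation, diagonal, transformation and its inverse. -/
structure KState (n : ℕ) (α : ℝ) where
  /-- the perturbation -/
  P : X n (Mhat α)
  /-- the correction of the diagonal -/
  Λ : Mhat α
  /-- the transformation -/
  U : X n Op
  /-- the inverse transformation -/
  V : X n Op

section iteration

variable {n : ℕ} {α : ℝ}

/-- The iteration at the frequency `ω`. -/
def kam (s : ℝ) (ρ : ℕ → ℝ) (P₀ : (Fin n → ℝ) → X n (Mhat α)) (ω : Fin n → ℝ) : ℕ → KState n α
  | 0 => ⟨P₀ ω, 0, incl 0 1, incl 0 1⟩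
  | m + 1 =>
    ⟨newP ω (kam s ρ P₀ ω m).Λ (ρ m) (ρ (m + 1)) (kam s ρ P₀ ω m).P,
      (kam s ρ P₀ ω m).Λ + meanDiag (kam s ρ P₀ ω m).P,
      newU s ω (kam s ρ P₀ ω m).Λ (ρ m) (kam s ρ P₀ ω m).P (kam s ρ P₀ ω m).U,
      newV s ω (kam s ρ P₀ ω m).Λ (ρ m) (kam s ρ P₀ ω m).P (kam s ρ P₀ ω m).V⟩

/-- The frequencies that are non-resonant in the first `m` steps. -/
def goodSet (γ δ : ℕ → ℝ) (s : ℝ) (ρ : ℕ → ℝ) (P₀ : (Fin n → ℝ) → X n (Mhat α)) (m : ℕ) :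
    Set (Fin n → ℝ) :=
  {ω ∈ freqBox n | ∀ j < m, NonRes (γ j) (δ j) ω (kam s ρ P₀ ω j).Λ}

/-- Admissible initial perturbations. -/
structure InitOK (ρ₀ e₀ : ℝ) (P₀ : (Fin n → ℝ) → X n (Mhat α)) : Prop where
  bd : ∀ ω ∈ freqBox n, ‖P₀ ω‖ ≤ e₀
  lip : ∀ ω ∈ freqBox n, ∀ ω' ∈ freqBox n, ‖P₀ ω - P₀ ω'‖ ≤ e₀ * ‖ω - ω'‖
  herm : ∀ ω ∈ freqBox n, IsHerm ρ₀ (P₀ ω)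

variable {γ δ ρ e : ℕ → ℝ} {s g E : ℝ} {P₀ : (Fin n → ℝ) → X n (Mhat α)} {ω ω' : Fin n → ℝ}

theorem goodSet_anti {m l : ℕ} (h : l ≤ m) : goodSet γ δ s ρ P₀ m ⊆ goodSet γ δ s ρ P₀ l :=
  fun _ hω => ⟨hω.1, fun j hj => hω.2 j (hj.trans_le h)⟩

theorem Sched.e_nonneg (S : Sched γ δ ρ e s g E) (m : ℕ) : 0 ≤ e m := (S.par m).he

theorem Sched.sum_le (S : Sched γ δ ρ e s g E) (m : ℕ) : ∑ j ∈ Finset.range m, e j ≤ E :=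
  sum_le_hasSum _ (fun j _ => S.e_nonneg j) S.summ

/-- Reaching step m uses only the non-resonance conditions of the earlier steps, so these bounds are
available when the resonances of step m are measured. -/
theorem kam_bounds (hα : α ∈ Set.Ioc (0 : ℝ) 1) (S : Sched γ δ ρ e s g E)
    (hP : InitOK (ρ 0) (e 0) P₀) (m : ℕ) (hω : ω ∈ goodSet γ δ s ρ P₀ m) :
    ‖(kam s ρ P₀ ω m).P‖ ≤ e m ∧ ‖(kam s ρ P₀ ω m).Λ‖ ≤ ∑ j ∈ Finset.range m, e j ∧
      IsHerm (ρ m) (kam s ρ P₀ ω m).P := by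
  induction m with
  | zero => exact ⟨hP.bd ω hω.1, by simp [kam], hP.herm ω hω.1⟩
  | succ m ih =>
    obtain ⟨h1, h2, h3⟩ := ih (goodSet_anti m.le_succ hω)
    have hstep : StepAt (γ m) (δ m) (e m) ω (kam s ρ P₀ ω m).Λ (kam s ρ P₀ ω m).P :=
      ⟨h2.trans ((S.sum_le m).trans S.hE), hω.2 m m.lt_succ_self, h1⟩
    refine ⟨(norm_newP_le hα (S.par m) hstep).trans (le_trans ?_ (S.next m)), ?_,
      h3.newP hα (S.par m) hstep⟩
    · have := (S.par m).gcon_nonneg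
      have := S.e_nonneg m
      gcongr
      norm_num
    · rw [Finset.sum_range_succ]
      exact (norm_add_le _ _).trans (add_le_add h2 ((norm_meanDiag_le _).trans h1))

theorem kam_stepAt (hα : α ∈ Set.Ioc (0 : ℝ) 1) (S : Sched γ δ ρ e s g E)
    (hP : InitOK (ρ 0) (e 0) P₀) {m : ℕ} (hω : ω ∈ goodSet γ δ s ρ P₀ (m + 1)) :
    StepAt (γ m) (δ m) (e m) ω (kam s ρ P₀ ω m).Λ (kam s ρ P₀ ω m).P := by
  obtain ⟨h1, h2, -⟩ := kam_bounds hα S hP m (goodSet_anti m.le_succ hω)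
  exact ⟨h2.trans ((S.sum_le m).trans S.hE), hω.2 m m.lt_succ_self, h1⟩

/-- The same sequence e bounds size and Lipschitz constant; the factor 1000 in the schedule is the
one of the Lipschitz estimate. Comparing two surviving frequencies directly avoids derivatives on a
set that need not be open. -/
theorem kam_lip (hα : α ∈ Set.Ioc (0 : ℝ) 1) (S : Sched γ δ ρ e s g E)
    (hP : InitOK (ρ 0) (e 0) P₀) (m : ℕ) (hω : ω ∈ goodSet γ δ s ρ P₀ m)
    (hω' : ω' ∈ goodSet γ δ s ρ P₀ m) :
    ‖(kam s ρ P₀ ω m).P - (kam s ρ P₀ ω' m).P‖ ≤ e m * ‖ω - ω'‖ ∧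
      ‖(kam s ρ P₀ ω m).Λ - (kam s ρ P₀ ω' m).Λ‖ ≤ (∑ j ∈ Finset.range m, e j) * ‖ω - ω'‖ := by
  induction m with
  | zero => exact ⟨hP.lip ω hω.1 ω' hω'.1, by simp [kam]⟩
  | succ m ih =>
    obtain ⟨h1, h2⟩ := ih (goodSet_anti m.le_succ hω) (goodSet_anti m.le_succ hω')
    have hr := norm_nonneg (ω - ω')
    have h3 : (∑ j ∈ Finset.range m, e j) * ‖ω - ω'‖ ≤ ‖ω - ω'‖ :=
      mul_le_of_le_one_left hr ((S.sum_le m).trans S.hE)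
    constructor
    · refine (norm_newP_sub_le hα (S.par m) (kam_stepAt hα S hP hω) (kam_stepAt hα S hP hω')
        le_rfl (h2.trans h3) h1).trans ?_
      gcongr
      exact S.next m
    · rw [Finset.sum_range_succ, add_mul]
      have : (kam s ρ P₀ ω (m + 1)).Λ - (kam s ρ P₀ ω' (m + 1)).Λ =
          ((kam s ρ P₀ ω m).Λ - (kam s ρ P₀ ω' m).Λ) +
            meanDiag ((kam s ρ P₀ ω m).P - (kam s ρ P₀ ω' m).P) := by
        rw [← meanDiag_sub]; exact add_sub_add_comm _ _ _ _
      rw [this]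
      exact (norm_add_le _ _).trans (add_le_add h2 ((norm_meanDiag_le _).trans h1))

/-! ### The limit -/

/-- The frequencies that are non-resonant in all steps. -/
def goodInf (γ δ : ℕ → ℝ) (s : ℝ) (ρ : ℕ → ℝ) (P₀ : (Fin n → ℝ) → X n (Mhat α)) :
    Set (Fin n → ℝ) := ⋂ m, goodSet γ δ s ρ P₀ m

/-- The limit of the diagonals. -/
def lamLim (s : ℝ) (ρ : ℕ → ℝ) (P₀ : (Fin n → ℝ) → X n (Mhat α)) (ω : Fin n → ℝ) : Mhat α :=
  ∑' m, meanDiag (kam s ρ P₀ ω m).P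

/-- The limit of the transformations. -/
def uLim (s : ℝ) (ρ : ℕ → ℝ) (P₀ : (Fin n → ℝ) → X n (Mhat α)) (ω : Fin n → ℝ) : X n Op :=
  incl 0 1 + ∑' m, ((kam s ρ P₀ ω (m + 1)).U - (kam s ρ P₀ ω m).U)

/-- The limit of the inverse transformations. -/
def vLim (s : ℝ) (ρ : ℕ → ℝ) (P₀ : (Fin n → ℝ) → X n (Mhat α)) (ω : Fin n → ℝ) : X n Op :=
  incl 0 1 + ∑' m, ((kam s ρ P₀ ω (m + 1)).V - (kam s ρ P₀ ω m).V)

theorem tendsto_of_summable_sub {F : Type*} [NormedAddCommGroup F] [CompleteSpace F] {u : ℕ → F}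
    {b : ℕ → ℝ} (hb : Summable b) (h : ∀ m, ‖u (m + 1) - u m‖ ≤ b m) :
    Filter.Tendsto u Filter.atTop (nhds (u 0 + ∑' m, (u (m + 1) - u m))) := by
  have h1 := ((Summable.of_norm_bounded hb h).hasSum.tendsto_sum_nat).const_add (u 0)
  refine h1.congr fun m => ?_
  rw [Finset.sum_range_sub, add_sub_cancel]

variable (hα : α ∈ Set.Ioc (0 : ℝ) 1)

theorem Sched.summable_geo (_ : Sched γ δ ρ e s g E) :
    Summable fun m : ℕ => 8 * (g * (1 / 2) ^ m) :=
  ((summable_geometric_of_lt_one (by norm_num) (by norm_num)).mul_left g).mul_left 8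

/-- As long as ‖u m‖ ≤ 2 the increments are at most 8g 2^{-m}, which sum to 16g ≤ 1, so the bound 2
is never exceeded. -/
theorem norm_le_of_step {F : Type*} [NormedAddCommGroup F] (S : Sched γ δ ρ e s g E) {u : ℕ → F}
    (h0 : ‖u 0‖ ≤ 1) (h : ∀ m, ‖u (m + 1) - u m‖ ≤ 4 * gcon (γ m) (δ m) (e m) * ‖u m‖) (m : ℕ) :
    ‖u m‖ ≤ 2 ∧ ‖u (m + 1) - u m‖ ≤ 8 * (g * (1 / 2) ^ m) := by
  have h1 : ∀ m, ‖u m‖ ≤ 1 + 16 * g * (1 - (1 / 2) ^ m) := fun m => by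
    induction m with
    | zero => simpa using h0
    | succ m ih =>
      have h2 : (0 : ℝ) < (1 / 2) ^ m := by positivity
      have h3 : ‖u m‖ ≤ 2 := by nlinarith [S.hg, S.hg0]
      have h4 : ‖u (m + 1) - u m‖ ≤ 4 * (g * (1 / 2) ^ m) * 2 :=
        (h m).trans (mul_le_mul (mul_le_mul_of_nonneg_left (S.geo m) (by norm_num)) h3
          (norm_nonneg _) (mul_nonneg (by norm_num) (mul_nonneg S.hg0 h2.le)))
      have h5 : ‖u (m + 1)‖ ≤ ‖u m‖ + ‖u (m + 1) - u m‖ := by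
        simpa using norm_add_le (u m) (u (m + 1) - u m)
      rw [pow_succ]
      linarith
  have h2 : (0 : ℝ) < (1 / 2) ^ m := by positivity
  have h3 : ‖u m‖ ≤ 2 := by nlinarith [h1 m, S.hg, S.hg0]
  refine ⟨h3, (h m).trans ((mul_le_mul (mul_le_mul_of_nonneg_left (S.geo m) (by norm_num)) h3
          (norm_nonneg _) (mul_nonneg (by norm_num) (mul_nonneg S.hg0 h2.le))).trans ?_)⟩
  linarith

theorem norm_incl_one : ‖(incl 0 1 : X n Op)‖ ≤ 1 := by
  rw [norm_incl_apply]; exact ContinuousLinearMap.norm_id_le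

theorem goodInf_mem (hω : ω ∈ goodInf γ δ s ρ P₀) (m : ℕ) : ω ∈ goodSet γ δ s ρ P₀ m :=
  Set.mem_iInter.1 hω m

theorem tendsto_uLim (hα : α ∈ Set.Ioc (0 : ℝ) 1) (S : Sched γ δ ρ e s g E)
    (hP : InitOK (ρ 0) (e 0) P₀) (hω : ω ∈ goodInf γ δ s ρ P₀) :
    Filter.Tendsto (fun m => (kam s ρ P₀ ω m).U) Filter.atTop (nhds (uLim s ρ P₀ ω)) :=
  tendsto_of_summable_sub (u := fun m => (kam s ρ P₀ ω m).U) S.summable_geo fun m =>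
    (norm_le_of_step S (u := fun m => (kam s ρ P₀ ω m).U) norm_incl_one (fun m =>
      norm_newU_sub_le hα (S.par m) (kam_stepAt hα S hP (goodInf_mem hω _)) S.hs.le
        (S.hsρ _) _) m).2

theorem tendsto_vLim (hα : α ∈ Set.Ioc (0 : ℝ) 1) (S : Sched γ δ ρ e s g E)
    (hP : InitOK (ρ 0) (e 0) P₀) (hω : ω ∈ goodInf γ δ s ρ P₀) :
    Filter.Tendsto (fun m => (kam s ρ P₀ ω m).V) Filter.atTop (nhds (vLim s ρ P₀ ω)) :=
  tendsto_of_summable_sub (u := fun m => (kam s ρ P₀ ω m).V) S.summable_geo fun m =>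
    (norm_le_of_step S (u := fun m => (kam s ρ P₀ ω m).V) norm_incl_one (fun m =>
      norm_newV_sub_le hα (S.par m) (kam_stepAt hα S hP (goodInf_mem hω _)) S.hs.le
        (S.hsρ _) _) m).2

theorem tendsto_lamLim (hα : α ∈ Set.Ioc (0 : ℝ) 1) (S : Sched γ δ ρ e s g E)
    (hP : InitOK (ρ 0) (e 0) P₀) (hω : ω ∈ goodInf γ δ s ρ P₀) :
    Filter.Tendsto (fun m => (kam s ρ P₀ ω m).Λ) Filter.atTop (nhds (lamLim s ρ P₀ ω)) := by
  have h1 : Summable fun m => meanDiag (kam s ρ P₀ ω m).P :=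
    Summable.of_norm_bounded S.summ.summable fun m =>
      (norm_meanDiag_le _).trans (kam_bounds hα S hP m (goodInf_mem hω m)).1
  refine h1.hasSum.tendsto_sum_nat.congr fun m => ?_
  induction m with
  | zero => simp [kam]
  | succ m ih => rw [Finset.sum_range_succ, ih]; rfl

theorem norm_lamLim_le (hα : α ∈ Set.Ioc (0 : ℝ) 1) (S : Sched γ δ ρ e s g E)
    (hP : InitOK (ρ 0) (e 0) P₀) (hω : ω ∈ goodInf γ δ s ρ P₀) : ‖lamLim s ρ P₀ ω‖ ≤ E :=
  le_of_tendsto (tendsto_lamLim hα S hP hω).norm (Filter.Eventually.of_forall fun m =>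
    (kam_bounds hα S hP m (goodInf_mem hω m)).2.1.trans (S.sum_le m))

theorem norm_lamLim_sub_le (hα : α ∈ Set.Ioc (0 : ℝ) 1) (S : Sched γ δ ρ e s g E)
    (hP : InitOK (ρ 0) (e 0) P₀) (hω : ω ∈ goodInf γ δ s ρ P₀) (hω' : ω' ∈ goodInf γ δ s ρ P₀) :
    ‖lamLim s ρ P₀ ω - lamLim s ρ P₀ ω'‖ ≤ E * ‖ω - ω'‖ :=
  le_of_tendsto ((tendsto_lamLim hα S hP hω).sub (tendsto_lamLim hα S hP hω')).norm
    (Filter.Eventually.of_forall fun m =>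
      (kam_lip hα S hP m (goodInf_mem hω m) (goodInf_mem hω' m)).2.trans
        (mul_le_mul_of_nonneg_right (S.sum_le m) (norm_nonneg _)))

theorem tendsto_evX {E' : Type*} [NormedAddCommGroup E'] [NormedSpace ℂ E'] [CompleteSpace E']
    {u : ℕ → X n E'} {a : X n E'} (h : Filter.Tendsto u Filter.atTop (nhds a)) (s : ℝ)
    (θ : Fin n → ℂ) :
    Filter.Tendsto (fun m => evX s θ (u m)) Filter.atTop (nhds (evX s θ a)) :=
  ((evX s θ).continuous.tendsto a).comp h

theorem evX_kam_succ (hα : α ∈ Set.Ioc (0 : ℝ) 1) (S : Sched γ δ ρ e s g E)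
    (hP : InitOK (ρ 0) (e 0) P₀) (hω : ω ∈ goodInf γ δ s ρ P₀) {θ : Fin n → ℂ}
    (hθ : θ ∈ cstrip n s) (m : ℕ) :
    evX s θ (kam s ρ P₀ ω (m + 1)).U = evX s θ (kam s ρ P₀ ω m).U *
        cayley (genV ω (kam s ρ P₀ ω m).Λ (ρ m) (kam s ρ P₀ ω m).P θ) ∧
      evX s θ (kam s ρ P₀ ω (m + 1)).V =
        cayley (-genV ω (kam s ρ P₀ ω m).Λ (ρ m) (kam s ρ P₀ ω m).P θ) *
          evX s θ (kam s ρ P₀ ω m).V :=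
  ⟨evX_newU hα (S.par m) (kam_stepAt hα S hP (goodInf_mem hω _)) S.hs.le (S.hsρ _) hθ _,
    evX_newV hα (S.par m) (kam_stepAt hα S hP (goodInf_mem hω _)) S.hs.le (S.hsρ _) hθ _⟩

theorem evX_kam_zero {θ : Fin n → ℂ} (hθ : θ ∈ cstrip n s) :
    evX s θ (kam s ρ P₀ ω 0).U = 1 ∧ evX s θ (kam s ρ P₀ ω 0).V = 1 :=
  ⟨evX_incl_zero s hθ _, evX_incl_zero s hθ _⟩

theorem norm_genV_kam (hα : α ∈ Set.Ioc (0 : ℝ) 1) (S : Sched γ δ ρ e s g E)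
    (hP : InitOK (ρ 0) (e 0) P₀) (hω : ω ∈ goodInf γ δ s ρ P₀) {θ : Fin n → ℂ}
    (hθ : θ ∈ cstrip n s) (m : ℕ) :
    ‖genV ω (kam s ρ P₀ ω m).Λ (ρ m) (kam s ρ P₀ ω m).P θ‖ < 1 := by
  have := norm_genV_le hα (S.par m) (kam_stepAt hα S hP (goodInf_mem hω _))
    (cstrip_mono (S.hsρ _) hθ)
  have := (S.par m).hg
  linarith

theorem evX_uLim_mul_vLim (hα : α ∈ Set.Ioc (0 : ℝ) 1) (S : Sched γ δ ρ e s g E)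
    (hP : InitOK (ρ 0) (e 0) P₀) (hω : ω ∈ goodInf γ δ s ρ P₀) {θ : Fin n → ℂ}
    (hθ : θ ∈ cstrip n s) :
    evX s θ (uLim s ρ P₀ ω) * evX s θ (vLim s ρ P₀ ω) = 1 ∧
      evX s θ (vLim s ρ P₀ ω) * evX s θ (uLim s ρ P₀ ω) = 1 := by
  have hu := tendsto_evX (tendsto_uLim hα S hP hω) s θ
  have hv := tendsto_evX (tendsto_vLim hα S hP hω) s θ
  have h : ∀ m, evX s θ (kam s ρ P₀ ω m).U * evX s θ (kam s ρ P₀ ω m).V = 1 ∧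
      evX s θ (kam s ρ P₀ ω m).V * evX s θ (kam s ρ P₀ ω m).U = 1 := fun m => by
    induction m with
    | zero => rw [(evX_kam_zero hθ).1, (evX_kam_zero hθ).2]; simp
    | succ m ih =>
      have hn := norm_genV_kam hα S hP hω hθ m
      have h1 := cayley_mul_cayley_neg hn
      have h2 := cayley_mul_cayley_neg (by rwa [← norm_neg] at hn)
      rw [neg_neg] at h2
      obtain ⟨e1, e2⟩ := evX_kam_succ hα S hP hω hθ m
      rw [e1, e2]
      set A := evX s θ (kam s ρ P₀ ω m).U
      set B := evX s θ (kam s ρ P₀ ω m).V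
      set G := genV ω (kam s ρ P₀ ω m).Λ (ρ m) (kam s ρ P₀ ω m).P θ
      constructor
      · calc A * cayley G * (cayley (-G) * B) = A * (cayley G * cayley (-G)) * B := by noncomm_ring
          _ = 1 := by rw [h1, mul_one, ih.1]
      · calc cayley (-G) * B * (A * cayley G) = cayley (-G) * (B * A) * cayley G := by noncomm_ring
          _ = 1 := by rw [ih.2, mul_one, h2]
  exact ⟨tendsto_nhds_unique (hu.mul hv) (tendsto_const_nhds.congr fun m => (h m).1.symm),
    tendsto_nhds_unique (hv.mul hu) (tendsto_const_nhds.congr fun m => (h m).2.symm)⟩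

theorem star_cayley {G : Op} (hG : ‖G‖ < 1) (hs : star G = -G) : star (cayley G) = cayley (-G) := by
  have hG' : ‖-G‖ < 1 := by rwa [norm_neg]
  have h1 := congrArg star (cayley_mul hG)
  rw [star_mul, star_sub, star_add, star_one, hs] at h1
  exact (isUnit_one_sub_of_norm_lt_one hG').mul_left_cancel (h1.trans (mul_cayley hG').symm)

theorem star_evX_uLim (hα : α ∈ Set.Ioc (0 : ℝ) 1) (S : Sched γ δ ρ e s g E)
    (hP : InitOK (ρ 0) (e 0) P₀) (hω : ω ∈ goodInf γ δ s ρ P₀) (x : Fin n → ℝ) :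
    star (evX s (toC x) (uLim s ρ P₀ ω)) = evX s (toC x) (vLim s ρ P₀ ω) := by
  have hθ := toC_mem_cstrip S.hs.le x
  have hu := tendsto_evX (tendsto_uLim hα S hP hω) s (toC x)
  have hv := tendsto_evX (tendsto_vLim hα S hP hω) s (toC x)
  refine tendsto_nhds_unique hu.star (hv.congr fun m => ?_)
  induction m with
  | zero => rw [(evX_kam_zero hθ).1, (evX_kam_zero hθ).2, star_one]
  | succ m ih =>
    obtain ⟨e1, e2⟩ := evX_kam_succ hα S hP hω hθ m
    rw [e1, e2, star_mul, ← ih, star_cayley (norm_genV_kam hα S hP hω hθ m)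
      (star_genV hα (S.par m) (kam_stepAt hα S hP (goodInf_mem hω _))
        (kam_bounds hα S hP m (goodInf_mem hω m)).2.2 x)]

theorem wBd_uLim_sub_one (hα : α ∈ Set.Ioc (0 : ℝ) 1) (S : Sched γ δ ρ e s g E)
    (hP : InitOK (ρ 0) (e 0) P₀) (hω : ω ∈ goodInf γ δ s ρ P₀) {θ : Fin n → ℂ}
    (hθ : θ ∈ cstrip n s) {p : ℝ} (hp : p ∈ Set.Icc (0 : ℝ) 2) :
    WBd p (evX s θ (uLim s ρ P₀ ω) - 1) (16 * g) ∧
      WBd p (evX s θ (vLim s ρ P₀ ω) - 1) (16 * g) := by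
  have hu := (tendsto_evX (tendsto_uLim hα S hP hω) s θ).sub_const 1
  have hv := (tendsto_evX (tendsto_vLim hα S hP hω) s θ).sub_const 1
  have hcay : ∀ m, WBd p (cayley (genV ω (kam s ρ P₀ ω m).Λ (ρ m) (kam s ρ P₀ ω m).P θ) - 1)
      (4 * gcon (γ m) (δ m) (e m)) ∧
      WBd p (cayley (-genV ω (kam s ρ P₀ ω m).Λ (ρ m) (kam s ρ P₀ ω m).P θ) - 1)
      (4 * gcon (γ m) (δ m) (e m)) := fun m => by
    have hn := norm_genV_kam hα S hP hω hθ m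
    have hw := wBd_genV hα (S.par m) (kam_stepAt hα S hP (goodInf_mem hω _))
      (cstrip_mono (S.hsρ _) hθ) hp
    have hw' := hw.smul (-1)
    rw [neg_one_smul, norm_neg, norm_one, one_mul] at hw'
    exact ⟨hw.cayley_sub_one hn (S.par m).gcon_nonneg (S.par m).hg,
      hw'.cayley_sub_one (by rwa [norm_neg]) (S.par m).gcon_nonneg (S.par m).hg⟩
  have hb : ∀ m : ℕ, 0 ≤ 16 * g * (1 - (1 / 2 : ℝ) ^ m) := fun m =>
    mul_nonneg (mul_nonneg (by norm_num) S.hg0)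
      (sub_nonneg.2 (pow_le_one₀ (by norm_num) (by norm_num)))
  -- The previous bound is at most 1, so one step adds at most 8g 2^{-m}, exactly the increment of
  -- 16g(1 - 2^{-m}).
  have hstep : ∀ m : ℕ, 16 * g * (1 - (1 / 2 : ℝ) ^ m) * (4 * gcon (γ m) (δ m) (e m)) +
      16 * g * (1 - (1 / 2 : ℝ) ^ m) + 4 * gcon (γ m) (δ m) (e m) ≤
      16 * g * (1 - (1 / 2 : ℝ) ^ (m + 1)) := fun m => by
    have h2 : (0 : ℝ) < (1 / 2) ^ m := by positivity
    have h3 := S.geo m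
    have h4 := (S.par m).gcon_nonneg
    have h5 : 16 * g * (1 - (1 / 2 : ℝ) ^ m) ≤ 1 := by nlinarith [S.hg, S.hg0]
    rw [pow_succ]
    nlinarith [mul_le_mul_of_nonneg_right h5 h4]
  have h : ∀ m, WBd p (evX s θ (kam s ρ P₀ ω m).U - 1) (16 * g * (1 - (1 / 2) ^ m)) ∧
      WBd p (evX s θ (kam s ρ P₀ ω m).V - 1) (16 * g * (1 - (1 / 2) ^ m)) := fun m => by
    induction m with
    | zero =>
      rw [(evX_kam_zero hθ).1, (evX_kam_zero hθ).2]
      simpa using WBd.zero p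
    | succ m ih =>
      obtain ⟨e1, e2⟩ := evX_kam_succ hα S hP hω hθ m
      rw [e1, e2]
      refine ⟨(WBd.mul_sub_one (hb m) ih.1 (hcay m).1).mono (hstep m),
        (WBd.mul_sub_one (mul_nonneg (by norm_num) (S.par m).gcon_nonneg)
          (hcay m).2 ih.2).mono (le_trans (le_of_eq (by ring)) (hstep m))⟩
  have hle : ∀ m : ℕ, 16 * g * (1 - (1 / 2 : ℝ) ^ m) ≤ 16 * g := fun m => by
    have h2 : (0 : ℝ) < (1 / 2) ^ m := by positivity
    nlinarith [S.hg0]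
  exact ⟨WBd.of_tendsto (fun m => (h m).1.mono (hle m)) hu,
    WBd.of_tendsto (fun m => (h m).2.mono (hle m)) hv⟩

/-- Pass to the limit in the invariant of `comm_newU`: the remaining perturbation has norm at most e
m, which tends to 0. -/
theorem comm_uLim (hα : α ∈ Set.Ioc (0 : ℝ) 1) (S : Sched γ δ ρ e s g E)
    (hP : InitOK (ρ 0) (e 0) P₀) (hω : ω ∈ goodInf γ δ s ρ P₀) (t : ℝ) :
    Comm lam (lamOf (lamLim s ρ P₀ ω)) (evX s (toC (t • ω)) (uLim s ρ P₀ ω))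
      (Complex.I • devX S.hs ω t (uLim s ρ P₀ ω) -
        (evX (ρ 0) (toC (t • ω)) (P₀ ω)).op * evX s (toC (t • ω)) (uLim s ρ P₀ ω)) := by
  set θ := toC (t • ω) with hθd
  have hθ : θ ∈ cstrip n s := toC_mem_cstrip S.hs.le _
  have hu := tendsto_evX (tendsto_uLim hα S hP hω) s θ
  have hdu := ((devX S.hs ω t : X n Op →L[ℂ] Op).continuous.tendsto _).comp
    (tendsto_uLim hα S hP hω)
  set P₁ := (evX (ρ 0) θ (P₀ ω)).op
  have h : ∀ m, Comm lam (lamOf (kam s ρ P₀ ω m).Λ) (evX s θ (kam s ρ P₀ ω m).U)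
      (Complex.I • devX S.hs ω t (kam s ρ P₀ ω m).U - P₁ * evX s θ (kam s ρ P₀ ω m).U +
        evX s θ (kam s ρ P₀ ω m).U * (evX (ρ m) θ (kam s ρ P₀ ω m).P).op) := fun m => by
    induction m with
    | zero =>
      rw [(evX_kam_zero hθ).1, mul_one, one_mul]
      have h0 : devX S.hs ω t (kam s ρ P₀ ω 0).U = 0 := by
        have : (kam s ρ P₀ ω 0).U = incl 0 1 := rfl
        rw [this, devX_incl]
        simp [freq]
      have h1 : lamOf (kam s ρ P₀ ω 0).Λ = lam := by
        funext i; simp [kam, lamOf, entry]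
      rw [h0, h1, smul_zero, zero_sub]
      have : -P₁ + (evX (ρ 0) θ (kam s ρ P₀ ω 0).P).op = 0 := neg_add_cancel _
      rw [this]
      exact Comm.one _
    | succ m ih =>
      exact comm_newU hα (S.par m) (kam_stepAt hα S hP (goodInf_mem hω _))
        (kam_bounds hα S hP m (goodInf_mem hω m)).2.2 S.hs (S.hsρ _) ih
  have hp0 : Filter.Tendsto (fun m => (evX (ρ m) θ (kam s ρ P₀ ω m).P).op) Filter.atTop
      (nhds 0) := by
    refine squeeze_zero_norm (fun m => ?_) S.summ.summable.tendsto_atTop_zero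
    refine (Mhat.norm_op_le _).trans ?_
    have h1 : ‖evX (ρ m) θ (kam s ρ P₀ ω m).P‖ ≤ 1 * ‖(kam s ρ P₀ ω m).P‖ :=
      ContinuousLinearMap.le_of_opNorm_le _ (norm_evX_le _ _) _
    rw [one_mul] at h1
    exact h1.trans (kam_bounds hα S hP m (goodInf_mem hω m)).1
  refine Comm.of_tendsto (l := Filter.atTop) h hu ?_ fun j => ?_
  · have := ((hdu.const_smul Complex.I).sub (hu.const_mul P₁)).add (hu.mul hp0)
    rw [mul_zero, add_zero] at this
    exact this
  · have h2 : Filter.Tendsto (fun m => entry ((kam s ρ P₀ ω m).Λ).op j j) Filter.atTop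
        (nhds (entry (lamLim s ρ P₀ ω).op j j)) :=
      (((entryCLM j j).comp Mhat.opCLM).continuous.tendsto _).comp (tendsto_lamLim hα S hP hω)
    exact ((Complex.continuous_re.tendsto _).comp h2).const_add (lam j)

end iteration

/-! ### Transfer of solutions -/

theorem norm_sum_entry_mul_le (Z : Op) (u : Ell2) (i N : ℕ) :
    ‖∑ j ∈ Finset.range N, entry Z i j * u j‖ ≤ ‖Z‖ * ‖u‖ := by
  have h1 : ‖∑ j ∈ Finset.range N, entry Z i j * u j‖ₑ ≤ ‖Z‖ₑ * ‖u‖ₑ := by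
    calc _ ≤ ∑ j ∈ Finset.range N, ‖entry Z i j * u j‖ₑ := enorm_sum_le _ _
      _ ≤ ∑' j, ‖entry Z i j‖ₑ * ‖u j‖ₑ := by
        simp only [enorm_mul]; exact ENNReal.sum_le_tsum _
      _ ≤ _ := tsum_mul_le_of_sq (tsum_row_le Z i) (tsum_enorm_sq u).le
  rw [← ofReal_norm, ← ofReal_norm Z, ← ofReal_norm u, ← ENNReal.ofReal_mul (norm_nonneg _)] at h1
  exact (ENNReal.ofReal_le_ofReal_iff (by positivity)).1 h1

/-- The derivatives converge pointwise under a continuous bound, with no uniformity in t assumed.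
Dominated convergence gives the integral equation for f, and continuity of h gives the derivative
back. -/
theorem hasDerivAt_of_sums {f h : ℝ → ℂ} {F H : ℕ → ℝ → ℂ} {b : ℝ → ℝ}
    (hF : ∀ N t, HasDerivAt (F N) (H N t) t) (hH : ∀ N, Continuous (H N)) (hc : Continuous h)
    (hb : Continuous b) (hbd : ∀ N t, ‖H N t‖ ≤ b t)
    (hf : ∀ t, Filter.Tendsto (fun N => F N t) Filter.atTop (nhds (f t)))
    (hh : ∀ t, Filter.Tendsto (fun N => H N t) Filter.atTop (nhds (h t))) (t : ℝ) :
    HasDerivAt f (h t) t := by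
  have h1 : ∀ r, f r = f 0 + ∫ τ in (0 : ℝ)..r, h τ := fun r => by
    have e1 : ∀ N, ∫ τ in (0 : ℝ)..r, H N τ = F N r - F N 0 := fun N =>
      intervalIntegral.integral_eq_sub_of_hasDerivAt (fun x _ => hF N x)
        ((hH N).intervalIntegrable 0 r)
    have e2 : Filter.Tendsto (fun N => ∫ τ in (0 : ℝ)..r, H N τ) Filter.atTop
        (nhds (∫ τ in (0 : ℝ)..r, h τ)) :=
      intervalIntegral.tendsto_integral_filter_of_dominated_convergence b
        (Filter.Eventually.of_forall fun N => (hH N).aestronglyMeasurable)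
        (Filter.Eventually.of_forall fun N => Filter.Eventually.of_forall fun x _ => hbd N x)
        (hb.intervalIntegrable 0 r) (Filter.Eventually.of_forall fun x _ => hh x)
    have e3 := tendsto_nhds_unique e2 (((hf r).sub (hf 0)).congr fun N => (e1 N).symm)
    rw [e3]; ring
  rw [show f = fun r => f 0 + ∫ τ in (0 : ℝ)..r, h τ from funext h1]
  exact ((hc.integral_hasStrictDerivAt 0 t).hasDerivAt).const_add _

/-- Differentiating X_ij y_j produces b_j X_ij y_j with b_j possibly unbounded. The commutation
relation trades it for a_i X_ij y_j, with i fixed, plus entries of bounded operators, so the sum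
over j can be differentiated term by term. -/
theorem isSolution_of_comm {a b : ℕ → ℝ} {X X' A B : ℝ → Op} (hX : ∀ t, HasDerivAt X (X' t) t)
    (hA : Continuous A) (hB : Continuous B)
    (hc : ∀ t, Comm a b (X t) (Complex.I • X' t - A t * X t + X t * B t)) {y : ℝ → Ell2}
    (hy : IsSolution b B y) : IsSolution a A fun t => X t (y t) := by
  have hXc : Continuous X := continuous_iff_continuousAt.2 fun t => (hX t).continuousAt
  obtain ⟨hyc, hyd⟩ := hy
  choose y' hy' hye using hyd
  have hentry : ∀ {Z : ℝ → Op}, Continuous Z → ∀ i j, Continuous fun t => entry (Z t) i j :=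
    fun {Z} hZ i j => (entryCLM i j).continuous.comp hZ
  have hcoord : ∀ {z : ℝ → Ell2}, Continuous z → ∀ j, Continuous fun t => z t j :=
    fun {z} hz j => (coord j).continuous.comp hz
  have hBy : Continuous fun t => B t (y t) := hB.clm_apply hyc
  have hXy : Continuous fun t => X t (y t) := hXc.clm_apply hyc
  have hAX : Continuous fun t => A t * X t := hA.mul hXc
  have hXB : Continuous fun t => X t * B t := hXc.mul hB
  refine ⟨hXy, fun t i => ?_⟩
  set T : ℕ → ℝ → ℂ := fun j t => -Complex.I * ((a i : ℂ) * (entry (X t) i j * y t j) +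
    entry (A t * X t) i j * y t j - entry (X t * B t) i j * y t j +
    entry (X t) i j * (B t (y t)) j) with hT
  set h : ℝ → ℂ := fun t => -Complex.I * ((a i : ℂ) * (X t (y t)) i + ((A t * X t) (y t)) i -
    ((X t * B t) (y t)) i + (X t (B t (y t))) i) with hh
  have hTd : ∀ j t, HasDerivAt (fun r => entry (X r) i j * y r j) (T j t) t := fun j t => by
    have h1 : HasDerivAt (fun r => entry (X r) i j) (entry (X' t) i j) t :=
      ((entryCLM i j).restrictScalars ℝ).hasFDerivAt.comp_hasDerivAt t (hX t)
    refine (h1.mul (hy' t j)).congr_deriv ?_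
    have h2 := hc t i j
    rw [entry_add, entry_sub, entry_smul] at h2
    have h3 := hye t j
    simp only [hT]
    push_cast at h2
    linear_combination (Complex.I * y t j) * h2 - Complex.I * entry (X t) i j * h3 +
      (entry (X' t) i j * y t j + entry (X t) i j * y' t j) * Complex.I_sq
  have hTs : ∀ t, HasSum (fun j => T j t) (h t) := fun t =>
    (((((hasSum_entry_mul (X t) (y t) i).mul_left _).add
      (hasSum_entry_mul (A t * X t) (y t) i)).sub
      (hasSum_entry_mul (X t * B t) (y t) i)).add
      (hasSum_entry_mul (X t) (B t (y t)) i)).mul_left _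
  refine ⟨h t, hasDerivAt_of_sums (f := fun t => (X t (y t)) i) (h := h)
    (F := fun N t => ∑ j ∈ Finset.range N, entry (X t) i j * y t j)
    (H := fun N t => ∑ j ∈ Finset.range N, T j t)
    (b := fun t => |a i| * (‖X t‖ * ‖y t‖) + ‖A t * X t‖ * ‖y t‖ + ‖X t * B t‖ * ‖y t‖ +
      ‖X t‖ * ‖B t (y t)‖)
    (fun N t => HasDerivAt.fun_sum fun j _ => hTd j t) (fun N => ?_) ?_ ?_ (fun N t => ?_)
    (fun t => (hasSum_entry_mul (X t) (y t) i).tendsto_sum_nat)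
    (fun t => (hTs t).tendsto_sum_nat) t, ?_⟩
  · refine continuous_finsetSum _ fun j _ => ?_
    exact continuous_const.mul ((((continuous_const.mul ((hentry hXc i j).mul (hcoord hyc j))).add
      ((hentry hAX i j).mul (hcoord hyc j))).sub ((hentry hXB i j).mul (hcoord hyc j))).add
      ((hentry hXc i j).mul (hcoord hBy j)))
  · exact continuous_const.mul ((((continuous_const.mul (hcoord hXy i)).add
      (hcoord (hAX.clm_apply hyc) i)).sub (hcoord (hXB.clm_apply hyc) i)).add
      (hcoord (hXc.clm_apply hBy) i))
  · exact (((continuous_const.mul (hXc.norm.mul hyc.norm)).add (hAX.norm.mul hyc.norm)).add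
      (hXB.norm.mul hyc.norm)).add (hXc.norm.mul hBy.norm)
  · simp only [hT, ← Finset.mul_sum, Finset.sum_add_distrib, Finset.sum_sub_distrib]
    rw [norm_mul, norm_neg, Complex.norm_I, one_mul]
    refine (norm_add_le _ _).trans (add_le_add ((norm_sub_le _ _).trans (add_le_add
      ((norm_add_le _ _).trans (add_le_add ?_ ?_)) ?_)) ?_)
    · rw [norm_mul, Complex.norm_real, Real.norm_eq_abs]
      gcongr
      exact norm_sum_entry_mul_le _ _ _ _
    all_goals exact norm_sum_entry_mul_le _ _ _ _
  · simp only [hh]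
    have e1 : ((A t * X t) (y t)) i = (A t (X t (y t))) i := rfl
    have e2 : ((X t * B t) (y t)) i = (X t (B t (y t))) i := rfl
    rw [e1, e2]
    linear_combination (-((a i : ℂ) * (X t (y t)) i + (A t (X t (y t))) i)) * Complex.I_sq

theorem Comm.star {a b : ℕ → ℝ} {X K : Op} (h : Comm a b X K) : Comm b a (star X) (-star K) := by
  intro i j
  have h1 := congrArg (starRingEnd ℂ) (h j i)
  rw [map_mul, Complex.conj_ofReal] at h1
  rw [entry_neg, entry_star, entry_star, ← h1]
  push_cast
  ring

theorem hasDerivAt_star_op {f : ℝ → Op} {f' : Op} {t : ℝ} (h : HasDerivAt f f' t) :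
    HasDerivAt (fun r => star (f r)) (star f') t := by
  have : StarModule ℝ Op := ⟨fun r A => by
    have e : ∀ (c : ℝ) (B : Op), c • B = (c : ℂ) • B := fun c B =>
      (algebraMap_smul ℂ c B).symm
    rw [e, star_smul, ← starRingEnd_apply, Complex.conj_ofReal, e]
    rfl⟩
  have h1 : HasFDerivAt (fun A : Op => star A) ((starL' ℝ : Op ≃L[ℝ] Op) : Op →L[ℝ] Op) (f t) :=
    (starL' ℝ : Op ≃L[ℝ] Op).hasFDerivAt
  exact h1.comp_hasDerivAt t h

/-- The adjoint relation has the same form with the two systems exchanged because A is self-adjoint;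
for the converse, apply the transfer to X*, which undoes X. -/
theorem isSolution_iff_of_comm {a b : ℕ → ℝ} {X X' A : ℝ → Op}
    (hX : ∀ t, HasDerivAt X (X' t) t) (hA : Continuous A) (hAs : ∀ t, IsSelfAdjoint (A t))
    (hc : ∀ t, Comm a b (X t) (Complex.I • X' t - A t * X t)) (hu : ∀ t, star (X t) * X t = 1)
    (y : ℝ → Ell2) : IsSolution a A (fun t => X t (y t)) ↔ IsSolution b 0 y := by
  constructor
  · intro h
    have h1 := isSolution_of_comm (X := fun t => star (X t)) (X' := fun t => star (X' t))
      (A := 0) (B := A) (b := a) (a := b) (fun t => hasDerivAt_star_op (hX t)) continuous_const hA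
      (fun t => by
        have := (hc t).star
        simp only [star_sub, star_smul, star_mul, (hAs t).star_eq] at this
        refine (congrArg (Comm _ _ _) ?_).mp this
        rw [← starRingEnd_apply, Complex.conj_I]
        simp [add_comm]) h
    have h2 : (fun t => star (X t) (X t (y t))) = y := funext fun t => by
      have := congrArg (fun Z : Op => Z (y t)) (hu t)
      exact this
    rwa [h2] at h1
  · intro h
    exact isSolution_of_comm hX hA (B := 0) continuous_const (fun t => by
      simpa using hc t) h

/-! ### Measure estimates -/

open MeasureTheory

theorem measurableSet_freqBox (n : ℕ) : MeasurableSet (freqBox n) :=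
  MeasurableSet.univ_pi fun _ => measurableSet_Ico

theorem volume_freqBox (n : ℕ) : volume (freqBox n) = ENNReal.ofReal (2 * Real.pi) ^ n := by
  rw [freqBox, volume_pi_pi]
  simp

/-- Fubini in the j-th coordinate: two points of one slice satisfy |a - b|/2 ≤ 2η, so the slice has
diameter at most 4η. -/
theorem volume_slab_succ_le {n : ℕ} {f : (Fin (n + 1) → ℝ) → ℝ} (hf : Continuous f)
    (j : Fin (n + 1)) (hs : ∀ (y : Fin n → ℝ) (a b : ℝ),
      1 / 2 * |a - b| ≤ |f (j.insertNth a y) - f (j.insertNth b y)|) (η : ℝ) :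
    volume (freqBox (n + 1) ∩ {ω | |f ω| < η}) ≤
      ENNReal.ofReal (4 * η) * ENNReal.ofReal (2 * Real.pi) ^ n := by
  have hmp := (volume_preserving_piFinSuccAbove (fun _ : Fin (n + 1) => ℝ) j).symm
  have hmeas : MeasurableSet (freqBox (n + 1) ∩ {ω | |f ω| < η}) :=
    (measurableSet_freqBox _).inter (isOpen_lt hf.abs continuous_const).measurableSet
  rw [← hmp.measure_preimage hmeas.nullMeasurableSet]
  set T := (MeasurableEquiv.piFinSuccAbove (fun _ : Fin (n + 1) => ℝ) j).symm ⁻¹'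
    (freqBox (n + 1) ∩ {ω | |f ω| < η}) with hT
  have hTm : MeasurableSet T := (MeasurableEquiv.measurable _) hmeas
  have hmem : ∀ (a : ℝ) (y : Fin n → ℝ), (a, y) ∈ T →
      y ∈ freqBox n ∧ |f (j.insertNth a y)| < η := fun a y h => by
    refine ⟨fun i _ => ?_, h.2⟩
    have := h.1 (j.succAbove i) (Set.mem_univ _)
    have e : (MeasurableEquiv.piFinSuccAbove (fun _ : Fin (n + 1) => ℝ) j).symm (a, y)
      (j.succAbove i) = y i := Fin.insertNth_apply_succAbove (α := fun _ => ℝ) j a y i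
    rwa [e] at this
  rw [Measure.volume_eq_prod, Measure.prod_apply_symm hTm]
  calc _ ≤ ∫⁻ y : Fin n → ℝ, (freqBox n).indicator (fun _ => ENNReal.ofReal (4 * η)) y := by
        refine lintegral_mono fun y => ?_
        by_cases hy : y ∈ freqBox n
        · rw [Set.indicator_of_mem hy]
          refine (Real.volume_le_diam _).trans (Metric.ediam_le fun a ha b hb => ?_)
          have h1 := (hmem a y ha).2
          have h2 := (hmem b y hb).2
          have h3 := hs y a b
          have h4 := abs_sub (f (j.insertNth a y)) (f (j.insertNth b y))
          rw [edist_dist, Real.dist_eq]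
          exact ENNReal.ofReal_le_ofReal (by linarith)
        · rw [Set.indicator_of_notMem hy]
          have : (fun x => (x, y)) ⁻¹' T = ∅ :=
            Set.eq_empty_of_forall_notMem fun a ha => hy (hmem a y ha).1
          rw [this, measure_empty]
    _ = _ := by
        rw [lintegral_indicator (measurableSet_freqBox n), setLIntegral_const, volume_freqBox]

theorem freq_insertNth_sub {n : ℕ} (k : Idx (n + 1)) (j : Fin (n + 1)) (y : Fin n → ℝ) (a b : ℝ) :
    freq k (j.insertNth a y) - freq k (j.insertNth b y) = (k j : ℝ) * (a - b) := by
  simp only [freq, Fin.sum_univ_succAbove _ j, Fin.insertNth_apply_same,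
    Fin.insertNth_apply_succAbove]
  ring

/-- Some k_j is a nonzero integer, so k·ω has slope at least 1 in that direction and the Lipschitz
perturbation can destroy at most half of it. -/
theorem volume_slab_le {n : ℕ} (hn : 1 ≤ n) {k : Idx n} (hk : k ≠ 0) {h : (Fin n → ℝ) → ℝ}
    {K : NNReal} (hK : (K : ℝ) ≤ 1 / 2) (hh : LipschitzWith K h) (η : ℝ) :
    volume (freqBox n ∩ {ω | |freq k ω + h ω| < η}) ≤
      ENNReal.ofReal (4 * η) * ENNReal.ofReal (2 * Real.pi) ^ (n - 1) := by
  obtain ⟨n, rfl⟩ : ∃ m, n = m + 1 := ⟨n - 1, by omega⟩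
  obtain ⟨j, hj⟩ : ∃ j, k j ≠ 0 := by
    by_contra! hc; exact hk (funext hc)
  have hfc : Continuous fun ω : Fin (n + 1) → ℝ => freq k ω := by unfold freq; fun_prop
  refine volume_slab_succ_le (hfc.add hh.continuous) j (fun y a b => ?_) η
  have h1 : |h (j.insertNth a y) - h (j.insertNth b y)| ≤ 1 / 2 * |a - b| := by
    have e1 := hh.dist_le_mul (j.insertNth a y) (j.insertNth b y)
    rw [Real.dist_eq] at e1
    have e2 : dist (j.insertNth a y : Fin (n + 1) → ℝ) (j.insertNth b y) ≤ |a - b| := by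
      refine (dist_pi_le_iff (abs_nonneg _)).2 fun i => ?_
      refine Fin.succAboveCases j ?_ (fun i => ?_) i
      · simp [Real.dist_eq]
      · simp
    exact e1.trans (mul_le_mul hK e2 dist_nonneg (by norm_num))
  have h2 : |a - b| ≤ |(k j : ℝ) * (a - b)| := by
    rw [abs_mul]
    refine le_mul_of_one_le_left (abs_nonneg _) ?_
    exact_mod_cast Int.one_le_abs hj
  have h3 : freq k (j.insertNth a y) + h (j.insertNth a y) -
      (freq k (j.insertNth b y) + h (j.insertNth b y)) =
      (k j : ℝ) * (a - b) - -(h (j.insertNth a y) - h (j.insertNth b y)) := by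
    rw [← freq_insertNth_sub k j y]; ring
  simp only [Pi.add_apply]
  rw [h3]
  have h4 := abs_sub_abs_le_abs_sub ((k j : ℝ) * (a - b))
    (-(h (j.insertNth a y) - h (j.insertNth b y)))
  rw [abs_neg] at h4
  linarith

/-! ### Sums over the Fourier indices -/

theorem tsum_pi_prod (f : ℤ → ℝ≥0∞) (n : ℕ) :
    ∑' k : Fin n → ℤ, ∏ j, f (k j) = (∑' z, f z) ^ n := by
  induction n with
  | zero => simp
  | succ n ih =>
    rw [← (Fin.consEquiv fun _ => ℤ).tsum_eq, ENNReal.tsum_prod', pow_succ', ← ih,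
      ← ENNReal.tsum_mul_right]
    refine tsum_congr fun z => ?_
    rw [← ENNReal.tsum_mul_left]
    refine tsum_congr fun k => ?_
    rw [Fin.prod_univ_succ]
    rfl

theorem tsum_exp_abs_le {c : ℝ} (hc : 0 < c) (hc1 : c ≤ 1) :
    ∑' z : ℤ, ENNReal.ofReal (Real.exp (-(c * |(z : ℝ)|))) ≤ ENNReal.ofReal (4 / c) := by
  have hx1 : Real.exp (-c) < 1 := by rw [Real.exp_lt_one_iff]; linarith
  have hgeo : HasSum (fun m : ℕ => Real.exp (-c) ^ m) (1 - Real.exp (-c))⁻¹ :=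
    hasSum_geometric_of_lt_one (Real.exp_pos _).le hx1
  have hinv : (1 - Real.exp (-c))⁻¹ ≤ 2 / c := by
    have h1 : Real.exp (-c) ≤ (1 + c)⁻¹ := by
      rw [Real.exp_neg]
      gcongr
      linarith [Real.add_one_le_exp c]
    have h2 : c / 2 ≤ 1 - Real.exp (-c) := by
      have : c / 2 ≤ 1 - (1 + c)⁻¹ := by
        rw [le_sub_iff_add_le, ← le_sub_iff_add_le', inv_le_iff_one_le_mul₀ (by linarith)]
        nlinarith
      linarith
    calc _ ≤ (c / 2)⁻¹ := by gcongr
      _ = _ := by rw [inv_div]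
  have hsum : ∑' m : ℕ, ENNReal.ofReal (Real.exp (-c) ^ m) ≤ ENNReal.ofReal (2 / c) := by
    rw [← ENNReal.ofReal_tsum_of_nonneg (fun m => by positivity) hgeo.summable, hgeo.tsum_eq]
    exact ENNReal.ofReal_le_ofReal hinv
  have h1 : ∀ m : ℕ, ENNReal.ofReal (Real.exp (-(c * |((m : ℤ) : ℝ)|))) =
      ENNReal.ofReal (Real.exp (-c) ^ m) := fun m => by
    rw [← Real.exp_nat_mul, Int.cast_natCast, abs_of_nonneg (Nat.cast_nonneg m)]
    congr 2; ring
  have h2 : ∀ m : ℕ, ENNReal.ofReal (Real.exp (-(c * |((-((m : ℤ) + 1) : ℤ) : ℝ)|))) ≤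
      ENNReal.ofReal (Real.exp (-c) ^ m) := fun m => by
    rw [← Real.exp_nat_mul]
    refine ENNReal.ofReal_le_ofReal (Real.exp_le_exp.2 ?_)
    push_cast
    rw [abs_neg, abs_of_nonneg (by positivity)]
    nlinarith
  have hS := HasSum.of_nat_of_neg_add_one
    (f := fun z : ℤ => ENNReal.ofReal (Real.exp (-(c * |(z : ℝ)|))))
    ENNReal.summable.hasSum ENNReal.summable.hasSum
  rw [hS.tsum_eq]
  calc _ ≤ ENNReal.ofReal (2 / c) + ENNReal.ofReal (2 / c) := by
        refine add_le_add (le_trans (le_of_eq (tsum_congr h1)) hsum)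
          ((ENNReal.tsum_le_tsum h2).trans hsum)
    _ = _ := by
        rw [← ENNReal.ofReal_add (by positivity) (by positivity)]
        congr 1; ring

theorem tsum_exp_kn_le (n : ℕ) {c : ℝ} (hc : 0 < c) (hc1 : c ≤ 1) :
    ∑' k : Idx n, ENNReal.ofReal (Real.exp (-(c * kn k))) ≤ ENNReal.ofReal ((4 / c) ^ n) := by
  have h : ∀ k : Idx n, ENNReal.ofReal (Real.exp (-(c * kn k))) =
      ∏ j, ENNReal.ofReal (Real.exp (-(c * |(k j : ℝ)|))) := fun k => by
    rw [← ENNReal.ofReal_prod_of_nonneg fun j _ => (Real.exp_pos _).le, ← Real.exp_sum, kn,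
      Finset.mul_sum, Finset.sum_neg_distrib]
  simp only [h]
  rw [tsum_pi_prod (fun z : ℤ => ENNReal.ofReal (Real.exp (-(c * |(z : ℝ)|)))),
    ENNReal.ofReal_pow (by positivity)]
  gcongr
  exact tsum_exp_abs_le hc hc1

theorem tsum_sq_exp_kn_le (n : ℕ) {c : ℝ} (hc : 0 < c) (hc1 : c ≤ 1) :
    ∑' k : Idx n, ENNReal.ofReal (kn k ^ 2 * Real.exp (-(2 * c * kn k))) ≤
      ENNReal.ofReal (2 / c ^ 2 * (4 / c) ^ n) := by
  rw [ENNReal.ofReal_mul (by positivity)]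
  refine le_trans ?_ (mul_le_mul_right (tsum_exp_kn_le n hc hc1) _)
  rw [← ENNReal.tsum_mul_left]
  refine ENNReal.tsum_le_tsum fun k => ?_
  rw [← ENNReal.ofReal_mul (by positivity)]
  refine ENNReal.ofReal_le_ofReal ?_
  have hk := mul_nonneg hc.le (kn_nonneg k)
  have h1 : (c * kn k) ^ 2 / 2 ≤ Real.exp (c * kn k) := by
    have := Real.pow_div_factorial_le_exp _ hk 2
    simpa using this
  have h2 : Real.exp (-(2 * c * kn k)) = Real.exp (-(c * kn k)) * Real.exp (-(c * kn k)) := by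
    rw [← Real.exp_add]; congr 1; ring
  have h3 : Real.exp (c * kn k) * Real.exp (-(c * kn k)) = 1 := by
    rw [← Real.exp_add]; simp
  rw [h2, ← mul_assoc]
  gcongr
  calc kn k ^ 2 * Real.exp (-(c * kn k))
      = 2 / c ^ 2 * ((c * kn k) ^ 2 / 2) * Real.exp (-(c * kn k)) := by field_simp
    _ ≤ 2 / c ^ 2 * Real.exp (c * kn k) * Real.exp (-(c * kn k)) := by gcongr
    _ = _ := by rw [mul_assoc, h3, mul_one]

section resonances

variable {n : ℕ} {α : ℝ}

/-- Telescoping along the diagonal: m differences, each at most ‖Λ‖ divided by the weight at l. This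
is the only asymptotic information about the eigenvalues used in the measure estimate. -/
theorem minW_mul_abs_re_sub_le (hα : 0 ≤ α) (Λ : Mhat α) (l m : ℕ) :
    minW α l l * |(entry Λ.op (l + m) (l + m)).re - (entry Λ.op l l).re| ≤ m * ‖Λ‖ := by
  induction m with
  | zero => simp
  | succ m ih =>
    have h1 : minW α l l * |(diffEntry Λ.op (l + m) (l + m)).re| ≤ ‖Λ‖ := by
      refine le_trans ?_ (norm_diffEntry_le Λ (l + m) (l + m))
      exact mul_le_mul (minW_mono hα (by simp)) (Complex.abs_re_le_norm _)
        (abs_nonneg _) (minW_pos α _ _).le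
    have h2 : (entry Λ.op (l + (m + 1)) (l + (m + 1))).re - (entry Λ.op l l).re =
        (diffEntry Λ.op (l + m) (l + m)).re +
          ((entry Λ.op (l + m) (l + m)).re - (entry Λ.op l l).re) := by
      rw [diffEntry, Complex.sub_re, ← add_assoc]; ring
    rw [h2]
    calc _ ≤ minW α l l * (|(diffEntry Λ.op (l + m) (l + m)).re| +
          |(entry Λ.op (l + m) (l + m)).re - (entry Λ.op l l).re|) :=
          mul_le_mul_of_nonneg_left (abs_add_le _ _) (minW_pos α l l).le
      _ ≤ _ := by rw [mul_add]; push_cast; linarith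

/-- A natural number bounding the number of relevant differences `i - j`. -/
def resN (k : Idx n) : ℕ := 8 * ∑ j, (k j).natAbs

theorem resN_eq (k : Idx n) : (resN k : ℝ) = 8 * kn k := by
  simp [resN, kn, Nat.cast_natAbs]

theorem one_le_kn {k : Idx n} (hk : k ≠ 0) : 1 ≤ kn k := by
  obtain ⟨j, hj⟩ : ∃ j, k j ≠ 0 := by
    by_contra! hc; exact hk (funext hc)
  have h1 : (1 : ℝ) ≤ |(k j : ℝ)| := by exact_mod_cast Int.one_le_abs hj
  exact h1.trans (Finset.single_le_sum (f := fun j => |(k j : ℝ)|) (fun _ _ => abs_nonneg _)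
    (Finset.mem_univ j))

theorem abs_freq_le_of_mem {ω : Fin n → ℝ} (hω : ω ∈ freqBox n) (k : Idx n) :
    |freq k ω| ≤ 2 * Real.pi * kn k := by
  refine (abs_freq_le k ω).trans ?_
  rw [mul_comm]
  refine mul_le_mul_of_nonneg_right ((pi_norm_le_iff_of_nonneg (by positivity)).2 fun j => ?_)
    (kn_nonneg k)
  have := hω j (Set.mem_univ j)
  rw [Real.norm_eq_abs, abs_of_nonneg this.1]
  exact this.2.le

theorem dvs_eq (ω : Fin n → ℝ) (Λ : Mhat α) (k : Idx n) (i j : ℕ) :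
    dvs ω Λ k i j = freq k ω + (2 * (((i : ℤ) - j : ℤ) : ℝ) + ((entry Λ.op i i).re -
      (entry Λ.op j j).re)) := by
  simp only [dvs, lamOf, lam]; push_cast; ring

theorem abs_re_entry_le (Λ : Mhat α) (i : ℕ) : |(entry Λ.op i i).re| ≤ ‖Λ‖ :=
  (Complex.abs_re_le_norm _).trans (Mhat.norm_entry_le Λ i i)

/-- A small divisor needs 2|i - j| to be compensated by k·ω, of size at most 2π|k|. For k = 0
nothing can compensate the spectral gap 2. -/
theorem abs_sub_le_of_resonant {γ δ : ℝ} (hγ : 0 < γ) (hγ1 : γ ≤ 1 / 4) (hδ : 0 < δ)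
    {ω : Fin n → ℝ} (hω : ω ∈ freqBox n) {Λ : Mhat α} (hΛ : ‖Λ‖ ≤ 1 / 4) {k : Idx n} {i j : ℕ}
    (hkij : k ≠ 0 ∨ i ≠ j) (h : |dvs ω Λ k i j| < γ * Real.exp (-(δ * kn k)) * dw i j) :
    k ≠ 0 ∧ |(((i : ℤ) - j : ℤ) : ℝ)| ≤ 8 * kn k := by
  have hw : Real.exp (-(δ * kn k)) ≤ 1 :=
    Real.exp_le_one_iff.2 (by nlinarith [kn_nonneg k])
  have hdw : dw i j = 1 + |(((i : ℤ) - j : ℤ) : ℝ)| := by simp [dw]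
  set μ := |(((i : ℤ) - j : ℤ) : ℝ)| with hμ
  have hμ0 : 0 ≤ μ := abs_nonneg _
  have h1 : γ * Real.exp (-(δ * kn k)) * dw i j ≤ 1 / 4 * (1 + μ) := by
    rw [hdw]
    have : γ * Real.exp (-(δ * kn k)) ≤ 1 / 4 * 1 := by gcongr
    nlinarith
  have h2 := abs_freq_le_of_mem hω k
  have h3 : 2 * μ ≤ |dvs ω Λ k i j| + |freq k ω| + 1 / 2 := by
    have e1 : 2 * (((i : ℤ) - j : ℤ) : ℝ) = dvs ω Λ k i j - freq k ω -
        ((entry Λ.op i i).re - (entry Λ.op j j).re) := by rw [dvs_eq]; ring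
    have e2 : 2 * μ = |2 * (((i : ℤ) - j : ℤ) : ℝ)| := by rw [abs_mul, abs_two]
    rw [e2, e1]
    have e3 := abs_sub (dvs ω Λ k i j - freq k ω) ((entry Λ.op i i).re - (entry Λ.op j j).re)
    have e4 := abs_sub (dvs ω Λ k i j) (freq k ω)
    have e5 := abs_sub ((entry Λ.op i i).re) ((entry Λ.op j j).re)
    have e6 := abs_re_entry_le Λ i
    have e7 := abs_re_entry_le Λ j
    linarith
  have hpi := Real.pi_lt_d2
  by_cases hk : k = 0
  · exfalso
    have hij : i ≠ j := by tauto
    have h4 : 1 ≤ μ := by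
      have h5 : ((i : ℤ) - j) ≠ 0 := sub_ne_zero.2 (by exact_mod_cast hij)
      rw [hμ, ← Int.cast_abs, ← Int.cast_one, Int.cast_le]
      exact Int.one_le_abs h5
    rw [hk, kn_zero, mul_zero] at h2
    rw [hk] at h3 h1 h
    linarith
  · refine ⟨hk, ?_⟩
    have := one_le_kn hk
    nlinarith

theorem rpow_neg_half_ceil {x : ℝ} (hx : 0 < x) (hx1 : x ≤ 1) :
    x ^ (-(1 / 2) : ℝ) ≤ ⌈x ^ (-(1 / 2) : ℝ)⌉₊ ∧
      (⌈x ^ (-(1 / 2) : ℝ)⌉₊ : ℝ) * x ≤ 2 * x ^ (1 / 2 : ℝ) := by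
  have h1 : 1 ≤ x ^ (-(1 / 2) : ℝ) := Real.one_le_rpow_of_pos_of_le_one_of_nonpos hx hx1 (by norm_num)
  refine ⟨Nat.le_ceil _, ?_⟩
  have h2 := Nat.ceil_lt_add_one (zero_le_one.trans h1)
  have h3 : x ^ (-(1 / 2) : ℝ) * x = x ^ (1 / 2 : ℝ) := by
    rw [← Real.rpow_add_one hx.ne']; norm_num
  nlinarith

/-- The constant of the measure estimate. -/
def resC (n : ℕ) (α : ℝ) : ℝ :=
  2380 * (2 / (α / 4) ^ 2 * (4 / (α / 4)) ^ n) * (2 * Real.pi) ^ (n - 1)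

/-- For each k and i - j infinitely many pairs may resonate. With x = γ e^{-δ|k|}, pairs with min(i,
j) below about x^{-1/2} get one slab of width O(x|k|) each. For the others the eigenvalue
corrections differ by O(x^{α/2}|k|), so a single slab of that width covers them all. Summing over k
gives γ^{α/2} δ^{-(n+2)}. -/
theorem volume_resonant_le (hn : 1 ≤ n) (hα : α ∈ Set.Ioc (0 : ℝ) 1) {γ δ E : ℝ} (hγ : 0 < γ)
    (hγ1 : γ ≤ 1 / 4) (hδ : 0 < δ) (hδ1 : δ ≤ 1) (hE : E ≤ 1 / 4) {S : Set (Fin n → ℝ)}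
    (hS : S ⊆ freqBox n) {Λ : (Fin n → ℝ) → Mhat α} (hb : ∀ ω ∈ S, ‖Λ ω‖ ≤ E)
    (hl : ∀ ω ∈ S, ∀ ω' ∈ S, ‖Λ ω - Λ ω'‖ ≤ E * ‖ω - ω'‖) :
    volume {ω ∈ S | ¬NonRes γ δ ω (Λ ω)} ≤
      ENNReal.ofReal (resC n α * (δ ^ (n + 2))⁻¹ * γ ^ (α / 2)) := by
  have hlip : ∀ i, LipschitzOnWith (1 / 4) (fun ω => (entry (Λ ω).op i i).re) S := fun i => by
    refine LipschitzOnWith.of_dist_le_mul fun ω hω ω' hω' => ?_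
    rw [Real.dist_eq, dist_eq_norm, ← Complex.sub_re, ← entry_sub, ← map_sub]
    refine (abs_re_entry_le _ i).trans ((hl ω hω ω' hω').trans ?_)
    push_cast
    gcongr
  -- The diagonal is controlled only on `S`. Extending its entries to ℝⁿ makes the resonance zones
  -- honest slabs, and a difference of two entries has Lipschitz constant 1/2, as `volume_slab_le`
  -- allows.
  choose R hR hRe using fun i => (hlip i).extend_real
  set x : Idx n → ℝ := fun k => γ * Real.exp (-(δ * kn k)) with hxd
  have hx0 : ∀ k, 0 < x k := fun k => mul_pos hγ (Real.exp_pos _)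
  have hx1 : ∀ k, x k ≤ 1 := fun k => mul_le_one₀ (by linarith) (Real.exp_pos _).le
    (Real.exp_le_one_iff.2 (by nlinarith [kn_nonneg k]))
  set y : Idx n → ℝ := fun k => x k ^ (α / 2) with hyd
  have hy0 : ∀ k, 0 < y k := fun k => Real.rpow_pos_of_pos (hx0 k) _
  have hxy : ∀ k, x k ≤ y k := fun k => by
    simpa using Real.rpow_le_rpow_of_exponent_ge (hx0 k) (hx1 k)
      (show α / 2 ≤ 1 by linarith [hα.2])
  have hxhy : ∀ k, x k ^ (1 / 2 : ℝ) ≤ y k := fun k =>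
    Real.rpow_le_rpow_of_exponent_ge (hx0 k) (hx1 k) (by linarith [hα.2])
  -- The threshold between the two regimes: L slabs of width O(x) total O(x^{1/2}) ≤ O(y), and
  -- beyond L the weight is at least 1/y.
  set L : Idx n → ℕ := fun k => ⌈x k ^ (-(1 / 2) : ℝ)⌉₊ with hL
  set A : Idx n → ℤ → ℕ → Set (Fin n → ℝ) := fun k m l => freqBox n ∩
    {ω | |freq k ω + (2 * (m : ℝ) + (R (l + m.toNat) ω - R (l + (-m).toNat) ω))| <
      9 * x k * kn k} with hA
  set B : Idx n → ℤ → Set (Fin n → ℝ) := fun k m => freqBox n ∩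
    {ω | |freq k ω + 2 * (m : ℝ)| < 17 * y k * kn k} with hB
  set W : Idx n → Set (Fin n → ℝ) := fun k =>
    ⋃ m ∈ Finset.Icc (-(resN k : ℤ)) (resN k), ((⋃ l ∈ Finset.range (L k), A k m l) ∪ B k m)
    with hW
  have hcover : {ω ∈ S | ¬NonRes γ δ ω (Λ ω)} ⊆ ⋃ k : Idx n, ⋃ _ : k ≠ 0, W k := by
    rintro ω ⟨hωS, hω⟩
    unfold NonRes at hω
    push Not at hω
    obtain ⟨k, i, j, hkij, hlt⟩ := hω
    have hΛ := hb ω hωS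
    obtain ⟨hk, hm⟩ := abs_sub_le_of_resonant hγ hγ1 hδ (hS hωS) (hΛ.trans hE) hkij hlt
    have hk1 := one_le_kn hk
    set m : ℤ := (i : ℤ) - j with hmd
    set l : ℕ := min i j with hld
    have hi : i = l + m.toNat := by omega
    have hj : j = l + (-m).toNat := by omega
    have hdw : dw i j ≤ 9 * kn k := by
      have : dw i j = 1 + |(m : ℝ)| := by simp [dw, hmd]
      rw [this]; linarith
    have hlt' : |dvs ω (Λ ω) k i j| < 9 * x k * kn k := by
      refine hlt.trans_le ?_
      calc _ ≤ x k * (9 * kn k) := mul_le_mul_of_nonneg_left hdw (hx0 k).le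
        _ = _ := by ring
    rw [dvs_eq, ← hmd] at hlt'
    simp only [Set.mem_iUnion]
    refine ⟨k, hk, ?_⟩
    simp only [hW, Set.mem_iUnion]
    refine ⟨m, ?_, ?_⟩
    · rw [Finset.mem_Icc, ← abs_le]
      rw [← resN_eq] at hm
      exact_mod_cast hm
    · by_cases hlL : l < L k
      · left
        simp only [Set.mem_iUnion]
        refine ⟨l, Finset.mem_range.2 hlL, hS hωS, ?_⟩
        have e1 := hRe i hωS
        have e2 := hRe j hωS
        simp only at e1 e2
        rw [Set.mem_ofPred_eq, ← hi, ← hj, ← e1, ← e2]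
        exact hlt'
      · right
        refine ⟨hS hωS, ?_⟩
        rw [Set.mem_ofPred_eq]
        have hd : |(entry (Λ ω).op i i).re - (entry (Λ ω).op j j).re| ≤ 8 * y k * kn k := by
          have h1 : minW α l l * |(entry (Λ ω).op i i).re - (entry (Λ ω).op j j).re| ≤
              8 * kn k := by
            have hN : ∀ N : ℕ, (N : ℝ) ≤ |(m : ℝ)| → (N : ℝ) * ‖Λ ω‖ ≤ 8 * kn k := fun N hN => by
              have h0 := norm_nonneg (Λ ω)
              have hc : (0 : ℝ) ≤ N := Nat.cast_nonneg N
              nlinarith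
            rcases le_total 0 m with h0 | h0
            · have hj' : j = l := by omega
              rw [hj', hi]
              refine (minW_mul_abs_re_sub_le hα.1.le (Λ ω) l m.toNat).trans (hN _ ?_)
              rw [← Int.cast_natCast, Int.toNat_of_nonneg h0]
              exact le_abs_self _
            · have hi' : i = l := by omega
              rw [hi', hj, abs_sub_comm]
              refine (minW_mul_abs_re_sub_le hα.1.le (Λ ω) l (-m).toNat).trans (hN _ ?_)
              rw [← Int.cast_natCast, Int.toNat_of_nonneg (by omega)]
              push_cast
              exact neg_le_abs _
          have h2 : (y k)⁻¹ ≤ minW α l l := by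
            have h3 : x k ^ (-(1 / 2) : ℝ) ≤ (l : ℝ) + 1 := by
              have := (rpow_neg_half_ceil (hx0 k) (hx1 k)).1
              have h4 : (L k : ℝ) ≤ l := by exact_mod_cast not_lt.1 hlL
              linarith
            calc (y k)⁻¹ = (x k ^ (-(1 / 2) : ℝ)) ^ α := by
                  rw [hyd, ← Real.rpow_neg (hx0 k).le, ← Real.rpow_mul (hx0 k).le]
                  congr 1; ring
              _ ≤ ((l : ℝ) + 1) ^ α :=
                  Real.rpow_le_rpow (Real.rpow_nonneg (hx0 k).le _) h3 hα.1.le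
              _ = _ := by simp [minW]
          have h4 := (mul_le_mul_of_nonneg_right h2 (abs_nonneg _)).trans h1
          rw [inv_mul_le_iff₀ (hy0 k)] at h4
          linarith
        have h5 := abs_sub (freq k ω + (2 * (m : ℝ) + ((entry (Λ ω).op i i).re -
          (entry (Λ ω).op j j).re))) ((entry (Λ ω).op i i).re - (entry (Λ ω).op j j).re)
        have h6 : freq k ω + (2 * (m : ℝ) + ((entry (Λ ω).op i i).re -
          (entry (Λ ω).op j j).re)) - ((entry (Λ ω).op i i).re - (entry (Λ ω).op j j).re) =
          freq k ω + 2 * (m : ℝ) := by ring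
        rw [h6] at h5
        have h7 : 9 * x k * kn k ≤ 9 * y k * kn k := by gcongr; exact hxy k
        linarith
  set c : ℝ≥0∞ := ENNReal.ofReal (2 * Real.pi) ^ (n - 1) with hc
  have hWk : ∀ k : Idx n, k ≠ 0 → volume (W k) ≤ ENNReal.ofReal (2380 * kn k ^ 2 * y k) * c := by
    intro k hk
    have hk1 := one_le_kn hk
    have hAm : ∀ m l, volume (A k m l) ≤ ENNReal.ofReal (4 * (9 * x k * kn k)) * c := fun m l => by
      refine volume_slab_le hn hk (K := 0 + (1 / 4 + 1 / 4)) (by norm_num)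
        ((LipschitzWith.const _).add ((hR _).sub (hR _))) _
    have hBm : ∀ m, volume (B k m) ≤ ENNReal.ofReal (4 * (17 * y k * kn k)) * c := fun m =>
      volume_slab_le hn hk (K := 0) (by norm_num) (LipschitzWith.const _) _
    have hm : ∀ m, volume ((⋃ l ∈ Finset.range (L k), A k m l) ∪ B k m) ≤
        ENNReal.ofReal (140 * kn k * y k) * c := fun m => by
      calc _ ≤ (∑ l ∈ Finset.range (L k), volume (A k m l)) + volume (B k m) :=
            (measure_union_le _ _).trans (add_le_add_left (measure_biUnion_finset_le _ _) _)
        _ ≤ (∑ l ∈ Finset.range (L k), ENNReal.ofReal (4 * (9 * x k * kn k)) * c) +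
            ENNReal.ofReal (4 * (17 * y k * kn k)) * c :=
            add_le_add (Finset.sum_le_sum fun l _ => hAm m l) (hBm m)
        _ = (ENNReal.ofReal (L k) * ENNReal.ofReal (4 * (9 * x k * kn k)) +
            ENNReal.ofReal (4 * (17 * y k * kn k))) * c := by
            rw [Finset.sum_const, Finset.card_range, nsmul_eq_mul, ENNReal.ofReal_natCast]; ring
        _ ≤ _ := by
            gcongr
            have := hx0 k
            have := hy0 k
            rw [← ENNReal.ofReal_mul (by positivity), ← ENNReal.ofReal_add (by positivity)
              (by positivity)]
            refine ENNReal.ofReal_le_ofReal ?_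
            have h1 := (rpow_neg_half_ceil (hx0 k) (hx1 k)).2.trans
              (mul_le_mul_of_nonneg_left (hxhy k) zero_le_two)
            have h2 : (L k : ℝ) * x k * kn k ≤ 2 * y k * kn k := by gcongr
            linarith
    calc _ ≤ ∑ m ∈ Finset.Icc (-(resN k : ℤ)) (resN k), volume
          ((⋃ l ∈ Finset.range (L k), A k m l) ∪ B k m) := measure_biUnion_finset_le _ _
      _ ≤ ∑ m ∈ Finset.Icc (-(resN k : ℤ)) (resN k), ENNReal.ofReal (140 * kn k * y k) * c :=
          Finset.sum_le_sum fun m _ => hm m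
      _ = ENNReal.ofReal ((2 * resN k + 1 : ℕ) : ℝ) * ENNReal.ofReal (140 * kn k * y k) * c := by
          rw [Finset.sum_const, nsmul_eq_mul, ENNReal.ofReal_natCast, Int.card_Icc, mul_assoc]
          have : ((resN k : ℤ) + 1 - -(resN k : ℤ)).toNat = 2 * resN k + 1 := by omega
          rw [this, ← mul_assoc]
      _ ≤ _ := by
          gcongr
          rw [← ENNReal.ofReal_mul (by positivity)]
          refine ENNReal.ofReal_le_ofReal ?_
          -- There are at most 17|k| values of i - j since |k| ≥ 1; each costs 140 = 36·2 + 68, and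
          -- 17·140 = 2380.
          have h3 : ((2 * resN k + 1 : ℕ) : ℝ) ≤ 17 * kn k := by
            push_cast; rw [resN_eq]; linarith
          have h4 : 0 ≤ 140 * kn k * y k := by have := hy0 k; positivity
          calc _ ≤ 17 * kn k * (140 * kn k * y k) := mul_le_mul_of_nonneg_right h3 h4
            _ = _ := by ring
  have hcc : 0 < δ * α / 4 := by have := hα.1; positivity
  have hy : ∀ k, y k = γ ^ (α / 2) * Real.exp (-(2 * (δ * α / 4) * kn k)) := fun k => by
    rw [hyd, hxd]
    simp only
    rw [Real.mul_rpow hγ.le (Real.exp_pos _).le, ← Real.exp_mul]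
    congr 2; ring
  calc _ ≤ volume (⋃ k : Idx n, ⋃ _ : k ≠ 0, W k) := measure_mono hcover
    _ ≤ ∑' k : Idx n, volume (⋃ _ : k ≠ 0, W k) := measure_iUnion_le _
    _ ≤ ∑' k : Idx n, ENNReal.ofReal (2380 * γ ^ (α / 2)) * c *
        ENNReal.ofReal (kn k ^ 2 * Real.exp (-(2 * (δ * α / 4) * kn k))) := by
        refine ENNReal.tsum_le_tsum fun k => ?_
        by_cases hk : k = 0
        · simp [hk]
        · have : (⋃ _ : k ≠ 0, W k) = W k := by simp [hk]
          rw [this]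
          refine (hWk k hk).trans (le_of_eq ?_)
          rw [mul_right_comm (ENNReal.ofReal (2380 * γ ^ (α / 2))),
            ← ENNReal.ofReal_mul (by positivity), hy]
          congr 2; ring
    _ ≤ ENNReal.ofReal (2380 * γ ^ (α / 2)) * c *
        ENNReal.ofReal (2 / (δ * α / 4) ^ 2 * (4 / (δ * α / 4)) ^ n) := by
        rw [ENNReal.tsum_mul_left]
        gcongr
        exact tsum_sq_exp_kn_le n hcc (by nlinarith [hα.1, hα.2])
    _ = _ := by
        have := hα.1
        rw [hc, ← ENNReal.ofReal_pow (by positivity), ← ENNReal.ofReal_mul (by positivity),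
          ← ENNReal.ofReal_mul (by positivity)]
        congr 1
        unfold resC
        have h1 : (4 / (δ * α / 4)) ^ n = (4 / (α / 4)) ^ n * (δ ^ n)⁻¹ := by
          rw [← inv_pow, ← mul_pow]; congr 1; field_simp
        rw [h1, pow_add]
        field_simp

end resonances

/-! ### Whitney differentiability of Lipschitz functions on large Cantor sets -/

section whitney

variable {n : ℕ}

/-- The points at which the first order Taylor expansion of `f` has the relative error
`1 / (N + 1)` on the ball of radius `1 / (M + 1)`, tested on a dense sequence. -/
def unifDiff (f : (Fin n → ℝ) → ℝ) (N M : ℕ) : Set (Fin n → ℝ) :=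
  {x | ∀ m, ‖TopologicalSpace.denseSeq (Fin n → ℝ) m‖ < 1 / ((M : ℝ) + 1) →
    |f (x + TopologicalSpace.denseSeq (Fin n → ℝ) m) - f x -
      fderiv ℝ f x (TopologicalSpace.denseSeq (Fin n → ℝ) m)| ≤
      1 / ((N : ℝ) + 1) * ‖TopologicalSpace.denseSeq (Fin n → ℝ) m‖}

/-- Testing increments on a dense sequence keeps `unifDiff` measurable; by continuity in the
increment nothing is lost. -/
theorem unifDiff_forall {f : (Fin n → ℝ) → ℝ} (hf : Continuous f) {N M : ℕ} {x : Fin n → ℝ}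
    (hx : x ∈ unifDiff f N M) {h : Fin n → ℝ} (hh : ‖h‖ < 1 / ((M : ℝ) + 1)) :
    |f (x + h) - f x - fderiv ℝ f x h| ≤ 1 / ((N : ℝ) + 1) * ‖h‖ := by
  set C : Set (Fin n → ℝ) := {h | |f (x + h) - f x - fderiv ℝ f x h| ≤ 1 / ((N : ℝ) + 1) * ‖h‖}
  have hC : IsClosed C := isClosed_le (by fun_prop) (by fun_prop)
  have h1 := (TopologicalSpace.denseRange_denseSeq (Fin n → ℝ)).open_subset_closure_inter
    (Metric.isOpen_ball (x := (0 : Fin n → ℝ)) (ε := 1 / ((M : ℝ) + 1)))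
  have h2 : closure (Metric.ball 0 (1 / ((M : ℝ) + 1)) ∩
      Set.range (TopologicalSpace.denseSeq (Fin n → ℝ))) ⊆ C := by
    refine closure_minimal ?_ hC
    rintro _ ⟨hb, m, rfl⟩
    exact hx m (by simpa using hb)
  exact h2 (h1 (by simpa using hh))

theorem measurableSet_unifDiff {f : (Fin n → ℝ) → ℝ} (hf : Continuous f) (N M : ℕ) :
    MeasurableSet (unifDiff f N M) := by
  unfold unifDiff
  rw [Set.ofPred_forall]
  refine MeasurableSet.iInter fun m => ?_
  by_cases hm : ‖TopologicalSpace.denseSeq (Fin n → ℝ) m‖ < 1 / ((M : ℝ) + 1)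
  · simp only [hm, true_imp_iff]
    refine measurableSet_le ?_ measurable_const
    refine Measurable.abs ?_
    exact ((hf.comp (continuous_add_const _)).measurable.sub hf.measurable).sub
      (measurable_fderiv_apply_const ℝ f _)
  · simp only [hm, false_imp_iff]
    exact MeasurableSet.univ

theorem unifDiff_mono (f : (Fin n → ℝ) → ℝ) (N : ℕ) : Monotone (unifDiff f N) := by
  intro M M' h x hx m hm
  exact hx m (hm.trans_le (by gcongr))

theorem exists_mem_unifDiff {f : (Fin n → ℝ) → ℝ} {x : Fin n → ℝ} (hx : DifferentiableAt ℝ f x)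
    (N : ℕ) : ∃ M, x ∈ unifDiff f N M := by
  have h := hasFDerivAt_iff_isLittleO_nhds_zero.1 hx.hasFDerivAt
  have h1 := h.def (show (0 : ℝ) < 1 / ((N : ℝ) + 1) by positivity)
  obtain ⟨r, hr, hr'⟩ := Metric.eventually_nhds_iff.1 h1
  obtain ⟨M, hM⟩ := exists_nat_one_div_lt hr
  refine ⟨M, fun m hm => ?_⟩
  exact hr' (by rw [dist_zero_right]; exact hm.trans hM)

/-- Egorov: at points of differentiability the sets `unifDiff f N M` increase to everything as M
grows, so on finite measure what is left out tends to 0. -/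
theorem exists_measure_diff_unifDiff_le {f : (Fin n → ℝ) → ℝ} (hf : Continuous f)
    {T : Set (Fin n → ℝ)} (hT : MeasurableSet T) (hfin : volume T ≠ ∞)
    (hd : ∀ x ∈ T, DifferentiableAt ℝ f x) (N : ℕ) {η : ℝ≥0∞} (hη : 0 < η) :
    ∃ M, volume (T \ unifDiff f N M) ≤ η := by
  have hlim := tendsto_measure_iInter_atTop (μ := volume) (s := fun M => T \ unifDiff f N M)
    (fun M => (hT.diff (measurableSet_unifDiff hf N M)).nullMeasurableSet)
    (fun M M' h => Set.sdiff_subset_sdiff_right (unifDiff_mono f N h))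
    ⟨0, ne_top_of_le_ne_top hfin (measure_mono Set.sdiff_subset)⟩
  have he : ⋂ M, T \ unifDiff f N M = ∅ := by
    refine Set.eq_empty_of_forall_notMem fun x hx => ?_
    rw [Set.mem_iInter] at hx
    obtain ⟨M, hM⟩ := exists_mem_unifDiff (hd x (hx 0).1) N
    exact (hx M).2 hM
  rw [he, measure_empty] at hlim
  exact ((tendsto_order.1 hlim).2 η hη).exists.imp fun M h => h.le

/-- Compare the two linear parts on increments of one fixed size: both Taylor errors are uniformly
small, and f at shifted points changes by at most K |x - a|. -/
theorem continuousOn_fderiv_of_unifDiff {f : (Fin n → ℝ) → ℝ} {K : NNReal} (hf : LipschitzWith K f)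
    {S : Set (Fin n → ℝ)} (hS : ∀ N, ∃ M, S ⊆ unifDiff f N M) : ContinuousOn (fderiv ℝ f) S := by
  intro a ha
  refine Metric.continuousWithinAt_iff.2 fun ε hε => ?_
  obtain ⟨N, hN⟩ := exists_nat_one_div_lt (show (0 : ℝ) < ε / 8 by positivity)
  obtain ⟨M, hM⟩ := hS N
  set r : ℝ := 1 / ((M : ℝ) + 1) with hr
  have hr0 : 0 < r := by positivity
  set c : ℝ := 1 / ((N : ℝ) + 1) with hc
  have hc0 : 0 < c := by positivity
  refine ⟨c * (r / 4) / (K + 1), by positivity, fun {x} hx hxa => ?_⟩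
  have hKx : K * dist x a ≤ c * (r / 4) := by
    rw [lt_div_iff₀ (by positivity)] at hxa
    nlinarith [dist_nonneg (x := x) (y := a)]
  rw [dist_eq_norm]
  refine lt_of_le_of_lt (b := 4 * c) ?_ (by linarith)
  -- Only increments with r/4 ≤ ‖h‖ < r/2 are needed. They lie within the radius of uniformity, yet
  -- are long enough for K |x - a| ≤ c r/4 to be dominated by c‖h‖.
  refine ContinuousLinearMap.opNorm_le_of_shell' (ε := r / 2) (c := (1 / 2 : ℝ)) (by positivity)
    (by positivity) (by norm_num) fun h h1 h2 => ?_
  have h1' : r / 4 ≤ ‖h‖ := by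
    refine le_trans (le_of_eq ?_) h1
    norm_num
    ring
  have e1 := unifDiff_forall hf.continuous (hM hx) (h := h) (by linarith)
  have e2 := unifDiff_forall hf.continuous (hM ha) (h := h) (by linarith)
  have e3 : |f (x + h) - f (a + h)| ≤ K * dist x a := by
    have := hf.dist_le_mul (x + h) (a + h)
    rwa [dist_add_right, Real.dist_eq] at this
  have e4 : |f x - f a| ≤ K * dist x a := by
    have := hf.dist_le_mul x a
    rwa [Real.dist_eq] at this
  rw [_root_.sub_apply, Real.norm_eq_abs]
  have e5 : fderiv ℝ f x h - fderiv ℝ f a h = -(f (x + h) - f x - fderiv ℝ f x h) +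
      (f (a + h) - f a - fderiv ℝ f a h) + (f (x + h) - f (a + h)) - (f x - f a) := by ring
  rw [e5]
  have e6 : c * (r / 4) ≤ c * ‖h‖ := by gcongr
  rw [abs_le] at *
  constructor <;> linarith [e1.1, e1.2, e2.1, e2.2, e3.1, e3.2, e4.1, e4.2]

theorem whitneyC1On_of_unifDiff {f : (Fin n → ℝ) → ℝ} {K : NNReal} (hf : LipschitzWith K f)
    {S : Set (Fin n → ℝ)} (hS : ∀ N, ∃ M, S ⊆ unifDiff f N M) : WhitneyC1On f S := by
  refine ⟨fderiv ℝ f, continuousOn_fderiv_of_unifDiff hf hS, fun a ha => ?_⟩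
  rw [Asymptotics.isLittleO_iff]
  intro c hc
  obtain ⟨N, hN⟩ := exists_nat_one_div_lt hc
  obtain ⟨M, hM⟩ := hS N
  have h1 : ∀ᶠ z in nhdsWithin ((a, a) : (Fin n → ℝ) × (Fin n → ℝ)) (S ×ˢ S),
      ‖z.2 - z.1‖ < 1 / ((M : ℝ) + 1) := by
    refine nhdsWithin_le_nhds ?_
    have hcont : Continuous fun z : (Fin n → ℝ) × (Fin n → ℝ) => ‖z.2 - z.1‖ := by fun_prop
    refine (hcont.tendsto (a, a)).eventually_lt_const ?_
    simp only [sub_self, norm_zero]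
    positivity
  filter_upwards [h1, self_mem_nhdsWithin] with z hz hzS
  have h2 := unifDiff_forall hf.continuous (hM hzS.1) hz
  rw [add_sub_cancel] at h2
  rw [Real.norm_eq_abs]
  exact h2.trans (by gcongr)

theorem isTotallyDisconnected_of_irrational {S : Set (Fin n → ℝ)}
    (hS : ∀ x ∈ S, ∀ j (q : ℚ), x j ≠ q) : IsTotallyDisconnected S := by
  intro t htS ht x hx y hy
  by_contra hne
  obtain ⟨j, hj⟩ := Function.ne_iff.1 hne
  have himg : IsPreconnected ((fun z : Fin n → ℝ => z j) '' t) :=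
    ht.image _ (continuous_apply j).continuousOn
  wlog hlt : x j < y j generalizing x y
  · exact this hy hx (Ne.symm hne) (Ne.symm hj) (lt_of_le_of_ne (not_lt.1 hlt) (Ne.symm hj))
  obtain ⟨q, hq1, hq2⟩ := exists_rat_btwn hlt
  obtain ⟨z, hz, hzq⟩ := himg.Icc_subset (Set.mem_image_of_mem _ hx) (Set.mem_image_of_mem _ hy)
    ⟨hq1.le, hq2.le⟩
  exact hS z (htS hz) j q hzq

/-- Rademacher gives differentiability almost everywhere, Egorov uniform Taylor expansions for all f
i at once, inner regularity a compact set, and Cantor–Bendixson a perfect one. Irrational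
coordinates exclude nontrivial connected subsets. -/
theorem exists_cantor_whitney (hn : 1 ≤ n) {T : Set (Fin n → ℝ)} (hT : MeasurableSet T)
    (hfin : volume T ≠ ∞) {f : ℕ → (Fin n → ℝ) → ℝ} {K : NNReal}
    (hf : ∀ i, LipschitzWith K (f i)) {η : ℝ≥0∞} (hη : 0 < η) (hηT : η < volume T) :
    ∃ S ⊆ T, IsCantorSet S ∧ volume (T \ S) ≤ η ∧ ∀ i, WhitneyC1On (f i) S := by
  have : Nonempty (Fin n) := ⟨⟨0, hn⟩⟩
  -- the points of differentiability with irrational coordinates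
  set Z : Set (Fin n → ℝ) := {x | (∀ i, DifferentiableAt ℝ (f i) x) ∧ ∀ j (q : ℚ), x j ≠ q} with hZ
  have hZm : MeasurableSet Z := by
    have h1 : MeasurableSet {x | ∀ i, DifferentiableAt ℝ (f i) x} := by
      rw [Set.ofPred_forall]
      exact MeasurableSet.iInter fun i => measurableSet_of_differentiableAt ℝ _
    have h2 : MeasurableSet {x : Fin n → ℝ | ∀ j (q : ℚ), x j ≠ q} := by
      simp only [Set.ofPred_forall]
      exact MeasurableSet.iInter fun j => MeasurableSet.iInter fun q =>
        (measurableSet_eq_fun (measurable_pi_apply j) measurable_const).compl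
    exact h1.inter h2
  have hZae : ∀ᵐ x, x ∈ Z := by
    refine Filter.Eventually.and (ae_all_iff.2 fun i => (hf i).ae_differentiableAt)
      (ae_all_iff.2 fun j => ae_all_iff.2 fun q => ?_)
    have h : volume {x : Fin n → ℝ | x j = (q : ℝ)} = 0 := by
      rw [volume_pi]
      exact Measure.pi_hyperplane _ j _
    exact measure_mono_null (fun x hx => not_not.1 hx) h
  set T₁ := T ∩ Z with hT₁
  have hT₁m : MeasurableSet T₁ := hT.inter hZm
  have hT₁f : volume T₁ ≠ ∞ := ne_top_of_le_ne_top hfin (measure_mono Set.inter_subset_left)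
  have hη2 : (η / 2 : ℝ≥0∞) ≠ 0 := (ENNReal.half_pos hη.ne').ne'
  -- Half of η is distributed over all pairs (function, precision); the other half is for the
  -- passage to a compact set.
  obtain ⟨w, hw0, hw⟩ := ENNReal.exists_pos_sum_of_countable' hη2 (ℕ × ℕ)
  choose M hM using fun p : ℕ × ℕ => exists_measure_diff_unifDiff_le (hf p.1).continuous hT₁m hT₁f
    (fun x hx => hx.2.1 p.1) p.2 (hw0 p)
  set T₂ := T₁ ∩ ⋂ p : ℕ × ℕ, unifDiff (f p.1) p.2 (M p) with hT₂
  have hT₂m : MeasurableSet T₂ := hT₁m.inter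
    (MeasurableSet.iInter fun p => measurableSet_unifDiff (hf p.1).continuous _ _)
  have hT₁₂ : volume (T₁ \ T₂) ≤ η / 2 := by
    calc _ ≤ volume (⋃ p : ℕ × ℕ, T₁ \ unifDiff (f p.1) p.2 (M p)) := by
          refine measure_mono fun x hx => ?_
          simp only [hT₂, Set.mem_sdiff, Set.mem_inter_iff, Set.mem_iInter, not_and, not_forall] at hx
          obtain ⟨p, hp⟩ := hx.2 hx.1
          exact Set.mem_iUnion.2 ⟨p, hx.1, hp⟩
      _ ≤ ∑' p, w p := (measure_iUnion_le _).trans (ENNReal.tsum_le_tsum hM)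
      _ ≤ _ := hw.le
  have hT₂f : volume T₂ ≠ ∞ := ne_top_of_le_ne_top hT₁f (measure_mono Set.inter_subset_left)
  obtain ⟨C, hCT, hC, hCv⟩ := hT₂m.exists_isCompact_sdiff_lt hT₂f hη2
  -- Discarding the countable part V costs no measure, since for n ≥ 1 the volume has no atoms.
  obtain ⟨V, D, hV, hD, hCVD⟩ := exists_countable_union_perfect_of_isClosed hC.isClosed
  have hDC : D ⊆ C := hCVD ▸ Set.subset_union_right
  have hDT₂ : D ⊆ T₂ := hDC.trans hCT
  have hDT : D ⊆ T := hDT₂.trans (Set.inter_subset_left.trans Set.inter_subset_left)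
  have hvol : volume (T \ D) ≤ η := by
    have hcov : T \ D ⊆ Zᶜ ∪ (T₁ \ T₂) ∪ (T₂ \ C) ∪ V := by
      intro x hx
      by_cases h1 : x ∈ Z
      · by_cases h2 : x ∈ T₂
        · by_cases h3 : x ∈ C
          · rw [hCVD] at h3
            rcases h3 with h3 | h3
            · exact Or.inr h3
            · exact absurd h3 hx.2
          · exact Or.inl (Or.inr ⟨h2, h3⟩)
        · exact Or.inl (Or.inl (Or.inr ⟨⟨hx.1, h1⟩, h2⟩))
      · exact Or.inl (Or.inl (Or.inl h1))
    have hZ0 : volume Zᶜ = 0 := hZae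
    calc _ ≤ volume (Zᶜ ∪ (T₁ \ T₂) ∪ (T₂ \ C) ∪ V) := measure_mono hcov
      _ ≤ volume Zᶜ + volume (T₁ \ T₂) + volume (T₂ \ C) + volume V :=
        (measure_union_le _ _).trans (add_le_add_left ((measure_union_le _ _).trans
          (add_le_add_left (measure_union_le _ _) _)) _)
      _ ≤ 0 + η / 2 + η / 2 + 0 :=
        add_le_add (add_le_add (add_le_add hZ0.le hT₁₂) hCv.le) (hV.measure_zero _).le
      _ = η := by rw [zero_add, add_zero, ENNReal.add_halves]
  refine ⟨D, hDT, ⟨?_, hC.of_isClosed_subset hD.closed hDC, hD.acc, ?_⟩, hvol, fun i => ?_⟩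
  · rw [Set.nonempty_iff_ne_empty]
    rintro rfl
    rw [Set.sdiff_empty] at hvol
    exact absurd hηT (not_lt.2 hvol)
  · exact isTotallyDisconnected_of_irrational fun x hx => (hDT₂ hx).1.2.2
  · exact whitneyC1On_of_unifDiff (hf i) fun N =>
      ⟨M (i, N), fun x hx => Set.mem_iInter.1 (hDT₂ hx).2 (i, N)⟩

end whitney

/-! ### Fourier coefficients of analytic functions on the torus -/

section fourier

variable {n : ℕ} {E : Type*} [NormedAddCommGroup E] [NormedSpace ℂ E] [CompleteSpace E]

/-- The normalized measure of the torus. -/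
def torusMeasure (n : ℕ) : Measure (UnitAddTorus (Fin n)) :=
  Measure.pi fun _ => AddCircle.haarAddCircle

instance (n : ℕ) : IsProbabilityMeasure (torusMeasure n) := by
  unfold torusMeasure; infer_instance

instance (n : ℕ) : (torusMeasure n).IsAddRightInvariant := by
  unfold torusMeasure; infer_instance

/-- The representative in `[0, 2π)^n` of a point of the torus. -/
def rep (y : UnitAddTorus (Fin n)) : Fin n → ℝ :=
  fun j => 2 * Real.pi * (AddCircle.equivIco 1 0 (y j) : ℝ)

/-- The class of `x / 2π` in the torus. -/
def toTorus (x : Fin n → ℝ) : UnitAddTorus (Fin n) :=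
  fun j => ((x j / (2 * Real.pi) : ℝ) : UnitAddCircle)

theorem toTorus_rep (y : UnitAddTorus (Fin n)) : toTorus (rep y) = y := by
  funext j
  have hpi := Real.pi_ne_zero
  rw [toTorus, rep, mul_div_cancel_left₀ _ (by positivity)]
  exact AddCircle.coe_equivIco

theorem toTorus_add (x z : Fin n → ℝ) : toTorus (x + z) = toTorus x + toTorus z := by
  funext j
  simp [toTorus, add_div]

theorem measurable_rep : Measurable (rep : UnitAddTorus (Fin n) → Fin n → ℝ) := by
  refine measurable_pi_lambda _ fun j => Measurable.const_mul ?_ _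
  have h : Measurable (AddCircle.equivIco (1 : ℝ) 0) :=
    (AddCircle.measurableEquivIco (1 : ℝ) 0).measurable
  exact measurable_subtype_coe.comp (h.comp (measurable_pi_apply j))

theorem isOpenQuotientMap_toTorus :
    IsOpenQuotientMap (toTorus : (Fin n → ℝ) → UnitAddTorus (Fin n)) := by
  refine IsOpenQuotientMap.piMap (f := fun _ (x : ℝ) => ((x / (2 * Real.pi) : ℝ) : UnitAddCircle))
    fun _ => ?_
  have hpi : (2 * Real.pi) ≠ 0 := by have := Real.pi_pos; positivity
  exact (QuotientAddGroup.isOpenQuotientMap_mk (N := AddSubgroup.zmultiples (1 : ℝ))).comp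
    (Homeomorph.mulRight₀ (2 * Real.pi)⁻¹ (inv_ne_zero hpi)).isOpenQuotientMap

/-- A function on `ℝ^n` that is `2π`-periodic in each variable. -/
def IsPer {F : Type*} (g : (Fin n → ℝ) → F) : Prop :=
  ∀ x j, g (x + Pi.single j (2 * Real.pi)) = g x

theorem IsPer.add_int {F : Type*} {g : (Fin n → ℝ) → F} (h : IsPer g) (m : Fin n → ℤ)
    (x : Fin n → ℝ) : g (x + fun j => 2 * Real.pi * (m j : ℝ)) = g x := by
  have h1 : ∀ (j : Fin n) (p : ℤ) (x : Fin n → ℝ),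
      g (x + Pi.single j (2 * Real.pi * (p : ℝ))) = g x := by
    intro j p
    induction p with
    | zero => simp
    | succ p ih =>
      intro x
      have := h (x + Pi.single j (2 * Real.pi * ((p : ℤ) : ℝ))) j
      rw [ih, add_assoc, ← Pi.single_add] at this
      rw [← this]
      push_cast
      ring_nf
    | pred p ih =>
      intro x
      have := h (x + Pi.single j (2 * Real.pi * ((-(p : ℤ) - 1 : ℤ) : ℝ))) j
      rw [add_assoc, ← Pi.single_add] at this
      rw [← this, ← ih x]
      push_cast
      ring_nf
  have h2 : ∀ (s : Finset (Fin n)) (x : Fin n → ℝ),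
      g (x + ∑ j ∈ s, Pi.single j (2 * Real.pi * (m j : ℝ))) = g x := by
    intro s
    induction s using Finset.induction_on with
    | empty => simp
    | insert j s hj ih =>
      intro x
      rw [Finset.sum_insert hj, ← add_assoc, ih, h1]
  rw [← h2 Finset.univ x]
  congr 2
  exact (Finset.univ_sum_single _).symm

theorem IsPer.rep_toTorus {F : Type*} {g : (Fin n → ℝ) → F} (h : IsPer g) (x : Fin n → ℝ) :
    g (rep (toTorus x)) = g x := by
  have hpi := Real.pi_ne_zero
  have h1 : ∀ j, ∃ m : ℤ, x j = rep (toTorus x) j + 2 * Real.pi * (m : ℝ) := fun j => by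
    have h2 := congrFun (toTorus_rep (toTorus x)) j
    have h3 : ((x j / (2 * Real.pi) - rep (toTorus x) j / (2 * Real.pi) : ℝ) : UnitAddCircle) = 0 := by
      rw [AddCircle.coe_sub, sub_eq_zero]
      exact h2.symm
    obtain ⟨m, hm⟩ := (AddCircle.coe_eq_zero_iff (1 : ℝ)).1 h3
    refine ⟨m, ?_⟩
    rw [zsmul_eq_mul, mul_one] at hm
    rw [hm]
    field_simp
    ring
  choose m hm using h1
  rw [← h.add_int m (rep (toTorus x))]
  congr 1
  exact (funext hm).symm

theorem IsPer.continuous_rep {F : Type*} [TopologicalSpace F] {g : (Fin n → ℝ) → F} (h : IsPer g)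
    (hg : Continuous g) : Continuous fun y => g (rep y) := by
  rw [isOpenQuotientMap_toTorus.isQuotientMap.continuous_iff]
  exact hg.congr fun x => (h.rep_toTorus x).symm

/-- By periodicity a shift of the representative is a translation of the torus, which preserves its
measure. -/
theorem IsPer.integral_rep_add {g : (Fin n → ℝ) → E} (h : IsPer g) (a : Fin n → ℝ) :
    ∫ y, g (rep y + a) ∂torusMeasure n = ∫ y, g (rep y) ∂torusMeasure n := by
  rw [← integral_add_right_eq_self (fun y => g (rep y)) (toTorus a)]
  refine integral_congr_ae (Filter.Eventually.of_forall fun y => ?_)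
  have := h.rep_toTorus (rep y + a)
  rw [toTorus_add, toTorus_rep] at this
  exact this.symm

theorem mFourier_eq_expf (k : Idx n) (y : UnitAddTorus (Fin n)) :
    UnitAddTorus.mFourier k y = expf k (toC (rep y)) := by
  have hpi := Real.pi_ne_zero
  conv_lhs => rw [← toTorus_rep y]
  change ∏ j, (fourier (k j) ((rep y j / (2 * Real.pi) : ℝ) : UnitAddCircle)) = _
  simp only [fourier_coe_apply, expf, toC, ← Complex.exp_sum, Finset.mul_sum]
  congr 1
  refine Finset.sum_congr rfl fun j _ => ?_
  have : (Real.pi : ℂ) ≠ 0 := by exact_mod_cast hpi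
  push_cast
  field_simp

theorem expf_single (k : Idx n) (j : Fin n) :
    expf k (Pi.single j ((2 * Real.pi : ℝ) : ℂ)) = 1 := by
  rw [expf, Finset.sum_eq_single j (fun i _ hi => by simp [hi]) (by simp), Pi.single_eq_same]
  rw [Complex.exp_eq_one_iff]
  exact ⟨k j, by push_cast; ring⟩

theorem expf_add_right (k : Idx n) (θ η : Fin n → ℂ) : expf k (θ + η) = expf k θ * expf k η := by
  rw [expf, expf, expf, ← Complex.exp_add, ← mul_add, ← Finset.sum_add_distrib]
  congr 2
  exact Finset.sum_congr rfl fun j _ => by rw [Pi.add_apply]; ring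

theorem toC_add (x z : Fin n → ℝ) : toC (x + z) = toC x + toC z := by
  funext j; simp [toC]

theorem toC_single (j : Fin n) (a : ℝ) : toC (Pi.single j a) = Pi.single j (a : ℂ) := by
  funext i
  rcases eq_or_ne i j with rfl | h
  · simp [toC]
  · simp [toC, h]

theorem toC_mem_strip {ρ : ℝ} (hρ : 0 < ρ) (x : Fin n → ℝ) : toC x ∈ strip n ρ :=
  fun j => by simpa [toC] using hρ

theorem continuous_toC : Continuous (toC : (Fin n → ℝ) → Fin n → ℂ) := by
  unfold toC; fun_prop

theorem continuous_expf (k : Idx n) : Continuous (expf k) := by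
  unfold expf; fun_prop

/-- The Fourier coefficients of a function on the torus. -/
def fourierCoef (f : (Fin n → ℂ) → E) (k : Idx n) : E :=
  ∫ y, expf (-k) (toC (rep y)) • f (toC (rep y)) ∂torusMeasure n

variable {σ M : ℝ} {f : (Fin n → ℂ) → E}

/-- The direction in which the contour is shifted. -/
def sgn (k : Idx n) : Fin n → ℝ := fun j => (SignType.sign (k j) : ℝ)

theorem freq_sgn (k : Idx n) : freq k (sgn k) = kn k := by
  unfold freq kn sgn
  refine Finset.sum_congr rfl fun j _ => ?_
  rcases lt_trichotomy (k j) 0 with h | h | h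
  · rw [sign_neg h, abs_of_neg (by exact_mod_cast h)]; simp
  · simp [h]
  · rw [sign_pos h, abs_of_pos (by exact_mod_cast h)]; simp

theorem abs_sgn_le (k : Idx n) (j : Fin n) : |sgn k j| ≤ 1 := by
  unfold sgn
  rcases lt_trichotomy (k j) 0 with h | h | h
  · rw [sign_neg h]; simp
  · simp [h]
  · rw [sign_pos h]; simp

theorem shift_mem_strip (k : Idx n) (x : Fin n → ℝ) {z : ℂ} (hz : |z.im| < σ) :
    toC x + z • toC (sgn k) ∈ strip n σ := by
  intro j
  have h : ((toC x + z • toC (sgn k)) j).im = z.im * sgn k j := by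
    simp [toC]
  rw [h, abs_mul]
  exact (mul_le_of_le_one_right (abs_nonneg _) (abs_sgn_le k j)).trans_lt hz

/-- The Fourier coefficient computed on a shifted contour. -/
def shiftCoef (f : (Fin n → ℂ) → E) (k : Idx n) (z : ℂ) : E :=
  ∫ y, expf (-k) (toC (rep y)) • f (toC (rep y) + z • toC (sgn k)) ∂torusMeasure n

theorem aestronglyMeasurable_comp_rep {g : (Fin n → ℝ) → E} (hg : Continuous g) :
    AEStronglyMeasurable (fun y => g (rep y)) (torusMeasure n) :=
  (hg.stronglyMeasurable.comp_measurable measurable_rep).aestronglyMeasurable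

theorem continuous_shift (k : Idx n) (z : ℂ) :
    Continuous fun x : Fin n → ℝ => toC x + z • toC (sgn k) :=
  continuous_toC.add continuous_const

theorem norm_shiftCoef_le (hM : ∀ θ ∈ strip n σ, ‖f θ‖ ≤ M) (k : Idx n) {z : ℂ}
    (hz : |z.im| < σ) : ‖shiftCoef f k z‖ ≤ M := by
  refine (norm_integral_le_of_norm_le_const (C := M) (Filter.Eventually.of_forall fun y => ?_)).trans
    (by simp)
  rw [norm_smul, norm_expf_toC, one_mul]
  exact hM _ (shift_mem_strip k _ hz)

/-- Differentiation under the integral. The integrand's derivative is at most M/r by Cauchy's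
estimate; r is a third of the distance to the boundary, so circles of radius r around nearby points
stay in the strip. -/
theorem hasDerivAt_shiftCoef (hf : AnalyticOnNhd ℂ f (strip n σ))
    (hM : ∀ θ ∈ strip n σ, ‖f θ‖ ≤ M) (k : Idx n) {z : ℂ} (hz : |z.im| < σ) :
    DifferentiableAt ℂ (shiftCoef f k) z := by
  set r : ℝ := (σ - |z.im|) / 3 with hr
  have hr0 : 0 < r := by rw [hr]; linarith
  have him : ∀ w ∈ Metric.ball z (2 * r), |w.im| < σ := fun w hw => by
    have h1 : |(w - z).im| ≤ ‖w - z‖ := Complex.abs_im_le_norm _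
    rw [Metric.mem_ball, dist_eq_norm] at hw
    have h2 : w.im = z.im + (w - z).im := by simp
    have h3 := abs_add_le z.im (w - z).im
    rw [← h2] at h3
    linarith
  have hd : ∀ (x : Fin n → ℝ) (w : ℂ), |w.im| < σ →
      HasDerivAt (fun w : ℂ => f (toC x + w • toC (sgn k)))
        (fderiv ℂ f (toC x + w • toC (sgn k)) (toC (sgn k))) w := fun x w hw => by
    have h1 := (hf _ (shift_mem_strip k x hw)).differentiableAt.hasFDerivAt
    have h2 : HasDerivAt (fun w : ℂ => toC x + w • toC (sgn k)) (toC (sgn k)) w := by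
      simpa using ((hasDerivAt_id w).smul_const (toC (sgn k))).const_add (toC x)
    exact h1.comp_hasDerivAt w h2
  have hcont : ∀ w : ℂ, |w.im| < σ → Continuous fun x : Fin n → ℝ =>
      expf (-k) (toC x) • f (toC x + w • toC (sgn k)) := fun w hw =>
    ((continuous_expf _).comp continuous_toC).smul
      (hf.continuousOn.comp_continuous (continuous_shift k w) fun x => shift_mem_strip k x hw)
  have hcont' : Continuous fun x : Fin n → ℝ =>
      expf (-k) (toC x) • fderiv ℂ f (toC x + z • toC (sgn k)) (toC (sgn k)) :=
    ((continuous_expf _).comp continuous_toC).smul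
      ((hf.fderiv.continuousOn.comp_continuous (continuous_shift k z) fun x =>
        shift_mem_strip k x hz).clm_apply continuous_const)
  refine (hasDerivAt_integral_of_dominated_loc_of_deriv_le (μ := torusMeasure n)
    (F := fun w y => expf (-k) (toC (rep y)) • f (toC (rep y) + w • toC (sgn k)))
    (F' := fun w y => expf (-k) (toC (rep y)) •
      fderiv ℂ f (toC (rep y) + w • toC (sgn k)) (toC (sgn k)))
    (bound := fun _ => M / r) (Metric.ball_mem_nhds z hr0) ?_ ?_ ?_ ?_ (integrable_const _)
    ?_).2.differentiableAt
  · filter_upwards [Metric.ball_mem_nhds z (show 0 < 2 * r by linarith)] with w hw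
    exact aestronglyMeasurable_comp_rep (hcont w (him w hw))
  · refine Integrable.of_bound (aestronglyMeasurable_comp_rep (hcont z hz)) M
      (Filter.Eventually.of_forall fun y => ?_)
    rw [norm_smul, norm_expf_toC, one_mul]
    exact hM _ (shift_mem_strip k _ hz)
  · exact aestronglyMeasurable_comp_rep hcont'
  · refine Filter.Eventually.of_forall fun y w hw => ?_
    rw [norm_smul, norm_expf_toC, one_mul]
    have hball : Metric.closedBall w r ⊆ Metric.ball z (2 * r) := fun v hv => by
      rw [Metric.mem_closedBall] at hv
      rw [Metric.mem_ball] at hw ⊢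
      linarith [dist_triangle v w z]
    have hw' := him w (hball (Metric.mem_closedBall_self hr0.le))
    rw [← (hd (rep y) w hw').deriv]
    refine Complex.norm_deriv_le_of_forall_mem_sphere_norm_le hr0
      (DifferentiableOn.diffContOnCl_ball (U := Metric.ball z (2 * r)) (fun v hv =>
        (hd (rep y) v (him v hv)).differentiableAt.differentiableWithinAt) hball) fun v hv => ?_
    exact hM _ (shift_mem_strip k _ (him v (hball (Metric.sphere_subset_closedBall hv))))
  · refine Filter.Eventually.of_forall fun y w hw => ?_
    exact (hd (rep y) w (him w (Metric.ball_subset_ball (by linarith) hw))).const_smul _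

theorem isPer_coef (hσ : 0 < σ) (hp : IsPeriodicOn σ f) (k : Idx n) :
    IsPer fun x : Fin n → ℝ => expf k (toC x) • f (toC x) := fun x j => by
  simp only
  rw [toC_add, toC_single, expf_add_right, expf_single, mul_one, hp _ (toC_mem_strip hσ x)]

theorem shiftCoef_real (hσ : 0 < σ) (hp : IsPeriodicOn σ f) (k : Idx n) (t : ℝ) :
    shiftCoef f k t = Complex.exp (Complex.I * t * kn k) • fourierCoef f k := by
  have h := (isPer_coef hσ hp (-k)).integral_rep_add (t • sgn k)
  rw [fourierCoef, ← h, ← integral_smul, shiftCoef]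
  refine integral_congr_ae (Filter.Eventually.of_forall fun y => ?_)
  have h1 : (t : ℂ) • toC (sgn k) = toC (t • sgn k) := by funext j; simp [toC]
  simp only
  rw [h1, toC_add, smul_smul, expf_add_right, expf_flow, freq_neg, freq_sgn]
  congr 1
  rw [mul_left_comm, ← Complex.exp_add]
  rw [show Complex.I * t * kn k + Complex.I * ((-kn k : ℝ) : ℂ) * t = 0 by push_cast; ring]
  simp

/-- For real z this is translation invariance. Both sides are analytic in the strip |Im z| < σ, so
the identity theorem replaces an explicit contour shift. -/
theorem shiftCoef_eq (hσ : 0 < σ) (hf : AnalyticOnNhd ℂ f (strip n σ)) (hp : IsPeriodicOn σ f)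
    (hM : ∀ θ ∈ strip n σ, ‖f θ‖ ≤ M) (k : Idx n) {z : ℂ} (hz : |z.im| < σ) :
    shiftCoef f k z = Complex.exp (Complex.I * z * kn k) • fourierCoef f k := by
  set U : Set ℂ := {z | |z.im| < σ} with hU
  have hUo : IsOpen U := isOpen_lt (by fun_prop) continuous_const
  have hUc : IsPreconnected U := by
    have : U = Complex.imLm ⁻¹' Set.Ioo (-σ) σ := by
      ext w; simp [hU, abs_lt]
    rw [this]
    exact ((convex_Ioo (-σ) σ).linear_preimage Complex.imLm).isPreconnected
  have h1 : AnalyticOnNhd ℂ (shiftCoef f k) U := DifferentiableOn.analyticOnNhd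
    (fun w hw => (hasDerivAt_shiftCoef hf hM k hw).differentiableWithinAt) hUo
  have h2 : AnalyticOnNhd ℂ (fun z => Complex.exp (Complex.I * z * kn k) • fourierCoef f k) U :=
    DifferentiableOn.analyticOnNhd (by fun_prop) hUo
  refine h1.eqOn_of_preconnected_of_frequently_eq h2 hUc (z₀ := 0) (by simpa [hU] using hσ) ?_ hz
  have h3 : Filter.Tendsto (fun t : ℝ => (t : ℂ)) (nhdsWithin 0 {0}ᶜ) (nhdsWithin 0 {0}ᶜ) := by
    refine tendsto_nhdsWithin_of_tendsto_nhds_of_eventually_within _ ?_ ?_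
    · exact (Complex.continuous_ofReal.tendsto' 0 0 (by simp)).mono_left nhdsWithin_le_nhds
    · filter_upwards [self_mem_nhdsWithin] with t ht
      simpa using ht
  exact h3.frequently (Filter.Eventually.of_forall fun t => shiftCoef_real hσ hp k t).frequently

/-- Shift all coordinates at once, in the direction of the signs of k, by z = -iρ: the shifted
coefficient is e^{ρ|k|} times the original and still bounded by M. -/
theorem norm_fourierCoef_le {ρ : ℝ} (hρ0 : 0 ≤ ρ) (hρ : ρ < σ)
    (hf : AnalyticOnNhd ℂ f (strip n σ)) (hp : IsPeriodicOn σ f)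
    (hM : ∀ θ ∈ strip n σ, ‖f θ‖ ≤ M) (k : Idx n) :
    ‖fourierCoef f k‖ ≤ M * Real.exp (-(ρ * kn k)) := by
  have hz : |(-(ρ * Complex.I)).im| < σ := by simpa [abs_of_nonneg hρ0] using hρ
  have h1 := norm_shiftCoef_le hM k hz
  rw [shiftCoef_eq (hρ0.trans_lt hρ) hf hp hM k hz, norm_smul] at h1
  have h2 : Complex.I * -(ρ * Complex.I) * kn k = ((ρ * kn k : ℝ) : ℂ) := by
    push_cast
    linear_combination (-(ρ : ℂ) * kn k) * Complex.I_mul_I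
  rw [h2, Complex.norm_exp_ofReal] at h1
  rw [Real.exp_neg, ← div_eq_mul_inv, le_div_iff₀ (Real.exp_pos _), mul_comm]
  exact h1

/-- Continuous functionals reduce the vector-valued inversion to the scalar theorem for absolutely
summable coefficients. -/
theorem hasSum_fourierCoef (hσ : 0 < σ) (hf : ContinuousOn f (strip n σ))
    (hp : IsPeriodicOn σ f) (hs : Summable fun k => ‖fourierCoef f k‖) (x : Fin n → ℝ) :
    HasSum (fun k => expf k (toC x) • fourierCoef f k) (f (toC x)) := by
  have hper : IsPer fun x : Fin n → ℝ => f (toC x) := fun x j => by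
    simp only
    rw [toC_add, toC_single, hp _ (toC_mem_strip hσ x)]
  have hcont : Continuous fun x : Fin n → ℝ => f (toC x) :=
    hf.comp_continuous continuous_toC (toC_mem_strip hσ)
  have hperk : ∀ k, IsPer fun x : Fin n → ℝ => expf k (toC x) := fun k x j => by
    simp only
    rw [toC_add, toC_single, expf_add_right, expf_single, mul_one]
  have hint : ∀ k, Integrable (fun y => expf (-k) (toC (rep y)) • f (toC (rep y)))
      (torusMeasure n) := fun k =>
    ((isPer_coef hσ hp (-k)).continuous_rep (((continuous_expf _).comp continuous_toC).smul
      hcont)).integrable_of_hasCompactSupport (HasCompactSupport.of_compactSpace _)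
  have hsum : Summable fun k => expf k (toC x) • fourierCoef f k :=
    Summable.of_norm (by simpa only [norm_smul, norm_expf_toC, one_mul] using hs)
  refine (hsum.hasSum_iff).2 ((SeparatingDual.eq_iff_forall_dual_eq (R := ℂ)).2 fun φ => ?_)
  rw [φ.map_tsum hsum]
  set h : C(UnitAddTorus (Fin n), ℂ) :=
    ⟨fun y => φ (f (toC (rep y))), φ.continuous.comp (hper.continuous_rep hcont)⟩ with hh
  have hco : ∀ k, UnitAddTorus.mFourierCoeff h k = φ (fourierCoef f k) := fun k => by
    rw [fourierCoef, ← φ.integral_comp_comm (hint k)]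
    refine integral_congr_ae (Filter.Eventually.of_forall fun y => ?_)
    simp only [map_smul, mFourier_eq_expf]
    rfl
  have hsφ : Summable (UnitAddTorus.mFourierCoeff h) :=
    (φ.summable hs.of_norm).congr fun k => (hco k).symm
  have h1 := (UnitAddTorus.hasSum_mFourier_series_apply_of_summable hsφ (toTorus x)).tsum_eq
  have h2 : h (toTorus x) = φ (f (toC x)) := by
    rw [hh]
    exact congrArg φ (hper.rep_toTorus x)
  rw [h2] at h1
  rw [← h1]
  refine tsum_congr fun k => ?_
  rw [hco, mFourier_eq_expf, map_smul, smul_eq_mul, smul_eq_mul, mul_comm, (hperk k).rep_toTorus x]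

end fourier

/-! ### The Fourier series of the perturbation -/

section initial

variable {n : ℕ} {E : Type*} [NormedAddCommGroup E] [NormedSpace ℂ E] [CompleteSpace E]
  {σ M : ℝ} {f g : (Fin n → ℂ) → E}

theorem summable_exp_kn (n : ℕ) {c : ℝ} (hc : 0 < c) :
    Summable fun k : Idx n => Real.exp (-(c * kn k)) := by
  have h1 := tsum_exp_kn_le n (lt_min hc one_pos) (min_le_right c 1)
  have h2 := ENNReal.summable_toReal (ne_top_of_le_ne_top ENNReal.ofReal_ne_top h1)
  simp only [ENNReal.toReal_ofReal (Real.exp_pos _).le] at h2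
  refine Summable.of_nonneg_of_le (fun _ => (Real.exp_pos _).le) (fun k => ?_) h2
  have := kn_nonneg k
  gcongr
  exact min_le_left _ _

/-- The sum of `e^{-c|k|}` over the lattice. -/
def expSum (n : ℕ) (c : ℝ) : ℝ := ∑' k : Idx n, Real.exp (-(c * kn k))

theorem expSum_nonneg (n : ℕ) (c : ℝ) : 0 ≤ expSum n c := tsum_nonneg fun _ => (Real.exp_pos _).le

theorem integrable_coef (hσ : 0 < σ) (hf : ContinuousOn f (strip n σ)) (hp : IsPeriodicOn σ f)
    (k : Idx n) : Integrable (fun y => expf k (toC (rep y)) • f (toC (rep y))) (torusMeasure n) :=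
  ((isPer_coef hσ hp k).continuous_rep (((continuous_expf _).comp continuous_toC).smul
    (hf.comp_continuous continuous_toC (toC_mem_strip hσ)))).integrable_of_hasCompactSupport
      (HasCompactSupport.of_compactSpace _)

theorem fourierCoef_sub (hσ : 0 < σ) (hf : ContinuousOn f (strip n σ)) (hp : IsPeriodicOn σ f)
    (hg : ContinuousOn g (strip n σ)) (hq : IsPeriodicOn σ g) (k : Idx n) :
    fourierCoef (f - g) k = fourierCoef f k - fourierCoef g k := by
  rw [fourierCoef, fourierCoef, fourierCoef, ← integral_sub (integrable_coef hσ hf hp _)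
    (integrable_coef hσ hg hq _)]
  simp only [Pi.sub_apply, smul_sub]

open Classical in
/-- The Fourier series of `f`, as a sequence with the weight `e^{ρ|k|}` (`0` if the weighted
coefficients are not summable). -/
def fourierX (ρ : ℝ) (f : (Fin n → ℂ) → E) : X n E :=
  if h : Memℓp (fun k : Idx n => (Real.exp (ρ * kn k) : ℂ) • fourierCoef f k) 1 then ⟨_, h⟩ else 0

theorem norm_exp_smul_fourierCoef_le {ρ : ℝ} (hρ0 : 0 ≤ ρ) {δ : ℝ} (hδ : 0 < δ) (hρ : ρ + δ < σ)
    (hf : AnalyticOnNhd ℂ f (strip n σ)) (hp : IsPeriodicOn σ f)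
    (hM : ∀ θ ∈ strip n σ, ‖f θ‖ ≤ M) (k : Idx n) :
    ‖(Real.exp (ρ * kn k) : ℂ) • fourierCoef f k‖ ≤ M * Real.exp (-(δ * kn k)) := by
  rw [norm_smul, Complex.norm_real, Real.norm_eq_abs, Real.abs_exp]
  have h := norm_fourierCoef_le (add_nonneg hρ0 hδ.le) hρ hf hp hM k
  calc _ ≤ Real.exp (ρ * kn k) * (M * Real.exp (-((ρ + δ) * kn k))) := by gcongr
    _ = M * (Real.exp (ρ * kn k) * Real.exp (-((ρ + δ) * kn k))) := by ring
    _ = _ := by rw [← Real.exp_add]; congr 2; ring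

theorem fourierX_apply {ρ : ℝ} (hρ0 : 0 ≤ ρ) {δ : ℝ} (hδ : 0 < δ) (hρ : ρ + δ < σ)
    (hf : AnalyticOnNhd ℂ f (strip n σ)) (hp : IsPeriodicOn σ f)
    (hM : ∀ θ ∈ strip n σ, ‖f θ‖ ≤ M) (k : Idx n) :
    fourierX ρ f k = (Real.exp (ρ * kn k) : ℂ) • fourierCoef f k := by
  have h : Memℓp (fun k : Idx n => (Real.exp (ρ * kn k) : ℂ) • fourierCoef f k) 1 := by
    refine (memℓp_gen_iff (by norm_num)).2 ?_
    simp only [ENNReal.toReal_one, Real.rpow_one]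
    exact Summable.of_nonneg_of_le (fun _ => norm_nonneg _)
      (norm_exp_smul_fourierCoef_le hρ0 hδ hρ hf hp hM) ((summable_exp_kn n hδ).mul_left M)
  rw [fourierX, dif_pos h]

theorem norm_X_le_of_le {a : X n E} {δ : ℝ} (hδ : 0 < δ)
    (h : ∀ k, ‖a k‖ ≤ M * Real.exp (-(δ * kn k))) : ‖a‖ ≤ M * expSum n δ :=
  hasSum_le h (hasSum_norm_X a) ((summable_exp_kn n hδ).hasSum.mul_left M)

theorem norm_fourierX_le {ρ : ℝ} (hρ0 : 0 ≤ ρ) {δ : ℝ} (hδ : 0 < δ) (hρ : ρ + δ < σ)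
    (hf : AnalyticOnNhd ℂ f (strip n σ)) (hp : IsPeriodicOn σ f)
    (hM : ∀ θ ∈ strip n σ, ‖f θ‖ ≤ M) : ‖fourierX ρ f‖ ≤ M * expSum n δ :=
  norm_X_le_of_le hδ fun k => by
    rw [fourierX_apply hρ0 hδ hρ hf hp hM]
    exact norm_exp_smul_fourierCoef_le hρ0 hδ hρ hf hp hM k

theorem norm_fourierX_sub_le {ρ : ℝ} (hρ0 : 0 ≤ ρ) {δ : ℝ} (hδ : 0 < δ) (hρ : ρ + δ < σ)
    (hf : AnalyticOnNhd ℂ f (strip n σ)) (hp : IsPeriodicOn σ f)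
    (hg : AnalyticOnNhd ℂ g (strip n σ)) (hq : IsPeriodicOn σ g) {M' : ℝ}
    (hM : ∀ θ ∈ strip n σ, ‖f θ‖ ≤ M) (hM' : ∀ θ ∈ strip n σ, ‖g θ‖ ≤ M') {L : ℝ}
    (hL : ∀ θ ∈ strip n σ, ‖f θ - g θ‖ ≤ L) :
    ‖fourierX ρ f - fourierX ρ g‖ ≤ L * expSum n δ := by
  have hσ : 0 < σ := by linarith
  refine norm_X_le_of_le hδ fun k => ?_
  have h1 : (fourierX ρ f - fourierX ρ g) k = (Real.exp (ρ * kn k) : ℂ) • fourierCoef (f - g) k := by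
    rw [fourierCoef_sub hσ hf.continuousOn hp hg.continuousOn hq, smul_sub,
      ← fourierX_apply hρ0 hδ hρ hf hp hM, ← fourierX_apply hρ0 hδ hρ hg hq hM']
    rfl
  rw [h1]
  exact norm_exp_smul_fourierCoef_le hρ0 hδ hρ (hf.sub hg)
    (fun θ hθ j => by rw [Pi.sub_apply, Pi.sub_apply, hp θ hθ, hq θ hθ]) hL k

theorem evX_fourierX {ρ : ℝ} (hρ0 : 0 ≤ ρ) {δ : ℝ} (hδ : 0 < δ) (hρ : ρ + δ < σ)
    (hf : AnalyticOnNhd ℂ f (strip n σ)) (hp : IsPeriodicOn σ f)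
    (hM : ∀ θ ∈ strip n σ, ‖f θ‖ ≤ M) (x : Fin n → ℝ) :
    evX ρ (toC x) (fourierX ρ f) = f (toC x) := by
  have hσ : 0 < σ := by linarith
  have h1 : ∀ k, coefX ρ k (fourierX ρ f) = fourierCoef f k := fun k => by
    rw [coefX, fourierX_apply hρ0 hδ hρ hf hp hM, smul_smul, ← Complex.ofReal_mul, ← Real.exp_add]
    simp
  have h2 : Summable fun k => ‖fourierCoef f k‖ :=
    Summable.of_nonneg_of_le (fun _ => norm_nonneg _)
      (fun k => norm_fourierCoef_le hδ.le (by linarith) hf hp hM k)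
      ((summable_exp_kn n hδ).mul_left M)
  refine (hasSum_evX (toC_mem_cstrip hρ0 x) (fourierX ρ f)).unique ?_
  simp only [h1]
  exact hasSum_fourierCoef hσ hf.continuousOn hp h2 x

variable {α : ℝ} {P : (Fin n → ℝ) → (Fin n → ℂ) → Mhat α}

theorem convex_freqBox (n : ℕ) : Convex ℝ (freqBox n) :=
  convex_pi fun _ _ => convex_Ico _ _

theorem norm_le_of_norm_single_le {F : Type*} [NormedAddCommGroup F] [NormedSpace ℝ F]
    {T : (Fin n → ℝ) →L[ℝ] F} (hM : 0 ≤ M) (h : ∀ j, ‖T (Pi.single j 1)‖ ≤ M) : ‖T‖ ≤ n * M := by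
  refine T.opNorm_le_bound (by positivity) fun v => ?_
  have h1 : T v = ∑ j, v j • T (Pi.single j 1) := by
    conv_lhs => rw [← Finset.univ_sum_single v, map_sum]
    refine Finset.sum_congr rfl fun j _ => ?_
    rw [← map_smul]
    congr 1
    rw [← Pi.single_smul, smul_eq_mul, mul_one]
  rw [h1]
  refine (norm_sum_le_of_le (f := fun j => v j • T (Pi.single j 1)) (n := fun _ => ‖v‖ * M)
    Finset.univ fun j _ => ?_).trans ?_
  · rw [norm_smul]
    exact mul_le_mul (norm_le_pi_norm v j) (h j) (norm_nonneg _) (norm_nonneg _)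
  · rw [Finset.sum_const, Finset.card_univ, Fintype.card_fin, nsmul_eq_mul]
    linarith

theorem MemMhat.exists_bound (hP : MemMhat α σ P) : ∃ M : ℝ, 0 ≤ M ∧
    (∀ ω ∈ freqBox n, ∀ θ ∈ strip n σ, ‖P ω θ‖ ≤ M) ∧
    ∀ ω ∈ freqBox n, ∀ ω' ∈ freqBox n, ∀ θ ∈ strip n σ, ‖P ω θ - P ω' θ‖ ≤ M * ‖ω - ω'‖ := by
  obtain ⟨M, hM⟩ := hP.bounded
  refine ⟨(n + 1) * max M 0, by positivity, fun ω hω θ hθ => ?_, fun ω hω ω' hω' θ hθ => ?_⟩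
  · have := (hM ω hω θ hθ).1
    have h2 : 0 ≤ (n : ℝ) * max M 0 := by positivity
    linarith [le_max_left M 0]
  · have hd : DifferentiableOn ℝ (fun w => P w θ) (freqBox n) := by
      have h1 : ContDiffOn ℝ 1 (fun w => P w θ) (freqBox n) :=
        hP.contDiff.comp (f := fun w : Fin n → ℝ => (w, θ)) (by fun_prop) fun w hw => ⟨hw, hθ⟩
      exact h1.differentiableOn one_ne_zero
    refine (convex_freqBox n).norm_image_sub_le_of_norm_fderivWithin_le hd (fun w hw => ?_) hω' hω
    refine (norm_le_of_norm_single_le (le_max_right M 0) fun j =>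
      ((hM w hw θ hθ).2 j).trans (le_max_left _ _)).trans ?_
    have := le_max_right M 0
    nlinarith

/-- Width 3σ/4 leaves a margin σ/8 for summability of the coefficients, and room for the iteration
to shrink towards σ/2. The derivative bounds on the convex box become a Lipschitz bound, the only
regularity in ω that is used. -/
theorem MemMhat.exists_fourier (hσ : 0 < σ) (hP : MemMhat α σ P) :
    ∃ M : ℝ, 0 < M ∧ ∃ Q : (Fin n → ℝ) → X n (Mhat α),
      (∀ ω ∈ freqBox n, ‖Q ω‖ ≤ M) ∧
      (∀ ω ∈ freqBox n, ∀ ω' ∈ freqBox n, ‖Q ω - Q ω'‖ ≤ M * ‖ω - ω'‖) ∧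
      ∀ ω ∈ freqBox n, ∀ x, evX (3 * σ / 4) (toC x) (Q ω) = P ω (toC x) := by
  obtain ⟨M, hM0, hM, hL⟩ := hP.exists_bound
  have h1 : 0 ≤ 3 * σ / 4 := by positivity
  have h2 : 0 < σ / 8 := by positivity
  have h3 : 3 * σ / 4 + σ / 8 < σ := by linarith
  have hS := expSum_nonneg n (σ / 8)
  refine ⟨M * expSum n (σ / 8) + 1, by positivity, fun ω => fourierX (3 * σ / 4) (P ω),
    fun ω hω => ?_, fun ω hω ω' hω' => ?_, fun ω hω x => ?_⟩
  · have := norm_fourierX_le h1 h2 h3 (hP.analytic ω hω) (hP.periodic ω hω) (hM ω hω)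
    linarith
  · refine (norm_fourierX_sub_le h1 h2 h3 (hP.analytic ω hω) (hP.periodic ω hω)
      (hP.analytic ω' hω') (hP.periodic ω' hω') (hM ω hω) (hM ω' hω')
      (hL ω hω ω' hω')).trans ?_
    have := norm_nonneg (ω - ω')
    nlinarith
  · exact evX_fourierX h1 h2 h3 (hP.analytic ω hω) (hP.periodic ω hω) (hM ω hω) x

end initial

/-! ### The measure of the good frequencies and the choice of parameters -/

section measure

variable {n : ℕ} {α : ℝ} {γ δ ρ e : ℕ → ℝ} {s g E : ℝ} {P₀ : (Fin n → ℝ) → X n (Mhat α)}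

theorem freqBox_diff_goodInf_subset : freqBox n \ goodInf γ δ s ρ P₀ ⊆
    ⋃ m, {ω ∈ goodSet γ δ s ρ P₀ m | ¬NonRes (γ m) (δ m) ω (kam s ρ P₀ ω m).Λ} := by
  classical
  rintro ω ⟨hω, hω'⟩
  have h : ∃ m, ¬NonRes (γ m) (δ m) ω (kam s ρ P₀ ω m).Λ := by
    by_contra! h
    exact hω' (Set.mem_iInter.2 fun m => ⟨hω, fun j _ => h j⟩)
  exact Set.mem_iUnion.2 ⟨Nat.find h, ⟨hω, fun j hj => not_not.1 (Nat.find_min h hj)⟩,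
    Nat.find_spec h⟩

/-- Sort the lost frequencies by the first step at which they become resonant; at that step they
still enjoy all bounds of the iteration. -/
theorem volume_freqBox_diff_goodInf_le (hn : 1 ≤ n) (hα : α ∈ Set.Ioc (0 : ℝ) 1)
    (S : Sched γ δ ρ e s g E) (hE : E ≤ 1 / 4) (hγ : ∀ m, γ m ≤ 1 / 4)
    (hP : InitOK (ρ 0) (e 0) P₀) : volume (freqBox n \ goodInf γ δ s ρ P₀) ≤
      ∑' m, ENNReal.ofReal (resC n α * (δ m ^ (n + 2))⁻¹ * γ m ^ (α / 2)) := by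
  refine (measure_mono freqBox_diff_goodInf_subset).trans ((measure_iUnion_le _).trans
    (ENNReal.tsum_le_tsum fun m => ?_))
  exact volume_resonant_le hn hα (S.par m).hγ (hγ m) (S.par m).hδ (S.par m).hδ1 hE
    (fun ω hω => hω.1) (fun ω hω => (kam_bounds hα S hP m hω).2.1.trans (S.sum_le m))
    fun ω hω ω' hω' => (kam_lip hα S hP m hω hω').2.trans
      (mul_le_mul_of_nonneg_right (S.sum_le m) (norm_nonneg _))

/-- Measurability of `goodInf` is not needed: the estimate concerns outer measure, and removing a
measurable hull of the bad set leaves a measurable good subset. -/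
theorem exists_measurableSet_subset_goodInf {η : ℝ≥0∞}
    (h : volume (freqBox n \ goodInf γ δ s ρ P₀) ≤ η) : ∃ T ⊆ goodInf γ δ s ρ P₀,
      MeasurableSet T ∧ T ⊆ freqBox n ∧ volume (freqBox n \ T) ≤ η := by
  refine ⟨freqBox n \ toMeasurable volume (freqBox n \ goodInf γ δ s ρ P₀), fun ω hω => ?_,
    (measurableSet_freqBox n).diff (measurableSet_toMeasurable _ _), Set.sdiff_subset, ?_⟩
  · by_contra h'
    exact hω.2 (subset_toMeasurable _ _ ⟨hω.1, h'⟩)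
  · refine (measure_mono fun ω hω => ?_).trans ((measure_toMeasurable _).trans_le h)
    by_contra h'
    exact hω.2 ⟨hω.1, h'⟩

end measure

/-! ### The choice of the parameters. -/

section params

/-- The ratio of the small divisor constants of consecutive steps. -/
def gamRatio (n : ℕ) (α : ℝ) : ℝ := 2 ^ (-(2 * ((n : ℝ) + 3) / α))

theorem gamRatio_pos (n : ℕ) (α : ℝ) : 0 < gamRatio n α := Real.rpow_pos_of_pos two_pos _

theorem gamRatio_le_one (n : ℕ) {α : ℝ} (hα : 0 < α) : gamRatio n α ≤ 1 :=
  Real.rpow_le_one_of_one_le_of_nonpos one_le_two (by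
    rw [neg_nonpos]; positivity)

/-- The ratio is chosen for this: in the measure estimate it outweighs the factor 2^{n+2} per step
lost by halving δ and leaves a geometric series of ratio 1/2. -/
theorem gamRatio_rpow (n : ℕ) {α : ℝ} (hα : 0 < α) :
    gamRatio n α ^ (α / 2) = (1 / 2) ^ (n + 3) := by
  rw [gamRatio, ← Real.rpow_mul zero_le_two,
    show -(2 * ((n : ℝ) + 3) / α) * (α / 2) = -((n + 3 : ℕ) : ℝ) by
      push_cast; field_simp, Real.rpow_neg zero_le_two, Real.rpow_natCast, one_div, inv_pow]

/-- The initial loss of width. -/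
def del0 (σ : ℝ) : ℝ := min 1 (σ / 32)

theorem del0_pos {σ : ℝ} (hσ : 0 < σ) : 0 < del0 σ := lt_min one_pos (by positivity)

/-- The ratio of the sizes of the perturbations of consecutive steps. -/
def pertRatio (n : ℕ) (α : ℝ) : ℝ := gamRatio n α ^ 3 / 4

variable (n : ℕ) {α σ M x : ℝ}

/-- `pertRatio` offsets the cube of the γ-ratio and, by its factor 1/4, the halving of δ, leaving
the size of G at 2^{-m} times its initial value. The width lost at step m is σ/8 · 2^{-m}, at least
4δ since `del0 σ ≤ σ/32`. As the bound for G also contains e, smallness of its initial value alone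
closes the recursion. -/
theorem sched_of_small (hα : α ∈ Set.Ioc (0 : ℝ) 1) (hσ : 0 < σ) (hM : 0 < M) (hx : 0 < x)
    (hx1 : x ≤ 1 / 4) (hg : 1000 * (13 * M * x ^ 9 / del0 σ) ≤ pertRatio n α)
    (hE : 2 * M * x ^ 12 ≤ 1 / 4) :
    Sched (fun m => x * gamRatio n α ^ m) (fun m => del0 σ * (1 / 2) ^ m)
      (fun m => σ / 2 + σ / 4 * (1 / 2) ^ m) (fun m => M * x ^ 12 * pertRatio n α ^ m) (σ / 2)
      (13 * M * x ^ 9 / del0 σ) (M * x ^ 12 * (1 - pertRatio n α)⁻¹) := by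
  have hb := gamRatio_pos n α
  have hb1 := gamRatio_le_one n hα.1
  have hd := del0_pos hσ
  have hd1 : del0 σ ≤ 1 := min_le_left _ _
  have hd2 : del0 σ ≤ σ / 32 := min_le_right _ _
  have hq : 0 < pertRatio n α := by unfold pertRatio; positivity
  have hq1 : pertRatio n α ≤ 1 / 4 := by
    unfold pertRatio
    have := pow_le_one₀ (n := 3) hb.le hb1
    linarith
  have hg0 : 0 ≤ 13 * M * x ^ 9 / del0 σ := by positivity
  have hgc : ∀ m : ℕ, gcon (x * gamRatio n α ^ m) (del0 σ * (1 / 2) ^ m)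
      (M * x ^ 12 * pertRatio n α ^ m) = 13 * M * x ^ 9 / del0 σ * (1 / 2) ^ m := fun m => by
    have h4 : ((4 : ℝ) ^ m) = 2 ^ m * 2 ^ m := by rw [← mul_pow]; norm_num
    unfold gcon pertRatio
    rw [div_pow _ (4 : ℝ), mul_pow, ← pow_mul, ← pow_mul, mul_comm 3 m, h4, one_div_pow]
    field_simp
  have hhalf : ∀ m : ℕ, ((1 : ℝ) / 2) ^ m ≤ 1 := fun m =>
    pow_le_one₀ (by norm_num) (by norm_num)
  have hhalf0 : ∀ m : ℕ, (0 : ℝ) < (1 / 2) ^ m := fun m => by positivity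
  refine ⟨fun m => ⟨by positivity, ?_, by positivity, ?_, by positivity, ?_, by positivity, ?_⟩,
    fun m => ?_, by positivity, fun m => ?_, fun m => (hgc m).le, hg0, by linarith, ?_, ?_⟩
  · exact mul_le_one₀ (by linarith) (by positivity) (pow_le_one₀ hb.le hb1)
  · exact mul_le_one₀ hd1 (by positivity) (hhalf m)
  · have := hhalf0 m
    rw [pow_succ]
    nlinarith
  · rw [hgc]
    have := hhalf m
    have := hhalf0 m
    nlinarith
  · rw [hgc, pow_succ (pertRatio n α)]
    have h1 : 1000 * (13 * M * x ^ 9 / del0 σ * (1 / 2) ^ m) ≤ pertRatio n α := by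
      refine le_trans ?_ hg
      rw [← mul_assoc]
      exact mul_le_of_le_one_right (by positivity) (hhalf m)
    calc _ ≤ pertRatio n α * (M * x ^ 12 * pertRatio n α ^ m) := by gcongr
      _ = _ := by ring
  · have := hhalf0 m
    have : 0 ≤ σ / 4 * (1 / 2) ^ m := by positivity
    linarith
  · exact (hasSum_geometric_of_lt_one hq.le (by linarith)).mul_left _
  · have h1 : (1 - pertRatio n α)⁻¹ ≤ 2 := by
      rw [inv_le_comm₀ (by linarith) two_pos]; linarith
    have : 0 < M * x ^ 12 := by positivity
    nlinarith

theorem pertSum_le (hα : α ∈ Set.Ioc (0 : ℝ) 1) (hM : 0 < M) (hx : 0 < x) :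
    M * x ^ 12 * (1 - pertRatio n α)⁻¹ ≤ 2 * M * x ^ 12 := by
  have hb := gamRatio_pos n α
  have hb1 := gamRatio_le_one n hα.1
  have hq1 : pertRatio n α ≤ 1 / 4 := by
    unfold pertRatio
    have := pow_le_one₀ (n := 3) hb.le hb1
    linarith
  have h1 : (1 - pertRatio n α)⁻¹ ≤ 2 := by
    rw [inv_le_comm₀ (by linarith) two_pos]; linarith
  have : 0 < M * x ^ 12 := by positivity
  nlinarith

theorem resC_pos (hα : 0 < α) : 0 < resC n α := by
  unfold resC
  have := Real.pi_pos
  positivity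

/-- The constant in the measure estimate. -/
def measC (n : ℕ) (α σ : ℝ) : ℝ := 2 * (resC n α * (del0 σ ^ (n + 2))⁻¹)

theorem measC_pos (hα : 0 < α) (hσ : 0 < σ) : 0 < measC n α σ := by
  unfold measC
  have := resC_pos n hα
  have := del0_pos hσ
  positivity

theorem tsum_resonant_le (hα : 0 < α) (hσ : 0 < σ) (hx : 0 < x) :
    ∑' m : ℕ, ENNReal.ofReal (resC n α * ((del0 σ * (1 / 2) ^ m) ^ (n + 2))⁻¹ *
      (x * gamRatio n α ^ m) ^ (α / 2)) ≤ ENNReal.ofReal (measC n α σ * x ^ (α / 2)) := by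
  have hd := del0_pos hσ
  have hr := resC_pos n hα
  have hb := gamRatio_pos n α
  have h : ∀ m : ℕ, resC n α * ((del0 σ * (1 / 2) ^ m) ^ (n + 2))⁻¹ *
      (x * gamRatio n α ^ m) ^ (α / 2) =
      (resC n α * (del0 σ ^ (n + 2))⁻¹ * x ^ (α / 2)) * (1 / 2) ^ m := fun m => by
    have h1 : (gamRatio n α ^ m) ^ (α / 2) = ((1 / 2) ^ (n + 3)) ^ m := by
      rw [← gamRatio_rpow n hα, ← Real.rpow_natCast, ← Real.rpow_mul hb.le, mul_comm,
        Real.rpow_mul hb.le, Real.rpow_natCast]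
    rw [Real.mul_rpow hx.le (by positivity), h1, mul_pow, mul_inv]
    have h2 : (((1 / 2 : ℝ) ^ m) ^ (n + 2))⁻¹ * ((1 / 2) ^ (n + 3)) ^ m = (1 / 2) ^ m := by
      rw [pow_succ (1 / 2 : ℝ) (n + 2), mul_pow, ← mul_assoc, pow_right_comm]
      rw [inv_mul_cancel₀ (by positivity), one_mul]
    linear_combination (resC n α * (del0 σ ^ (n + 2))⁻¹ * x ^ (α / 2)) * h2
  simp only [h]
  have hs := (hasSum_geometric_of_lt_one (r := (1 / 2 : ℝ)) (by norm_num) (by norm_num)).mul_left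
    (resC n α * (del0 σ ^ (n + 2))⁻¹ * x ^ (α / 2))
  rw [← ENNReal.ofReal_tsum_of_nonneg (fun m => by positivity) hs.summable, hs.tsum_eq]
  refine ENNReal.ofReal_le_ofReal (le_of_eq ?_)
  rw [measC]
  ring

end params

/-! ### The reducing transformation -/

section reduction

variable {n : ℕ} {α : ℝ}

open Classical in
/-- The equivalence with inverse `B` given by `A` (the identity if `B` is not inverse to `A`). -/
def equivOfPair (A B : Op) : Ell2 ≃L[ℂ] Ell2 :=
  if h : A * B = 1 ∧ B * A = 1 then ContinuousLinearEquiv.equivOfInverse' A B h.1 h.2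
  else ContinuousLinearEquiv.refl ℂ Ell2

theorem coe_equivOfPair {A B : Op} (h : A * B = 1 ∧ B * A = 1) :
    (equivOfPair A B : Op) = A ∧ ((equivOfPair A B).symm : Op) = B := by
  rw [equivOfPair, dif_pos h]
  exact ⟨rfl, rfl⟩

theorem strip_subset_cstrip (n : ℕ) (s : ℝ) : strip n s ⊆ cstrip n s := fun _ h j => (h j).le

theorem isOpen_strip (n : ℕ) (s : ℝ) : IsOpen (strip n s) := by
  have : strip n s = ⋂ j, {θ : Fin n → ℂ | |(θ j).im| < s} := by
    ext θ; simp [strip]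
  rw [this]
  exact isOpen_iInter_of_finite fun j => isOpen_lt (by fun_prop) continuous_const

theorem evX_add_single {E : Type*} [NormedAddCommGroup E] [NormedSpace ℂ E] [CompleteSpace E]
    {s : ℝ} {θ : Fin n → ℂ} (hθ : θ ∈ cstrip n s) (j : Fin n) (a : X n E) :
    evX s (θ + Pi.single j ((2 * Real.pi : ℝ) : ℂ)) a = evX s θ a := by
  have h1 : θ + Pi.single j ((2 * Real.pi : ℝ) : ℂ) ∈ cstrip n s := fun i => by
    have h2 : ((Pi.single j ((2 * Real.pi : ℝ) : ℂ) : Fin n → ℂ) i).im = 0 := by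
      rw [← toC_single]
      simp [toC]
    rw [Pi.add_apply, Complex.add_im, h2, add_zero]
    exact hθ i
  have h2 := hasSum_evX h1 a
  simp only [expf_add_right, expf_single, mul_one] at h2
  exact h2.unique (hasSum_evX hθ a)

variable {γ δ ρ e : ℕ → ℝ} {s g E : ℝ} {P₀ : (Fin n → ℝ) → X n (Mhat α)} {ω : Fin n → ℝ}

/-- The transformation that reduces the system. -/
def redU (s : ℝ) (ρ : ℕ → ℝ) (P₀ : (Fin n → ℝ) → X n (Mhat α)) (ω : Fin n → ℝ)
    (θ : Fin n → ℂ) : Ell2 ≃L[ℂ] Ell2 :=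
  equivOfPair (evX s θ (uLim s ρ P₀ ω)) (evX s θ (vLim s ρ P₀ ω))

theorem coe_redU (hα : α ∈ Set.Ioc (0 : ℝ) 1) (S : Sched γ δ ρ e s g E)
    (hP : InitOK (ρ 0) (e 0) P₀) (hω : ω ∈ goodInf γ δ s ρ P₀) {θ : Fin n → ℂ}
    (hθ : θ ∈ cstrip n s) : (redU s ρ P₀ ω θ : Op) = evX s θ (uLim s ρ P₀ ω) ∧
      ((redU s ρ P₀ ω θ).symm : Op) = evX s θ (vLim s ρ P₀ ω) :=
  coe_equivOfPair (evX_uLim_mul_vLim hα S hP hω hθ)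

theorem isPeriodicOn_redU (s : ℝ) (ρ : ℕ → ℝ) (P₀ : (Fin n → ℝ) → X n (Mhat α))
    (ω : Fin n → ℝ) : IsPeriodicOn s (redU s ρ P₀ ω) := fun θ hθ j => by
  rw [redU, redU, evX_add_single (strip_subset_cstrip n s hθ),
    evX_add_single (strip_subset_cstrip n s hθ)]

theorem analyticOnNhd_redU (hα : α ∈ Set.Ioc (0 : ℝ) 1) (S : Sched γ δ ρ e s g E)
    (hP : InitOK (ρ 0) (e 0) P₀) (hω : ω ∈ goodInf γ δ s ρ P₀) :
    AnalyticOnNhd ℂ (fun θ => (redU s ρ P₀ ω θ : Op)) (strip n s) :=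
  (analyticOnNhd_evX S.hs (uLim s ρ P₀ ω)).congr (isOpen_strip n s) fun _ hθ =>
    (coe_redU hα S hP hω (strip_subset_cstrip n s hθ)).1.symm

theorem redU_mem_unitary (hα : α ∈ Set.Ioc (0 : ℝ) 1) (S : Sched γ δ ρ e s g E)
    (hP : InitOK (ρ 0) (e 0) P₀) (hω : ω ∈ goodInf γ δ s ρ P₀) (x : Fin n → ℝ) :
    (redU s ρ P₀ ω (toC x) : Op) ∈ unitary Op := by
  have hθ := toC_mem_cstrip S.hs.le x
  have h := evX_uLim_mul_vLim hα S hP hω hθ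
  rw [(coe_redU hα S hP hω hθ).1, Unitary.mem_iff, star_evX_uLim hα S hP hω]
  exact ⟨h.2, h.1⟩

theorem opNormLe_redU_sub_one (hα : α ∈ Set.Ioc (0 : ℝ) 1) (S : Sched γ δ ρ e s g E)
    (hP : InitOK (ρ 0) (e 0) P₀) (hω : ω ∈ goodInf γ δ s ρ P₀) {θ : Fin n → ℂ}
    (hθ : θ ∈ strip n s) {p K : ℝ} (hp : p ∈ Set.Icc (0 : ℝ) 2) (hK : 16 * g ≤ K) :
    OpNormLe p ((redU s ρ P₀ ω θ : Op) - 1) K ∧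
      OpNormLe p (((redU s ρ P₀ ω θ).symm : Op) - 1) K := by
  have hθ' := strip_subset_cstrip n s hθ
  have h := wBd_uLim_sub_one hα S hP hω hθ' hp
  rw [(coe_redU hα S hP hω hθ').1, (coe_redU hα S hP hω hθ').2]
  exact ⟨(h.1.mono hK).opNormLe, (h.2.mono hK).opNormLe⟩

theorem isSolution_redU_iff (hα : α ∈ Set.Ioc (0 : ℝ) 1) (S : Sched γ δ ρ e s g E)
    (hP : InitOK (ρ 0) (e 0) P₀) (hω : ω ∈ goodInf γ δ s ρ P₀) (hω' : ω ∈ freqBox n)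
    (v : ℝ → Ell2) :
    IsSolution lam (fun t => (evX (ρ 0) (toC (t • ω)) (P₀ ω)).op)
      (fun t => redU s ρ P₀ ω (toC (t • ω)) (v t)) ↔
      IsSolution (lamOf (lamLim s ρ P₀ ω)) 0 v := by
  have hθ : ∀ t : ℝ, toC (t • ω) ∈ cstrip n s := fun t => toC_mem_cstrip S.hs.le _
  have hU : (fun t : ℝ => redU s ρ P₀ ω (toC (t • ω)) (v t)) =
      fun t => evX s (toC (t • ω)) (uLim s ρ P₀ ω) (v t) := funext fun t =>
    DFunLike.congr_fun (coe_redU hα S hP hω (hθ t)).1 (v t)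
  rw [hU]
  have hρ0 : 0 < ρ 0 := S.hs.trans_le (S.hsρ 0)
  refine isSolution_iff_of_comm (X := fun t => evX s (toC (t • ω)) (uLim s ρ P₀ ω))
    (X' := fun t => devX S.hs ω t (uLim s ρ P₀ ω))
    (A := fun t => (evX (ρ 0) (toC (t • ω)) (P₀ ω)).op)
    (fun t => hasDerivAt_evX S.hs ω _ t) ?_ (fun t => hP.herm ω hω' _)
    (fun t => comm_uLim hα S hP hω t) (fun t => ?_) v
  · have h1 : Continuous fun t : ℝ => evX (ρ 0) (toC (t • ω)) (P₀ ω) :=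
      continuous_iff_continuousAt.2 fun t => (hasDerivAt_evX hρ0 ω _ t).continuousAt
    exact (Mhat.opCLM (α := α)).continuous.comp h1
  · rw [star_evX_uLim hα S hP hω]
    exact (evX_uLim_mul_vLim hα S hP hω (hθ t)).2

/-- A globally defined Lipschitz extension is what Rademacher's theorem needs in
`exists_cantor_whitney`. -/
theorem exists_lipschitz_lamLim (hα : α ∈ Set.Ioc (0 : ℝ) 1) (S : Sched γ δ ρ e s g E)
    (hP : InitOK (ρ 0) (e 0) P₀) (hE : E ≤ 1) (i : ℕ) : ∃ f : (Fin n → ℝ) → ℝ,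
      LipschitzWith 1 f ∧ ∀ ω ∈ goodInf γ δ s ρ P₀, f ω = lamOf (lamLim s ρ P₀ ω) i := by
  have h : LipschitzOnWith 1 (fun ω => lamOf (lamLim s ρ P₀ ω) i) (goodInf γ δ s ρ P₀) := by
    refine LipschitzOnWith.of_dist_le_mul fun ω hω ω' hω' => ?_
    rw [Real.dist_eq, dist_eq_norm, lamOf, lamOf, add_sub_add_left_eq_sub, ← Complex.sub_re,
      ← entry_sub, ← map_sub]
    refine (abs_re_entry_le _ i).trans ((norm_lamLim_sub_le hα S hP hω hω').trans ?_)
    push_cast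
    gcongr
  obtain ⟨f, hf, hfe⟩ := h.extend_real
  exact ⟨f, hf, fun ω hω => (hfe hω).symm⟩

theorem abs_lamOf_sub_lam_le (Λ : Mhat α) (i : ℕ) : |lamOf Λ i - lam i| ≤ ‖Λ‖ := by
  rw [lamOf, add_sub_cancel_left]
  exact abs_re_entry_le Λ i

end reduction

/-! ### Smallness of ε and extraction of the Cantor set. -/

section main

variable {n : ℕ} {α : ℝ}

theorem exists_small_param (n : ℕ) (hα : 0 < α) {σ : ℝ} (M : ℝ) : ∃ x₀ > (0 : ℝ),
    ∀ x, 0 < x → x < x₀ → x ≤ 1 / 4 ∧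
      1000 * (13 * M * x ^ 9 / del0 σ) ≤ pertRatio n α ∧ 2 * M * x ^ 12 ≤ 1 / 4 ∧
      2 * (measC n α σ * x ^ (α / 2)) < (2 * Real.pi) ^ n := by
  have hq : 0 < pertRatio n α := by
    have := gamRatio_pos n α
    unfold pertRatio
    positivity
  have hpi := Real.pi_pos
  have hr : Continuous fun x : ℝ => x ^ (α / 2) :=
    Real.continuous_rpow_const (by positivity)
  have h1 : ∀ᶠ x : ℝ in nhds 0, x < 1 / 4 := gt_mem_nhds (by norm_num)
  have h2 : ∀ᶠ x : ℝ in nhds 0, 1000 * (13 * M * x ^ 9 / del0 σ) < pertRatio n α :=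
    ((by fun_prop : Continuous fun x : ℝ => 1000 * (13 * M * x ^ 9 / del0 σ)).tendsto'
      0 0 (by simp)).eventually_lt_const hq
  have h3 : ∀ᶠ x : ℝ in nhds 0, 2 * M * x ^ 12 < 1 / 4 :=
    ((by fun_prop : Continuous fun x : ℝ => 2 * M * x ^ 12).tendsto'
      0 0 (by simp)).eventually_lt_const (by norm_num)
  have h4 : ∀ᶠ x : ℝ in nhds 0, 2 * (measC n α σ * x ^ (α / 2)) < (2 * Real.pi) ^ n :=
    ((by fun_prop : Continuous fun x : ℝ => 2 * (measC n α σ * x ^ (α / 2))).tendsto'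
      0 0 (by rw [Real.zero_rpow (by positivity)]; simp)).eventually_lt_const (by positivity)
  obtain ⟨r, hr, h⟩ := Metric.eventually_nhds_iff.1 (h1.and (h2.and (h3.and h4)))
  refine ⟨r, hr, fun x hx hxr => ?_⟩
  obtain ⟨a, b, c, d⟩ := h (y := x) (by rwa [dist_zero_right, Real.norm_eq_abs, abs_of_pos hx])
  exact ⟨a.le, b.le, c.le, d⟩

theorem initOK_smul {ρ₀ M ε : ℝ} (hε : 0 ≤ ε) {Q : (Fin n → ℝ) → X n (Mhat α)}
    {P : (Fin n → ℝ) → (Fin n → ℂ) → Mhat α} (hQ : ∀ ω ∈ freqBox n, ‖Q ω‖ ≤ M)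
    (hL : ∀ ω ∈ freqBox n, ∀ ω' ∈ freqBox n, ‖Q ω - Q ω'‖ ≤ M * ‖ω - ω'‖)
    (hQP : ∀ ω ∈ freqBox n, ∀ x, evX ρ₀ (toC x) (Q ω) = P ω (toC x))
    (hherm : ∀ ω ∈ freqBox n, ∀ x : Fin n → ℝ, IsSelfAdjoint (P ω (toC x)).op) :
    InitOK ρ₀ (M * ε) fun ω => (ε : ℂ) • Q ω := by
  have hs : IsSelfAdjoint (ε : ℂ) := Complex.conj_ofReal ε
  have hn : ∀ a : X n (Mhat α), ‖(ε : ℂ) • a‖ = ‖a‖ * ε := fun a => by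
    rw [norm_smul, Complex.norm_real, Real.norm_of_nonneg hε, mul_comm]
  refine ⟨fun ω hω => ?_, fun ω hω ω' hω' => ?_, fun ω hω x => ?_⟩
  · rw [hn]
    exact mul_le_mul_of_nonneg_right (hQ ω hω) hε
  · rw [← smul_sub, hn, mul_right_comm]
    exact mul_le_mul_of_nonneg_right (hL ω hω ω' hω') hε
  · have h1 : evX ρ₀ (toC x) ((ε : ℂ) • Q ω) = (ε : ℂ) • P ω (toC x) := by
      rw [← hQP ω hω x]
      exact (evX ρ₀ (toC x) : X n (Mhat α) →L[ℂ] Mhat α).map_smul (ε : ℂ) (Q ω)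
    have h2 : (evX ρ₀ (toC x) ((ε : ℂ) • Q ω)).op = (ε : ℂ) • (P ω (toC x)).op := by
      rw [h1]
      exact (Mhat.op (α := α)).map_smul (ε : ℂ) (P ω (toC x))
    rw [h2]
    exact hs.smul (hherm ω hω x)

/-- The Whitney–Cantor refinement may discard as much as the resonances did, hence 2η; since 2η is
less than the volume of the box, the set T has measure above η. -/
theorem exists_cantor_of_diff_le (hn : 1 ≤ n) {T : Set (Fin n → ℝ)} (hT : MeasurableSet T)
    (hTf : T ⊆ freqBox n) {η : ℝ} (hη : 0 < η) (hTη : volume (freqBox n \ T) ≤ ENNReal.ofReal η)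
    (hη2 : 2 * η < (2 * Real.pi) ^ n) {f : ℕ → (Fin n → ℝ) → ℝ} {K : NNReal}
    (hf : ∀ i, LipschitzWith K (f i)) :
    ∃ S ⊆ T, IsCantorSet S ∧ volume (freqBox n \ S) ≤ ENNReal.ofReal (2 * η) ∧
      ∀ i, WhitneyC1On (f i) S := by
  have hpi := Real.pi_pos
  have hvol : volume (freqBox n) = ENNReal.ofReal ((2 * Real.pi) ^ n) := by
    rw [volume_freqBox, ENNReal.ofReal_pow (by positivity)]
  have htwo : ENNReal.ofReal η + ENNReal.ofReal η = ENNReal.ofReal (2 * η) := by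
    rw [← ENNReal.ofReal_add hη.le hη.le, two_mul]
  have hlt : ENNReal.ofReal η < volume T := by
    by_contra! h
    have h1 : volume (freqBox n) ≤ ENNReal.ofReal (2 * η) := by
      rw [← htwo]
      refine (measure_mono (fun ω hω => ?_)).trans
        ((measure_union_le (freqBox n \ T) T).trans (add_le_add hTη h))
      by_cases hωT : ω ∈ T
      · exact Or.inr hωT
      · exact Or.inl ⟨hω, hωT⟩
    rw [hvol] at h1
    exact absurd h1 (not_le.2 ((ENNReal.ofReal_lt_ofReal_iff (by positivity)).2 hη2))
  obtain ⟨S, hST, hS, hv, hW⟩ := exists_cantor_whitney hn hT (ne_top_of_le_ne_top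
    (by rw [hvol]; exact ENNReal.ofReal_ne_top) (measure_mono hTf)) hf
    (ENNReal.ofReal_pos.2 hη) hlt
  refine ⟨S, hST, hS, ?_, hW⟩
  rw [← htwo]
  refine (measure_mono (fun ω hω => ?_)).trans
    ((measure_union_le (freqBox n \ T) (T \ S)).trans (add_le_add hTη hv))
  by_cases hωT : ω ∈ T
  · exact Or.inr ⟨hωT, hω.2⟩
  · exact Or.inl ⟨hω.1, hωT⟩

end main

end Reducibility

end

/-! ### Assembly of the theorem. -/

theorem theorem2p1 {n : ℕ} (hn : 1 ≤ n) {σ α : ℝ} (hσ : 0 < σ) (hα : α ∈ Set.Ioc (0 : ℝ) 1)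
    (P : (Fin n → ℝ) → (Fin n → ℂ) → Reducibility.Mhat α)
    (hP : Reducibility.MemMhat α σ P)
    (hherm : ∀ ω ∈ Reducibility.freqBox n, ∀ x : Fin n → ℝ,
      IsSelfAdjoint (P ω (Reducibility.toC x)).op) :
    ∃ εs > (0 : ℝ), ∃ C > (0 : ℝ), ∀ ε ∈ Set.Ioo 0 εs,
      ∃ S ⊆ Reducibility.freqBox n, Reducibility.IsCantorSet S ∧
        MeasureTheory.volume (Reducibility.freqBox n \ S)
          ≤ ENNReal.ofReal (C * ε ^ (α / (17 * (α + 2)))) ∧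
        ∃ (lamInf : ℕ → (Fin n → ℝ) → ℝ)
          (U : (Fin n → ℝ) → (Fin n → ℂ) → (Reducibility.Ell2 ≃L[ℂ] Reducibility.Ell2)),
          (∀ i, Reducibility.WhitneyC1On (lamInf i) S) ∧
          ∀ ω ∈ S,
            -- the eigenvalues
            (∀ i, |lamInf i ω - Reducibility.lam i| ≤ C * ε) ∧
            -- analyticity on the complex torus and unitarity at real angles
            Reducibility.IsPeriodicOn (σ / 2) (U ω) ∧
            AnalyticOnNhd ℂ (fun θ => (U ω θ : Reducibility.Op))
              (Reducibility.strip n (σ / 2)) ∧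
            (∀ x : Fin n → ℝ,
              (U ω (Reducibility.toC x) : Reducibility.Op) ∈ unitary Reducibility.Op) ∧
            -- closeness to the identity
            (∀ θ ∈ Reducibility.strip n (σ / 2), ∀ p ∈ Set.Icc (0 : ℝ) 2,
              Reducibility.OpNormLe p ((U ω θ : Reducibility.Op) - 1)
                (C * ε ^ (2 / 3 : ℝ)) ∧
              Reducibility.OpNormLe p (((U ω θ).symm : Reducibility.Op) - 1)
                (C * ε ^ (2 / 3 : ℝ))) ∧
            -- reduction to the autonomous diagonal system
            (∀ v : ℝ → Reducibility.Ell2,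
              Reducibility.IsSolution Reducibility.lam
                (fun t => (ε : ℂ) • (P ω (Reducibility.toC (t • ω))).op)
                (fun t => U ω (Reducibility.toC (t • ω)) (v t)) ↔
              Reducibility.IsSolution (fun i => lamInf i ω) 0 v) := by
  open Reducibility in
  obtain ⟨M, hM, Q, hQ, hL, hQP⟩ := hP.exists_fourier hσ
  obtain ⟨x₀, hx₀, hsmall⟩ := exists_small_param n hα.1 (σ := σ) M
  have hmc := measC_pos n hα.1 hσ
  have hd := del0_pos hσ
  -- The three positive summands of C serve the measure, the eigenvalues and the transformation
  -- respectively.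
  refine ⟨min 1 (x₀ ^ 12), by positivity, 2 * measC n α σ + 2 * M + 16 * (13 * M / del0 σ),
    by positivity, fun ε hε => ?_⟩
  have hε0 : 0 < ε := hε.1
  have hε1 : ε < 1 := hε.2.trans_le (min_le_left _ _)
  -- With initial perturbation O(x^12) and γ₀ = x, the generator is O(x^12/γ₀³) = O(x^9), and the
  -- excluded measure is O(x^{α/2}).
  set x : ℝ := ε ^ (1 / 12 : ℝ) with hxdef
  have hx : 0 < x := Real.rpow_pos_of_pos hε0 _
  have hx12 : x ^ 12 = ε := by
    rw [hxdef, ← Real.rpow_natCast, ← Real.rpow_mul hε0.le]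
    norm_num
  have hxx₀ : x < x₀ := by
    refine lt_of_pow_lt_pow_left₀ 12 hx₀.le ?_
    rw [hx12]
    exact hε.2.trans_le (min_le_right _ _)
  have hx1 : x ≤ 1 := Real.rpow_le_one hε0.le hε1.le (by norm_num)
  obtain ⟨c1, c2, c3, c4⟩ := hsmall x hx hxx₀
  have S := sched_of_small n hα hσ hM hx c1 c2 c3
  have hE := pertSum_le n hα hM hx
  set ρ : ℕ → ℝ := fun m => σ / 2 + σ / 4 * (1 / 2) ^ m with hρ
  set e : ℕ → ℝ := fun m => M * x ^ 12 * pertRatio n α ^ m with he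
  set γ : ℕ → ℝ := fun m => x * gamRatio n α ^ m with hγ
  set δ : ℕ → ℝ := fun m => del0 σ * (1 / 2) ^ m with hδ
  set P₀ : (Fin n → ℝ) → X n (Mhat α) := fun ω => (ε : ℂ) • Q ω with hP₀
  have hρ0 : ρ 0 = 3 * σ / 4 := by rw [hρ]; simp only [pow_zero]; ring
  have he0 : e 0 = M * ε := by rw [he]; simp only [pow_zero, mul_one, hx12]
  have hI : InitOK (ρ 0) (e 0) P₀ := by
    rw [hρ0, he0]
    exact initOK_smul hε0.le hQ hL hQP hherm
  have hγ4 : ∀ m, γ m ≤ 1 / 4 := fun m =>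
    (mul_le_of_le_one_right hx.le (pow_le_one₀ (gamRatio_pos n α).le
      (gamRatio_le_one n hα.1))).trans c1
  have hbad := (volume_freqBox_diff_goodInf_le hn hα S (hE.trans c3) hγ4 hI).trans
    (tsum_resonant_le n hα.1 hσ hx)
  obtain ⟨T, hTg, hTm, hTf, hTv⟩ := exists_measurableSet_subset_goodInf hbad
  choose f hf hfe using exists_lipschitz_lamLim hα S hI S.hE
  have hη : 0 < measC n α σ * x ^ (α / 2) := mul_pos hmc (Real.rpow_pos_of_pos hx _)
  obtain ⟨K, hKT, hK, hKv, hKw⟩ := exists_cantor_of_diff_le hn hTm hTf hη hTv c4 hf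
  refine ⟨K, hKT.trans hTf, hK, hKv.trans (ENNReal.ofReal_le_ofReal ?_), f, redU (σ / 2) ρ P₀,
    hKw, fun ω hω => ⟨fun i => ?_, isPeriodicOn_redU _ _ _ _,
    analyticOnNhd_redU hα S hI (hTg (hKT hω)), redU_mem_unitary hα S hI (hTg (hKT hω)),
    fun θ hθ p hp => opNormLe_redU_sub_one hα S hI (hTg (hKT hω)) hθ hp ?_, fun v => ?_⟩⟩
  -- The exponent obtained is α/24, which is better than required since 17(α + 2) > 34.
  · have h1 : x ^ (α / 2) ≤ ε ^ (α / (17 * (α + 2))) := by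
      rw [hxdef, ← Real.rpow_mul hε0.le]
      refine Real.rpow_le_rpow_of_exponent_ge hε0 hε1.le ?_
      rw [div_le_iff₀ (by linarith [hα.1])]
      nlinarith [hα.1]
    have h2 : 0 < ε ^ (α / (17 * (α + 2))) := Real.rpow_pos_of_pos hε0 _
    calc 2 * (measC n α σ * x ^ (α / 2)) = (2 * measC n α σ) * x ^ (α / 2) := by ring
      _ ≤ _ := by
        gcongr
        have : 0 < 16 * (13 * M / del0 σ) := by positivity
        linarith
  · rw [hfe i ω (hTg (hKT hω))]
    refine (abs_lamOf_sub_lam_le _ i).trans ((norm_lamLim_le hα S hI (hTg (hKT hω))).trans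
      (hE.trans ?_))
    rw [hx12]
    gcongr
    have : 0 < 16 * (13 * M / del0 σ) := by positivity
    linarith
  -- The estimate gives x^9 = ε^{3/4}; one factor x ≤ 1 is dropped.
  · have h1 : x ^ 8 = ε ^ (2 / 3 : ℝ) := by
      rw [hxdef, ← Real.rpow_natCast, ← Real.rpow_mul hε0.le]
      norm_num
    rw [← h1]
    have h2 : x ^ 9 ≤ x ^ 8 := pow_le_pow_of_le_one hx.le hx1 (by norm_num)
    calc 16 * (13 * M * x ^ 9 / del0 σ) = 16 * (13 * M / del0 σ) * x ^ 9 := by ring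
      _ ≤ 16 * (13 * M / del0 σ) * x ^ 8 := by gcongr
      _ ≤ _ := by
        gcongr
        linarith
  · have hωf := hTf (hKT hω)
    have h1 := isSolution_redU_iff hα S hI (hTg (hKT hω)) hωf v
    have h2 : (fun t : ℝ => (evX (ρ 0) (toC (t • ω)) (P₀ ω)).op) =
        fun t => (ε : ℂ) • (P ω (toC (t • ω))).op := funext fun t => by
      rw [hρ0, hP₀]
      simp only
      rw [map_smul, hQP ω hωf, map_smul]
    rw [h2] at h1
    have h3 : (fun i => f i ω) = lamOf (lamLim (σ / 2) ρ P₀ ω) :=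
      funext fun i => hfe i ω (hTg (hKT hω))
    rw [h3]
    exact h1
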